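/- **Setting.** Let $z_{\min}<z_{\max}$ and $\rho\in\mathbb R$, let $\sigma\ge 0$ and $\mu$ be smooth functions on $[z_{\min},z_{\max}]$ with $\sigma=\mu=0$ at $z_{\min}$ and at $z_{\max}$, and let $u$ be a utility function, smooth on $(0,\infty)$ with $u'>0$, $u''<0$ and $u'((0,\infty))=(0,\infty)$. For $p>0$ let $H(p)=\max_{c}\,(-cp+u(c))$, the maximum being over $c>0$, and write $H_p=H'$, $H_{pp}=H''$. Let $s\in\mathbb N$ with $s\ge4$, $w_\infty>0$, $A>0$, and $D=[-3A,3A]\times[z_{\min},z_{\max}]$, with points $(a,z)$. Elements of the Sobolev spaces below are identified with their continuous representatives. Put $\Theta(y,f)=H_p(y+fw_\infty)$, $$K[y,g,f]=\iint_D g\,H_{pp}(y+fw_\infty)\,(y+fw_\infty)\,da\,dz,$$ $$\begin{aligned}P[y,f,g]=&-\iint_D z\,\partial_z(\mu g)\,da\,dz\\&+\iint_D gH_{pp}(y+fw_\infty)\Big(-\tfrac12\sigma^2\partial_{zz}y-\mu\,\partial_zy-H_p(y+fw_\infty)\,\partial_ay+\rho\,(y+fw_\infty)\Big)da\,dz\\&+\iint_D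 H_p(y+fw_\infty)\Big(\tfrac12\partial_{zz}(\sigma^2g)-\partial_z(\mu g)-\partial_a\big(gH_p(y+fw_\infty)\big)\Big)da\,dz.\end{aligned}$$ **Data.** Let $y_T\in H^{s+1}(D)$ and $g_0\in H^s(D)$ have supports with respect to $a$ contained in $(-A,A)$. Assume that $g_0$ is a probability density ($g_0\ge0$, $\iint_D g_0\,da\,dz=1$) and that $W:=\min_D(y_T+w_\infty)>0$. **Solutions.** For $T>0$, a solution on $[0,T]$ is a triple $(y,g,f)$ with $$y\in L^\infty([0,T];H^{s+1}(D))\cap C([0,T];H^{s'+1}(D)),\qquad g\in L^\infty([0,T];H^{s}(D))\cap C([0,T];H^{s'}(D))$$ for all integers $0\le s'<s$, and $f\in C^1([0,T])$, such that for every $t\in[0,T]$ the supports of $y(t,\cdot)$ and $g(t,\cdot)$ with respect to $a$ are contained in $(-2A,2A)$ and $y(t,\cdot)+f(t)w_\infty>0$ on $D$ (so that the equations make sense), and such that, with $r(t)=P[y,f,g](t)/K[y,g,f](t)$, the following equations hold classically for $0<t<T$ and $(a,z)$ in the interior of $D$: $$\partial_ty+\tfrac12\sigma^2\partial_{zz}y+\mu\,\partial_zy+(r-\rho)y+(z+ra+\Theta(y,f))\,\partial_ay=0,$$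 $$\partial_tg-\tfrac12\partial_{zz}(\sigma^2g)+\partial_z(\mu g)+\partial_a\big((z+ra+\Theta(y,f))\,g\big)=0,$$ $$f'+rf-\rho f=0,$$ with $y(T,\cdot)=y_T$, $g(0,\cdot)=g_0$ on $D$ and $f(T)=1$. **Theorem 7.1.** There is $T_{***}>0$, depending only on the parameters ($z_{\min},z_{\max},\sigma,\mu,u,\rho,w_\infty,A,s$) and the data ($y_T,g_0$), such that if $0<T<T_{***}$, then any two solutions $(y_1,g_1,f_1)$ and $(y_2,g_2,f_2)$ on $[0,T]$ with these data coincide: $y_1=y_2$ and $g_1=g_2$ on $[0,T]\times D$, and $f_1=f_2$ on $[0,T]$. -/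

import Mathlib

open MeasureTheory Set Filter Topology
open scoped ContDiff

noncomputable section

namespace WealthMFG

/-! Functions of wealth and income are functions of `x = (a, z)` on `ℝ × ℝ`. -/

/-- The partial derivative in the wealth variable `a`. -/
def dA (h : ℝ × ℝ → ℝ) : ℝ × ℝ → ℝ := fun x => deriv (fun a => h (a, x.2)) x.1

/-- The partial derivative in the income variable `z`. -/
def dZ (h : ℝ × ℝ → ℝ) : ℝ × ℝ → ℝ := fun x => deriv (fun z => h (x.1, z)) x.2

/-! ### Sobolev spaces `H^k(Ω)` of integer order, by weak derivatives -/

/-- `g` is a square integrable weak derivative `∂_a^i ∂_z^j f` on `Ω`. -/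
def IsWeakDeriv (Ω : Set (ℝ × ℝ)) (i j : ℕ) (f g : ℝ × ℝ → ℝ) : Prop :=
  MemLp g 2 (volume.restrict Ω) ∧
  ∀ φ : ℝ × ℝ → ℝ, ContDiff ℝ ∞ φ → HasCompactSupport φ → tsupport φ ⊆ Ω →
    ∫ x in Ω, f x * (dA^[i] (dZ^[j] φ)) x = (-1) ^ (i + j) * ∫ x in Ω, g x * φ x

/-- `f ∈ H^k(Ω)`. -/
def MemSobolev (Ω : Set (ℝ × ℝ)) (k : ℕ) (f : ℝ × ℝ → ℝ) : Prop :=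
  MemLp f 2 (volume.restrict Ω) ∧ ∀ i j : ℕ, i + j ≤ k → ∃ g, IsWeakDeriv Ω i j f g

open Classical in
/-- The weak derivative `∂_a^i ∂_z^j f` (unique up to null sets), or `0` if there is none in `L²`. -/
def weakDeriv (Ω : Set (ℝ × ℝ)) (i j : ℕ) (f : ℝ × ℝ → ℝ) : ℝ × ℝ → ℝ :=
  if h : ∃ g, IsWeakDeriv Ω i j f g then h.choose else 0

/-- The norm of `H^k(Ω)`. -/
def sobolevNorm (Ω : Set (ℝ × ℝ)) (k : ℕ) (f : ℝ × ℝ → ℝ) : ℝ :=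
  Real.sqrt (∑ i ∈ Finset.range (k + 1), ∑ j ∈ Finset.range (k + 1 - i),
    ∫ x in Ω, (weakDeriv Ω i j f x) ^ 2)

/-- `h ∈ L^∞([0,T]; H^k(Ω))`. -/
def MemLinftySobolev (T : ℝ) (Ω : Set (ℝ × ℝ)) (k : ℕ) (h : ℝ → ℝ × ℝ → ℝ) : Prop :=
  ∃ M : ℝ, ∀ᵐ t ∂(volume.restrict (Icc 0 T)),
    MemSobolev Ω k (h t) ∧ sobolevNorm Ω k (h t) ≤ M

/-- `h ∈ C([0,T]; H^k(Ω))`. -/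
def MemCSobolev (T : ℝ) (Ω : Set (ℝ × ℝ)) (k : ℕ) (h : ℝ → ℝ × ℝ → ℝ) : Prop :=
  (∀ t ∈ Icc 0 T, MemSobolev Ω k (h t)) ∧
  ∀ t₀ ∈ Icc 0 T,
    Tendsto (fun t => sobolevNorm Ω k (fun x => h t x - h t₀ x)) (𝓝[Icc 0 T] t₀) (𝓝 0)

/-! ### Utility and Hamiltonian -/

/-- The assumptions on the consumer utility function `u`, which need only be defined for `c > 0`
(so that, for example, `u = log` is allowed). -/
structure IsUtility (u : ℝ → ℝ) : Prop where
  smooth : ContDiffOn ℝ ∞ u (Ioi 0)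
  deriv_pos : ∀ c, 0 < c → 0 < deriv u c
  deriv2_neg : ∀ c, 0 < c → deriv (deriv u) c < 0
  range_deriv : deriv u '' Ioi 0 = Ioi 0

/-- The Hamiltonian `H(p) = max_c (-c p + u(c))`, which is used for `p > 0` only.  Under `IsUtility`
the maximum is attained at the point `c > 0` with `u'(c) = p`, so that allowing also `c = 0` (with
`u(0)` the limit of `u` at `0`, possibly `-∞`) would not change its value. -/
def hamiltonian (u : ℝ → ℝ) (p : ℝ) : ℝ := sSup ((fun c => -c * p + u c) '' Ioi 0)

/-- `H_p` -/
def Hp (u : ℝ → ℝ) : ℝ → ℝ := deriv (hamiltonian u)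

/-- `H_pp` -/
def Hpp (u : ℝ → ℝ) : ℝ → ℝ := deriv (Hp u)

/-! ### The model -/

/-- The parameters: the income interval, the diffusion coefficient `σ`, the transport coefficient
`μ`, the utility `u`, the discount rate `ρ`, the constant `w_∞` and the length scale `A`. -/
structure Model where
  zMin : ℝ
  zMax : ℝ
  σ : ℝ → ℝ
  μ : ℝ → ℝ
  u : ℝ → ℝ
  ρ : ℝ
  wInf : ℝ
  A : ℝ

/-- The standing assumptions on the parameters. -/
structure Model.Admissible (m : Model) : Prop where
  zMin_lt_zMax : m.zMin < m.zMax
  σ_smooth : ContDiffOn ℝ ∞ m.σ (Icc m.zMin m.zMax)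
  μ_smooth : ContDiffOn ℝ ∞ m.μ (Icc m.zMin m.zMax)
  σ_nonneg : ∀ z ∈ Icc m.zMin m.zMax, 0 ≤ m.σ z
  σ_zMin : m.σ m.zMin = 0
  σ_zMax : m.σ m.zMax = 0
  μ_zMin : m.μ m.zMin = 0
  μ_zMax : m.μ m.zMax = 0
  utility : IsUtility m.u
  wInf_pos : 0 < m.wInf
  A_pos : 0 < m.A

/-- The spatial domain `D = [-3A, 3A] × [z_min, z_max]`. -/
def Model.D (m : Model) : Set (ℝ × ℝ) :=
  Icc (-(3 * m.A)) (3 * m.A) ×ˢ Icc m.zMin m.zMax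

/-- The interior of `D`. -/
def Model.Ω (m : Model) : Set (ℝ × ℝ) :=
  Ioo (-(3 * m.A)) (3 * m.A) ×ˢ Ioo m.zMin m.zMax

/-- The support with respect to `a` of a function on `D`. -/
def Model.aSupport (m : Model) (h : ℝ × ℝ → ℝ) : Set ℝ :=
  closure {a | ∃ z, (a, z) ∈ m.D ∧ h (a, z) ≠ 0}

/-- `W = min_D (y_T + w_∞)`. -/
def Model.W (m : Model) (yT : ℝ × ℝ → ℝ) : ℝ := sInf ((fun x => yT x + m.wInf) '' m.D)

/-- `Θ(y, f) = H_p(y + f w_∞)`, at one time. -/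
def Model.Θ (m : Model) (y : ℝ × ℝ → ℝ) (f : ℝ) : ℝ × ℝ → ℝ :=
  fun x => Hp m.u (y x + f * m.wInf)

/-- `K[y, g, f]`, at one time. -/
def Model.K (m : Model) (y g : ℝ × ℝ → ℝ) (f : ℝ) : ℝ :=
  ∫ x in m.D, g x * Hpp m.u (y x + f * m.wInf) * (y x + f * m.wInf)

/-- `P[y, f, g]`, at one time. -/
def Model.P (m : Model) (y : ℝ × ℝ → ℝ) (f : ℝ) (g : ℝ × ℝ → ℝ) : ℝ :=
  -(∫ x in m.D, x.2 * dZ (fun x' => m.μ x'.2 * g x') x)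
  + (∫ x in m.D, g x * Hpp m.u (y x + f * m.wInf) *
      (-(1 / 2) * m.σ x.2 ^ 2 * dZ (dZ y) x - m.μ x.2 * dZ y x
        - Hp m.u (y x + f * m.wInf) * dA y x + m.ρ * (y x + f * m.wInf)))
  + ∫ x in m.D, Hp m.u (y x + f * m.wInf) *
      (1 / 2 * dZ (dZ (fun x' => m.σ x'.2 ^ 2 * g x')) x
        - dZ (fun x' => m.μ x'.2 * g x') x
        - dA (fun x' => g x' * Hp m.u (y x' + f * m.wInf)) x)

/-- The interest rate `r = P / K` as a function of time. -/
def Model.rate (m : Model) (y g : ℝ → ℝ × ℝ → ℝ) (f : ℝ → ℝ) (t : ℝ) : ℝ :=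
  m.P (y t) (f t) (g t) / m.K (y t) (g t) (f t)

/-- The assumptions on the data `y_T`, `g_0`.  The continuity clauses select the continuous
representative of an element of the Sobolev space. -/
structure Model.IsData (m : Model) (s : ℕ) (yT g₀ : ℝ × ℝ → ℝ) : Prop where
  yT_cont : ContinuousOn yT m.D
  g₀_cont : ContinuousOn g₀ m.D
  yT_mem : MemSobolev m.Ω (s + 1) yT
  g₀_mem : MemSobolev m.Ω s g₀
  yT_supp : m.aSupport yT ⊆ Ioo (-m.A) m.A
  g₀_supp : m.aSupport g₀ ⊆ Ioo (-m.A) m.A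
  g₀_nonneg : ∀ x ∈ m.D, 0 ≤ g₀ x
  g₀_mass : ∫ x in m.D, g₀ x = 1
  W_pos : 0 < m.W yT

/-- `(y, g, f)` is a solution on `[0,T]` of the relaxed system with data `y_T`, `g_0`, in the
Sobolev class of index `s` and with support in `(-2A, 2A)` with respect to `a`.  As `s ≥ 4` below,
`y(t,·)` and `g(t,·)` are twice continuously differentiable by Sobolev embedding, once their
continuous representatives are chosen, so all derivatives with respect to `a`, `z` are classical. -/
structure Model.IsSolution (m : Model) (s : ℕ) (yT g₀ : ℝ × ℝ → ℝ) (T : ℝ)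
    (y g : ℝ → ℝ × ℝ → ℝ) (f : ℝ → ℝ) : Prop where
  y_cont : ∀ t ∈ Icc 0 T, ContinuousOn (y t) m.D
  g_cont : ∀ t ∈ Icc 0 T, ContinuousOn (g t) m.D
  y_Linfty : MemLinftySobolev T m.Ω (s + 1) y
  g_Linfty : MemLinftySobolev T m.Ω s g
  y_C : ∀ s' < s, MemCSobolev T m.Ω (s' + 1) y
  g_C : ∀ s' < s, MemCSobolev T m.Ω s' g
  f_C1 : ContDiffOn ℝ 1 f (Icc 0 T)
  y_supp : ∀ t ∈ Icc 0 T, m.aSupport (y t) ⊆ Ioo (-(2 * m.A)) (2 * m.A)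
  g_supp : ∀ t ∈ Icc 0 T, m.aSupport (g t) ⊆ Ioo (-(2 * m.A)) (2 * m.A)
  /-- `y + f w_∞` lies in the domain `(0, ∞)` of `H` -/
  pos : ∀ t ∈ Icc 0 T, ∀ x ∈ m.D, 0 < y t x + f t * m.wInf
  y_diff : ∀ t ∈ Ioo 0 T, ∀ x ∈ m.Ω, DifferentiableAt ℝ (fun τ => y τ x) t
  g_diff : ∀ t ∈ Ioo 0 T, ∀ x ∈ m.Ω, DifferentiableAt ℝ (fun τ => g τ x) t
  y_eq : ∀ t ∈ Ioo 0 T, ∀ x ∈ m.Ω,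
    deriv (fun τ => y τ x) t + 1 / 2 * m.σ x.2 ^ 2 * dZ (dZ (y t)) x + m.μ x.2 * dZ (y t) x
      + (m.rate y g f t - m.ρ) * y t x
      + (x.2 + m.rate y g f t * x.1 + m.Θ (y t) (f t) x) * dA (y t) x = 0
  g_eq : ∀ t ∈ Ioo 0 T, ∀ x ∈ m.Ω,
    deriv (fun τ => g τ x) t - 1 / 2 * dZ (dZ (fun x' => m.σ x'.2 ^ 2 * g t x')) x
      + dZ (fun x' => m.μ x'.2 * g t x') x
      + dA (fun x' => (x'.2 + m.rate y g f t * x'.1 + m.Θ (y t) (f t) x') * g t x') x = 0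
  f_eq : ∀ t ∈ Ioo 0 T, deriv f t + m.rate y g f t * f t - m.ρ * f t = 0
  y_terminal : ∀ x ∈ m.D, y T x = yT x
  g_initial : ∀ x ∈ m.D, g 0 x = g₀ x
  f_terminal : f T = 1

end WealthMFG

end

noncomputable section

namespace WealthMFG

section

notation "ℝ²" => ℝ × ℝ
notation "𝕁(" m ")" => Ioo (Model.zMin m) (Model.zMax m)
notation "𝕫(" m ")" => max |Model.zMin m| |Model.zMax m|

/-! ### Elementary calculus at a maximum -/

lemma second_deriv_nonpos_of_isLocalMax {f f' : ℝ → ℝ} {x d : ℝ} (hf : ∀ᶠ y in 𝓝 x, HasDerivAt f (f' y) y)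
    (hd : HasDerivAt f' d x) (hmax : IsLocalMax f x) : d ≤ 0 := by
  by_contra! hpos
  have hfx : HasDerivAt f (f' x) x := hf.self_of_nhds
  have h0 : f' x = 0 := hmax.hasDerivAt_eq_zero hfx
  have hev : deriv f =ᶠ[𝓝 x] f' := hf.mono fun y hy => hy.deriv
  have hdd : deriv (deriv f) x = d := by rw [hev.deriv_eq, hd.deriv]
  have hmin : IsLocalMin f x :=
    isLocalMin_of_deriv_deriv_pos (by rw [hdd]; exact hpos) (by rw [hfx.deriv, h0]) hfx.continuousAt
  have hconst : f =ᶠ[𝓝 x] fun _ => f x := by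
    filter_upwards [hmax, hmin] with y h1 h2 using le_antisymm h1 h2
  have h1 : deriv f =ᶠ[𝓝 x] fun _ => 0 := by
    have := hconst.deriv
    simpa using this
  have h2 : deriv (deriv f) x = 0 := by rw [h1.deriv_eq]; simp
  linarith

lemma deriv_nonpos_of_right_max {f : ℝ → ℝ} {t T d : ℝ} (htT : t < T) (hf : HasDerivAt f d t)
    (hmax : ∀ s ∈ Ioo t T, f s ≤ f t) : d ≤ 0 := by
  have h1 : Tendsto (slope f t) (𝓝[>] t) (𝓝 d) :=
    (hasDerivAt_iff_tendsto_slope.1 hf).mono_left (nhdsWithin_mono _ fun s hs => ne_of_gt hs)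
  refine le_of_tendsto h1 ?_
  filter_upwards [Ioo_mem_nhdsGT htT] with s hs
  rw [slope_def_field]
  exact div_nonpos_of_nonpos_of_nonneg (by linarith [hmax s hs]) (by linarith [hs.1])

/-! ### Time dependent functions on the strip -/

/-- A function of `(t, a, z)` together with candidates for its derivatives. -/
structure StripPath where
  val : ℝ → ℝ → ℝ → ℝ
  da : ℝ → ℝ → ℝ → ℝ
  dz : ℝ → ℝ → ℝ → ℝ
  dzz : ℝ → ℝ → ℝ → ℝ
  dt : ℝ → ℝ → ℝ → ℝ

/-- The function is regular on `[0,T] × ℝ × (zl, zr)`, with all derivatives bounded by `M`. -/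
structure StripPath.Regular (p : StripPath) (zl zr T M : ℝ) : Prop where
  cont : ContinuousOn (fun x : ℝ × ℝ × ℝ => p.val x.1 x.2.1 x.2.2)
    (Icc 0 T ×ˢ univ ×ˢ Ioo zl zr)
  cont_da : ContinuousOn (fun x : ℝ × ℝ × ℝ => p.da x.1 x.2.1 x.2.2)
    (Icc 0 T ×ˢ univ ×ˢ Ioo zl zr)
  cont_dz : ∀ t ∈ Icc 0 T, ContinuousOn (fun x : ℝ² => p.dz t x.1 x.2) (univ ×ˢ Ioo zl zr)
  cont_dzz : ∀ t ∈ Icc 0 T, ContinuousOn (fun x : ℝ² => p.dzz t x.1 x.2) (univ ×ˢ Ioo zl zr)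
  cont_dt : ∀ t ∈ Ioo 0 T, ContinuousOn (fun x : ℝ² => p.dt t x.1 x.2) (univ ×ˢ Ioo zl zr)
  has_da : ∀ t ∈ Icc 0 T, ∀ a, ∀ z ∈ Ioo zl zr,
    HasDerivAt (fun a => p.val t a z) (p.da t a z) a
  has_dz : ∀ t ∈ Icc 0 T, ∀ a, ∀ z ∈ Ioo zl zr,
    HasDerivAt (fun z => p.val t a z) (p.dz t a z) z
  has_dzz : ∀ t ∈ Icc 0 T, ∀ a, ∀ z ∈ Ioo zl zr,
    HasDerivAt (fun z => p.dz t a z) (p.dzz t a z) z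
  has_dt : ∀ t ∈ Ioo 0 T, ∀ a, ∀ z ∈ Ioo zl zr,
    HasDerivAt (fun t => p.val t a z) (p.dt t a z) t
  bound : ∀ t ∈ Icc 0 T, ∀ a, ∀ z ∈ Ioo zl zr, |p.val t a z| ≤ M
  bound_da : ∀ t ∈ Icc 0 T, ∀ a, ∀ z ∈ Ioo zl zr, |p.da t a z| ≤ M
  bound_dz : ∀ t ∈ Icc 0 T, ∀ a, ∀ z ∈ Ioo zl zr, |p.dz t a z| ≤ M
  bound_dzz : ∀ t ∈ Icc 0 T, ∀ a, ∀ z ∈ Ioo zl zr, |p.dzz t a z| ≤ M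
  bound_dt : ∀ t ∈ Ioo 0 T, ∀ a, ∀ z ∈ Ioo zl zr, |p.dt t a z| ≤ M

lemma StripPath.Regular.mono {p : StripPath} {M' : ℝ} (hp : p.Regular zl zr T M) (h : M ≤ M') :
    p.Regular zl zr T M' :=
  { hp with
    bound := fun t ht a z hz => (hp.bound t ht a z hz).trans h
    bound_da := fun t ht a z hz => (hp.bound_da t ht a z hz).trans h
    bound_dz := fun t ht a z hz => (hp.bound_dz t ht a z hz).trans h
    bound_dzz := fun t ht a z hz => (hp.bound_dzz t ht a z hz).trans h
    bound_dt := fun t ht a z hz => (hp.bound_dt t ht a z hz).trans h }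

/-- A second order operator `A ∂_zz + m ∂_z` on `(zl, zr)` which degenerates at both ends. -/
structure Degenerate (zl zr C : ℝ) (A m : ℝ → ℝ) : Prop where
  nonneg : ∀ z ∈ Ioo zl zr, 0 ≤ A z
  left : ∀ z ∈ Ioo zl zr, A z ≤ C * (z - zl) ^ 2
  right : ∀ z ∈ Ioo zl zr, A z ≤ C * (zr - z) ^ 2
  drift_left : ∀ z ∈ Ioo zl zr, |m z| ≤ C * (z - zl)
  drift_right : ∀ z ∈ Ioo zl zr, |m z| ≤ C * (zr - z)

variable {zl zr T M : ℝ}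

lemma Degenerate.barrier {C : ℝ} {A m : ℝ → ℝ} (h : Degenerate zl zr C A m) {z : ℝ} (hz : z ∈ Ioo zl zr) :
    A z * (1 / (z - zl) ^ 2 + 1 / (zr - z) ^ 2) - m z * (1 / (z - zl) - 1 / (zr - z)) ≤ 4 * C := by
  have h1 : 0 < z - zl := by linarith [hz.1]
  have h2 : 0 < zr - z := by linarith [hz.2]
  have e1 : A z * (1 / (z - zl) ^ 2) ≤ C := by
    rw [mul_one_div, div_le_iff₀ (by positivity)]; exact h.left z hz
  have e2 : A z * (1 / (zr - z) ^ 2) ≤ C := by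
    rw [mul_one_div, div_le_iff₀ (by positivity)]; exact h.right z hz
  have e3 : -m z * (1 / (z - zl)) ≤ C := by
    rw [mul_one_div, div_le_iff₀ (by positivity)]
    exact (neg_le_abs _).trans (h.drift_left z hz)
  have e4 : m z * (1 / (zr - z)) ≤ C := by
    rw [mul_one_div, div_le_iff₀ (by positivity)]
    exact (le_abs_self _).trans (h.drift_right z hz)
  linarith

section MaximumPrinciple

lemma barrier_hasDerivAt {z : ℝ} (hz : z ∈ Ioo zl zr) :
    HasDerivAt (fun z => Real.log (z - zl) + Real.log (zr - z)) (1 / (z - zl) - 1 / (zr - z)) z := by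
  have h1 : 0 < z - zl := by linarith [hz.1]
  have h2 : 0 < zr - z := by linarith [hz.2]
  have := (((hasDerivAt_id' z).sub_const zl).log h1.ne').add
    (((hasDerivAt_id' z).const_sub zr).log h2.ne')
  refine this.congr_deriv ?_
  ring

lemma barrier_hasDerivAt' {z : ℝ} (hz : z ∈ Ioo zl zr) : HasDerivAt (fun z => 1 / (z - zl) - 1 / (zr - z))
      (-(1 / (z - zl) ^ 2 + 1 / (zr - z) ^ 2)) z := by
  have h1 : 0 < z - zl := by linarith [hz.1]
  have h2 : 0 < zr - z := by linarith [hz.2]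
  have := (((hasDerivAt_id' z).sub_const zl).fun_inv h1.ne').fun_sub
    (((hasDerivAt_id' z).const_sub zr).fun_inv h2.ne')
  simp only [one_div]
  refine this.congr_deriv ?_
  field_simp; ring

lemma barrier_le {z : ℝ} (hz : z ∈ Ioo zl zr) :
    Real.log (z - zl) ≤ Real.log (zr - zl) ∧ Real.log (zr - z) ≤ Real.log (zr - zl) :=
  ⟨Real.log_le_log (by linarith [hz.1]) (by linarith [hz.2]),
    Real.log_le_log (by linarith [hz.2]) (by linarith [hz.1])⟩

set_option maxHeartbeats 1000000 in
/-- The maximum principle for the backward equation, before the barrier is removed. -/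
lemma StripPath.Regular.barrier_nonpos {p : StripPath} (hp : p.Regular zl zr T M)
    {A m : ℝ → ℝ} {C : ℝ} (hC : 0 ≤ C) (hA : Degenerate zl zr C A m)
    {b : ℝ → ℝ → ℝ → ℝ} {R K S c t₀ : ℝ} (ht₀ : 0 ≤ t₀) (hK : 0 ≤ K) (hS : 0 ≤ S) (hc : 0 ≤ c)
    (hclamp : ∀ t ∈ Icc t₀ T, ∀ a, ∀ z ∈ Ioo zl zr, ∃ a' ∈ Icc (-R) R, p.val t a z ≤ p.val t a' z)
    (hT : ∀ a, ∀ z ∈ Ioo zl zr, p.val T a z ≤ K)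
    (hineq : ∀ t ∈ Ioo t₀ T, ∀ a, ∀ z ∈ Ioo zl zr, 0 < p.val t a z →
      -(p.dt t a z + A z * p.dzz t a z + m z * p.dz t a z + b t a z * p.da t a z)
        ≤ c * p.val t a z + S) {δ : ℝ} (hδ : 0 < δ) : ∀ t ∈ Ioc t₀ T, ∀ a, ∀ z ∈ Ioo zl zr,
      Real.exp (-(c * (T - t))) * p.val t a z - K - S * (T - t) - δ * (1 + (4 * C + 1) * (T - t))
        + δ * (Real.log (z - zl) + Real.log (zr - z) - 2 * Real.log (zr - zl)) ≤ 0 := by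
  set θ : ℝ → ℝ → ℝ → ℝ := fun t a z =>
    Real.exp (-(c * (T - t))) * p.val t a z - K - S * (T - t) - δ * (1 + (4 * C + 1) * (T - t))
        + δ * (Real.log (z - zl) + Real.log (zr - z) - 2 * Real.log (zr - zl)) with hθ
  intro t₁ ht₁ a₁ z₁ hz₁
  change θ t₁ a₁ z₁ ≤ 0
  by_contra! hpos
  have hzz : zl < zr := hz₁.1.trans hz₁.2
  have hL : 0 < zr - zl := sub_pos.2 hzz
  have hM : 0 ≤ M := (abs_nonneg _).trans (hp.bound t₁ ⟨ht₀.trans ht₁.1.le, ht₁.2⟩ a₁ z₁ hz₁)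
  have hexp : ∀ t ≤ T, Real.exp (-(c * (T - t))) ≤ 1 := fun t ht =>
    Real.exp_le_one_iff.2 (by nlinarith)
  set η : ℝ := (zr - zl) * Real.exp (-(M / δ)) with hη
  have hηpos : 0 < η := by positivity
  have hlogη : Real.log η = Real.log (zr - zl) - M / δ := by
    rw [hη, Real.log_mul hL.ne' (Real.exp_pos _).ne', Real.log_exp]; ring
  have hnear : ∀ t ∈ Icc t₁ T, ∀ a, ∀ z ∈ Ioo zl zr,
      z ∉ Icc (zl + η) (zr - η) → θ t a z < 0 := by
    intro t ht a z hz hzn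
    have hlog : Real.log (z - zl) + Real.log (zr - z) - 2 * Real.log (zr - zl)
        ≤ -(M / δ) := by
      obtain ⟨b1, b2⟩ := barrier_le hz
      rcases not_and_or.1 hzn with h | h
      · have : Real.log (z - zl) ≤ Real.log η :=
          Real.log_le_log (by linarith [hz.1]) (by linarith [not_le.1 h])
        linarith
      · have : Real.log (zr - z) ≤ Real.log η :=
          Real.log_le_log (by linarith [hz.2]) (by linarith [not_le.1 h])
        linarith
    have h1 : δ * (Real.log (z - zl) + Real.log (zr - z) - 2 * Real.log (zr - zl))
        ≤ -M := by
      calc _ ≤ δ * (-(M / δ)) := by gcongr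
        _ = -M := by field_simp
    have h2 : Real.exp (-(c * (T - t))) * p.val t a z ≤ M := by
      have hb := hp.bound t ⟨ht₀.trans (ht₁.1.le.trans ht.1), ht.2⟩ a z hz
      calc _ ≤ Real.exp (-(c * (T - t))) * M := by
            gcongr; exact (le_abs_self _).trans hb
        _ ≤ 1 * M := by gcongr; exact hexp t ht.2
        _ = M := one_mul M
    have h3 : 0 ≤ S * (T - t) := mul_nonneg hS (by linarith [ht.2])
    have h4 : 0 ≤ (4 * C + 1) * (T - t) := mul_nonneg (by linarith) (by linarith [ht.2])
    have h5 : δ ≤ δ * (1 + (4 * C + 1) * (T - t)) := by nlinarith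
    simp only [hθ]; linarith
  set Q : Set (ℝ × ℝ × ℝ) := Icc t₁ T ×ˢ Icc (-R) R ×ˢ Icc (zl + η) (zr - η) with hQ
  have hQc : IsCompact Q := isCompact_Icc.prod (isCompact_Icc.prod isCompact_Icc)
  have hIcc : ∀ {z}, z ∈ Icc (zl + η) (zr - η) → z ∈ Ioo zl zr := fun hz =>
    ⟨by linarith [hz.1], by linarith [hz.2]⟩
  have hQsub : Q ⊆ Icc 0 T ×ˢ univ ×ˢ Ioo zl zr := by
    rintro ⟨t, a, z⟩ ⟨h1, -, h3⟩
    exact ⟨⟨ht₀.trans (ht₁.1.le.trans h1.1), h1.2⟩, mem_univ _, hIcc h3⟩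
  have hcontθ : ContinuousOn (fun x : ℝ × ℝ × ℝ => θ x.1 x.2.1 x.2.2) Q := by
    simp only [hθ]
    have hv := hp.cont.mono hQsub
    have l1 : ContinuousOn (fun x : ℝ × ℝ × ℝ => Real.log (x.2.2 - zl)) Q :=
      ContinuousOn.log (by fun_prop) fun x hx => by
        have := (hIcc hx.2.2).1; exact (sub_pos.2 this).ne'
    have l2 : ContinuousOn (fun x : ℝ × ℝ × ℝ => Real.log (zr - x.2.2)) Q :=
      ContinuousOn.log (by fun_prop) fun x hx => by
        have := (hIcc hx.2.2).2; exact (sub_pos.2 this).ne'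
    fun_prop
  have hmono : ∀ t ∈ Icc t₁ T, ∀ a, ∀ z ∈ Ioo zl zr, ∃ a' ∈ Icc (-R) R,
      θ t a z ≤ θ t a' z := by
    intro t ht a z hz
    obtain ⟨a', ha', hle⟩ := hclamp t ⟨ht₁.1.le.trans ht.1, ht.2⟩ a z hz
    refine ⟨a', ha', ?_⟩
    simp only [hθ]; gcongr
  have hz₁' : z₁ ∈ Icc (zl + η) (zr - η) := by
    by_contra h; exact (hnear t₁ ⟨le_rfl, ht₁.2⟩ a₁ z₁ hz₁ h).not_gt hpos
  obtain ⟨a₁', ha₁', hle₁⟩ := hmono t₁ ⟨le_rfl, ht₁.2⟩ a₁ z₁ hz₁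
  have hmem : ((t₁, a₁', z₁) : ℝ × ℝ × ℝ) ∈ Q := ⟨⟨le_rfl, ht₁.2⟩, ha₁', hz₁'⟩
  obtain ⟨⟨t, a, z⟩, ⟨ht, ha, hz⟩, hmax⟩ := hQc.exists_isMaxOn ⟨_, hmem⟩ hcontθ
  simp only at ht ha hz
  have hmax' : ∀ t' a' z', ((t', a', z') : ℝ × ℝ × ℝ) ∈ Q → θ t' a' z' ≤ θ t a z :=
    fun t' a' z' h => isMaxOn_iff.1 hmax _ h
  have hposmax : 0 < θ t a z := hpos.trans_le (hle₁.trans (hmax' _ _ _ hmem))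
  have hglob : ∀ t' ∈ Icc t₁ T, ∀ a', ∀ z' ∈ Ioo zl zr, θ t' a' z' ≤ θ t a z := by
    intro t' ht' a' z' hz'
    by_cases h : z' ∈ Icc (zl + η) (zr - η)
    · obtain ⟨a'', ha'', hle⟩ := hmono t' ht' a' z' hz'
      have hm : ((t', a'', z') : ℝ × ℝ × ℝ) ∈ Q := ⟨ht', ha'', h⟩
      exact hle.trans (hmax' _ _ _ hm)
    · exact (hnear t' ht' a' z' hz' h).le.trans hposmax.le
  have hzO := hIcc hz
  have htT : t < T := by
    rcases ht.2.lt_or_eq with h | h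
    · exact h
    · exfalso
      obtain ⟨b1, b2⟩ := barrier_le hzO
      have : δ * (Real.log (z - zl) + Real.log (zr - z) - 2 * Real.log (zr - zl)) ≤ 0 :=
        mul_nonpos_of_nonneg_of_nonpos hδ.le (by linarith)
      have h3 := hT a z hzO
      rw [h] at hposmax
      simp only [hθ, sub_self, mul_zero, neg_zero, Real.exp_zero, one_mul, add_zero, mul_one]
        at hposmax
      linarith
  have ht0 : t ∈ Ioo 0 T := ⟨ht₀.trans_lt (ht₁.1.trans_le ht.1), htT⟩
  have htI : t ∈ Icc 0 T := Ioo_subset_Icc_self ht0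
  set e : ℝ := Real.exp (-(c * (T - t))) with he
  have hepos : 0 < e := Real.exp_pos _
  have hda : e * p.da t a z = 0 := by
    have hloc : IsLocalMax (fun a => θ t a z) a := Eventually.of_forall fun a' => hglob t ht a' z hzO
    refine hloc.hasDerivAt_eq_zero ?_
    have heq : (fun a => θ t a z) = fun a => e * p.val t a z + (θ t 0 z - e * p.val t 0 z) := by
      ext a; simp only [hθ, he]; ring
    rw [heq]
    exact ((hp.has_da t htI a z hzO).const_mul e).add_const _
  have hlocz : IsLocalMax (fun z => θ t a z) z := by
    filter_upwards [Ioo_mem_nhds hzO.1 hzO.2] with z' hz' using hglob t ht a z' hz'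
  have hder : ∀ z' ∈ Ioo zl zr, HasDerivAt (fun z => θ t a z)
      (e * p.dz t a z' + δ * (1 / (z' - zl) - 1 / (zr - z'))) z' := by
    intro z' hz'
    have heq : (fun z => θ t a z) = fun z => e * p.val t a z +
        δ * (Real.log (z - zl) + Real.log (zr - z)) + (-K - S * (T - t)
          - δ * (1 + (4 * C + 1) * (T - t)) - δ * (2 * Real.log (zr - zl))) := by
      ext z; simp only [hθ, he]; ring
    rw [heq]
    exact (((hp.has_dz t htI a z' hz').const_mul e).add
      ((barrier_hasDerivAt hz').const_mul δ)).add_const _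
  have hdz := hlocz.hasDerivAt_eq_zero (hder z hzO)
  have hdzz : e * p.dzz t a z + δ * -(1 / (z - zl) ^ 2 + 1 / (zr - z) ^ 2) ≤ 0 := by
    refine second_deriv_nonpos_of_isLocalMax ?_
      (((hp.has_dzz t htI a z hzO).const_mul e).add ((barrier_hasDerivAt' hzO).const_mul δ)) hlocz
    filter_upwards [Ioo_mem_nhds hzO.1 hzO.2] with z' hz' using hder z' hz'
  have hdt : c * e * p.val t a z + e * p.dt t a z + S + δ * (4 * C + 1) ≤ 0 := by
    refine deriv_nonpos_of_right_max htT (f := fun t => θ t a z) ?_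
      fun s hs => hglob s ⟨ht.1.trans hs.1.le, hs.2.le⟩ a z hzO
    have hlin : HasDerivAt (fun s : ℝ => T - s) (-1) t := by
      simpa using (hasDerivAt_id t).const_sub T
    have hexpd : HasDerivAt (fun s : ℝ => Real.exp (-(c * (T - s)))) (c * e) t := by
      have := ((hlin.const_mul c).fun_neg).exp
      refine this.congr_deriv ?_
      rw [he]; ring
    have := ((((hexpd.fun_mul (hp.has_dt t ht0 a z hzO)).sub_const K).fun_sub (hlin.const_mul S)).fun_sub
      (((hlin.const_mul (4 * C + 1)).const_add 1).const_mul δ)).add_const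
        (δ * (Real.log (z - zl) + Real.log (zr - z) - 2 * Real.log (zr - zl)))
    refine this.congr_deriv ?_
    ring
  have hvpos : 0 < p.val t a z := by
    by_contra! hneg
    obtain ⟨b1, b2⟩ := barrier_le hzO
    have h1 : δ * (Real.log (z - zl) + Real.log (zr - z) - 2 * Real.log (zr - zl)) ≤ 0 :=
        mul_nonpos_of_nonneg_of_nonpos hδ.le (by linarith)
    have h2 : e * p.val t a z ≤ 0 := mul_nonpos_of_nonneg_of_nonpos hepos.le hneg
    have h3 : 0 ≤ S * (T - t) := mul_nonneg hS (by linarith)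
    have h4 : 0 ≤ δ * (1 + (4 * C + 1) * (T - t)) := by
      have : 0 ≤ (4 * C + 1) * (T - t) := mul_nonneg (by linarith) (by linarith)
      positivity
    simp only [hθ] at hposmax; linarith
  have hin := mul_le_mul_of_nonneg_left (hineq t ⟨ht₁.1.trans_le ht.1, htT⟩ a z hzO hvpos) hepos.le
  have hb := mul_le_mul_of_nonneg_left (hA.barrier hzO) hδ.le
  have hAz := mul_le_mul_of_nonneg_left hdzz (hA.nonneg z hzO)
  have heS : e * S ≤ S := by
    have := hexp t htT.le
    nlinarith
  have hmz : e * (m z * p.dz t a z) = - (δ * (m z * (1 / (z - zl) - 1 / (zr - z)))) := by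
    have : e * p.dz t a z = - (δ * (1 / (z - zl) - 1 / (zr - z))) := by linarith
    calc e * (m z * p.dz t a z) = m z * (e * p.dz t a z) := by ring
      _ = _ := by rw [this]; ring
  have hbz : e * (b t a z * p.da t a z) = 0 := by
    calc e * (b t a z * p.da t a z) = b t a z * (e * p.da t a z) := by ring
      _ = 0 := by rw [hda, mul_zero]
  linarith

/-- The maximum principle for the backward equation. -/
lemma StripPath.Regular.le_of_backward {p : StripPath} (hp : p.Regular zl zr T M)
    {A m : ℝ → ℝ} {C : ℝ} (hC : 0 ≤ C) (hA : Degenerate zl zr C A m)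
    {b : ℝ → ℝ → ℝ → ℝ} {R K S c t₀ : ℝ} (ht₀ : 0 ≤ t₀) (hK : 0 ≤ K) (hS : 0 ≤ S) (hc : 0 ≤ c)
    (hclamp : ∀ t ∈ Icc t₀ T, ∀ a, ∀ z ∈ Ioo zl zr, ∃ a' ∈ Icc (-R) R, p.val t a z ≤ p.val t a' z)
    (hT : ∀ a, ∀ z ∈ Ioo zl zr, p.val T a z ≤ K)
    (hineq : ∀ t ∈ Ioo t₀ T, ∀ a, ∀ z ∈ Ioo zl zr, 0 < p.val t a z →
      -(p.dt t a z + A z * p.dzz t a z + m z * p.dz t a z + b t a z * p.da t a z) ≤ c * p.val t a z + S) :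
    ∀ t ∈ Icc t₀ T, ∀ a, ∀ z ∈ Ioo zl zr, p.val t a z ≤ (K + S * (T - t)) * Real.exp (c * (T - t)) := by
  intro t ht a z hz
  rcases ht.2.eq_or_lt with h | hlt
  · rw [h]; simpa using hT a z hz
  have key : ∀ t ∈ Ioc t₀ T, p.val t a z ≤ (K + S * (T - t)) * Real.exp (c * (T - t)) := by
    intro t ht
    have h0 : Real.exp (-(c * (T - t))) * p.val t a z - K - S * (T - t) ≤ 0 := by
      have hlim : Tendsto (fun δ : ℝ => Real.exp (-(c * (T - t))) * p.val t a z - K - S * (T - t)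
          - δ * (1 + (4 * C + 1) * (T - t))
          + δ * (Real.log (z - zl) + Real.log (zr - z) - 2 * Real.log (zr - zl)))
          (𝓝[>] 0) (𝓝 (Real.exp (-(c * (T - t))) * p.val t a z - K - S * (T - t)
          - 0 * (1 + (4 * C + 1) * (T - t))
          + 0 * (Real.log (z - zl) + Real.log (zr - z) - 2 * Real.log (zr - zl)))) := by
        apply tendsto_nhdsWithin_of_tendsto_nhds
        apply Continuous.tendsto
        fun_prop
      have := le_of_tendsto hlim (by
        filter_upwards [self_mem_nhdsWithin] with δ hδ
        exact hp.barrier_nonpos hC hA ht₀ hK hS hc hclamp hT hineq hδ t ht a z hz)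
      simpa using this
    have h1 : p.val t a z = Real.exp (c * (T - t)) * (Real.exp (-(c * (T - t))) * p.val t a z) := by
      rw [← mul_assoc, ← Real.exp_add]; simp
    rw [h1, mul_comm (K + _)]
    gcongr; linarith
  rcases ht.1.eq_or_lt with h | h
  · have hcl : ContinuousOn (fun t => p.val t a z) (Icc 0 T) :=
      hp.cont.comp (f := fun t : ℝ => ((t, a, z) : ℝ × ℝ × ℝ)) (by fun_prop)
        fun s hs => ⟨hs, mem_univ _, hz⟩
    have hne : (𝓝[Ioo t T] t).NeBot := by
      rw [nhdsWithin_Ioo_eq_nhdsGT hlt]; infer_instance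
    have h1 : Tendsto (fun t => p.val t a z) (𝓝[Ioo t T] t) (𝓝 (p.val t a z)) :=
      (hcl t ⟨by linarith, ht.2⟩).mono_left
        (nhdsWithin_mono _ fun s hs => ⟨by linarith [hs.1], hs.2.le⟩)
    have h2 : Tendsto (fun t => (K + S * (T - t)) * Real.exp (c * (T - t))) (𝓝[Ioo t T] t)
        (𝓝 ((K + S * (T - t)) * Real.exp (c * (T - t)))) := by
      apply tendsto_nhdsWithin_of_tendsto_nhds
      apply Continuous.tendsto
      fun_prop
    refine le_of_tendsto_of_tendsto h1 h2 ?_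
    filter_upwards [self_mem_nhdsWithin] with s hs using key s ⟨by linarith [hs.1], hs.2.le⟩
  · exact key t ⟨h, ht.2⟩

end MaximumPrinciple

end

section

/-! ### Operations on strip functions -/

variable {zl zr T M : ℝ}

/-- Time reversal. -/
def StripPath.rev (p : StripPath) (T : ℝ) : StripPath where
  val t := p.val (T - t)
  da t := p.da (T - t)
  dz t := p.dz (T - t)
  dzz t := p.dzz (T - t)
  dt t a z := -p.dt (T - t) a z

lemma StripPath.Regular.rev {p : StripPath} (hp : p.Regular zl zr T M) : (p.rev T).Regular zl zr T M := by
  have hI : ∀ {t}, t ∈ Icc 0 T → T - t ∈ Icc 0 T := fun h => ⟨by linarith [h.2], by linarith [h.1]⟩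
  have hO : ∀ {t}, t ∈ Ioo 0 T → T - t ∈ Ioo 0 T := fun h => ⟨by linarith [h.2], by linarith [h.1]⟩
  have hmap : ContinuousOn (fun x : ℝ × ℝ × ℝ => ((T - x.1, x.2.1, x.2.2) : ℝ × ℝ × ℝ))
    (Icc 0 T ×ˢ univ ×ˢ Ioo zl zr) := by fun_prop
  exact
  { cont := hp.cont.comp hmap fun x hx => ⟨hI hx.1, hx.2⟩
    cont_da := hp.cont_da.comp hmap fun x hx => ⟨hI hx.1, hx.2⟩
    cont_dz := fun t ht => hp.cont_dz _ (hI ht)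
    cont_dzz := fun t ht => hp.cont_dzz _ (hI ht)
    cont_dt := fun t ht => (hp.cont_dt _ (hO ht)).neg
    has_da := fun t ht => hp.has_da _ (hI ht)
    has_dz := fun t ht => hp.has_dz _ (hI ht)
    has_dzz := fun t ht => hp.has_dzz _ (hI ht)
    has_dt := fun t ht a z hz => by
      have := (hp.has_dt _ (hO ht) a z hz).scomp t ((hasDerivAt_id' t).const_sub T)
      refine this.congr_deriv ?_
      simp [StripPath.rev]
    bound := fun t ht => hp.bound _ (hI ht)
    bound_da := fun t ht => hp.bound_da _ (hI ht)
    bound_dz := fun t ht => hp.bound_dz _ (hI ht)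
    bound_dzz := fun t ht => hp.bound_dzz _ (hI ht)
    bound_dt := fun t ht a z hz => by
      simpa [StripPath.rev] using hp.bound_dt _ (hO ht) a z hz }

/-- The maximum principle for the forward equation. -/
lemma StripPath.Regular.le_of_forward {p : StripPath} (hp : p.Regular zl zr T M)
    {A m : ℝ → ℝ} {C : ℝ} (hC : 0 ≤ C) (hA : Degenerate zl zr C A m)
    {b : ℝ → ℝ → ℝ → ℝ} {R K S c : ℝ} (hK : 0 ≤ K) (hS : 0 ≤ S) (hc : 0 ≤ c)
    (hclamp : ∀ t ∈ Icc 0 T, ∀ a, ∀ z ∈ Ioo zl zr, ∃ a' ∈ Icc (-R) R, p.val t a z ≤ p.val t a' z)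
    (h0 : ∀ a, ∀ z ∈ Ioo zl zr, p.val 0 a z ≤ K)
    (hineq : ∀ t ∈ Ioo 0 T, ∀ a, ∀ z ∈ Ioo zl zr, 0 < p.val t a z →
      p.dt t a z - (A z * p.dzz t a z + m z * p.dz t a z + b t a z * p.da t a z) ≤ c * p.val t a z + S) :
    ∀ t ∈ Icc 0 T, ∀ a, ∀ z ∈ Ioo zl zr, p.val t a z ≤ (K + S * t) * Real.exp (c * t) := by
  intro t ht a z hz
  have h := hp.rev.le_of_backward (t₀ := 0) (b := fun t => b (T - t)) hC hA le_rfl hK hS hc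
    (fun t ht => hclamp (T - t) ⟨by linarith [ht.2], by linarith [ht.1]⟩)
    (by simpa [StripPath.rev] using h0)
    (fun t ht a z hz hpos => by
      have := hineq (T - t) ⟨by linarith [ht.2], by linarith [ht.1]⟩ a z hz hpos
      simp only [StripPath.rev]; linarith)
    (T - t) ⟨by linarith [ht.2], by linarith [ht.1]⟩ a z hz
  simpa [StripPath.rev] using h

/-- Linear combinations with constant coefficients. -/
def StripPath.comb (p : StripPath) (c : ℝ) (q : StripPath) (d : ℝ) : StripPath where
  val t a z := c * p.val t a z + d * q.val t a z
  da t a z := c * p.da t a z + d * q.da t a z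
  dz t a z := c * p.dz t a z + d * q.dz t a z
  dzz t a z := c * p.dzz t a z + d * q.dzz t a z
  dt t a z := c * p.dt t a z + d * q.dt t a z

lemma abs_comb_le {c d x y X Y : ℝ} (hx : |x| ≤ X) (hy : |y| ≤ Y) : |c * x + d * y| ≤ |c| * X + |d| * Y := by
  refine (abs_add_le _ _).trans ?_
  rw [abs_mul, abs_mul]
  gcongr

lemma StripPath.Regular.comb {p q : StripPath} {M' : ℝ} (hp : p.Regular zl zr T M)
    (hq : q.Regular zl zr T M') (c d : ℝ) : (p.comb c q d).Regular zl zr T (|c| * M + |d| * M') where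
  cont := (hp.cont.const_smul c).add (hq.cont.const_smul d)
  cont_da := (hp.cont_da.const_smul c).add (hq.cont_da.const_smul d)
  cont_dz t ht := ((hp.cont_dz t ht).const_smul c).add ((hq.cont_dz t ht).const_smul d)
  cont_dzz t ht := ((hp.cont_dzz t ht).const_smul c).add ((hq.cont_dzz t ht).const_smul d)
  cont_dt t ht := ((hp.cont_dt t ht).const_smul c).add ((hq.cont_dt t ht).const_smul d)
  has_da t ht a z hz := ((hp.has_da t ht a z hz).const_mul c).add ((hq.has_da t ht a z hz).const_mul d)
  has_dz t ht a z hz := ((hp.has_dz t ht a z hz).const_mul c).add ((hq.has_dz t ht a z hz).const_mul d)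
  has_dzz t ht a z hz :=
    ((hp.has_dzz t ht a z hz).const_mul c).add ((hq.has_dzz t ht a z hz).const_mul d)
  has_dt t ht a z hz := ((hp.has_dt t ht a z hz).const_mul c).add ((hq.has_dt t ht a z hz).const_mul d)
  bound t ht a z hz := abs_comb_le (hp.bound t ht a z hz) (hq.bound t ht a z hz)
  bound_da t ht a z hz := abs_comb_le (hp.bound_da t ht a z hz) (hq.bound_da t ht a z hz)
  bound_dz t ht a z hz := abs_comb_le (hp.bound_dz t ht a z hz) (hq.bound_dz t ht a z hz)
  bound_dzz t ht a z hz := abs_comb_le (hp.bound_dzz t ht a z hz) (hq.bound_dzz t ht a z hz)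
  bound_dt t ht a z hz := abs_comb_le (hp.bound_dt t ht a z hz) (hq.bound_dt t ht a z hz)

/-- Translation in the wealth variable. -/
def StripPath.shift (p : StripPath) (h : ℝ) : StripPath where
  val t a z := p.val t (a + h) z
  da t a z := p.da t (a + h) z
  dz t a z := p.dz t (a + h) z
  dzz t a z := p.dzz t (a + h) z
  dt t a z := p.dt t (a + h) z

lemma StripPath.Regular.shift {p : StripPath} (hp : p.Regular zl zr T M) (h : ℝ) :
    (p.shift h).Regular zl zr T M := by
  have hmap : ContinuousOn (fun x : ℝ × ℝ × ℝ => ((x.1, x.2.1 + h, x.2.2) : ℝ × ℝ × ℝ))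
    (Icc 0 T ×ˢ univ ×ˢ Ioo zl zr) := by fun_prop
  have hmap' : ContinuousOn (fun x : ℝ² => ((x.1 + h, x.2) : ℝ²))
    (univ ×ˢ Ioo zl zr) := by fun_prop
  exact
  { cont := hp.cont.comp hmap fun x hx => ⟨hx.1, mem_univ _, hx.2.2⟩
    cont_da := hp.cont_da.comp hmap fun x hx => ⟨hx.1, mem_univ _, hx.2.2⟩
    cont_dz := fun t ht => (hp.cont_dz _ ht).comp hmap' fun x hx => ⟨mem_univ _, hx.2⟩
    cont_dzz := fun t ht => (hp.cont_dzz _ ht).comp hmap' fun x hx => ⟨mem_univ _, hx.2⟩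
    cont_dt := fun t ht => (hp.cont_dt _ ht).comp hmap' fun x hx => ⟨mem_univ _, hx.2⟩
    has_da := fun t ht a z hz => (hp.has_da t ht (a + h) z hz).comp_add_const a h
    has_dz := fun t ht a z hz => hp.has_dz t ht (a + h) z hz
    has_dzz := fun t ht a z hz => hp.has_dzz t ht (a + h) z hz
    has_dt := fun t ht a z hz => hp.has_dt t ht (a + h) z hz
    bound := fun t ht a z hz => hp.bound t ht (a + h) z hz
    bound_da := fun t ht a z hz => hp.bound_da t ht (a + h) z hz
    bound_dz := fun t ht a z hz => hp.bound_dz t ht (a + h) z hz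
    bound_dzz := fun t ht a z hz => hp.bound_dzz t ht (a + h) z hz
    bound_dt := fun t ht a z hz => hp.bound_dt t ht (a + h) z hz }

/-- Freezing in the wealth variable. -/
def StripPath.at (p : StripPath) (a₀ : ℝ) : StripPath where
  val t _ := p.val t a₀
  da _ _ _ := 0
  dz t _ := p.dz t a₀
  dzz t _ := p.dzz t a₀
  dt t _ := p.dt t a₀

lemma StripPath.Regular.at {p : StripPath} (hp : p.Regular zl zr T M) (a₀ : ℝ) :
    (p.at a₀).Regular zl zr T M := by
  have hmap : ContinuousOn (fun x : ℝ² => ((a₀, x.2) : ℝ²)) (univ ×ˢ Ioo zl zr) := by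
    fun_prop
  exact
  { cont := hp.cont.comp (f := fun x : ℝ × ℝ × ℝ => ((x.1, a₀, x.2.2) : ℝ × ℝ × ℝ)) (by fun_prop)
      fun x hx => ⟨hx.1, mem_univ _, hx.2.2⟩
    cont_da := continuousOn_const
    cont_dz := fun t ht => (hp.cont_dz _ ht).comp hmap fun x hx => ⟨mem_univ _, hx.2⟩
    cont_dzz := fun t ht => (hp.cont_dzz _ ht).comp hmap fun x hx => ⟨mem_univ _, hx.2⟩
    cont_dt := fun t ht => (hp.cont_dt _ ht).comp hmap fun x hx => ⟨mem_univ _, hx.2⟩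
    has_da := fun t ht a z hz => hasDerivAt_const a _
    has_dz := fun t ht a z hz => hp.has_dz t ht a₀ z hz
    has_dzz := fun t ht a z hz => hp.has_dzz t ht a₀ z hz
    has_dt := fun t ht a z hz => hp.has_dt t ht a₀ z hz
    bound := fun t ht a z hz => hp.bound t ht a₀ z hz
    bound_da := fun t ht a z hz => by
      simpa [StripPath.at] using (abs_nonneg _).trans (hp.bound _ ht a₀ z hz)
    bound_dz := fun t ht a z hz => hp.bound_dz t ht a₀ z hz
    bound_dzz := fun t ht a z hz => hp.bound_dzz t ht a₀ z hz
    bound_dt := fun t ht a z hz => hp.bound_dt t ht a₀ z hz }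

lemma hasDerivAt_comp_of_partial {u ua : ℝ → ℝ → ℝ} {X : ℝ → ℝ} {t ut X' : ℝ}
    (hut : HasDerivAt (fun τ => u τ (X t)) ut t) (hua : ∀ᶠ τ in 𝓝 t, ∀ a, HasDerivAt (u τ) (ua τ a) a)
    (hcont : ContinuousAt (fun x : ℝ² => ua x.1 x.2) (t, X t)) (hX : HasDerivAt X X' t) :
    HasDerivAt (fun τ => u τ (X τ)) (ut + ua t (X t) * X') t := by
  have key : HasDerivAt (fun τ => u τ (X τ) - u τ (X t) - ua t (X t) * (X τ - X t)) 0 t := by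
    rw [hasDerivAt_iff_isLittleO]
    have hO : (fun τ => X τ - X t) =O[𝓝 t] fun τ => τ - t := hX.isBigO_sub
    refine Asymptotics.IsLittleO.trans_isBigO ?_ hO
    rw [Asymptotics.isLittleO_iff]
    intro ε hε
    rw [Metric.continuousAt_iff] at hcont
    obtain ⟨δ, hδ, hball⟩ := hcont ε hε
    have h1 : ∀ᶠ τ in 𝓝 t, dist (X τ) (X t) < δ := hX.continuousAt (Metric.ball_mem_nhds _ hδ)
    have h2 : ∀ᶠ τ in 𝓝 t, dist τ t < δ := Metric.ball_mem_nhds _ hδ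
    filter_upwards [h1, h2, hua] with τ hτ1 hτ2 hτ3
    have hmv := (convex_ball (X t) δ).norm_image_sub_le_of_norm_hasDerivWithin_le
      (f := fun a => u τ a - ua t (X t) * a) (f' := fun a => ua τ a - ua t (X t)) (C := ε)
      (fun a _ => ((hτ3 a).sub (by simpa using (hasDerivAt_id' a).const_mul (ua t (X t)))).hasDerivWithinAt)
      (fun a ha => by
        have := hball (x := (τ, a)) (by
          rw [Prod.dist_eq]; exact max_lt hτ2 (Metric.mem_ball.1 ha))
        rw [dist_eq_norm] at this; exact this.le)
      (Metric.mem_ball_self hδ) (Metric.mem_ball.2 hτ1)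
    refine le_trans (le_of_eq (congrArg _ ?_)) hmv
    simp only [sub_self, mul_zero, smul_zero, sub_zero]
    ring
  have h2 : HasDerivAt (fun τ => ua t (X t) * (X τ - X t)) (ua t (X t) * X') t :=
    (hX.sub_const _).const_mul _
  have := (key.fun_add h2).fun_add hut
  simp only [sub_add_cancel] at this
  exact this.congr_deriv (by ring)

/-- The change of variables `α = E(t) a`, followed by multiplication with `c(t)`. -/
def StripPath.scale (p : StripPath) (E E' c c' : ℝ → ℝ) : StripPath where
  val t a z := c t * p.val t (a / E t) z
  da t a z := c t / E t * p.da t (a / E t) z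
  dz t a z := c t * p.dz t (a / E t) z
  dzz t a z := c t * p.dzz t (a / E t) z
  dt t a z := c' t * p.val t (a / E t) z
    + c t * (p.dt t (a / E t) z + p.da t (a / E t) z * (-(a / E t) * (E' t / E t)))

lemma StripPath.Regular.scale {p : StripPath} (hp : p.Regular zl zr T M)
    {E E' c c' : ℝ → ℝ} {e L R : ℝ} (he : 0 < e) (hR : 0 ≤ R) (hE : ContinuousOn E (Icc 0 T))
    (hc : ContinuousOn c (Icc 0 T)) (hEe : ∀ t ∈ Icc 0 T, e ≤ E t)
    (hE' : ∀ t ∈ Ioo 0 T, HasDerivAt E (E' t) t) (hc' : ∀ t ∈ Ioo 0 T, HasDerivAt c (c' t) t)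
    (hcL : ∀ t ∈ Icc 0 T, |c t| ≤ L) (hcL' : ∀ t ∈ Ioo 0 T, |c' t| ≤ L) (hEL' : ∀ t ∈ Ioo 0 T, |E' t| ≤ L)
    (hsupp : ∀ t ∈ Icc 0 T, ∀ a, ∀ z ∈ Ioo zl zr, R < |a| → p.da t a z = 0) :
    ∃ M', (p.scale E E' c c').Regular zl zr T M' := by
  have hEpos : ∀ t ∈ Icc 0 T, 0 < E t := fun t ht => he.trans_le (hEe t ht)
  have hmap : ContinuousOn (fun x : ℝ × ℝ × ℝ => ((x.1, x.2.1 / E x.1, x.2.2) : ℝ × ℝ × ℝ))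
      (Icc 0 T ×ˢ univ ×ˢ Ioo zl zr) := by
    have h1 : ContinuousOn (fun x : ℝ × ℝ × ℝ => E x.1) (Icc 0 T ×ˢ univ ×ˢ Ioo zl zr) :=
      hE.comp continuousOn_fst fun x hx => hx.1
    exact continuousOn_fst.prodMk (((by fun_prop : ContinuousOn (fun x : ℝ × ℝ × ℝ => x.2.1) _).div
      h1 fun x hx => (hEpos _ hx.1).ne').prodMk (by fun_prop))
  have hmapsTo : MapsTo (fun x : ℝ × ℝ × ℝ => ((x.1, x.2.1 / E x.1, x.2.2) : ℝ × ℝ × ℝ))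
      (Icc 0 T ×ˢ univ ×ˢ Ioo zl zr) (Icc 0 T ×ˢ univ ×ˢ Ioo zl zr) :=
    fun x hx => ⟨hx.1, mem_univ _, hx.2.2⟩
  have hcc : ContinuousOn (fun x : ℝ × ℝ × ℝ => c x.1) (Icc 0 T ×ˢ univ ×ˢ Ioo zl zr) :=
    hc.comp continuousOn_fst fun x hx => hx.1
  have hEE : ContinuousOn (fun x : ℝ × ℝ × ℝ => E x.1) (Icc 0 T ×ˢ univ ×ˢ Ioo zl zr) :=
    hE.comp continuousOn_fst fun x hx => hx.1
  have hm2 : ∀ t, ContinuousOn (fun x : ℝ² => ((x.1 / E t, x.2) : ℝ²))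
      (univ ×ˢ Ioo zl zr) := fun t => by fun_prop
  have hm2' : ∀ t, MapsTo (fun x : ℝ² => ((x.1 / E t, x.2) : ℝ²))
      (univ ×ˢ Ioo zl zr) (univ ×ˢ Ioo zl zr) := fun t x hx => ⟨mem_univ _, hx.2⟩
  have hdaC : ∀ t ∈ Icc 0 T, ContinuousOn (fun x : ℝ² => p.da t x.1 x.2) (univ ×ˢ Ioo zl zr) :=
    fun t ht => hp.cont_da.comp (f := fun x : ℝ² => ((t, x.1, x.2) : ℝ × ℝ × ℝ)) (by fun_prop)
      fun x hx => ⟨ht, hx⟩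
  have hvC : ∀ t ∈ Icc 0 T, ContinuousOn (fun x : ℝ² => p.val t x.1 x.2) (univ ×ˢ Ioo zl zr) :=
    fun t ht => hp.cont.comp (f := fun x : ℝ² => ((t, x.1, x.2) : ℝ × ℝ × ℝ)) (by fun_prop)
      fun x hx => ⟨ht, hx⟩
  by_cases hne : (Icc 0 T).Nonempty ∧ (Ioo zl zr).Nonempty
  swap
  · have hemp : ∀ t ∈ Icc 0 T, ∀ z ∈ Ioo zl zr, False := fun t ht z hz => hne ⟨⟨t, ht⟩, ⟨z, hz⟩⟩
    have hemp' : ∀ t ∈ Ioo 0 T, ∀ z ∈ Ioo zl zr, False := fun t ht =>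
      hemp t (Ioo_subset_Icc_self ht)
    exact ⟨0,
      { cont := fun x hx => (hemp _ hx.1 _ hx.2.2).elim
        cont_da := fun x hx => (hemp _ hx.1 _ hx.2.2).elim
        cont_dz := fun t ht x hx => (hemp _ ht _ hx.2).elim
        cont_dzz := fun t ht x hx => (hemp _ ht _ hx.2).elim
        cont_dt := fun t ht x hx => (hemp' _ ht _ hx.2).elim
        has_da := fun t ht a z hz => (hemp _ ht _ hz).elim
        has_dz := fun t ht a z hz => (hemp _ ht _ hz).elim
        has_dzz := fun t ht a z hz => (hemp _ ht _ hz).elim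
        has_dt := fun t ht a z hz => (hemp' _ ht _ hz).elim
        bound := fun t ht a z hz => (hemp _ ht _ hz).elim
        bound_da := fun t ht a z hz => (hemp _ ht _ hz).elim
        bound_dz := fun t ht a z hz => (hemp _ ht _ hz).elim
        bound_dzz := fun t ht a z hz => (hemp _ ht _ hz).elim
        bound_dt := fun t ht a z hz => (hemp' _ ht _ hz).elim }⟩
  obtain ⟨⟨t₀, ht₀⟩, z₀, hz₀⟩ := hne
  have hM : 0 ≤ M := (abs_nonneg _).trans (hp.bound t₀ ht₀ 0 z₀ hz₀)
  have hL : 0 ≤ L := (abs_nonneg _).trans (hcL t₀ ht₀)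
  have b1 : ∀ t ∈ Icc 0 T, ∀ x, |x| ≤ M → |c t * x| ≤ L * M := fun t ht x hx => by
    rw [abs_mul]; exact mul_le_mul (hcL t ht) hx (abs_nonneg _) hL
  refine ⟨L * M + L / e * M + (L * M + L * (M + M * (R * (L / e)))),
    { cont := hcc.mul (hp.cont.comp hmap hmapsTo)
      cont_da := (hcc.div hEE fun x hx => (hEpos _ hx.1).ne').mul (hp.cont_da.comp hmap hmapsTo)
      cont_dz := fun t ht => continuousOn_const.mul ((hp.cont_dz t ht).comp (hm2 t) (hm2' t))
      cont_dzz := fun t ht => continuousOn_const.mul ((hp.cont_dzz t ht).comp (hm2 t) (hm2' t))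
      cont_dt := fun t ht => by
        have ht' := Ioo_subset_Icc_self ht
        refine (continuousOn_const.mul ((hvC t ht').comp (hm2 t) (hm2' t))).add
          (continuousOn_const.mul (((hp.cont_dt t ht).comp (hm2 t) (hm2' t)).add
            (((hdaC t ht').comp (hm2 t) (hm2' t)).mul (by fun_prop))))
      has_da := fun t ht a z hz => ?_
      has_dz := fun t ht a z hz => (hp.has_dz t ht (a / E t) z hz).const_mul (c t)
      has_dzz := fun t ht a z hz => (hp.has_dzz t ht (a / E t) z hz).const_mul (c t)
      has_dt := fun t ht a z hz => ?_
      bound := fun t ht a z hz => (b1 t ht _ (hp.bound t ht _ z hz)).trans ?_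
      bound_da := fun t ht a z hz => ?_
      bound_dz := fun t ht a z hz => (b1 t ht _ (hp.bound_dz t ht _ z hz)).trans ?_
      bound_dzz := fun t ht a z hz => (b1 t ht _ (hp.bound_dzz t ht _ z hz)).trans ?_
      bound_dt := fun t ht a z hz => ?_ }⟩
  · have := ((hp.has_da t ht (a / E t) z hz).comp a ((hasDerivAt_id' a).div_const (E t))).const_mul (c t)
    refine this.congr_deriv ?_
    simp only [StripPath.scale]; ring
  · have ht' := Ioo_subset_Icc_self ht
    have hEt := (hEpos t ht').ne'
    have hX : HasDerivAt (fun τ => a / E τ) (-(a / E t) * (E' t / E t)) t := by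
      have := (hasDerivAt_const t a).fun_div (hE' t ht) hEt
      refine this.congr_deriv ?_
      field_simp; ring
    have hnear : ∀ᶠ τ in 𝓝 t, τ ∈ Ioo 0 T := Ioo_mem_nhds ht.1 ht.2
    have hchain := hasDerivAt_comp_of_partial (u := fun τ a => p.val τ a z) (ua := fun τ a => p.da τ a z)
      (X := fun τ => a / E τ) (hp.has_dt t ht (a / E t) z hz)
      (by filter_upwards [hnear] with τ hτ a' using hp.has_da τ (Ioo_subset_Icc_self hτ) a' z hz)
      (by
        have h1 : ContinuousAt (fun x : ℝ × ℝ × ℝ => p.da x.1 x.2.1 x.2.2) (t, a / E t, z) := by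
          refine hp.cont_da.continuousAt ?_
          exact prod_mem_nhds (Icc_mem_nhds ht.1 ht.2) (prod_mem_nhds univ_mem (Ioo_mem_nhds hz.1 hz.2))
        exact h1.comp (f := fun x : ℝ² => ((x.1, x.2, z) : ℝ × ℝ × ℝ)) (x := (t, a / E t))
          (by fun_prop)) hX
    exact (hc' t ht).mul hchain
  · have : 0 ≤ L / e * M + (L * M + L * (M + M * (R * (L / e)))) := by positivity
    linarith
  · have h1 : |c t / E t| ≤ L / e := by
      rw [abs_div, abs_of_pos (hEpos t ht)]
      exact div_le_div₀ hL (hcL t ht) he (hEe t ht)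
    have h2 : |(p.scale E E' c c').da t a z| ≤ L / e * M := by
      simp only [StripPath.scale]; rw [abs_mul]
      exact mul_le_mul h1 (hp.bound_da t ht _ z hz) (abs_nonneg _) (by positivity)
    have : 0 ≤ L * M + (L * M + L * (M + M * (R * (L / e)))) := by positivity
    linarith
  · have : 0 ≤ L / e * M + (L * M + L * (M + M * (R * (L / e)))) := by positivity
    linarith
  · have : 0 ≤ L / e * M + (L * M + L * (M + M * (R * (L / e)))) := by positivity
    linarith
  · have ht' := Ioo_subset_Icc_self ht
    have h1 : |c' t * p.val t (a / E t) z| ≤ L * M := by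
      rw [abs_mul]; exact mul_le_mul (hcL' t ht) (hp.bound t ht' _ z hz) (abs_nonneg _) hL
    have h2 : |p.da t (a / E t) z * (-(a / E t) * (E' t / E t))| ≤ M * (R * (L / e)) := by
      by_cases h : R < |a / E t|
      · rw [hsupp t ht' _ z hz h]; simp; positivity
      · have h3 : |E' t / E t| ≤ L / e := by
          rw [abs_div, abs_of_pos (hEpos t ht')]
          exact div_le_div₀ hL (hEL' t ht) he (hEe t ht')
        rw [abs_mul, abs_mul, abs_neg]
        exact mul_le_mul (hp.bound_da t ht' _ z hz)
          (mul_le_mul (not_lt.1 h) h3 (abs_nonneg _) hR) (by positivity) hM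
    have h3 := b1 t ht' 1
    have h4 : |c t * (p.dt t (a / E t) z + p.da t (a / E t) z * (-(a / E t) * (E' t / E t)))|
        ≤ L * (M + M * (R * (L / e))) := by
      rw [abs_mul]
      exact mul_le_mul (hcL t ht') ((abs_add_le _ _).trans (add_le_add (hp.bound_dt t ht _ z hz) h2))
        (abs_nonneg _) hL
    have h5 : |(p.scale E E' c c').dt t a z| ≤ L * M + L * (M + M * (R * (L / e))) :=
      (abs_add_le _ _).trans (add_le_add h1 h4)
    have : 0 ≤ L * M + L / e * M := by positivity
    linarith

end

section

variable {zl zr T M : ℝ}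

/-! ### Primitives in the wealth variable -/

lemma continuousOn_primitive {P : Type*} [TopologicalSpace P] [FirstCountableTopology P]
    {S : Set P} {F : P → ℝ → ℝ} {M R : ℝ} (hF : ContinuousOn (fun x : P × ℝ => F x.1 x.2) (S ×ˢ univ))
    (hM : ∀ p ∈ S, ∀ s, |F p s| ≤ M) :
    ContinuousOn (fun x : P × ℝ => ∫ s in (-R)..x.2, F x.1 s) (S ×ˢ univ) := by
  have hc : ∀ p ∈ S, Continuous (F p) := fun p hp => by
    rw [← continuousOn_univ]
    exact hF.comp (f := fun s : ℝ => ((p, s) : P × ℝ)) (by fun_prop) fun s _ => ⟨hp, mem_univ _⟩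
  rintro ⟨p₀, a₀⟩ ⟨hp₀, -⟩
  have hS : ∀ᶠ x in 𝓝[S ×ˢ (univ : Set ℝ)] (p₀, a₀), x.1 ∈ S := by
    filter_upwards [self_mem_nhdsWithin] with x hx using hx.1
  have h1 : ContinuousWithinAt (fun x : P × ℝ => ∫ s in (-R)..a₀, F x.1 s) (S ×ˢ univ) (p₀, a₀) := by
    refine intervalIntegral.continuousWithinAt_of_dominated_interval (bound := fun _ => M) ?_ ?_
      intervalIntegrable_const ?_
    · filter_upwards [hS] with x hx using (hc _ hx).aestronglyMeasurable
    · filter_upwards [hS] with x hx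
      exact Eventually.of_forall fun s _ => hM _ hx s
    · refine Eventually.of_forall fun s _ => ?_
      exact ContinuousWithinAt.comp (f := fun x : P × ℝ => ((x.1, s) : P × ℝ)) (x := (p₀, a₀))
        (g := fun x : P × ℝ => F x.1 x.2) (t := S ×ˢ univ) (hF (p₀, s) ⟨hp₀, mem_univ _⟩)
        (Continuous.continuousWithinAt (by fun_prop)) fun x hx => ⟨hx.1, mem_univ _⟩
  have h2 : Tendsto (fun x : P × ℝ => ∫ s in a₀..x.2, F x.1 s) (𝓝[S ×ˢ univ] (p₀, a₀)) (𝓝 0) := by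
    refine squeeze_zero_norm' (a := fun x : P × ℝ => M * |x.2 - a₀|) ?_ ?_
    · filter_upwards [hS] with x hx
      exact intervalIntegral.norm_integral_le_of_norm_le_const fun s _ => hM _ hx s
    · have : Tendsto (fun x : P × ℝ => M * |x.2 - a₀|) (𝓝 (p₀, a₀)) (𝓝 (M * |a₀ - a₀|)) :=
        Continuous.tendsto (f := fun x : P × ℝ => M * |x.2 - a₀|) (by fun_prop) _
      simp only [sub_self, abs_zero, mul_zero] at this
      exact this.mono_left nhdsWithin_le_nhds
  have h3 := h1.tendsto.add h2
  rw [add_zero] at h3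
  refine h3.congr' ?_
  filter_upwards [hS] with x hx
  exact intervalIntegral.integral_add_adjacent_intervals ((hc _ hx).intervalIntegrable _ _)
    ((hc _ hx).intervalIntegrable _ _)

lemma hasDerivAt_primitive {F F' : ℝ → ℝ → ℝ} {U : Set ℝ} {x₀ M R a : ℝ} (hU : U ∈ 𝓝 x₀)
    (hF : ∀ x ∈ U, Continuous (F x)) (hF' : Continuous (F' x₀)) (hM : ∀ x ∈ U, ∀ s, |F' x s| ≤ M)
    (hd : ∀ x ∈ U, ∀ s, HasDerivAt (fun x => F x s) (F' x s) x) :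
    HasDerivAt (fun x => ∫ s in (-R)..a, F x s) (∫ s in (-R)..a, F' x₀ s) x₀ := by
  refine (intervalIntegral.hasDerivAt_integral_of_dominated_loc_of_deriv_le (s := U)
    (bound := fun _ => M) hU ?_ ((hF _ (mem_of_mem_nhds hU)).intervalIntegrable _ _)
    hF'.aestronglyMeasurable ?_ intervalIntegrable_const ?_).2
  · filter_upwards [hU] with x hx using (hF x hx).aestronglyMeasurable
  · exact Eventually.of_forall fun s _ x hx => hM x hx s
  · exact Eventually.of_forall fun s _ x hx => hd x hx s

lemma primitive_eq_zero {F : ℝ → ℝ} {R a : ℝ} (hR : 0 ≤ R) (hF : ∀ s, R ≤ |s| → F s = 0)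
    (ha : a ≤ -R) : ∫ s in (-R)..a, F s = 0 := by
  rw [intervalIntegral.integral_congr (g := fun _ => 0)]
  · simp
  · intro s hs
    rw [uIcc_of_ge ha] at hs
    exact hF s (by rw [abs_of_nonpos (by linarith [hs.2])]; linarith [hs.2])

lemma primitive_eq_right {F : ℝ → ℝ} {R a : ℝ} (hR : 0 ≤ R) (hc : Continuous F)
    (hF : ∀ s, R ≤ |s| → F s = 0) (ha : R ≤ a) : ∫ s in (-R)..a, F s = ∫ s in (-R)..R, F s := by
  rw [← intervalIntegral.integral_add_adjacent_intervals (hc.intervalIntegrable (-R) R)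
    (hc.intervalIntegrable R a), add_eq_left, intervalIntegral.integral_congr (g := fun _ => 0)]
  · simp
  · intro s hs
    rw [uIcc_of_le ha] at hs
    exact hF s (by rw [abs_of_nonneg (by linarith [hs.1])]; exact hs.1)

lemma abs_primitive_le {F : ℝ → ℝ} {R a M : ℝ} (hR : 0 ≤ R) (hc : Continuous F)
    (hF : ∀ s, R ≤ |s| → F s = 0) (hM : ∀ s, |F s| ≤ M) : |∫ s in (-R)..a, F s| ≤ M * (2 * R) := by
  have hM0 : 0 ≤ M := (abs_nonneg _).trans (hM 0)
  have key : ∀ a ∈ Icc (-R) R, |∫ s in (-R)..a, F s| ≤ M * (2 * R) := fun a ha => by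
    refine (intervalIntegral.norm_integral_le_of_norm_le_const (f := F) fun s _ => hM s).trans ?_
    gcongr
    rw [abs_of_nonneg (by linarith [ha.1])]; linarith [ha.2]
  rcases le_total a (-R) with h | h
  · rw [primitive_eq_zero hR hF h]; simp; positivity
  rcases le_total R a with h' | h'
  · rw [primitive_eq_right hR hc hF h']; exact key R ⟨by linarith, le_rfl⟩
  · exact key a ⟨h, h'⟩

/-- The primitive in the wealth variable, starting at `-R`. -/
def StripPath.prim (p : StripPath) (R : ℝ) : StripPath where
  val t a z := ∫ s in (-R)..a, p.val t s z
  da := p.val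
  dz t a z := ∫ s in (-R)..a, p.dz t s z
  dzz t a z := ∫ s in (-R)..a, p.dzz t s z
  dt t a z := ∫ s in (-R)..a, p.dt t s z

namespace StripPath.Regular

variable {p : StripPath} {R : ℝ}

lemma da_eq_zero (hp : p.Regular zl zr T M)
    (hs : ∀ t ∈ Icc 0 T, ∀ a, ∀ z ∈ Ioo zl zr, R ≤ |a| → p.val t a z = 0) :
    ∀ t ∈ Icc 0 T, ∀ a, ∀ z ∈ Ioo zl zr, R < |a| → p.da t a z = 0 := by
  intro t ht a z hz ha
  have hev : (fun a => p.val t a z) =ᶠ[𝓝 a] fun _ => 0 := by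
    filter_upwards [(continuous_abs.isOpen_preimage _ isOpen_Ioi).mem_nhds (show a ∈ abs ⁻¹' Ioi R from ha)]
      with a' ha' using hs t ht a' z hz (le_of_lt ha')
  exact (hp.has_da t ht a z hz).unique ((hasDerivAt_const a (0 : ℝ)).congr_of_eventuallyEq hev)

lemma dz_eq_zero (hp : p.Regular zl zr T M)
    (hs : ∀ t ∈ Icc 0 T, ∀ a, ∀ z ∈ Ioo zl zr, R ≤ |a| → p.val t a z = 0) :
    ∀ t ∈ Icc 0 T, ∀ a, ∀ z ∈ Ioo zl zr, R ≤ |a| → p.dz t a z = 0 := by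
  intro t ht a z hz ha
  have hev : (fun z => p.val t a z) =ᶠ[𝓝 z] fun _ => 0 := by
    filter_upwards [Ioo_mem_nhds hz.1 hz.2] with z' hz' using hs t ht a z' hz' ha
  exact (hp.has_dz t ht a z hz).unique ((hasDerivAt_const z (0 : ℝ)).congr_of_eventuallyEq hev)

lemma dzz_eq_zero (hp : p.Regular zl zr T M)
    (hs : ∀ t ∈ Icc 0 T, ∀ a, ∀ z ∈ Ioo zl zr, R ≤ |a| → p.val t a z = 0) :
    ∀ t ∈ Icc 0 T, ∀ a, ∀ z ∈ Ioo zl zr, R ≤ |a| → p.dzz t a z = 0 := by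
  intro t ht a z hz ha
  have hev : (fun z => p.dz t a z) =ᶠ[𝓝 z] fun _ => 0 := by
    filter_upwards [Ioo_mem_nhds hz.1 hz.2] with z' hz' using hp.dz_eq_zero hs t ht a z' hz' ha
  exact (hp.has_dzz t ht a z hz).unique ((hasDerivAt_const z (0 : ℝ)).congr_of_eventuallyEq hev)

lemma dt_eq_zero (hp : p.Regular zl zr T M)
    (hs : ∀ t ∈ Icc 0 T, ∀ a, ∀ z ∈ Ioo zl zr, R ≤ |a| → p.val t a z = 0) :
    ∀ t ∈ Ioo 0 T, ∀ a, ∀ z ∈ Ioo zl zr, R ≤ |a| → p.dt t a z = 0 := by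
  intro t ht a z hz ha
  have hev : (fun t => p.val t a z) =ᶠ[𝓝 t] fun _ => 0 := by
    filter_upwards [Ioo_mem_nhds ht.1 ht.2] with t' ht' using hs t' (Ioo_subset_Icc_self ht') a z hz ha
  exact (hp.has_dt t ht a z hz).unique ((hasDerivAt_const t (0 : ℝ)).congr_of_eventuallyEq hev)

lemma cont_slice (hp : p.Regular zl zr T M) {t : ℝ} (ht : t ∈ Icc 0 T) :
    ContinuousOn (fun x : ℝ² => p.val t x.1 x.2) (univ ×ˢ Ioo zl zr) :=
  hp.cont.comp (f := fun x : ℝ² => ((t, x.1, x.2) : ℝ × ℝ × ℝ)) (by fun_prop)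
    fun x hx => ⟨ht, hx⟩

lemma cont_da_slice (hp : p.Regular zl zr T M) {t : ℝ} (ht : t ∈ Icc 0 T) :
    ContinuousOn (fun x : ℝ² => p.da t x.1 x.2) (univ ×ˢ Ioo zl zr) :=
  hp.cont_da.comp (f := fun x : ℝ² => ((t, x.1, x.2) : ℝ × ℝ × ℝ)) (by fun_prop)
    fun x hx => ⟨ht, hx⟩

end StripPath.Regular

lemma continuous_line {F : ℝ → ℝ → ℝ}
    (hF : ContinuousOn (fun x : ℝ² => F x.1 x.2) (univ ×ˢ Ioo zl zr)) {z : ℝ}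
    (hz : z ∈ Ioo zl zr) : Continuous fun a => F a z := by
  rw [← continuousOn_univ]
  exact hF.comp (f := fun s : ℝ => ((s, z) : ℝ²)) (by fun_prop) fun s _ => ⟨mem_univ _, hz⟩

lemma continuousOn_primitive_strip {F : ℝ → ℝ → ℝ} {R : ℝ}
    (hF : ContinuousOn (fun x : ℝ² => F x.1 x.2) (univ ×ˢ Ioo zl zr))
    (hM : ∀ a, ∀ z ∈ Ioo zl zr, |F a z| ≤ M) :
    ContinuousOn (fun x : ℝ² => ∫ s in (-R)..x.1, F s x.2) (univ ×ˢ Ioo zl zr) := by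
  have := continuousOn_primitive (P := ℝ) (S := Ioo zl zr) (F := fun z s => F s z) (M := M) (R := R)
    (hF.comp (f := fun x : ℝ² => ((x.2, x.1) : ℝ²)) (by fun_prop) fun x hx => ⟨mem_univ _, hx.1⟩)
    fun z hz s => hM s z hz
  exact this.comp (f := fun x : ℝ² => ((x.2, x.1) : ℝ²)) (by fun_prop)
    fun x hx => ⟨hx.2, mem_univ _⟩

lemma StripPath.Regular.prim {p : StripPath} {R : ℝ} (hp : p.Regular zl zr T M) (hR : 0 ≤ R)
    (hs : ∀ t ∈ Icc 0 T, ∀ a, ∀ z ∈ Ioo zl zr, R ≤ |a| → p.val t a z = 0) (hM : 0 ≤ M) :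
    (p.prim R).Regular zl zr T (M * (2 * R) + M) := by
  have hM' : M * (2 * R) ≤ M * (2 * R) + M := by linarith
  have hM'' : M ≤ M * (2 * R) + M := by have : 0 ≤ M * (2 * R) := by positivity
                                        linarith
  have hcz : ∀ t ∈ Icc 0 T, ∀ z ∈ Ioo zl zr, Continuous fun a => p.val t a z :=
    fun t ht z hz => continuous_line (hp.cont_slice ht) hz
  have hcdz : ∀ t ∈ Icc 0 T, ∀ z ∈ Ioo zl zr, Continuous fun a => p.dz t a z :=
    fun t ht z hz => continuous_line (hp.cont_dz t ht) hz
  have hcdzz : ∀ t ∈ Icc 0 T, ∀ z ∈ Ioo zl zr, Continuous fun a => p.dzz t a z :=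
    fun t ht z hz => continuous_line (hp.cont_dzz t ht) hz
  have hcdt : ∀ t ∈ Ioo 0 T, ∀ z ∈ Ioo zl zr, Continuous fun a => p.dt t a z :=
    fun t ht z hz => continuous_line (hp.cont_dt t ht) hz
  exact
  { cont := by
      have := continuousOn_primitive (P := ℝ²) (S := Icc 0 T ×ˢ Ioo zl zr)
        (F := fun x s => p.val x.1 s x.2) (M := M) (R := R)
        (hp.cont.comp (f := fun x : ℝ² × ℝ => ((x.1.1, x.2, x.1.2) : ℝ × ℝ × ℝ))
          (by fun_prop) fun x hx => ⟨hx.1.1, mem_univ _, hx.1.2⟩)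
        fun x hx s => hp.bound x.1 hx.1 s x.2 hx.2
      exact this.comp (f := fun x : ℝ × ℝ × ℝ => (((x.1, x.2.2), x.2.1) : ℝ² × ℝ))
        (by fun_prop) fun x hx => ⟨⟨hx.1, hx.2.2⟩, mem_univ _⟩
    cont_da := hp.cont
    cont_dz := fun t ht => continuousOn_primitive_strip (hp.cont_dz t ht) (hp.bound_dz t ht)
    cont_dzz := fun t ht => continuousOn_primitive_strip (hp.cont_dzz t ht) (hp.bound_dzz t ht)
    cont_dt := fun t ht => continuousOn_primitive_strip (hp.cont_dt t ht) (hp.bound_dt t ht)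
    has_da := fun t ht a z hz => (hcz t ht z hz).integral_hasStrictDerivAt (-R) a |>.hasDerivAt
    has_dz := fun t ht a z hz => hasDerivAt_primitive (F := fun z s => p.val t s z)
      (F' := fun z s => p.dz t s z) (Ioo_mem_nhds hz.1 hz.2) (hcz t ht) (hcdz t ht z hz)
      (fun z hz s => hp.bound_dz t ht s z hz) fun z hz s => hp.has_dz t ht s z hz
    has_dzz := fun t ht a z hz => hasDerivAt_primitive (F := fun z s => p.dz t s z)
      (F' := fun z s => p.dzz t s z) (Ioo_mem_nhds hz.1 hz.2) (hcdz t ht) (hcdzz t ht z hz)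
      (fun z hz s => hp.bound_dzz t ht s z hz) fun z hz s => hp.has_dzz t ht s z hz
    has_dt := fun t ht a z hz => hasDerivAt_primitive (F := fun t s => p.val t s z)
      (F' := fun t s => p.dt t s z) (Ioo_mem_nhds ht.1 ht.2)
      (fun t ht => hcz t (Ioo_subset_Icc_self ht) z hz) (hcdt t ht z hz)
      (fun t ht s => hp.bound_dt t ht s z hz) fun t ht s => hp.has_dt t ht s z hz
    bound := fun t ht a z hz => (abs_primitive_le hR (hcz t ht z hz) (fun s => hs t ht s z hz)
      fun s => hp.bound t ht s z hz).trans hM'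
    bound_da := fun t ht a z hz => (hp.bound t ht a z hz).trans hM''
    bound_dz := fun t ht a z hz => (abs_primitive_le hR (hcdz t ht z hz)
      (fun s => hp.dz_eq_zero hs t ht s z hz) fun s => hp.bound_dz t ht s z hz).trans hM'
    bound_dzz := fun t ht a z hz => (abs_primitive_le hR (hcdzz t ht z hz)
      (fun s => hp.dzz_eq_zero hs t ht s z hz) fun s => hp.bound_dzz t ht s z hz).trans hM'
    bound_dt := fun t ht a z hz => (abs_primitive_le hR (hcdt t ht z hz)
      (fun s => hp.dt_eq_zero hs t ht s z hz) fun s => hp.bound_dt t ht s z hz).trans hM' }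

/-! ### Bounded continuous functions and integrals over boxes -/

/-- `f` is continuous and bounded on `S`. -/
def BddCont (S : Set ℝ²) (f : ℝ² → ℝ) : Prop :=
  ContinuousOn f S ∧ ∃ K, ∀ x ∈ S, |f x| ≤ K

namespace BddCont

variable {S : Set ℝ²} {f g : ℝ² → ℝ}

lemma add (hf : BddCont S f) (hg : BddCont S g) : BddCont S fun x => f x + g x := by
  obtain ⟨h1, K, hK⟩ := hf
  obtain ⟨h2, L, hL⟩ := hg
  exact ⟨h1.add h2, K + L, fun x hx => (abs_add_le _ _).trans (add_le_add (hK x hx) (hL x hx))⟩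

lemma neg (hf : BddCont S f) : BddCont S fun x => -f x := by
  obtain ⟨h1, K, hK⟩ := hf
  exact ⟨h1.neg, K, fun x hx => by rw [abs_neg]; exact hK x hx⟩

lemma sub (hf : BddCont S f) (hg : BddCont S g) : BddCont S fun x => f x - g x := by
  simpa only [sub_eq_add_neg] using hf.add hg.neg

lemma mul (hf : BddCont S f) (hg : BddCont S g) : BddCont S fun x => f x * g x := by
  obtain ⟨h1, K, hK⟩ := hf
  obtain ⟨h2, L, hL⟩ := hg
  refine ⟨h1.mul h2, K * L, fun x hx => ?_⟩
  rw [abs_mul]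
  exact mul_le_mul (hK x hx) (hL x hx) (abs_nonneg _) ((abs_nonneg _).trans (hK x hx))

lemma const (c : ℝ) : BddCont S fun _ => c := ⟨continuousOn_const, |c|, fun _ _ => le_rfl⟩

lemma mono {S' : Set ℝ²} (hf : BddCont S f) (h : S' ⊆ S) : BddCont S' f :=
  ⟨hf.1.mono h, hf.2.imp fun _ hK x hx => hK x (h hx)⟩

lemma congr (hf : BddCont S f) (h : ∀ x ∈ S, g x = f x) : BddCont S g :=
  ⟨hf.1.congr h, hf.2.imp fun K hK x hx => by rw [h x hx]; exact hK x hx⟩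

end BddCont

/-- The box `(-R, R) × (zl, zr)`. -/
def box (R zl zr : ℝ) : Set ℝ² := Ioo (-R) R ×ˢ Ioo zl zr

notation "𝔹(" m ")" => box (3 * Model.A m) (Model.zMin m) (Model.zMax m)
notation "𝔹(" m "," Λ ")" => box (3 * Model.A m * Λ) (Model.zMin m) (Model.zMax m)

lemma measurableSet_box {R : ℝ} : MeasurableSet (box R zl zr) :=
  measurableSet_Ioo.prod measurableSet_Ioo

lemma isOpen_box {R : ℝ} : IsOpen (box R zl zr) := isOpen_Ioo.prod isOpen_Ioo

lemma box_subset_strip {R : ℝ} : box R zl zr ⊆ univ ×ˢ Ioo zl zr :=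
  fun _ hx => ⟨mem_univ _, hx.2⟩

lemma Model.zBound_nonneg (m : Model) : 0 ≤ 𝕫(m) := (abs_nonneg _).trans (le_max_left _ _)

lemma Model.bddCont_z (m : Model) : BddCont (univ ×ˢ 𝕁(m)) fun x => x.2 :=
  ⟨continuousOn_snd, 𝕫(m), fun _ hx => abs_le_max_abs_abs hx.2.1.le hx.2.2.le⟩

lemma volume_box_lt_top {R : ℝ} : volume (box R zl zr) < ⊤ := by
  rw [box, Measure.volume_eq_prod, Measure.prod_prod]
  exact ENNReal.mul_lt_top measure_Ioo_lt_top measure_Ioo_lt_top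

lemma volume_real_box {R : ℝ} (hR : 0 ≤ R) (hz : zl ≤ zr) :
    volume.real (box R zl zr) = 2 * R * (zr - zl) := by
  rw [box, Measure.volume_eq_prod, measureReal_prod_prod, Real.volume_real_Ioo_of_le (by linarith),
    Real.volume_real_Ioo_of_le hz]
  ring

lemma volume_restrict_box {R : ℝ} : volume.restrict (box R zl zr)
    = (volume.restrict (Ioo (-R) R)).prod (volume.restrict (Ioo zl zr)) := by
  rw [box, Measure.volume_eq_prod, Measure.prod_restrict]

lemma BddCont.integrableOn {R : ℝ} {f : ℝ² → ℝ} (hf : BddCont (box R zl zr) f) :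
    IntegrableOn f (box R zl zr) := by
  obtain ⟨h1, K, hK⟩ := hf
  exact (integrableOn_const (C := K) volume_box_lt_top.ne).mono'
    (h1.aestronglyMeasurable measurableSet_box)
    ((ae_restrict_iff' measurableSet_box).2 (Eventually.of_forall hK))

lemma abs_setIntegral_box_le {R K : ℝ} (hR : 0 ≤ R) (hz : zl ≤ zr) {f : ℝ² → ℝ}
    (hK : ∀ x ∈ box R zl zr, |f x| ≤ K) : |∫ x in box R zl zr, f x| ≤ K * (2 * R * (zr - zl)) := by
  have := norm_setIntegral_le_of_norm_le_const (f := f) volume_box_lt_top hK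
  rwa [volume_real_box hR hz] at this

lemma setIntegral_box_deriv_z {R M : ℝ} (hz : zl < zr) {Φ F : ℝ → ℝ → ℝ}
    (hd : ∀ a ∈ Ioo (-R) R, ∀ z ∈ Ioo zl zr, HasDerivAt (fun z => Φ a z) (F a z) z)
    (hF : BddCont (box R zl zr) fun x => F x.1 x.2)
    (hl : ∀ a ∈ Ioo (-R) R, ∀ z ∈ Ioo zl zr, |Φ a z| ≤ M * (z - zl))
    (hr : ∀ a ∈ Ioo (-R) R, ∀ z ∈ Ioo zl zr, |Φ a z| ≤ M * (zr - z)) : ∫ x in box R zl zr, F x.1 x.2 = 0 := by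
  have hint := hF.integrableOn
  rw [IntegrableOn, volume_restrict_box] at hint
  rw [volume_restrict_box, integral_prod _ hint]
  refine (setIntegral_congr_fun (g := fun _ => 0) measurableSet_Ioo fun a ha => ?_).trans (by simp)
  change ∫ z in Ioo zl zr, F a z = 0
  obtain ⟨hFc, K, hK⟩ := hF
  have hFa : IntegrableOn (fun z => F a z) (Ioo zl zr) := by
    have hfin : volume (Ioo zl zr) ≠ ⊤ := measure_Ioo_lt_top.ne
    refine (integrableOn_const (C := K) hfin).mono' ?_ ?_
    · refine ContinuousOn.aestronglyMeasurable ?_ measurableSet_Ioo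
      exact hFc.comp (f := fun z : ℝ => ((a, z) : ℝ²)) (by fun_prop) fun z hz => ⟨ha, hz⟩
    · exact (ae_restrict_iff' measurableSet_Ioo).2 (Eventually.of_forall fun z hz => hK (a, z) ⟨ha, hz⟩)
  rw [← integral_Ioc_eq_integral_Ioo, ← intervalIntegral.integral_of_le hz.le]
  rw [intervalIntegral.integral_eq_sub_of_hasDerivAt_of_tendsto hz (fa := 0) (fb := 0) (hd a ha)
    ((intervalIntegrable_iff_integrableOn_Ioo_of_le hz.le).2 hFa), sub_zero]
  · refine squeeze_zero_norm' (a := fun z => M * (z - zl)) ?_ ?_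
    · filter_upwards [Ioo_mem_nhdsGT hz] with z hz' using hl a ha z hz'
    · have : Tendsto (fun z => M * (z - zl)) (𝓝 zl) (𝓝 (M * (zl - zl))) :=
        Continuous.tendsto (f := fun z => M * (z - zl)) (by fun_prop) _
      simp only [sub_self, mul_zero] at this
      exact this.mono_left nhdsWithin_le_nhds
  · refine squeeze_zero_norm' (a := fun z => M * (zr - z)) ?_ ?_
    · filter_upwards [Ioo_mem_nhdsLT hz] with z hz' using hr a ha z hz'
    · have : Tendsto (fun z => M * (zr - z)) (𝓝 zr) (𝓝 (M * (zr - zr))) :=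
        Continuous.tendsto (f := fun z => M * (zr - z)) (by fun_prop) _
      simp only [sub_self, mul_zero] at this
      exact this.mono_left nhdsWithin_le_nhds

lemma setIntegral_box_deriv_a {R : ℝ} (hR : 0 ≤ R) {Ψ F : ℝ → ℝ → ℝ}
    (hd : ∀ a, ∀ z ∈ Ioo zl zr, HasDerivAt (fun a => Ψ a z) (F a z) a)
    (hF : ContinuousOn (fun x : ℝ² => F x.1 x.2) (univ ×ˢ Ioo zl zr))
    (hFb : ∃ K, ∀ x ∈ box R zl zr, |F x.1 x.2| ≤ K)
    (hl : ∀ z ∈ Ioo zl zr, Ψ (-R) z = 0) (hr : ∀ z ∈ Ioo zl zr, Ψ R z = 0) :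
    ∫ x in box R zl zr, F x.1 x.2 = 0 := by
  have hint := BddCont.integrableOn (R := R) (zl := zl) (zr := zr) ⟨hF.mono box_subset_strip, hFb⟩
  rw [IntegrableOn, volume_restrict_box] at hint
  rw [volume_restrict_box, integral_prod_symm _ hint]
  refine (setIntegral_congr_fun (g := fun _ => 0) measurableSet_Ioo fun z hz => ?_).trans (by simp)
  change ∫ a in Ioo (-R) R, F a z = 0
  have hc := continuous_line hF hz
  rw [← integral_Ioc_eq_integral_Ioo, ← intervalIntegral.integral_of_le (by linarith)]
  rw [intervalIntegral.integral_eq_sub_of_hasDerivAt (fun a _ => hd a z hz) (hc.intervalIntegrable _ _),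
    hl z hz, hr z hz, sub_zero]

lemma hasDerivAt_setIntegral_box {R K : ℝ} {h ht : ℝ → ℝ² → ℝ}
    (hd : ∀ t ∈ Ioo 0 T, ∀ x ∈ box R zl zr, HasDerivAt (fun t => h t x) (ht t x) t)
    (hh : ∀ t ∈ Ioo 0 T, BddCont (box R zl zr) (h t)) (hht : ∀ t ∈ Ioo 0 T, ContinuousOn (ht t) (box R zl zr))
    (hK : ∀ t ∈ Ioo 0 T, ∀ x ∈ box R zl zr, |ht t x| ≤ K) :
    ∀ t ∈ Ioo 0 T, HasDerivAt (fun t => ∫ x in box R zl zr, h t x) (∫ x in box R zl zr, ht t x) t := by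
  intro t htI
  refine (hasDerivAt_integral_of_dominated_loc_of_deriv_le (s := Ioo 0 T) (bound := fun _ => K)
    (Ioo_mem_nhds htI.1 htI.2) ?_ (hh t htI).integrableOn
    ((hht t htI).aestronglyMeasurable measurableSet_box) ?_ ?_ ?_).2
  · filter_upwards [Ioo_mem_nhds htI.1 htI.2] with s hs
      using (hh s hs).1.aestronglyMeasurable measurableSet_box
  · exact (ae_restrict_iff' measurableSet_box).2 (Eventually.of_forall fun x hx s hs => hK s hs x hx)
  · exact integrableOn_const volume_box_lt_top.ne
  · exact (ae_restrict_iff' measurableSet_box).2 (Eventually.of_forall fun x hx s hs => hd s hs x hx)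

lemma continuousOn_setIntegral_box {R K : ℝ} {h : ℝ → ℝ² → ℝ}
    (hh : ∀ t ∈ Icc 0 T, ContinuousOn (h t) (box R zl zr))
    (hc : ∀ x ∈ box R zl zr, ContinuousOn (fun t => h t x) (Icc 0 T))
    (hK : ∀ t ∈ Icc 0 T, ∀ x ∈ box R zl zr, |h t x| ≤ K) :
    ContinuousOn (fun t => ∫ x in box R zl zr, h t x) (Icc 0 T) := by
  intro t ht
  refine continuousWithinAt_of_dominated (bound := fun _ => K) ?_ ?_ ?_ ?_
  · filter_upwards [self_mem_nhdsWithin] with s hs using (hh s hs).aestronglyMeasurable measurableSet_box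
  · filter_upwards [self_mem_nhdsWithin] with s hs
    exact (ae_restrict_iff' measurableSet_box).2 (Eventually.of_forall fun x hx => hK s hs x hx)
  · exact integrableOn_const volume_box_lt_top.ne
  · exact (ae_restrict_iff' measurableSet_box).2 (Eventually.of_forall fun x hx => hc x hx t ht)

end

section

variable {zl zr T M : ℝ}

/-! ### The coefficients in the income variable and the weak form of the forward equation -/

/-- The diffusion coefficient `D = σ²/2` and the drift `μ` with their derivatives. -/
structure CoeffData where
  D : ℝ → ℝ
  D1 : ℝ → ℝ
  D2 : ℝ → ℝ
  μ : ℝ → ℝ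
  μ1 : ℝ → ℝ

/-- The expanded form of `∂_zz (D h) - ∂_z (μ h)`. -/
def CoeffData.fwd (k : CoeffData) (z h hz hzz : ℝ) : ℝ :=
  k.D z * hzz + (2 * k.D1 z - k.μ z) * hz + (k.D2 z - k.μ1 z) * h

structure CoeffData.Regular (k : CoeffData) (zl zr C : ℝ) : Prop where
  lt : zl < zr
  C_nonneg : 0 ≤ C
  has_D1 : ∀ z ∈ Ioo zl zr, HasDerivAt k.D (k.D1 z) z
  has_D2 : ∀ z ∈ Ioo zl zr, HasDerivAt k.D1 (k.D2 z) z
  has_μ1 : ∀ z ∈ Ioo zl zr, HasDerivAt k.μ (k.μ1 z) z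
  cont_D2 : ContinuousOn k.D2 (Ioo zl zr)
  cont_μ1 : ContinuousOn k.μ1 (Ioo zl zr)
  degenerate : Degenerate zl zr C k.D k.μ
  D_left : ∀ z ∈ Ioo zl zr, |k.D z| ≤ C * (z - zl)
  D_right : ∀ z ∈ Ioo zl zr, |k.D z| ≤ C * (zr - z)
  D1_left : ∀ z ∈ Ioo zl zr, |k.D1 z| ≤ C * (z - zl)
  D1_right : ∀ z ∈ Ioo zl zr, |k.D1 z| ≤ C * (zr - z)
  D_bdd : ∀ z ∈ Ioo zl zr, |k.D z| ≤ C
  D1_bdd : ∀ z ∈ Ioo zl zr, |k.D1 z| ≤ C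
  D2_bdd : ∀ z ∈ Ioo zl zr, |k.D2 z| ≤ C
  μ_bdd : ∀ z ∈ Ioo zl zr, |k.μ z| ≤ C
  μ1_bdd : ∀ z ∈ Ioo zl zr, |k.μ1 z| ≤ C

namespace CoeffData.Regular

variable {k : CoeffData} {C : ℝ}

lemma degenerate_fwd (hk : k.Regular zl zr C) : Degenerate zl zr (3 * C) k.D fun z => 2 * k.D1 z - k.μ z := by
  have hd := hk.degenerate
  have hC := hk.C_nonneg
  have habs : ∀ z, |2 * k.D1 z - k.μ z| ≤ 2 * |k.D1 z| + |k.μ z| := fun z => by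
    refine (abs_sub _ _).trans ?_
    rw [abs_mul]; simp
  refine ⟨hd.nonneg, fun z hz => (hd.left z hz).trans ?_, fun z hz => (hd.right z hz).trans ?_,
    fun z hz => ?_, fun z hz => ?_⟩
  · nlinarith [sq_nonneg (z - zl)]
  · nlinarith [sq_nonneg (zr - z)]
  · linarith [habs z, hk.D1_left z hz, hd.drift_left z hz]
  · linarith [habs z, hk.D1_right z hz, hd.drift_right z hz]

lemma bddCont_snd {f : ℝ → ℝ} (hf : ContinuousOn f (Ioo zl zr)) (hb : ∀ z ∈ Ioo zl zr, |f z| ≤ C) :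
    BddCont (univ ×ˢ Ioo zl zr) fun x => f x.2 :=
  ⟨hf.comp continuousOn_snd fun _ hx => hx.2, C, fun x hx => hb x.2 hx.2⟩

lemma bdd_D (hk : k.Regular zl zr C) : BddCont (univ ×ˢ Ioo zl zr) fun x => k.D x.2 :=
  bddCont_snd (fun z hz => (hk.has_D1 z hz).continuousAt.continuousWithinAt) hk.D_bdd

lemma bdd_D1 (hk : k.Regular zl zr C) : BddCont (univ ×ˢ Ioo zl zr) fun x => k.D1 x.2 :=
  bddCont_snd (fun z hz => (hk.has_D2 z hz).continuousAt.continuousWithinAt) hk.D1_bdd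

lemma bdd_D2 (hk : k.Regular zl zr C) : BddCont (univ ×ˢ Ioo zl zr) fun x => k.D2 x.2 :=
  bddCont_snd hk.cont_D2 hk.D2_bdd

lemma bdd_μ (hk : k.Regular zl zr C) : BddCont (univ ×ˢ Ioo zl zr) fun x => k.μ x.2 :=
  bddCont_snd (fun z hz => (hk.has_μ1 z hz).continuousAt.continuousWithinAt) hk.μ_bdd

lemma bdd_μ1 (hk : k.Regular zl zr C) : BddCont (univ ×ˢ Ioo zl zr) fun x => k.μ1 x.2 :=
  bddCont_snd hk.cont_μ1 hk.μ1_bdd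

lemma bdd_fwd (hk : k.Regular zl zr C) {h hz hzz : ℝ² → ℝ}
    (h0 : BddCont (univ ×ˢ Ioo zl zr) h) (h1 : BddCont (univ ×ˢ Ioo zl zr) hz)
    (h2 : BddCont (univ ×ˢ Ioo zl zr) hzz) :
    BddCont (univ ×ˢ Ioo zl zr) fun x => k.fwd x.2 (h x) (hz x) (hzz x) :=
  ((hk.bdd_D.mul h2).add ((((BddCont.const 2).mul hk.bdd_D1).sub hk.bdd_μ).mul h1)).add
    ((hk.bdd_D2.sub hk.bdd_μ1).mul h0)

end CoeffData.Regular

namespace StripPath.Regular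

variable {p : StripPath} {t : ℝ}

lemma bdd_val (hp : p.Regular zl zr T M) (ht : t ∈ Icc 0 T) :
    BddCont (univ ×ˢ Ioo zl zr) fun x => p.val t x.1 x.2 :=
  ⟨hp.cont_slice ht, M, fun x hx => hp.bound t ht x.1 x.2 hx.2⟩

lemma bdd_da (hp : p.Regular zl zr T M) (ht : t ∈ Icc 0 T) :
    BddCont (univ ×ˢ Ioo zl zr) fun x => p.da t x.1 x.2 :=
  ⟨hp.cont_da_slice ht, M, fun x hx => hp.bound_da t ht x.1 x.2 hx.2⟩

lemma bdd_dz (hp : p.Regular zl zr T M) (ht : t ∈ Icc 0 T) :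
    BddCont (univ ×ˢ Ioo zl zr) fun x => p.dz t x.1 x.2 :=
  ⟨hp.cont_dz t ht, M, fun x hx => hp.bound_dz t ht x.1 x.2 hx.2⟩

lemma bdd_dzz (hp : p.Regular zl zr T M) (ht : t ∈ Icc 0 T) :
    BddCont (univ ×ˢ Ioo zl zr) fun x => p.dzz t x.1 x.2 :=
  ⟨hp.cont_dzz t ht, M, fun x hx => hp.bound_dzz t ht x.1 x.2 hx.2⟩

end StripPath.Regular

/-- Integration by parts in the income variable. -/
lemma setIntegral_box_fwd {k : CoeffData} {C M' : ℝ} (hk : k.Regular zl zr C)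
    {p q : StripPath} (hp : p.Regular zl zr T M) (hq : q.Regular zl zr T M') {t R : ℝ} (ht : t ∈ Icc 0 T) :
    ∫ x in box R zl zr, (q.val t x.1 x.2 * k.fwd x.2 (p.val t x.1 x.2) (p.dz t x.1 x.2) (p.dzz t x.1 x.2)
      - p.val t x.1 x.2 * (k.D x.2 * q.dzz t x.1 x.2 + k.μ x.2 * q.dz t x.1 x.2)) = 0 := by
  obtain ⟨-, K1, hK1⟩ := ((hq.bdd_val ht).mul (hp.bdd_dz ht)).sub ((hp.bdd_val ht).mul (hq.bdd_dz ht))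
  obtain ⟨-, K2, hK2⟩ := (hq.bdd_val ht).mul (hp.bdd_val ht)
  have hC := hk.C_nonneg
  refine setIntegral_box_deriv_z (M := C * K1 + 2 * C * K2) hk.lt
    (Φ := fun a z => k.D z * (q.val t a z * p.dz t a z - p.val t a z * q.dz t a z)
      + (k.D1 z - k.μ z) * (q.val t a z * p.val t a z))
    (F := fun a z => q.val t a z * k.fwd z (p.val t a z) (p.dz t a z) (p.dzz t a z)
      - p.val t a z * (k.D z * q.dzz t a z + k.μ z * q.dz t a z)) ?_ ?_ ?_ ?_
  · intro a _ z hz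
    have hp0 := hp.has_dz t ht a z hz
    have hp1 := hp.has_dzz t ht a z hz
    have hq0 := hq.has_dz t ht a z hz
    have hq1 := hq.has_dzz t ht a z hz
    have := ((hk.has_D1 z hz).fun_mul ((hq0.fun_mul hp1).fun_sub (hp0.fun_mul hq1))).fun_add
      (((hk.has_D2 z hz).fun_sub (hk.has_μ1 z hz)).fun_mul (hq0.fun_mul hp0))
    refine this.congr_deriv ?_
    simp only [CoeffData.fwd]; ring
  · exact (((hq.bdd_val ht).mul (hk.bdd_fwd (hp.bdd_val ht) (hp.bdd_dz ht) (hp.bdd_dzz ht))).sub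
      ((hp.bdd_val ht).mul ((hk.bdd_D.mul (hq.bdd_dzz ht)).add (hk.bdd_μ.mul (hq.bdd_dz ht))))).mono
      box_subset_strip
  · intro a _ z hz
    have e1 := hK1 (a, z) ⟨mem_univ _, hz⟩
    have e2 := hK2 (a, z) ⟨mem_univ _, hz⟩
    have hd : 0 ≤ z - zl := by linarith [hz.1]
    have e3 : |k.D1 z - k.μ z| ≤ 2 * C * (z - zl) :=
      (abs_sub _ _).trans (by linarith [hk.D1_left z hz, hk.degenerate.drift_left z hz])
    refine (abs_add_le _ _).trans ?_
    rw [abs_mul, abs_mul]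
    have f1 := mul_le_mul (hk.D_left z hz) e1 (abs_nonneg _) (by positivity)
    have f2 := mul_le_mul e3 e2 (abs_nonneg _) (by positivity)
    simp only at f1 f2
    linarith
  · intro a _ z hz
    have e1 := hK1 (a, z) ⟨mem_univ _, hz⟩
    have e2 := hK2 (a, z) ⟨mem_univ _, hz⟩
    have hd : 0 ≤ zr - z := by linarith [hz.2]
    have e3 : |k.D1 z - k.μ z| ≤ 2 * C * (zr - z) :=
      (abs_sub _ _).trans (by linarith [hk.D1_right z hz, hk.degenerate.drift_right z hz])
    refine (abs_add_le _ _).trans ?_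
    rw [abs_mul, abs_mul]
    have f1 := mul_le_mul (hk.D_right z hz) e1 (abs_nonneg _) (by positivity)
    have f2 := mul_le_mul e3 e2 (abs_nonneg _) (by positivity)
    simp only at f1 f2
    linarith

/-- Integration by parts in the wealth variable. -/
lemma setIntegral_box_transport {M' : ℝ}
    {p q : StripPath} (hp : p.Regular zl zr T M) (hq : q.Regular zl zr T M') {t R : ℝ}
    (ht : t ∈ Icc 0 T) (hR : 0 ≤ R) (hs : ∀ a, ∀ z ∈ Ioo zl zr, R ≤ |a| → p.val t a z = 0)
    {b ba : ℝ → ℝ → ℝ} (hb : ∀ a, ∀ z ∈ Ioo zl zr, HasDerivAt (fun a => b a z) (ba a z) a)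
    (hbc : ContinuousOn (fun x : ℝ² => b x.1 x.2) (univ ×ˢ Ioo zl zr))
    (hbac : ContinuousOn (fun x : ℝ² => ba x.1 x.2) (univ ×ˢ Ioo zl zr))
    (hbb : ∃ K, ∀ x ∈ box R zl zr, |b x.1 x.2| ≤ K) (hbab : ∃ K, ∀ x ∈ box R zl zr, |ba x.1 x.2| ≤ K) :
    ∫ x in box R zl zr, (q.val t x.1 x.2 * (ba x.1 x.2 * p.val t x.1 x.2 + b x.1 x.2 * p.da t x.1 x.2)
      + p.val t x.1 x.2 * (b x.1 x.2 * q.da t x.1 x.2)) = 0 := by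
  have hbB : BddCont (box R zl zr) fun x => b x.1 x.2 := ⟨hbc.mono box_subset_strip, hbb⟩
  have hbaB : BddCont (box R zl zr) fun x => ba x.1 x.2 := ⟨hbac.mono box_subset_strip, hbab⟩
  have hbdd := (((hq.bdd_val ht).mono box_subset_strip).mul
    ((hbaB.mul ((hp.bdd_val ht).mono box_subset_strip)).add
      (hbB.mul ((hp.bdd_da ht).mono box_subset_strip)))).add
    (((hp.bdd_val ht).mono box_subset_strip).mul (hbB.mul ((hq.bdd_da ht).mono box_subset_strip)))
  refine setIntegral_box_deriv_a hR (Ψ := fun a z => q.val t a z * (b a z * p.val t a z))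
    (F := fun a z => q.val t a z * (ba a z * p.val t a z + b a z * p.da t a z)
      + p.val t a z * (b a z * q.da t a z)) ?_ ?_ hbdd.2 ?_ ?_
  · intro a z hz
    have := (hq.has_da t ht a z hz).fun_mul ((hb a z hz).fun_mul (hp.has_da t ht a z hz))
    exact this.congr_deriv (by ring)
  · exact ((hq.cont_slice ht).mul ((hbac.mul (hp.cont_slice ht)).add
      (hbc.mul (hp.cont_da_slice ht)))).add ((hp.cont_slice ht).mul (hbc.mul (hq.cont_da_slice ht)))
  · intro z hz; rw [hs (-R) z hz (by rw [abs_neg]; exact le_abs_self R)]; simp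
  · intro z hz; rw [hs R z hz (le_abs_self R)]; simp

/-- The weak form of the forward equation at one time. -/
lemma setIntegral_box_weak {k : CoeffData} {C M' : ℝ} (hk : k.Regular zl zr C)
    {p q : StripPath} (hp : p.Regular zl zr T M) (hq : q.Regular zl zr T M') {t R : ℝ}
    (ht : t ∈ Icc 0 T) (hR : 0 ≤ R) (hs : ∀ a, ∀ z ∈ Ioo zl zr, R ≤ |a| → p.val t a z = 0)
    {b ba : ℝ → ℝ → ℝ} (hb : ∀ a, ∀ z ∈ Ioo zl zr, HasDerivAt (fun a => b a z) (ba a z) a)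
    (hbc : ContinuousOn (fun x : ℝ² => b x.1 x.2) (univ ×ˢ Ioo zl zr))
    (hbac : ContinuousOn (fun x : ℝ² => ba x.1 x.2) (univ ×ˢ Ioo zl zr))
    (hbb : ∃ K, ∀ x ∈ box R zl zr, |b x.1 x.2| ≤ K) (hbab : ∃ K, ∀ x ∈ box R zl zr, |ba x.1 x.2| ≤ K) :
    ∫ x in box R zl zr, q.val t x.1 x.2 * (k.fwd x.2 (p.val t x.1 x.2) (p.dz t x.1 x.2) (p.dzz t x.1 x.2)
          - (ba x.1 x.2 * p.val t x.1 x.2 + b x.1 x.2 * p.da t x.1 x.2))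
      = ∫ x in box R zl zr, p.val t x.1 x.2 *
        (k.D x.2 * q.dzz t x.1 x.2 + k.μ x.2 * q.dz t x.1 x.2 + b x.1 x.2 * q.da t x.1 x.2) := by
  have hbB : BddCont (box R zl zr) fun x => b x.1 x.2 := ⟨hbc.mono box_subset_strip, hbb⟩
  have hbaB : BddCont (box R zl zr) fun x => ba x.1 x.2 := ⟨hbac.mono box_subset_strip, hbab⟩
  have P0 := (hp.bdd_val ht).mono (box_subset_strip (R := R))
  have Pa := (hp.bdd_da ht).mono (box_subset_strip (R := R))
  have Q0 := (hq.bdd_val ht).mono (box_subset_strip (R := R))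
  have Qa := (hq.bdd_da ht).mono (box_subset_strip (R := R))
  have Qz := (hq.bdd_dz ht).mono (box_subset_strip (R := R))
  have Qzz := (hq.bdd_dzz ht).mono (box_subset_strip (R := R))
  have PF := (hk.bdd_fwd (hp.bdd_val ht) (hp.bdd_dz ht) (hp.bdd_dzz ht)).mono (box_subset_strip (R := R))
  have hD := hk.bdd_D.mono (box_subset_strip (R := R))
  have hμ := hk.bdd_μ.mono (box_subset_strip (R := R))
  have h1 := setIntegral_box_fwd hk hp hq (R := R) ht
  have h2 := setIntegral_box_transport hp hq ht hR hs hb hbc hbac hbb hbab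
  rw [← sub_eq_zero, ← integral_sub, ← sub_eq_zero.2 (h1.trans h2.symm), ← integral_sub]
  · congr 1; ext x; ring
  · exact ((Q0.mul PF).sub (P0.mul ((hD.mul Qzz).add (hμ.mul Qz)))).integrableOn
  · exact ((Q0.mul ((hbaB.mul P0).add (hbB.mul Pa))).add (P0.mul (hbB.mul Qa))).integrableOn
  · exact (Q0.mul (PF.sub ((hbaB.mul P0).add (hbB.mul Pa)))).integrableOn
  · exact (P0.mul (((hD.mul Qzz).add (hμ.mul Qz)).add (hbB.mul Qa))).integrableOn

/-! ### The Hamiltonian -/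

section Hamiltonian

variable {u : ℝ → ℝ}

lemma IsUtility.contDiffOn_deriv (hu : IsUtility u) : ContDiffOn ℝ ∞ (deriv u) (Ioi 0) :=
  ((contDiffOn_infty_iff_deriv_of_isOpen isOpen_Ioi).1 hu.smooth).2

lemma IsUtility.strictAntiOn_deriv (hu : IsUtility u) : StrictAntiOn (deriv u) (Ioi 0) := by
  refine strictAntiOn_of_deriv_neg (convex_Ioi 0) hu.contDiffOn_deriv.continuousOn fun x hx => ?_
  rw [interior_Ioi] at hx
  exact hu.deriv2_neg x hx

/-- The optimal consumption is a smooth, decreasing function. -/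
lemma IsUtility.exists_consumption (hu : IsUtility u) :
    ∃ c : ℝ → ℝ, (∀ p, 0 < p → 0 < c p ∧ deriv u (c p) = p) ∧ ContDiffOn ℝ ∞ c (Ioi 0) ∧
      ∀ p, 0 < p → HasDerivAt c (deriv c p) p ∧ deriv c p < 0 := by
  have hex : ∀ p : ℝ, ∃ c, 0 < p → 0 < c ∧ deriv u c = p := fun p => by
    by_cases hp : 0 < p
    · have : p ∈ deriv u '' Ioi 0 := by rw [hu.range_deriv]; exact hp
      obtain ⟨c, hc, h⟩ := this
      exact ⟨c, fun _ => ⟨hc, h⟩⟩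
    · exact ⟨0, fun h => (hp h).elim⟩
  choose c hc using hex
  have hsm : ∀ p, 0 < p → ContDiffAt ℝ ∞ c p := by
    intro p hp
    obtain ⟨hc0, hcp⟩ := hc p hp
    have hU : ContDiffAt ℝ ∞ (deriv u) (c p) := hu.contDiffOn_deriv.contDiffAt (Ioi_mem_nhds hc0)
    have hd : HasDerivAt (deriv u) (deriv (deriv u) (c p)) (c p) :=
      (hU.differentiableAt (by simp)).hasDerivAt
    have hne : deriv (deriv u) (c p) ≠ 0 := (hu.deriv2_neg _ hc0).ne
    have hf := hd.hasFDerivAt_equiv hne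
    have hloc := hU.to_localInverse hf (by simp)
    rw [hcp] at hloc
    refine hloc.congr_of_eventuallyEq ?_
    have hstrict := hU.hasStrictFDerivAt' hf (by simp)
    have h1 : ∀ᶠ y in 𝓝 p, deriv u (hU.localInverse hf (by simp) y) = y := by
      have := hstrict.eventually_right_inverse
      rw [hcp] at this; exact this
    have h2 : ∀ᶠ y in 𝓝 p, 0 < hU.localInverse hf (by simp) y := by
      have hcont := hloc.continuousAt
      have himg : hU.localInverse hf (by simp) p = c p := by
        have := hU.localInverse_apply_image hf (by simp)
        rw [hcp] at this; exact this
      exact hcont.eventually (by rw [himg]; exact Ioi_mem_nhds hc0)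
    filter_upwards [h1, h2, Ioi_mem_nhds hp] with y hy1 hy2 hy3
    obtain ⟨a1, a2⟩ := hc y hy3
    exact hu.strictAntiOn_deriv.injOn a1 hy2 (a2.trans hy1.symm)
  refine ⟨c, hc, fun p hp => (hsm p hp).contDiffWithinAt, fun p hp => ?_⟩
  have hd : HasDerivAt c (deriv c p) p := ((hsm p hp).differentiableAt (by simp)).hasDerivAt
  refine ⟨hd, ?_⟩
  obtain ⟨hc0, hcp⟩ := hc p hp
  have hU : HasDerivAt (deriv u) (deriv (deriv u) (c p)) (c p) :=
    ((hu.contDiffOn_deriv.contDiffAt (Ioi_mem_nhds hc0)).differentiableAt (by simp)).hasDerivAt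
  have hcomp := hU.comp p hd
  have hid : HasDerivAt (deriv u ∘ c) 1 p := by
    refine (hasDerivAt_id p).congr_of_eventuallyEq ?_
    filter_upwards [Ioi_mem_nhds hp] with y hy using (hc y hy).2
  have heq := hcomp.unique hid
  by_contra! hge
  have := mul_nonpos_of_nonpos_of_nonneg (hu.deriv2_neg _ hc0).le hge
  linarith

lemma IsUtility.hamiltonian_eq (hu : IsUtility u) {p c : ℝ} (hc : 0 < c) (hcp : deriv u c = p) :
    hamiltonian u p = -c * p + u c := by
  have hdiff : ∀ x, 0 < x → DifferentiableAt ℝ u x := fun x hx =>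
    (hu.smooth.contDiffAt (Ioi_mem_nhds hx)).differentiableAt (by simp)
  refine IsGreatest.csSup_eq ⟨⟨c, hc, rfl⟩, ?_⟩
  rintro _ ⟨x, hx, rfl⟩
  simp only
  have hx0 : 0 < x := hx
  rcases lt_trichotomy x c with h | h | h
  · obtain ⟨ξ, hξ, hs⟩ := exists_deriv_eq_slope u h
      (fun y hy => (hdiff y (hx0.trans_le hy.1)).continuousAt.continuousWithinAt)
      (fun y hy => (hdiff y (hx0.trans hy.1)).differentiableWithinAt)
    have hlt := hu.strictAntiOn_deriv (show ξ ∈ Ioi 0 from hx0.trans hξ.1) (show c ∈ Ioi 0 from hc) hξ.2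
    rw [hs, hcp, lt_div_iff₀ (by linarith)] at hlt
    linarith
  · rw [h]
  · obtain ⟨ξ, hξ, hs⟩ := exists_deriv_eq_slope u h
      (fun y hy => (hdiff y (hc.trans_le hy.1)).continuousAt.continuousWithinAt)
      (fun y hy => (hdiff y (hc.trans hy.1)).differentiableWithinAt)
    have hlt := hu.strictAntiOn_deriv (show c ∈ Ioi 0 from hc) (show ξ ∈ Ioi 0 from hc.trans hξ.1) hξ.1
    rw [hs, hcp, div_lt_iff₀ (by linarith)] at hlt
    linarith

lemma IsUtility.Hp_props (hu : IsUtility u) : ContDiffOn ℝ ∞ (Hp u) (Ioi 0) ∧ ∀ p, 0 < p → 0 < Hpp u p := by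
  obtain ⟨c, hc, hsm, hd⟩ := hu.exists_consumption
  have hH : ∀ p, 0 < p → HasDerivAt (hamiltonian u) (-c p) p := by
    intro p hp
    have h1 : HasDerivAt (fun p => -c p * p + u (c p)) (-c p) p := by
      have hu' : HasDerivAt u (deriv u (c p)) (c p) :=
        ((hu.smooth.contDiffAt (Ioi_mem_nhds (hc p hp).1)).differentiableAt (by simp)).hasDerivAt
      have := ((hd p hp).1.fun_neg.fun_mul (hasDerivAt_id' p)).fun_add (hu'.comp p (hd p hp).1)
      refine this.congr_deriv ?_
      rw [(hc p hp).2]; ring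
    refine h1.congr_of_eventuallyEq ?_
    filter_upwards [Ioi_mem_nhds hp] with y hy using hu.hamiltonian_eq (hc y hy).1 (hc y hy).2
  have hHp : ∀ p ∈ Ioi (0 : ℝ), Hp u p = -c p := fun p hp => (hH p hp).deriv
  refine ⟨hsm.neg.congr hHp, fun p hp => ?_⟩
  have : HasDerivAt (Hp u) (-deriv c p) p := by
    refine (hd p hp).1.neg.congr_of_eventuallyEq ?_
    filter_upwards [Ioi_mem_nhds hp] with y hy using hHp y hy
  rw [Hpp, this.deriv]
  linarith [(hd p hp).2]

end Hamiltonian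

end

section

/-! ### Mollification of weak derivatives -/

section Mollification

open scoped Convolution

/-- The convolution of `w`, restricted to `Ω`, with the kernel `k`. -/
def moll (k : ℝ² → ℝ) (Ω : Set ℝ²) (w : ℝ² → ℝ) (x : ℝ²) : ℝ :=
  ∫ t in Ω, w t * k (x - t)

variable {k w h : ℝ² → ℝ} {Ω : Set ℝ²}

lemma moll_eq_convolution (hΩ : MeasurableSet Ω) :
    moll k Ω w = (Ω.indicator w ⋆[ContinuousLinearMap.mul ℝ ℝ, volume] k) := by
  ext x
  rw [moll, convolution_def, ← integral_indicator hΩ]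
  congr 1
  ext t
  by_cases ht : t ∈ Ω <;> simp [ht]

lemma locallyIntegrable_indicator (hΩ : MeasurableSet Ω) (hw : IntegrableOn w Ω) :
    LocallyIntegrable (Ω.indicator w) := ((integrable_indicator_iff hΩ).2 hw).locallyIntegrable

lemma contDiff_moll (hΩ : MeasurableSet Ω) (hw : IntegrableOn w Ω) (hk : ContDiff ℝ ∞ k)
    (hkc : HasCompactSupport k) : ContDiff ℝ ∞ (moll k Ω w) := by
  rw [moll_eq_convolution hΩ]
  exact hkc.contDiff_convolution_right _ (locallyIntegrable_indicator hΩ hw) hk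

lemma hasDerivAt_fst {u : ℝ² → ℝ} (hu : Differentiable ℝ u) (x : ℝ²) :
    HasDerivAt (fun a => u (a, x.2)) (fderiv ℝ u x (1, 0)) x.1 := by
  have h1 : HasDerivAt (fun a : ℝ => ((a, x.2) : ℝ²)) (1, 0) x.1 :=
    (hasDerivAt_id' x.1).prodMk (hasDerivAt_const x.1 x.2)
  exact (hu x).hasFDerivAt.comp_hasDerivAt_of_eq x.1 h1 rfl

lemma hasDerivAt_snd {u : ℝ² → ℝ} (hu : Differentiable ℝ u) (x : ℝ²) :
    HasDerivAt (fun z => u (x.1, z)) (fderiv ℝ u x (0, 1)) x.2 := by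
  have h1 : HasDerivAt (fun z : ℝ => ((x.1, z) : ℝ²)) (0, 1) x.2 :=
    (hasDerivAt_const x.2 x.1).prodMk (hasDerivAt_id' x.2)
  exact (hu x).hasFDerivAt.comp_hasDerivAt_of_eq x.2 h1 rfl

lemma dA_eq_fderiv {u : ℝ² → ℝ} (hu : Differentiable ℝ u) : dA u = fun x => fderiv ℝ u x (1, 0) :=
  funext fun x => (hasDerivAt_fst hu x).deriv

lemma dZ_eq_fderiv {u : ℝ² → ℝ} (hu : Differentiable ℝ u) : dZ u = fun x => fderiv ℝ u x (0, 1) :=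
  funext fun x => (hasDerivAt_snd hu x).deriv

/-- Test functions on the plane. -/
def IsTest (k : ℝ² → ℝ) : Prop := ContDiff ℝ ∞ k ∧ HasCompactSupport k

lemma IsTest.differentiable (hk : IsTest k) : Differentiable ℝ k := hk.1.differentiable (by simp)

lemma IsTest.fderiv_apply (hk : IsTest k) (v : ℝ²) : IsTest fun x => fderiv ℝ k x v :=
  ⟨(hk.1.fderiv_right (m := ∞) (by simp)).clm_apply contDiff_const, hk.2.fderiv_apply (𝕜 := ℝ) v⟩

lemma IsTest.dA (hk : IsTest k) : IsTest (dA k) := by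
  rw [dA_eq_fderiv hk.differentiable]; exact hk.fderiv_apply _

lemma IsTest.dZ (hk : IsTest k) : IsTest (dZ k) := by
  rw [dZ_eq_fderiv hk.differentiable]; exact hk.fderiv_apply _

lemma IsTest.dA_iterate (hk : IsTest k) (i : ℕ) : IsTest (WealthMFG.dA^[i] k) := by
  induction i with
  | zero => exact hk
  | succ i ih => rw [Function.iterate_succ_apply']; exact ih.dA

lemma IsTest.dZ_iterate (hk : IsTest k) (i : ℕ) : IsTest (WealthMFG.dZ^[i] k) := by
  induction i with
  | zero => exact hk
  | succ i ih => rw [Function.iterate_succ_apply']; exact ih.dZ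

lemma IsTest.dA_dZ (hk : IsTest k) : WealthMFG.dA (WealthMFG.dZ k) = WealthMFG.dZ (WealthMFG.dA k) := by
  rw [dA_eq_fderiv hk.dZ.differentiable, dZ_eq_fderiv hk.dA.differentiable,
    dA_eq_fderiv hk.differentiable, dZ_eq_fderiv hk.differentiable]
  ext x
  have hd : DifferentiableAt ℝ (fderiv ℝ k) x :=
    (hk.1.fderiv_right (m := 1) (by norm_cast)).differentiable (by simp) x
  have hsymm : IsSymmSndFDerivAt ℝ k x :=
    (contDiff_infty.1 hk.1 2).contDiffAt.isSymmSndFDerivAt (by simp)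
  rw [fderiv_clm_apply hd (differentiableAt_const _), fderiv_clm_apply hd (differentiableAt_const _)]
  simpa using hsymm.eq (1, 0) (0, 1)

lemma IsTest.dA_iterate_dZ (hk : IsTest k) (i : ℕ) :
    WealthMFG.dA^[i] (WealthMFG.dZ k) = WealthMFG.dZ (WealthMFG.dA^[i] k) := by
  induction i with
  | zero => rfl
  | succ i ih =>
    rw [Function.iterate_succ_apply', ih, Function.iterate_succ_apply', (hk.dA_iterate i).dA_dZ]

lemma hasDerivAt_moll_fst (hΩ : MeasurableSet Ω) (hw : IntegrableOn w Ω) (hk : IsTest k) (x : ℝ²) :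
    HasDerivAt (fun a => moll k Ω w (a, x.2)) (moll (dA k) Ω w x) x.1 := by
  have hsm := contDiff_moll hΩ hw hk.1 hk.2
  convert hasDerivAt_fst (hsm.differentiable (by simp)) x using 1
  rw [dA_eq_fderiv hk.differentiable, moll_eq_convolution hΩ, moll_eq_convolution hΩ]
  have hloc := locallyIntegrable_indicator hΩ hw
  rw [(hk.2.hasFDerivAt_convolution_right (ContinuousLinearMap.mul ℝ ℝ) hloc
    (hk.1.of_le (by simp)) x).fderiv, convolution_precompR_apply _ hloc (hk.2.fderiv (𝕜 := ℝ))
      (hk.1.continuous_fderiv (by simp))]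

lemma hasDerivAt_moll_snd (hΩ : MeasurableSet Ω) (hw : IntegrableOn w Ω) (hk : IsTest k) (x : ℝ²) :
    HasDerivAt (fun z => moll k Ω w (x.1, z)) (moll (dZ k) Ω w x) x.2 := by
  have hsm := contDiff_moll hΩ hw hk.1 hk.2
  convert hasDerivAt_snd (hsm.differentiable (by simp)) x using 1
  rw [dZ_eq_fderiv hk.differentiable, moll_eq_convolution hΩ, moll_eq_convolution hΩ]
  have hloc := locallyIntegrable_indicator hΩ hw
  rw [(hk.2.hasFDerivAt_convolution_right (ContinuousLinearMap.mul ℝ ℝ) hloc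
    (hk.1.of_le (by simp)) x).fderiv, convolution_precompR_apply _ hloc (hk.2.fderiv (𝕜 := ℝ))
      (hk.1.continuous_fderiv (by simp))]

lemma dA_reflect (hk : IsTest k) (x : ℝ²) : dA (fun t => k (x - t)) = fun t => -dA k (x - t) := by
  ext t
  have h1 : HasDerivAt (fun a => k (a, x.2 - t.2)) (dA k (x - t)) (x.1 - t.1) := by
    have := hasDerivAt_fst hk.differentiable (x - t)
    rw [dA_eq_fderiv hk.differentiable]; exact this
  have h2 := h1.scomp t.1 ((hasDerivAt_id' t.1).const_sub x.1)
  have h3 : (fun a => k (x - (a, t.2))) = (fun a => k (a, x.2 - t.2)) ∘ fun a => x.1 - a := rfl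
  rw [dA, h3, h2.deriv]; simp

lemma dZ_reflect (hk : IsTest k) (x : ℝ²) : dZ (fun t => k (x - t)) = fun t => -dZ k (x - t) := by
  ext t
  have h1 : HasDerivAt (fun z => k (x.1 - t.1, z)) (dZ k (x - t)) (x.2 - t.2) := by
    have := hasDerivAt_snd hk.differentiable (x - t)
    rw [dZ_eq_fderiv hk.differentiable]; exact this
  have h2 := h1.scomp t.2 ((hasDerivAt_id' t.2).const_sub x.2)
  have h3 : (fun a => k (x - (t.1, a))) = (fun z => k (x.1 - t.1, z)) ∘ fun a => x.2 - a := rfl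
  rw [dZ, h3, h2.deriv]; simp

lemma dA_const_mul (c : ℝ) (u : ℝ² → ℝ) : dA (fun t => c * u t) = fun t => c * dA u t :=
  funext fun t => deriv_const_mul_field (v := fun a => u (a, t.2)) c

lemma dZ_const_mul (c : ℝ) (u : ℝ² → ℝ) : dZ (fun t => c * u t) = fun t => c * dZ u t :=
  funext fun t => deriv_const_mul_field (v := fun z => u (t.1, z)) c

lemma iterate_reflect (hk : IsTest k) (x : ℝ²) (i j : ℕ) :
    dA^[i] (dZ^[j] fun t => k (x - t)) = fun t => (-1) ^ (i + j) * (dA^[i] (dZ^[j] k)) (x - t) := by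
  have hZ : dZ^[j] (fun t => k (x - t)) = fun t => (-1) ^ j * (dZ^[j] k) (x - t) := by
    induction j with
    | zero => simp
    | succ j ih =>
      rw [Function.iterate_succ_apply', ih, dZ_const_mul, dZ_reflect (hk.dZ_iterate j),
        Function.iterate_succ_apply']
      ext t; ring
  rw [hZ]
  induction i with
  | zero => simp
  | succ i ih =>
    rw [Function.iterate_succ_apply', ih, dA_const_mul, dA_reflect ((hk.dZ_iterate j).dA_iterate i),
      Function.iterate_succ_apply']
    ext t; ring

/-- Mollification turns weak derivatives into derivatives of the kernel. -/
lemma moll_weakDeriv {i j : ℕ} (hw : IsWeakDeriv Ω i j h w) (hk : IsTest k) {x : ℝ²}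
    (hsupp : tsupport (fun t => k (x - t)) ⊆ Ω) : moll (dA^[i] (dZ^[j] k)) Ω h x = moll k Ω w x := by
  have htest : IsTest fun t => k (x - t) := by
    refine ⟨hk.1.comp (contDiff_const.sub contDiff_id), ?_⟩
    exact hk.2.comp_homeomorph (Homeomorph.subLeft x)
  have h1 := hw.2 _ htest.1 htest.2 hsupp
  rw [iterate_reflect hk] at h1
  have h2 : ∫ t in Ω, h t * ((-1) ^ (i + j) * (dA^[i] (dZ^[j] k)) (x - t))
      = (-1) ^ (i + j) * moll (dA^[i] (dZ^[j] k)) Ω h x := by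
    rw [moll, ← integral_const_mul]; congr 1; ext t; ring
  rw [h2] at h1
  exact mul_left_cancel₀ (pow_ne_zero _ (by norm_num)) h1

/-! ### A sequence of kernels -/

/-- The `n`-th kernel of a standard mollifying sequence. -/
def bump (n : ℕ) : ContDiffBump (0 : ℝ²) where
  rIn := 1 / (n + 1) / 2
  rOut := 1 / (n + 1)
  rIn_pos := by positivity
  rIn_lt_rOut := by
    have : (0 : ℝ) < 1 / (n + 1) := by positivity
    linarith

/-- The normed `n`-th kernel. -/
def ker (n : ℕ) : ℝ² → ℝ := (bump n).normed volume

lemma ker_test (n : ℕ) : IsTest (ker n) :=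
  ⟨(bump n).contDiff_normed, (bump n).hasCompactSupport_normed⟩

lemma ker_nonneg (n : ℕ) (x : ℝ²) : 0 ≤ ker n x := (bump n).nonneg_normed x

lemma ker_neg (n : ℕ) (x : ℝ²) : ker n (-x) = ker n x := (bump n).normed_neg x

lemma ker_symm (n : ℕ) (x t : ℝ²) : ker n (x - t) = ker n (t - x) := by
  rw [← ker_neg, neg_sub]

lemma bump_tendsto : Tendsto (fun n => (bump n).rOut) atTop (𝓝 0) :=
  tendsto_one_div_add_atTop_nhds_zero_nat

lemma integral_ker (n : ℕ) (x : ℝ²) : ∫ t, ker n (x - t) = 1 := by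
  rw [integral_sub_left_eq_self (ker n) volume x]; exact (bump n).integral_normed

lemma tsupport_ker_reflect (n : ℕ) (x : ℝ²) :
    tsupport (fun t => ker n (x - t)) ⊆ Metric.closedBall x (bump n).rOut := by
  refine closure_minimal (fun t ht => ?_) Metric.isClosed_closedBall
  have : x - t ∈ Function.support (ker n) := ht
  rw [ker, (bump n).support_normed_eq, Metric.mem_ball, dist_zero_right] at this
  rw [Metric.mem_closedBall, dist_comm, dist_eq_norm]
  exact this.le

lemma moll_ker_eq (n : ℕ) (hΩ : MeasurableSet Ω) (x : ℝ²) : moll (ker n) Ω w x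
      = ((bump n).normed volume ⋆[ContinuousLinearMap.lsmul ℝ ℝ, volume] Ω.indicator w) x := by
  rw [moll, convolution_eq_swap, ← integral_indicator hΩ]
  congr 1
  ext t
  by_cases ht : t ∈ Ω <;> simp [ht, ker, mul_comm]

lemma moll_ker_tendsto_of_continuousOn (hΩ : IsOpen Ω) (hint : IntegrableOn w Ω)
    (hw : ContinuousOn w Ω) {x : ℝ²} (hx : x ∈ Ω) :
    Tendsto (fun n => moll (ker n) Ω w x) atTop (𝓝 (w x)) := by
  simp only [moll_ker_eq _ hΩ.measurableSet]
  refine ContDiffBump.convolution_tendsto_right (k := fun _ => x) (g := fun _ => Ω.indicator w)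
    bump_tendsto (Eventually.of_forall fun _ =>
      ((integrable_indicator_iff hΩ.measurableSet).2 hint).aestronglyMeasurable) ?_ tendsto_const_nhds
  have h1 : Tendsto (Ω.indicator w) (𝓝 x) (𝓝 (w x)) := by
    refine (hw.continuousAt (hΩ.mem_nhds hx)).tendsto.congr' ?_
    filter_upwards [hΩ.mem_nhds hx] with y hy
    rw [indicator_of_mem hy]
  exact h1.comp tendsto_snd

lemma moll_ker_abs_le {K : ℝ} (n : ℕ) (hb : ∀ t, |w t| ≤ K) (x : ℝ²) : |moll (ker n) Ω w x| ≤ K := by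
  have hint : Integrable (fun t => ker n (x - t)) :=
    (ContDiffBump.integrable_normed (bump n)).comp_sub_left x
  have hK : 0 ≤ K := (abs_nonneg _).trans (hb 0)
  refine (norm_integral_le_of_norm_le (f := fun t => w t * ker n (x - t))
    (g := fun t => K * ker n (x - t)) (hint.const_mul K).integrableOn (Eventually.of_forall fun t => ?_)).trans ?_
  · rw [norm_mul, Real.norm_eq_abs, Real.norm_eq_abs, abs_of_nonneg (ker_nonneg n _)]
    exact mul_le_mul_of_nonneg_right (hb t) (ker_nonneg n _)
  · rw [integral_const_mul]
    refine mul_le_of_le_one_right hK ?_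
    rw [← integral_ker n x]
    exact setIntegral_le_integral hint (Eventually.of_forall fun t => ker_nonneg n _)

/-- Mollification is symmetric. -/
lemma integral_mul_moll {F : ℝ² → ℝ} {Q : Set ℝ²} (n : ℕ) (hw : IntegrableOn w Ω) (hF : IntegrableOn F Q) :
    ∫ x in Q, F x * moll (ker n) Ω w x = ∫ t in Ω, w t * moll (ker n) Q F t := by
  simp only [moll, ← integral_const_mul]
  rw [integral_integral_swap]
  · congr 1; ext t; congr 1; ext x; rw [ker_symm n x t]; ring
  · obtain ⟨B, hB⟩ := (ker_test n).2.exists_bound_of_continuous (ker_test n).1.continuous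
    have h1 : Integrable (fun p : ℝ² × ℝ² => F p.1 * w p.2)
      ((volume.restrict Q).prod (volume.restrict Ω)) := hF.mul_prod hw
    have h2 : Integrable (fun p : ℝ² × ℝ² => ker n (p.1 - p.2) * (F p.1 * w p.2))
        ((volume.restrict Q).prod (volume.restrict Ω)) :=
      h1.bdd_mul (c := B)
        ((ker_test n).1.continuous.comp (continuous_fst.sub continuous_snd)).aestronglyMeasurable
        (Eventually.of_forall fun p => hB _)
    refine h2.congr (Eventually.of_forall fun p => ?_)
    simp only [Function.uncurry]; ring

lemma integral_mul_moll_tendsto {F : ℝ² → ℝ} {Q : Set ℝ²} (hΩ : MeasurableSet Ω)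
    (hQ : MeasurableSet Q) (hQΩ : Q ⊆ Ω)
    (hw : IntegrableOn w Ω) {K : ℝ} (hF : IntegrableOn F Q) (hK : ∀ x, |F x| ≤ K) :
    Tendsto (fun n => ∫ x in Q, F x * moll (ker n) Ω w x) atTop (𝓝 (∫ x in Q, F x * w x)) := by
  have hlim : ∫ x in Q, F x * w x = ∫ t in Ω, w t * Q.indicator F t := by
    rw [← integral_indicator hQ, ← integral_indicator hΩ]
    congr 1; ext t
    by_cases ht : t ∈ Q
    · simp [ht, hQΩ ht, mul_comm]
    · by_cases ht' : t ∈ Ω <;> simp [ht, ht']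
  simp only [integral_mul_moll _ hw hF, hlim]
  have hFi : LocallyIntegrable (Q.indicator F) := locallyIntegrable_indicator hQ hF
  have hae := ContDiffBump.ae_convolution_tendsto_right_of_locallyIntegrable (K := 2)
    (φ := bump) (l := atTop) bump_tendsto (Eventually.of_forall fun n => by simp only [bump]; linarith) hFi
  refine tendsto_integral_of_dominated_convergence (fun t => |w t| * K) (fun n => ?_)
    (hw.abs.mul_const K) (fun n => Eventually.of_forall fun t => ?_) ?_
  · exact hw.aestronglyMeasurable.mul
      (contDiff_moll hQ hF (ker_test n).1 (ker_test n).2).continuous.aestronglyMeasurable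
  · rw [norm_mul, Real.norm_eq_abs, Real.norm_eq_abs]
    exact mul_le_mul_of_nonneg_left (moll_ker_abs_le n hK t) (abs_nonneg _)
  · filter_upwards [ae_restrict_of_ae hae] with t ht
    simp only [← moll_ker_eq _ hQ] at ht
    exact ht.const_mul (w t)

lemma integral_abs_moll_le {Q : Set ℝ²} (n : ℕ) (hΩ : MeasurableSet Ω) (hQ : MeasurableSet Q)
    (hQf : volume Q ≠ ⊤) (hw : IntegrableOn w Ω) : ∫ x in Q, |moll (ker n) Ω w x| ≤ ∫ t in Ω, |w t| := by
  have h1 : ∀ x, |moll (ker n) Ω w x| ≤ moll (ker n) Ω (fun t => |w t|) x := fun x => by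
    refine (abs_integral_le_integral_abs).trans (le_of_eq ?_)
    rw [moll]; congr 1; ext t; rw [abs_mul, abs_of_nonneg (ker_nonneg n _)]
  obtain ⟨B, hB⟩ := (ker_test n).2.exists_bound_of_continuous (ker_test n).1.continuous
  have hcm := (contDiff_moll hΩ hw (ker_test n).1 (ker_test n).2).continuous
  have hcm' := (contDiff_moll hΩ hw.abs (ker_test n).1 (ker_test n).2).continuous
  have hbd : ∀ x, |moll (ker n) Ω (fun t => |w t|) x| ≤ ∫ t in Ω, |w t| * B := fun x => by
    refine norm_integral_le_of_norm_le (f := fun t => |w t| * ker n (x - t)) (hw.abs.mul_const B) (Eventually.of_forall fun t => ?_)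
    rw [norm_mul]
    exact mul_le_mul (by simp) (hB _) (norm_nonneg _) (abs_nonneg _)
  have hi2 : IntegrableOn (moll (ker n) Ω (fun t => |w t|)) Q :=
    (integrableOn_const (C := ∫ t in Ω, |w t| * B) hQf).mono' hcm'.aestronglyMeasurable
      (Eventually.of_forall hbd)
  have hi1 : IntegrableOn (fun x => |moll (ker n) Ω w x|) Q :=
    hi2.mono' hcm.abs.aestronglyMeasurable (Eventually.of_forall fun x => by simpa using h1 x)
  refine (integral_mono hi1 hi2 h1).trans ?_
  have h2 := integral_mul_moll (F := fun _ => 1) (Q := Q) n hw.abs (integrableOn_const hQf)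
  simp only [one_mul] at h2
  rw [h2]
  refine integral_mono ?_ hw.abs fun t => ?_
  · refine hw.abs.mono' (hw.abs.aestronglyMeasurable.mul
      (contDiff_moll hQ (integrableOn_const hQf) (ker_test n).1 (ker_test n).2).continuous.aestronglyMeasurable) (Eventually.of_forall fun t => ?_)
    rw [norm_mul]
    refine mul_le_of_le_one_right (abs_nonneg _) ?_ |>.trans (by simp)
    exact moll_ker_abs_le n (by simp) t
  · exact mul_le_of_le_one_right (abs_nonneg _) ((le_abs_self _).trans (moll_ker_abs_le n (by simp) t))

end Mollification

end

section

/-! ### An integral representation on rectangles -/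

/-- The Peano kernel on `[p,q]`. -/
def kap (p q a s : ℝ) : ℝ := if s < a then (s - p) / (q - p) else (s - q) / (q - p)

lemma kap_abs_le {p q a s : ℝ} (hs : s ∈ Ioc p q) : |kap p q a s| ≤ 1 := by
  have h0 : 0 < q - p := by linarith [hs.1, hs.2]
  unfold kap
  split_ifs
  · rw [abs_div, abs_of_pos h0, div_le_one h0, abs_of_nonneg (by linarith [hs.1])]; linarith [hs.2]
  · rw [abs_div, abs_of_pos h0, div_le_one h0, abs_of_nonpos (by linarith [hs.2])]; linarith [hs.1]

lemma measurable_kap (p q a : ℝ) : Measurable (kap p q a) :=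
  Measurable.ite measurableSet_Iio (by fun_prop) (by fun_prop)

lemma continuousAt_kap {p q a s : ℝ} (h : s ≠ a) : ContinuousAt (fun a => kap p q a s) a := by
  rcases lt_or_gt_of_ne h with h | h
  · refine (continuousAt_const (y := (s - p) / (q - p))).congr ?_
    filter_upwards [Ioi_mem_nhds h] with b hb
    exact (if_pos hb).symm
  · refine (continuousAt_const (y := (s - q) / (q - p))).congr ?_
    filter_upwards [Iio_mem_nhds h] with b hb
    exact (if_neg (not_lt.2 (le_of_lt hb))).symm

lemma kap_representation {p q a : ℝ} (hpq : p < q) (ha : a ∈ Icc p q) {f f' : ℝ → ℝ}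
    (hf : ∀ s, HasDerivAt f (f' s) s) (hf' : Continuous f') :
    f a = ∫ s in p..q, (f s / (q - p) + kap p q a s * f' s) := by
  have hc : Continuous f := continuous_iff_continuousAt.2 fun s => (hf s).continuousAt
  have hL : q - p ≠ 0 := by linarith
  have hi1 : ∀ x y, IntervalIntegrable (fun s => (f s + (s - p) * f' s) / (q - p)) volume x y :=
    fun x y => Continuous.intervalIntegrable (by fun_prop) _ _
  have hi2 : ∀ x y, IntervalIntegrable (fun s => (f s + (s - q) * f' s) / (q - p)) volume x y :=
    fun x y => Continuous.intervalIntegrable (by fun_prop) _ _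
  have e1 : ∀ᵐ s ∂volume, s ∈ uIoc p a → f s / (q - p) + kap p q a s * f' s
      = (f s + (s - p) * f' s) / (q - p) := by
    filter_upwards [compl_mem_ae_iff.2 (measure_singleton (μ := (volume : Measure ℝ)) a)] with s hs hsI
    rw [uIoc_of_le ha.1] at hsI
    rw [kap, if_pos (lt_of_le_of_ne hsI.2 hs)]; ring
  have e2 : ∀ᵐ s ∂volume, s ∈ uIoc a q → f s / (q - p) + kap p q a s * f' s
      = (f s + (s - q) * f' s) / (q - p) := by
    refine Eventually.of_forall fun s hsI => ?_
    rw [uIoc_of_le ha.2] at hsI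
    rw [kap, if_neg (not_lt.2 hsI.1.le)]; ring
  have j1 : IntervalIntegrable (fun s => f s / (q - p) + kap p q a s * f' s) volume p a :=
    (hi1 p a).congr_ae ((ae_restrict_iff' measurableSet_uIoc).2 (e1.mono fun s hs h => (hs h).symm))
  have j2 : IntervalIntegrable (fun s => f s / (q - p) + kap p q a s * f' s) volume a q :=
    (hi2 a q).congr_ae ((ae_restrict_iff' measurableSet_uIoc).2 (e2.mono fun s hs h => (hs h).symm))
  rw [← intervalIntegral.integral_add_adjacent_intervals j1 j2,
    intervalIntegral.integral_congr_ae e1, intervalIntegral.integral_congr_ae e2]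
  have d1 : ∀ c s, HasDerivAt (fun s => (s - c) * f s / (q - p)) ((f s + (s - c) * f' s) / (q - p)) s :=
    fun c s => by
      have := (((hasDerivAt_id' s).sub_const c).fun_mul (hf s)).div_const (q - p)
      exact this.congr_deriv (by ring)
  rw [intervalIntegral.integral_eq_sub_of_hasDerivAt (fun s _ => d1 p s) (hi1 _ _),
    intervalIntegral.integral_eq_sub_of_hasDerivAt (fun s _ => d1 q s) (hi2 _ _)]
  field_simp
  ring

/-- The integrand of the representation formula on the rectangle `(p,q] × (r,s]`. -/
def repIntegrand (p q r s : ℝ) (v₀₀ v₁₀ v₀₁ v₁₁ : ℝ² → ℝ) (x y : ℝ²) : ℝ :=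
  1 / ((q - p) * (s - r)) * v₀₀ y + kap p q x.1 y.1 / (s - r) * v₁₀ y
    + kap r s x.2 y.2 / (q - p) * v₀₁ y + kap p q x.1 y.1 * kap r s x.2 y.2 * v₁₁ y

/-- The right hand side of the representation formula. -/
def rep (p q r s : ℝ) (v₀₀ v₁₀ v₀₁ v₁₁ : ℝ² → ℝ) (x : ℝ²) : ℝ :=
  ∫ y in Ioc p q ×ˢ Ioc r s, repIntegrand p q r s v₀₀ v₁₀ v₀₁ v₁₁ x y

lemma setIntegral_add₄ {Q : Set ℝ²} {f g h k : ℝ² → ℝ} (hf : IntegrableOn f Q)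
    (hg : IntegrableOn g Q) (hh : IntegrableOn h Q) (hk : IntegrableOn k Q) :
    ∫ y in Q, (f y + g y + h y + k y)
      = (∫ y in Q, f y) + (∫ y in Q, g y) + (∫ y in Q, h y) + ∫ y in Q, k y := by
  have h1 : IntegrableOn (fun y => f y + g y) Q := hf.add hg
  have h2 : IntegrableOn (fun y => f y + g y + h y) Q := h1.add hh
  rw [integral_add h2 hk, integral_add h1 hh, integral_add hf hg]

section Rep

variable {p q r s : ℝ} {v₀₀ v₁₀ v₀₁ v₁₁ : ℝ² → ℝ}

lemma volume_rect_ne_top : volume (Ioc p q ×ˢ Ioc r s) ≠ ⊤ := by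
  rw [Measure.volume_eq_prod, Measure.prod_prod]
  exact (ENNReal.mul_lt_top measure_Ioc_lt_top measure_Ioc_lt_top).ne

lemma measurableSet_rect : MeasurableSet (Ioc p q ×ˢ Ioc r s) :=
  measurableSet_Ioc.prod measurableSet_Ioc

/-- The constant in the bound for `rep`. -/
def repConst (p q r s : ℝ) : ℝ := (1 + 1 / (q - p)) * (1 + 1 / (s - r))

lemma repKernel_bounds (hpq : p < q) (hrs : r < s) (x : ℝ²) {y : ℝ²} (hy : y ∈ Ioc p q ×ˢ Ioc r s) :
    |1 / ((q - p) * (s - r))| ≤ repConst p q r s ∧ |kap p q x.1 y.1 / (s - r)| ≤ repConst p q r s ∧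
    |kap r s x.2 y.2 / (q - p)| ≤ repConst p q r s ∧
    |kap p q x.1 y.1 * kap r s x.2 y.2| ≤ repConst p q r s := by
  have h1 : 0 < 1 / (q - p) := by have : 0 < q - p := by linarith
                                  positivity
  have h2 : 0 < 1 / (s - r) := by have : 0 < s - r := by linarith
                                  positivity
  have k1 := kap_abs_le (a := x.1) hy.1
  have k2 := kap_abs_le (a := x.2) hy.2
  have hR : repConst p q r s = 1 + 1 / (q - p) + 1 / (s - r) + 1 / (q - p) * (1 / (s - r)) := by
    unfold repConst; ring
  have h3 := mul_pos h1 h2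
  rw [hR]
  refine ⟨?_, ?_, ?_, ?_⟩
  · rw [← one_div_mul_one_div, abs_of_pos h3]; linarith
  · rw [div_eq_mul_one_div, abs_mul, abs_of_pos h2]
    have := mul_le_of_le_one_left h2.le k1; linarith
  · rw [div_eq_mul_one_div, abs_mul, abs_of_pos h1]
    have := mul_le_of_le_one_left h1.le k2; linarith
  · rw [abs_mul]
    have := mul_le_one₀ k1 (abs_nonneg _) k2; linarith

lemma repConst_nonneg (hpq : p < q) (hrs : r < s) : 0 ≤ repConst p q r s := by
  have h1 : 0 < q - p := by linarith
  have h2 : 0 < s - r := by linarith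
  unfold repConst; positivity

lemma repIntegrand_abs_le (hpq : p < q) (hrs : r < s) (x : ℝ²) {y : ℝ²}
    (hy : y ∈ Ioc p q ×ˢ Ioc r s) : |repIntegrand p q r s v₀₀ v₁₀ v₀₁ v₁₁ x y|
      ≤ repConst p q r s * (|v₀₀ y| + |v₁₀ y| + |v₀₁ y| + |v₁₁ y|) := by
  obtain ⟨h1, h2, h3, h4⟩ := repKernel_bounds hpq hrs x hy
  have key : ∀ {A B C : ℝ}, |A| ≤ C → |A * B| ≤ C * |B| := fun h => by
    rw [abs_mul]; exact mul_le_mul_of_nonneg_right h (abs_nonneg _)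
  unfold repIntegrand
  refine (abs_add_le _ _).trans ?_
  refine (add_le_add ((abs_add_le _ _).trans (add_le_add (abs_add_le _ _) le_rfl)) le_rfl).trans ?_
  linarith [key (B := v₀₀ y) h1, key (B := v₁₀ y) h2, key (B := v₀₁ y) h3, key (B := v₁₁ y) h4]

lemma aestronglyMeasurable_repIntegrand (x : ℝ²)
    (h₀₀ : IntegrableOn v₀₀ (Ioc p q ×ˢ Ioc r s)) (h₁₀ : IntegrableOn v₁₀ (Ioc p q ×ˢ Ioc r s))
    (h₀₁ : IntegrableOn v₀₁ (Ioc p q ×ˢ Ioc r s)) (h₁₁ : IntegrableOn v₁₁ (Ioc p q ×ˢ Ioc r s)) :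
    AEStronglyMeasurable (repIntegrand p q r s v₀₀ v₁₀ v₀₁ v₁₁ x) (volume.restrict (Ioc p q ×ˢ Ioc r s)) := by
  have m1 : Measurable fun y : ℝ² => kap p q x.1 y.1 := (measurable_kap p q x.1).comp measurable_fst
  have m2 : Measurable fun y : ℝ² => kap r s x.2 y.2 := (measurable_kap r s x.2).comp measurable_snd
  exact (((h₀₀.aestronglyMeasurable.const_mul _).add
    ((m1.div_const _).aestronglyMeasurable.mul h₁₀.aestronglyMeasurable)).add
    ((m2.div_const _).aestronglyMeasurable.mul h₀₁.aestronglyMeasurable)).add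
    ((m1.mul m2).aestronglyMeasurable.mul h₁₁.aestronglyMeasurable)

lemma integrable_repIntegrand (hpq : p < q) (hrs : r < s) (x : ℝ²)
    (h₀₀ : IntegrableOn v₀₀ (Ioc p q ×ˢ Ioc r s)) (h₁₀ : IntegrableOn v₁₀ (Ioc p q ×ˢ Ioc r s))
    (h₀₁ : IntegrableOn v₀₁ (Ioc p q ×ˢ Ioc r s)) (h₁₁ : IntegrableOn v₁₁ (Ioc p q ×ˢ Ioc r s)) :
    IntegrableOn (repIntegrand p q r s v₀₀ v₁₀ v₀₁ v₁₁ x) (Ioc p q ×ˢ Ioc r s) :=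
  ((((h₀₀.abs.add h₁₀.abs).add h₀₁.abs).add h₁₁.abs).const_mul (repConst p q r s)).mono'
    (aestronglyMeasurable_repIntegrand x h₀₀ h₁₀ h₀₁ h₁₁)
    ((ae_restrict_iff' measurableSet_rect).2 (Eventually.of_forall fun _ hy =>
      repIntegrand_abs_le hpq hrs x hy))

lemma rep_abs_le (hpq : p < q) (hrs : r < s) (x : ℝ²)
    (h₀₀ : IntegrableOn v₀₀ (Ioc p q ×ˢ Ioc r s)) (h₁₀ : IntegrableOn v₁₀ (Ioc p q ×ˢ Ioc r s))
    (h₀₁ : IntegrableOn v₀₁ (Ioc p q ×ˢ Ioc r s)) (h₁₁ : IntegrableOn v₁₁ (Ioc p q ×ˢ Ioc r s)) :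
    |rep p q r s v₀₀ v₁₀ v₀₁ v₁₁ x| ≤ repConst p q r s *
      ((∫ y in Ioc p q ×ˢ Ioc r s, |v₀₀ y|) + (∫ y in Ioc p q ×ˢ Ioc r s, |v₁₀ y|)
        + (∫ y in Ioc p q ×ˢ Ioc r s, |v₀₁ y|) + ∫ y in Ioc p q ×ˢ Ioc r s, |v₁₁ y|) := by
  rw [← setIntegral_add₄ h₀₀.abs h₁₀.abs h₀₁.abs h₁₁.abs, ← integral_const_mul]
  exact norm_integral_le_of_norm_le (f := repIntegrand p q r s v₀₀ v₁₀ v₀₁ v₁₁ x)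
    (g := fun y => repConst p q r s * (|v₀₀ y| + |v₁₀ y| + |v₀₁ y| + |v₁₁ y|)) ((((h₀₀.abs.add h₁₀.abs).add h₀₁.abs).add h₁₁.abs).const_mul _)
    ((ae_restrict_iff' measurableSet_rect).2 (Eventually.of_forall fun _ hy =>
      repIntegrand_abs_le hpq hrs x hy))

lemma ae_ne_coords (x : ℝ²) : ∀ᵐ y : ℝ², y.1 ≠ x.1 ∧ y.2 ≠ x.2 := by
  have h1 : volume ({x.1} ×ˢ (univ : Set ℝ)) = 0 := by
    rw [Measure.volume_eq_prod, Measure.prod_prod, Real.volume_singleton, zero_mul]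
  have h2 : volume ((univ : Set ℝ) ×ˢ {x.2}) = 0 := by
    rw [Measure.volume_eq_prod, Measure.prod_prod, Real.volume_singleton, mul_zero]
  filter_upwards [compl_mem_ae_iff.2 h1, compl_mem_ae_iff.2 h2] with y hy1 hy2
  exact ⟨fun h => hy1 ⟨h, mem_univ _⟩, fun h => hy2 ⟨mem_univ _, h⟩⟩

lemma continuous_rep (hpq : p < q) (hrs : r < s)
    (h₀₀ : IntegrableOn v₀₀ (Ioc p q ×ˢ Ioc r s)) (h₁₀ : IntegrableOn v₁₀ (Ioc p q ×ˢ Ioc r s))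
    (h₀₁ : IntegrableOn v₀₁ (Ioc p q ×ˢ Ioc r s)) (h₁₁ : IntegrableOn v₁₁ (Ioc p q ×ˢ Ioc r s)) :
    Continuous (rep p q r s v₀₀ v₁₀ v₀₁ v₁₁) := by
  refine continuous_iff_continuousAt.2 fun x => continuousAt_of_dominated
    (bound := fun y => repConst p q r s * (|v₀₀ y| + |v₁₀ y| + |v₀₁ y| + |v₁₁ y|))
    (Eventually.of_forall fun x => aestronglyMeasurable_repIntegrand x h₀₀ h₁₀ h₀₁ h₁₁)
    (Eventually.of_forall fun x => (ae_restrict_iff' measurableSet_rect).2 (Eventually.of_forall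
      fun _ hy => repIntegrand_abs_le hpq hrs x hy))
    ((((h₀₀.abs.add h₁₀.abs).add h₀₁.abs).add h₁₁.abs).const_mul _) ?_
  filter_upwards [ae_restrict_of_ae (ae_ne_coords x)] with y hy
  have c1 : ContinuousAt (fun x : ℝ² => kap p q x.1 y.1) x :=
    ContinuousAt.comp (f := Prod.fst) (continuousAt_kap hy.1) continuousAt_fst
  have c2 : ContinuousAt (fun x : ℝ² => kap r s x.2 y.2) x :=
    ContinuousAt.comp (f := Prod.snd) (continuousAt_kap hy.2) continuousAt_snd
  unfold repIntegrand
  exact ((continuousAt_const.add ((c1.div_const _).mul continuousAt_const)).add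
    ((c2.div_const _).mul continuousAt_const)).add ((c1.mul c2).mul continuousAt_const)

lemma continuous_integrableOn_rect {v : ℝ² → ℝ} (hv : Continuous v) : IntegrableOn v (Ioc p q ×ˢ Ioc r s) :=
  (hv.continuousOn.integrableOn_compact (K := Icc p q ×ˢ Icc r s)
    (isCompact_Icc.prod isCompact_Icc)).mono_set
    (prod_mono Ioc_subset_Icc_self Ioc_subset_Icc_self)

lemma eq_rep (hpq : p < q) (hrs : r < s) {u ua uz uaz : ℝ² → ℝ}
    (hu : Continuous u) (hua : Continuous ua) (huz : Continuous uz) (huaz : Continuous uaz)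
    (da : ∀ x : ℝ², HasDerivAt (fun a => u (a, x.2)) (ua x) x.1)
    (dz : ∀ x : ℝ², HasDerivAt (fun z => u (x.1, z)) (uz x) x.2)
    (daz : ∀ x : ℝ², HasDerivAt (fun z => ua (x.1, z)) (uaz x) x.2)
    {x : ℝ²} (hx : x ∈ Icc p q ×ˢ Icc r s) : u x = rep p q r s u ua uz uaz x := by
  have hint := integrable_repIntegrand hpq hrs x (continuous_integrableOn_rect hu)
    (continuous_integrableOn_rect hua) (continuous_integrableOn_rect huz)
    (continuous_integrableOn_rect huaz)
  rw [rep, Measure.volume_eq_prod, setIntegral_prod _ hint]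
  have h1 := kap_representation hpq hx.1 (f := fun a => u (a, x.2)) (f' := fun a => ua (a, x.2))
    (fun a => da (a, x.2)) (by fun_prop)
  simp only [Prod.mk.eta] at h1
  rw [h1, intervalIntegral.integral_of_le hpq.le]
  refine setIntegral_congr_fun measurableSet_Ioc fun a _ => ?_
  have h2 := kap_representation hrs hx.2 (f := fun z => u (a, z)) (f' := fun z => uz (a, z))
    (fun z => dz (a, z)) (by fun_prop)
  have h3 := kap_representation hrs hx.2 (f := fun z => ua (a, z)) (f' := fun z => uaz (a, z))
    (fun z => daz (a, z)) (by fun_prop)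
  have hk : IntervalIntegrable (kap r s x.2) volume r s := by
    rw [intervalIntegrable_iff, uIoc_of_le hrs.le]
    have hfin : volume (Ioc r s) ≠ ⊤ := measure_Ioc_lt_top.ne
    exact (integrableOn_const (C := (1 : ℝ)) hfin).mono' (measurable_kap r s x.2).aestronglyMeasurable
      ((ae_restrict_iff' measurableSet_Ioc).2 (Eventually.of_forall fun _ hy => kap_abs_le hy))
  have i2 : IntervalIntegrable (fun z => u (a, z) / (s - r) + kap r s x.2 z * uz (a, z)) volume r s :=
    (Continuous.intervalIntegrable (by fun_prop) _ _).add
      (hk.mul_continuousOn (by fun_prop))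
  have i3 : IntervalIntegrable (fun z => ua (a, z) / (s - r) + kap r s x.2 z * uaz (a, z)) volume r s :=
    (Continuous.intervalIntegrable (by fun_prop) _ _).add
      (hk.mul_continuousOn (by fun_prop))
  rw [h2, h3, ← intervalIntegral.integral_div, ← intervalIntegral.integral_const_mul,
    ← intervalIntegral.integral_add (i2.div_const _) (i3.const_mul _),
    intervalIntegral.integral_of_le hrs.le]
  refine setIntegral_congr_fun measurableSet_Ioc fun z _ => ?_
  have e1 : q - p ≠ 0 := by linarith
  have e2 : s - r ≠ 0 := by linarith
  simp only [repIntegrand]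
  field_simp
  ring

lemma integral_mul_moll_tendsto' {w F : ℝ² → ℝ} {Ω Q : Set ℝ²} (hΩ : MeasurableSet Ω)
    (hQ : MeasurableSet Q) (hQΩ : Q ⊆ Ω) (hQf : volume Q ≠ ⊤)
    (hw : IntegrableOn w Ω) {K : ℝ} (hF : Measurable F) (hK : ∀ x ∈ Q, |F x| ≤ K) (hK0 : 0 ≤ K) :
    Tendsto (fun n => ∫ x in Q, F x * moll (ker n) Ω w x) atTop (𝓝 (∫ x in Q, F x * w x)) := by
  have hF' : IntegrableOn (Q.indicator F) Q :=
    (integrableOn_const (C := K) hQf).mono' (hF.indicator hQ).aestronglyMeasurable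
      ((ae_restrict_iff' hQ).2 (Eventually.of_forall fun x hx => by
        rw [indicator_of_mem hx]; exact hK x hx))
  have := integral_mul_moll_tendsto hΩ hQ hQΩ hw hF' (K := K) fun x => by
    by_cases hx : x ∈ Q
    · rw [indicator_of_mem hx]; exact hK x hx
    · rw [indicator_of_notMem hx]; simpa using hK0
  have e : ∀ v : ℝ² → ℝ, ∫ x in Q, Q.indicator F x * v x = ∫ x in Q, F x * v x := fun v =>
    setIntegral_congr_fun hQ fun x hx => by simp only [indicator_of_mem hx]
  simpa only [e] using this

lemma rep_moll_tendsto (hpq : p < q) (hrs : r < s) {Ω : Set ℝ²} (hΩ : MeasurableSet Ω)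
    (hsub : Ioc p q ×ˢ Ioc r s ⊆ Ω) (x : ℝ²) (h₀₀ : IntegrableOn v₀₀ Ω) (h₁₀ : IntegrableOn v₁₀ Ω)
    (h₀₁ : IntegrableOn v₀₁ Ω) (h₁₁ : IntegrableOn v₁₁ Ω) :
    Tendsto (fun n => rep p q r s (moll (ker n) Ω v₀₀) (moll (ker n) Ω v₁₀) (moll (ker n) Ω v₀₁)
      (moll (ker n) Ω v₁₁) x) atTop (𝓝 (rep p q r s v₀₀ v₁₀ v₀₁ v₁₁ x)) := by
  have m1 : Measurable fun y : ℝ² => kap p q x.1 y.1 := (measurable_kap p q x.1).comp measurable_fst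
  have m2 : Measurable fun y : ℝ² => kap r s x.2 y.2 := (measurable_kap r s x.2).comp measurable_snd
  have hb := fun y hy => repKernel_bounds hpq hrs x (y := y) hy
  have hR := repConst_nonneg hpq hrs
  have split : ∀ {u₀₀ u₁₀ u₀₁ u₁₁ : ℝ² → ℝ}, IntegrableOn u₀₀ (Ioc p q ×ˢ Ioc r s) →
      IntegrableOn u₁₀ (Ioc p q ×ˢ Ioc r s) → IntegrableOn u₀₁ (Ioc p q ×ˢ Ioc r s) →
      IntegrableOn u₁₁ (Ioc p q ×ˢ Ioc r s) → rep p q r s u₀₀ u₁₀ u₀₁ u₁₁ x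
        = (∫ y in Ioc p q ×ˢ Ioc r s, 1 / ((q - p) * (s - r)) * u₀₀ y)
        + (∫ y in Ioc p q ×ˢ Ioc r s, kap p q x.1 y.1 / (s - r) * u₁₀ y)
        + (∫ y in Ioc p q ×ˢ Ioc r s, kap r s x.2 y.2 / (q - p) * u₀₁ y)
        + ∫ y in Ioc p q ×ˢ Ioc r s, kap p q x.1 y.1 * kap r s x.2 y.2 * u₁₁ y := by
    intro u₀₀ u₁₀ u₀₁ u₁₁ g₀₀ g₁₀ g₀₁ g₁₁
    have i0 : IntegrableOn (fun y => 1 / ((q - p) * (s - r)) * u₀₀ y) (Ioc p q ×ˢ Ioc r s) :=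
      g₀₀.const_mul _
    have i1 : IntegrableOn (fun y => kap p q x.1 y.1 / (s - r) * u₁₀ y) (Ioc p q ×ˢ Ioc r s) :=
      g₁₀.bdd_mul (c := repConst p q r s) (m1.div_const _).aestronglyMeasurable
        ((ae_restrict_iff' measurableSet_rect).2 (Eventually.of_forall fun y hy => (hb y hy).2.1))
    have i2 : IntegrableOn (fun y => kap r s x.2 y.2 / (q - p) * u₀₁ y) (Ioc p q ×ˢ Ioc r s) :=
      g₀₁.bdd_mul (c := repConst p q r s) (m2.div_const _).aestronglyMeasurable
        ((ae_restrict_iff' measurableSet_rect).2 (Eventually.of_forall fun y hy => (hb y hy).2.2.1))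
    have i3 : IntegrableOn (fun y => kap p q x.1 y.1 * kap r s x.2 y.2 * u₁₁ y)
        (Ioc p q ×ˢ Ioc r s) :=
      g₁₁.bdd_mul (c := repConst p q r s) (m1.mul m2).aestronglyMeasurable
        ((ae_restrict_iff' measurableSet_rect).2 (Eventually.of_forall fun y hy => (hb y hy).2.2.2))
    exact setIntegral_add₄ i0 i1 i2 i3
  have mi : ∀ n {v : ℝ² → ℝ}, IntegrableOn v Ω →
      IntegrableOn (moll (ker n) Ω v) (Ioc p q ×ˢ Ioc r s) := fun n v hv =>
    continuous_integrableOn_rect (contDiff_moll hΩ hv (ker_test n).1 (ker_test n).2).continuous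
  rw [split (h₀₀.mono_set hsub) (h₁₀.mono_set hsub) (h₀₁.mono_set hsub) (h₁₁.mono_set hsub)]
  refine Tendsto.congr (fun n => (split (mi n h₀₀) (mi n h₁₀) (mi n h₀₁) (mi n h₁₁)).symm) ?_
  have hQf := volume_rect_ne_top (p := p) (q := q) (r := r) (s := s)
  exact (((integral_mul_moll_tendsto' hΩ measurableSet_rect hsub hQf h₀₀ measurable_const
    (fun y hy => (hb y hy).1) hR).add
    (integral_mul_moll_tendsto' hΩ measurableSet_rect hsub hQf h₁₀ (m1.div_const _)
      (fun y hy => (hb y hy).2.1) hR)).add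
    (integral_mul_moll_tendsto' hΩ measurableSet_rect hsub hQf h₀₁ (m2.div_const _)
      (fun y hy => (hb y hy).2.2.1) hR)).add
    (integral_mul_moll_tendsto' hΩ measurableSet_rect hsub hQf h₁₁ (m1.mul m2)
      (fun y hy => (hb y hy).2.2.2) hR)

end Rep

end

section

/-! ### The Sobolev embedding on a rectangle -/

lemma hasDerivAt_of_tendsto_of_bounded {u u' : ℕ → ℝ → ℝ} {U U' : ℝ → ℝ} {x ε K : ℝ} (hε : 0 < ε)
    (hu : ∀ n s, HasDerivAt (u n) (u' n s) s) (hc : ∀ n, Continuous (u' n))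
    (hb : ∀ᶠ n in atTop, ∀ s ∈ Ioo (x - ε) (x + ε), |u' n s| ≤ K)
    (hU : ∀ s ∈ Ioo (x - ε) (x + ε), Tendsto (fun n => u n s) atTop (𝓝 (U s)))
    (hU' : ∀ s ∈ Ioo (x - ε) (x + ε), Tendsto (fun n => u' n s) atTop (𝓝 (U' s)))
    (hc' : ContinuousOn U' (Ioo (x - ε) (x + ε))) : HasDerivAt U (U' x) x := by
  have hx : x ∈ Ioo (x - ε) (x + ε) := ⟨by linarith, by linarith⟩
  have key : ∀ b ∈ Ioo (x - ε) (x + ε), U b = U x + ∫ s in x..b, U' s := by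
    intro b hb'
    have hsub : uIoc x b ⊆ Ioo (x - ε) (x + ε) :=
      uIoc_subset_uIcc.trans ((ordConnected_Ioo.uIcc_subset hx hb'))
    have h1 : Tendsto (fun n => ∫ s in x..b, u' n s) atTop (𝓝 (∫ s in x..b, U' s)) := by
      refine intervalIntegral.tendsto_integral_filter_of_dominated_convergence (fun _ => K)
        (Eventually.of_forall fun n => (hc n).aestronglyMeasurable) ?_ intervalIntegrable_const ?_
      · filter_upwards [hb] with n hn
        exact Eventually.of_forall fun s hs => hn s (hsub hs)
      · exact Eventually.of_forall fun s hs => hU' s (hsub hs)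
    have h2 : ∀ n, ∫ s in x..b, u' n s = u n b - u n x := fun n =>
      intervalIntegral.integral_eq_sub_of_hasDerivAt (fun s _ => hu n s) ((hc n).intervalIntegrable _ _)
    simp only [h2] at h1
    have h3 := tendsto_nhds_unique h1 ((hU b hb').sub (hU x hx))
    linarith
  have hnhds : Ioo (x - ε) (x + ε) ∈ 𝓝 x := Ioo_mem_nhds hx.1 hx.2
  have hd : HasDerivAt (fun b => ∫ s in x..b, U' s) (U' x) x :=
    intervalIntegral.integral_hasDerivAt_right (by simp)
      (hc'.stronglyMeasurableAtFilter isOpen_Ioo x hx) (hc'.continuousAt hnhds)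
  refine (hd.const_add (U x)).congr_of_eventuallyEq ?_
  filter_upwards [hnhds] with b hb' using key b hb'

section Embedding

variable {a₀ a₁ z₀ z₁ δ : ℝ} {h : ℝ² → ℝ} {w : ℕ → ℕ → ℝ² → ℝ}

local notation "𝓡" => SProd.sprod (Ioo a₀ a₁) (Ioo z₀ z₁)

/-- The derivatives of the `n`-th mollification. -/
def mollDeriv (Ω : Set ℝ²) (h : ℝ² → ℝ) (n i j : ℕ) : ℝ² → ℝ :=
  moll (dA^[i] (dZ^[j] (ker n))) Ω h

lemma mollDeriv_test (n i j : ℕ) : IsTest (dA^[i] (dZ^[j] (ker n))) :=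
  ((ker_test n).dZ_iterate j).dA_iterate i

lemma mollDeriv_continuous {Ω : Set ℝ²} (hΩ : MeasurableSet Ω) (hh : IntegrableOn h Ω) (n i j : ℕ) :
    Continuous (mollDeriv Ω h n i j) :=
  (contDiff_moll hΩ hh (mollDeriv_test n i j).1 (mollDeriv_test n i j).2).continuous

lemma mollDeriv_fst {Ω : Set ℝ²} (hΩ : MeasurableSet Ω) (hh : IntegrableOn h Ω) (n i j : ℕ) (x : ℝ²) :
    HasDerivAt (fun a => mollDeriv Ω h n i j (a, x.2)) (mollDeriv Ω h n (i + 1) j x) x.1 := by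
  have := hasDerivAt_moll_fst hΩ hh (mollDeriv_test n i j) x
  rw [← Function.iterate_succ_apply' dA] at this
  exact this

lemma mollDeriv_snd {Ω : Set ℝ²} (hΩ : MeasurableSet Ω) (hh : IntegrableOn h Ω) (n i j : ℕ) (x : ℝ²) :
    HasDerivAt (fun z => mollDeriv Ω h n i j (x.1, z)) (mollDeriv Ω h n i (j + 1) x) x.2 := by
  have := hasDerivAt_moll_snd hΩ hh (mollDeriv_test n i j) x
  rw [← ((ker_test n).dZ_iterate j).dA_iterate_dZ, ← Function.iterate_succ_apply' dZ] at this
  exact this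

lemma closedBall_subset_rect {x : ℝ²} {ρ : ℝ} (hρ : ρ < δ)
    (hx : x ∈ Icc (a₀ + δ) (a₁ - δ) ×ˢ Icc (z₀ + δ) (z₁ - δ)) : Metric.closedBall x ρ ⊆ 𝓡 := by
  intro y hy
  rw [Metric.mem_closedBall, Prod.dist_eq, max_le_iff, Real.dist_eq, Real.dist_eq, abs_le, abs_le] at hy
  obtain ⟨⟨h1, h2⟩, h3, h4⟩ := hy
  obtain ⟨⟨h5, h6⟩, h7, h8⟩ := hx
  exact ⟨⟨by linarith, by linarith⟩, by linarith, by linarith⟩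

lemma eventually_mollDeriv_eq (hδ : 0 < δ) {i j : ℕ} (hw : IsWeakDeriv 𝓡 i j h (w i j)) :
    ∀ᶠ n in atTop, ∀ x ∈ Icc (a₀ + δ) (a₁ - δ) ×ˢ Icc (z₀ + δ) (z₁ - δ), mollDeriv 𝓡 h n i j x
        = moll (ker n) 𝓡 (w i j) x := by
  filter_upwards [bump_tendsto.eventually (Iio_mem_nhds hδ)] with n hn x hx
  exact moll_weakDeriv hw (ker_test n) ((tsupport_ker_reflect n x).trans (closedBall_subset_rect hn hx))

lemma volume_openRect_ne_top : volume 𝓡 ≠ ⊤ := by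
  rw [Measure.volume_eq_prod, Measure.prod_prod]
  exact (ENNReal.mul_lt_top measure_Ioo_lt_top measure_Ioo_lt_top).ne

lemma measurableSet_openRect : MeasurableSet 𝓡 :=
  measurableSet_Ioo.prod measurableSet_Ioo

lemma IsWeakDeriv.integrableOn {i j : ℕ} {v : ℝ² → ℝ} (hw : IsWeakDeriv 𝓡 i j h v) : IntegrableOn v 𝓡 := by
  have : IsFiniteMeasure (volume.restrict 𝓡) :=
    ⟨by rw [Measure.restrict_apply_univ]; exact volume_openRect_ne_top.lt_top⟩
  exact hw.1.integrable (by norm_num)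

/-- The sum of the `L¹` norms which bounds the supremum of the derivative `(i,j)`. -/
def l1Sum (Ω : Set ℝ²) (w : ℕ → ℕ → ℝ² → ℝ) (i j : ℕ) : ℝ :=
  (∫ y in Ω, |w i j y|) + (∫ y in Ω, |w (i + 1) j y|) + (∫ y in Ω, |w i (j + 1) y|)
    + ∫ y in Ω, |w (i + 1) (j + 1) y|

lemma mollDeriv_rep (hδ : 0 < δ) (ha : a₀ + δ < a₁ - δ) (hz : z₀ + δ < z₁ - δ)
    (hh : IntegrableOn h 𝓡) {i j K : ℕ} (hij : i + j ≤ K)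
    (hw : ∀ i j, i + j ≤ K + 2 → IsWeakDeriv 𝓡 i j h (w i j)) :
    (∀ x ∈ Icc (a₀ + δ) (a₁ - δ) ×ˢ Icc (z₀ + δ) (z₁ - δ), Tendsto (fun n => mollDeriv 𝓡 h n i j x) atTop
        (𝓝 (rep (a₀ + δ) (a₁ - δ) (z₀ + δ) (z₁ - δ) (w i j) (w (i + 1) j) (w i (j + 1))
          (w (i + 1) (j + 1)) x))) ∧ ∀ᶠ n in atTop, ∀ x ∈ Icc (a₀ + δ) (a₁ - δ) ×ˢ Icc (z₀ + δ) (z₁ - δ),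
      |mollDeriv 𝓡 h n i j x| ≤ repConst (a₀ + δ) (a₁ - δ) (z₀ + δ) (z₁ - δ) * l1Sum 𝓡 w i j := by
  have hm : MeasurableSet 𝓡 := measurableSet_openRect
  have w00 := hw i j (by omega)
  have w10 := hw (i + 1) j (by omega)
  have w01 := hw i (j + 1) (by omega)
  have w11 := hw (i + 1) (j + 1) (by omega)
  have hsub : Ioc (a₀ + δ) (a₁ - δ) ×ˢ Ioc (z₀ + δ) (z₁ - δ) ⊆ 𝓡 :=
    fun y hy => ⟨⟨by linarith [hy.1.1], by linarith [hy.1.2]⟩, by linarith [hy.2.1], by linarith [hy.2.2]⟩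
  have key : ∀ᶠ n in atTop, ∀ x ∈ Icc (a₀ + δ) (a₁ - δ) ×ˢ Icc (z₀ + δ) (z₁ - δ),
      mollDeriv 𝓡 h n i j x = rep (a₀ + δ) (a₁ - δ) (z₀ + δ) (z₁ - δ) (moll (ker n) 𝓡 (w i j))
        (moll (ker n) 𝓡 (w (i + 1) j)) (moll (ker n) 𝓡 (w i (j + 1)))
        (moll (ker n) 𝓡 (w (i + 1) (j + 1))) x := by
    filter_upwards [eventually_mollDeriv_eq hδ w00, eventually_mollDeriv_eq hδ w10,
      eventually_mollDeriv_eq hδ w01, eventually_mollDeriv_eq hδ w11] with n h1 h2 h3 h4 x hx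
    rw [eq_rep ha hz (mollDeriv_continuous hm hh n i j) (mollDeriv_continuous hm hh n (i + 1) j)
      (mollDeriv_continuous hm hh n i (j + 1)) (mollDeriv_continuous hm hh n (i + 1) (j + 1))
      (mollDeriv_fst hm hh n i j) (mollDeriv_snd hm hh n i j) (mollDeriv_snd hm hh n (i + 1) j) hx]
    refine setIntegral_congr_fun measurableSet_rect fun y hy => ?_
    have hy' : y ∈ Icc (a₀ + δ) (a₁ - δ) ×ˢ Icc (z₀ + δ) (z₁ - δ) :=
      ⟨Ioc_subset_Icc_self hy.1, Ioc_subset_Icc_self hy.2⟩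
    simp only [repIntegrand, h1 y hy', h2 y hy', h3 y hy', h4 y hy']
  constructor
  · intro x hx
    refine (rep_moll_tendsto ha hz hm hsub x w00.integrableOn w10.integrableOn w01.integrableOn
      w11.integrableOn).congr' ?_
    filter_upwards [key] with n hn using (hn x hx).symm
  · filter_upwards [key] with n hn x hx
    rw [hn x hx]
    have mi : ∀ {v : ℝ² → ℝ}, IntegrableOn v 𝓡 →
        IntegrableOn (moll (ker n) 𝓡 v) (Ioc (a₀ + δ) (a₁ - δ) ×ˢ Ioc (z₀ + δ) (z₁ - δ)) := fun hv =>
      continuous_integrableOn_rect (contDiff_moll hm hv (ker_test n).1 (ker_test n).2).continuous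
    refine (rep_abs_le ha hz x (mi w00.integrableOn) (mi w10.integrableOn) (mi w01.integrableOn)
      (mi w11.integrableOn)).trans ?_
    refine mul_le_mul_of_nonneg_left ?_ (repConst_nonneg ha hz)
    have e : ∀ {v : ℝ² → ℝ}, IntegrableOn v 𝓡 →
        (∫ x in Ioc (a₀ + δ) (a₁ - δ) ×ˢ Ioc (z₀ + δ) (z₁ - δ), |moll (ker n) 𝓡 v x|)
          ≤ ∫ x in 𝓡, |v x| := fun hv =>
      integral_abs_moll_le n hm measurableSet_rect
        (volume_rect_ne_top (p := a₀ + δ) (q := a₁ - δ) (r := z₀ + δ) (s := z₁ - δ)) hv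
    exact add_le_add (add_le_add (add_le_add (e w00.integrableOn) (e w10.integrableOn))
      (e w01.integrableOn)) (e w11.integrableOn)

/-- The constant of the Sobolev embedding. -/
def sobConst (a₀ a₁ z₀ z₁ : ℝ) : ℝ := (1 + 2 / (a₁ - a₀)) * (1 + 2 / (z₁ - z₀))

lemma repConst_le (ha : a₀ < a₁) (hz : z₀ < z₁) (h1 : δ ≤ (a₁ - a₀) / 4) (h2 : δ ≤ (z₁ - z₀) / 4) :
    repConst (a₀ + δ) (a₁ - δ) (z₀ + δ) (z₁ - δ) ≤ sobConst a₀ a₁ z₀ z₁ := by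
  have e1 : 0 < a₁ - a₀ := by linarith
  have e2 : 0 < z₁ - z₀ := by linarith
  unfold repConst sobConst
  have f1 : 1 / (a₁ - δ - (a₀ + δ)) ≤ 2 / (a₁ - a₀) := by
    rw [div_le_div_iff₀ (by linarith) e1]; linarith
  have f2 : 1 / (z₁ - δ - (z₀ + δ)) ≤ 2 / (z₁ - z₀) := by
    rw [div_le_div_iff₀ (by linarith) e2]; linarith
  have f3 : 0 ≤ 1 / (z₁ - δ - (z₀ + δ)) := div_nonneg zero_le_one (by linarith)
  have f4 : 0 ≤ 2 / (a₁ - a₀) := by positivity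
  gcongr

lemma exists_margin {x : ℝ²} (hx : x ∈ 𝓡) : ∃ δ, 0 < δ ∧ δ ≤ (a₁ - a₀) / 4 ∧ δ ≤ (z₁ - z₀) / 4 ∧
      x ∈ Ioo (a₀ + δ) (a₁ - δ) ×ˢ Ioo (z₀ + δ) (z₁ - δ) := by
  obtain ⟨⟨h1, h2⟩, h3, h4⟩ := hx
  set m := min (min (x.1 - a₀) (a₁ - x.1)) (min (x.2 - z₀) (z₁ - x.2)) with hm
  have m1 : m ≤ x.1 - a₀ := (min_le_left _ _).trans (min_le_left _ _)
  have m2 : m ≤ a₁ - x.1 := (min_le_left _ _).trans (min_le_right _ _)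
  have m3 : m ≤ x.2 - z₀ := (min_le_right _ _).trans (min_le_left _ _)
  have m4 : m ≤ z₁ - x.2 := (min_le_right _ _).trans (min_le_right _ _)
  have mp : 0 < m := lt_min (lt_min (by linarith) (by linarith)) (lt_min (by linarith) (by linarith))
  exact ⟨m / 2, by linarith, by linarith, by linarith, ⟨by linarith, by linarith⟩,
    by linarith, by linarith⟩

/-- The Sobolev embedding `H^{K+2} ⊂ C^K` on an open rectangle. -/
lemma sobolev_embedding (ha : a₀ < a₁) (hz : z₀ < z₁) (hh : IntegrableOn h 𝓡) (hcont : ContinuousOn h 𝓡)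
    {K : ℕ} (hw : ∀ i j, i + j ≤ K + 2 → IsWeakDeriv 𝓡 i j h (w i j)) :
    ∃ W : ℕ → ℕ → ℝ² → ℝ, (∀ x ∈ 𝓡, W 0 0 x = h x) ∧ ∀ i j, i + j ≤ K → ContinuousOn (W i j) 𝓡 ∧
        (∀ x ∈ 𝓡, |W i j x| ≤ sobConst a₀ a₁ z₀ z₁ * l1Sum 𝓡 w i j) ∧ (i + j < K → ∀ x ∈ 𝓡,
          HasDerivAt (fun a => W i j (a, x.2)) (W (i + 1) j x) x.1 ∧
          HasDerivAt (fun z => W i j (x.1, z)) (W i (j + 1) x) x.2) := by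
  have hm : MeasurableSet 𝓡 := measurableSet_openRect
  have hl1 : ∀ i j, 0 ≤ l1Sum 𝓡 w i j := fun i j => by
    unfold l1Sum
    have : ∀ v : ℝ² → ℝ, 0 ≤ ∫ y in 𝓡, |v y| := fun v =>
      integral_nonneg fun y => abs_nonneg (v y)
    linarith [this (w i j), this (w (i + 1) j), this (w i (j + 1)), this (w (i + 1) (j + 1))]
  refine ⟨fun i j x => limUnder atTop fun n => mollDeriv 𝓡 h n i j x, ?_, ?_⟩
  · intro x hx
    refine Tendsto.limUnder_eq ?_
    exact moll_ker_tendsto_of_continuousOn (isOpen_Ioo.prod isOpen_Ioo) hh hcont hx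
  have hlim : ∀ i j, i + j ≤ K → ∀ x ∈ 𝓡, ∃ y, Tendsto (fun n => mollDeriv 𝓡 h n i j x) atTop (𝓝 y) := by
    intro i j hij x hx
    obtain ⟨δ, hδ, d1, d2, hxδ⟩ := exists_margin hx
    exact ⟨_, (mollDeriv_rep hδ (by linarith) (by linarith) hh hij hw).1 x
      ⟨Ioo_subset_Icc_self hxδ.1, Ioo_subset_Icc_self hxδ.2⟩⟩
  have hW : ∀ i j, i + j ≤ K → ∀ x ∈ 𝓡, Tendsto (fun n => mollDeriv 𝓡 h n i j x) atTop
      (𝓝 (limUnder atTop fun n => mollDeriv 𝓡 h n i j x)) := fun i j hij x hx =>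
    tendsto_nhds_limUnder (hlim i j hij x hx)
  have hWc : ∀ i j, i + j ≤ K → ContinuousOn (fun x => limUnder atTop fun n => mollDeriv 𝓡 h n i j x) 𝓡 := by
    intro i j hij x hx
    obtain ⟨δ, hδ, d1, d2, hxδ⟩ := exists_margin hx
    have hsub : Ioc (a₀ + δ) (a₁ - δ) ×ˢ Ioc (z₀ + δ) (z₁ - δ) ⊆ 𝓡 :=
      fun y hy => ⟨⟨by linarith [hy.1.1], by linarith [hy.1.2]⟩, by linarith [hy.2.1], by linarith [hy.2.2]⟩
    have hc := continuous_rep (p := a₀ + δ) (q := a₁ - δ) (r := z₀ + δ) (s := z₁ - δ)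
      (by linarith) (by linarith)
      ((hw i j (by omega)).integrableOn.mono_set hsub)
      ((hw (i + 1) j (by omega)).integrableOn.mono_set hsub)
      ((hw i (j + 1) (by omega)).integrableOn.mono_set hsub)
      ((hw (i + 1) (j + 1) (by omega)).integrableOn.mono_set hsub)
    refine ContinuousAt.continuousWithinAt (hc.continuousAt.congr ?_)
    filter_upwards [(isOpen_Ioo.prod isOpen_Ioo).mem_nhds hxδ] with y hy
    exact ((mollDeriv_rep hδ (by linarith) (by linarith) hh hij hw).1 y
      ⟨Ioo_subset_Icc_self hy.1, Ioo_subset_Icc_self hy.2⟩).limUnder_eq.symm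
  intro i j hij
  refine ⟨hWc i j hij, fun x hx => ?_, fun hlt x hx => ?_⟩
  · obtain ⟨δ, hδ, d1, d2, hxδ⟩ := exists_margin hx
    have h1 := (mollDeriv_rep hδ (by linarith) (by linarith) hh hij hw).2
    refine le_of_tendsto (hW i j hij x hx).abs ?_
    filter_upwards [h1] with n hn
    exact (hn x ⟨Ioo_subset_Icc_self hxδ.1, Ioo_subset_Icc_self hxδ.2⟩).trans
      (mul_le_mul_of_nonneg_right (repConst_le ha hz d1 d2) (hl1 i j))
  · obtain ⟨δ, hδ, d1, d2, hxδ⟩ := exists_margin hx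
    obtain ⟨⟨x1, x2⟩, x3, x4⟩ := hxδ
    constructor
    · set ε := min (x.1 - (a₀ + δ)) (a₁ - δ - x.1) with hε
      have e1 : ε ≤ x.1 - (a₀ + δ) := min_le_left _ _
      have e2 : ε ≤ a₁ - δ - x.1 := min_le_right _ _
      have hin : ∀ s ∈ Ioo (x.1 - ε) (x.1 + ε),
          ((s, x.2) : ℝ²) ∈ Icc (a₀ + δ) (a₁ - δ) ×ˢ Icc (z₀ + δ) (z₁ - δ) := fun s hs =>
        ⟨⟨by linarith [hs.1], by linarith [hs.2]⟩, x3.le, x4.le⟩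
      have hinO : ∀ s ∈ Ioo (x.1 - ε) (x.1 + ε), ((s, x.2) : ℝ²) ∈ 𝓡 := fun s hs =>
        ⟨⟨by linarith [hs.1], by linarith [hs.2]⟩, hx.2⟩
      refine hasDerivAt_of_tendsto_of_bounded (ε := ε)
        (K := repConst (a₀ + δ) (a₁ - δ) (z₀ + δ) (z₁ - δ) * l1Sum 𝓡 w (i + 1) j)
        (u := fun n a => mollDeriv 𝓡 h n i j (a, x.2)) (u' := fun n a => mollDeriv 𝓡 h n (i + 1) j (a, x.2))
        (U := fun a => limUnder atTop fun n => mollDeriv 𝓡 h n i j (a, x.2))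
        (U' := fun a => limUnder atTop fun n => mollDeriv 𝓡 h n (i + 1) j (a, x.2))
        (lt_min (by linarith) (by linarith)) (fun n s => mollDeriv_fst hm hh n i j (s, x.2))
        (fun n => (mollDeriv_continuous hm hh n (i + 1) j).comp (by fun_prop)) ?_
        (fun s hs => hW i j hij _ (hinO s hs)) (fun s hs => hW (i + 1) j (by omega) _ (hinO s hs))
        ((hWc (i + 1) j (by omega)).comp (by fun_prop) hinO)
      · filter_upwards [(mollDeriv_rep hδ (by linarith) (by linarith) hh
          (show i + 1 + j ≤ K by omega) hw).2] with n hn s hs using hn _ (hin s hs)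
    · set ε := min (x.2 - (z₀ + δ)) (z₁ - δ - x.2) with hε
      have e1 : ε ≤ x.2 - (z₀ + δ) := min_le_left _ _
      have e2 : ε ≤ z₁ - δ - x.2 := min_le_right _ _
      have hin : ∀ s ∈ Ioo (x.2 - ε) (x.2 + ε),
          ((x.1, s) : ℝ²) ∈ Icc (a₀ + δ) (a₁ - δ) ×ˢ Icc (z₀ + δ) (z₁ - δ) := fun s hs =>
        ⟨⟨x1.le, x2.le⟩, by linarith [hs.1], by linarith [hs.2]⟩
      have hinO : ∀ s ∈ Ioo (x.2 - ε) (x.2 + ε), ((x.1, s) : ℝ²) ∈ 𝓡 := fun s hs =>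
        ⟨hx.1, by linarith [hs.1], by linarith [hs.2]⟩
      refine hasDerivAt_of_tendsto_of_bounded (ε := ε)
        (K := repConst (a₀ + δ) (a₁ - δ) (z₀ + δ) (z₁ - δ) * l1Sum 𝓡 w i (j + 1))
        (u := fun n z => mollDeriv 𝓡 h n i j (x.1, z)) (u' := fun n z => mollDeriv 𝓡 h n i (j + 1) (x.1, z))
        (U := fun z => limUnder atTop fun n => mollDeriv 𝓡 h n i j (x.1, z))
        (U' := fun z => limUnder atTop fun n => mollDeriv 𝓡 h n i (j + 1) (x.1, z))
        (lt_min (by linarith) (by linarith)) (fun n s => mollDeriv_snd hm hh n i j (x.1, s))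
        (fun n => (mollDeriv_continuous hm hh n i (j + 1)).comp (by fun_prop)) ?_
        (fun s hs => hW i j hij _ (hinO s hs)) (fun s hs => hW i (j + 1) (by omega) _ (hinO s hs))
        ((hWc i (j + 1) (by omega)).comp (by fun_prop) hinO)
      · filter_upwards [(mollDeriv_rep hδ (by linarith) (by linarith) hh
          (show i + (j + 1) ≤ K by omega) hw).2] with n hn s hs using hn _ (hin s hs)

end Embedding

end

section

/-! ### Classical derivatives of functions in a Sobolev space -/

/-- The partial derivative `∂_a^i ∂_z^j h`. -/
def pd (i j : ℕ) (h : ℝ² → ℝ) : ℝ² → ℝ := dA^[i] (dZ^[j] h)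

/-- `h` is of class `C^K` on `Ω`, in terms of its partial derivatives. -/
def IsCk (Ω : Set ℝ²) (K : ℕ) (h : ℝ² → ℝ) : Prop :=
  ∀ i j, i + j ≤ K → ContinuousOn (pd i j h) Ω ∧ (i + j < K → ∀ x ∈ Ω,
    HasDerivAt (fun a => pd i j h (a, x.2)) (pd (i + 1) j h x) x.1 ∧
    HasDerivAt (fun z => pd i j h (x.1, z)) (pd i (j + 1) h x) x.2)

lemma pd_succ_fst (i j : ℕ) (h : ℝ² → ℝ) : pd (i + 1) j h = dA (pd i j h) :=
  Function.iterate_succ_apply' dA i _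

lemma pd_succ_snd (j : ℕ) (h : ℝ² → ℝ) : pd 0 (j + 1) h = dZ (pd 0 j h) :=
  Function.iterate_succ_apply' dZ j _

lemma eventually_line_fst {Ω : Set ℝ²} (hΩ : IsOpen Ω) {x : ℝ²} (hx : x ∈ Ω) :
    ∀ᶠ a in 𝓝 x.1, ((a, x.2) : ℝ²) ∈ Ω :=
  (show Continuous fun a : ℝ => ((a, x.2) : ℝ²) by fun_prop).continuousAt.eventually
    (hΩ.mem_nhds hx)

lemma eventually_line_snd {Ω : Set ℝ²} (hΩ : IsOpen Ω) {x : ℝ²} (hx : x ∈ Ω) :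
    ∀ᶠ z in 𝓝 x.2, ((x.1, z) : ℝ²) ∈ Ω :=
  (show Continuous fun z : ℝ => ((x.1, z) : ℝ²) by fun_prop).continuousAt.eventually
    (hΩ.mem_nhds hx)

/-- A family of successive derivatives consists of the iterated partial derivatives. -/
lemma pd_eq_of_hasDerivAt {Ω : Set ℝ²} (hΩ : IsOpen Ω) {K : ℕ} {h : ℝ² → ℝ}
    {W : ℕ → ℕ → ℝ² → ℝ} (h0 : ∀ x ∈ Ω, W 0 0 x = h x) (hW : ∀ i j, i + j < K → ∀ x ∈ Ω,
      HasDerivAt (fun a => W i j (a, x.2)) (W (i + 1) j x) x.1 ∧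
      HasDerivAt (fun z => W i j (x.1, z)) (W i (j + 1) x) x.2) :
    ∀ i j, i + j ≤ K → ∀ x ∈ Ω, pd i j h x = W i j x := by
  have hz : ∀ j, j ≤ K → ∀ x ∈ Ω, pd 0 j h x = W 0 j x := by
    intro j
    induction j with
    | zero => exact fun _ x hx => (h0 x hx).symm
    | succ j ih =>
      intro hj x hx
      rw [pd_succ_snd]
      refine (((hW 0 j (by omega) x hx).2).congr_of_eventuallyEq ?_).deriv
      filter_upwards [eventually_line_snd hΩ hx] with z hz using ih (by omega) _ hz
  intro i
  induction i with
  | zero => exact fun j hj => hz j (by omega)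
  | succ i ih =>
    intro j hj x hx
    rw [pd_succ_fst]
    refine (((hW i j (by omega) x hx).1).congr_of_eventuallyEq ?_).deriv
    filter_upwards [eventually_line_fst hΩ hx] with a ha using ih j (by omega) _ ha

lemma IsCk.of_hasDerivAt {Ω : Set ℝ²} (hΩ : IsOpen Ω) {K : ℕ} {h : ℝ² → ℝ}
    {W : ℕ → ℕ → ℝ² → ℝ} (h0 : ∀ x ∈ Ω, W 0 0 x = h x) (hc : ∀ i j, i + j ≤ K → ContinuousOn (W i j) Ω)
    (hW : ∀ i j, i + j < K → ∀ x ∈ Ω, HasDerivAt (fun a => W i j (a, x.2)) (W (i + 1) j x) x.1 ∧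
      HasDerivAt (fun z => W i j (x.1, z)) (W i (j + 1) x) x.2) : IsCk Ω K h := by
  have key := pd_eq_of_hasDerivAt hΩ h0 hW
  refine fun i j hij => ⟨(hc i j hij).congr (key i j hij), fun hlt x hx => ⟨?_, ?_⟩⟩
  · rw [key (i + 1) j (by omega) x hx]
    refine ((hW i j hlt x hx).1).congr_of_eventuallyEq ?_
    filter_upwards [eventually_line_fst hΩ hx] with a ha using key i j hij _ ha
  · rw [key i (j + 1) (by omega) x hx]
    refine ((hW i j hlt x hx).2).congr_of_eventuallyEq ?_
    filter_upwards [eventually_line_snd hΩ hx] with a ha using key i j hij _ ha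

lemma IsCk.pd_sub {Ω : Set ℝ²} (hΩ : IsOpen Ω) {K : ℕ} {h k : ℝ² → ℝ}
    (hh : IsCk Ω K h) (hk : IsCk Ω K k) {i j : ℕ} (hij : i + j ≤ K) {x : ℝ²} (hx : x ∈ Ω) :
    pd i j (fun y => h y - k y) x = pd i j h x - pd i j k x :=
  pd_eq_of_hasDerivAt hΩ (W := fun i j x => pd i j h x - pd i j k x) (fun _ _ => rfl)
    (fun i j hlt x hx =>
      ⟨((hh i j hlt.le).2 hlt x hx).1.fun_sub ((hk i j hlt.le).2 hlt x hx).1,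
        ((hh i j hlt.le).2 hlt x hx).2.fun_sub ((hk i j hlt.le).2 hlt x hx).2⟩) i j hij x hx

lemma IsCk.mono {Ω : Set ℝ²} {K L : ℕ} (hKL : K ≤ L) {h : ℝ² → ℝ} (hh : IsCk Ω L h) : IsCk Ω K h :=
  fun i j hij => ⟨(hh i j (hij.trans hKL)).1, fun hlt => (hh i j (hij.trans hKL)).2 (hlt.trans_le hKL)⟩

/-! ### Weak derivatives -/

lemma IsTest.memLp {φ : ℝ² → ℝ} (h : IsTest φ) (Ω : Set ℝ²) : MemLp φ 2 (volume.restrict Ω) :=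
  (h.1.continuous.memLp_of_hasCompactSupport h.2).restrict Ω

lemma integrable_mul_test {Ω : Set ℝ²} {f φ : ℝ² → ℝ} (hf : MemLp f 2 (volume.restrict Ω))
    (h : IsTest φ) : IntegrableOn (fun x => f x * φ x) Ω :=
  hf.integrable_mul (h.memLp Ω)

lemma IsWeakDeriv.sub {Ω : Set ℝ²} {i j : ℕ} {f f' g g' : ℝ² → ℝ}
    (hf : MemLp f 2 (volume.restrict Ω)) (hf' : MemLp f' 2 (volume.restrict Ω))
    (h : IsWeakDeriv Ω i j f g) (h' : IsWeakDeriv Ω i j f' g') :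
    IsWeakDeriv Ω i j (fun x => f x - f' x) (fun x => g x - g' x) := by
  refine ⟨h.1.sub h'.1, fun φ h1 h2 h3 => ?_⟩
  have ht : IsTest φ := ⟨h1, h2⟩
  have hd := (ht.dZ_iterate j).dA_iterate i
  simp only [sub_mul]
  rw [integral_sub (integrable_mul_test hf hd) (integrable_mul_test hf' hd),
    integral_sub (integrable_mul_test h.1 ht) (integrable_mul_test h'.1 ht), h.2 φ h1 h2 h3,
    h'.2 φ h1 h2 h3, mul_sub]

lemma MemSobolev.sub {Ω : Set ℝ²} {k : ℕ} {f g : ℝ² → ℝ} (hf : MemSobolev Ω k f)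
    (hg : MemSobolev Ω k g) : MemSobolev Ω k (fun x => f x - g x) := by
  refine ⟨hf.1.sub hg.1, fun i j hij => ?_⟩
  obtain ⟨f', hf'⟩ := hf.2 i j hij
  obtain ⟨g', hg'⟩ := hg.2 i j hij
  exact ⟨_, hf'.sub hf.1 hg.1 hg'⟩

lemma MemSobolev.mono {Ω : Set ℝ²} {k l : ℕ} (h : k ≤ l) {f : ℝ² → ℝ} (hf : MemSobolev Ω l f) :
    MemSobolev Ω k f := ⟨hf.1, fun i j hij => hf.2 i j (hij.trans h)⟩

lemma MemSobolev.isWeakDeriv {Ω : Set ℝ²} {k : ℕ} {f : ℝ² → ℝ} (hf : MemSobolev Ω k f) {i j : ℕ}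
    (hij : i + j ≤ k) : IsWeakDeriv Ω i j f (weakDeriv Ω i j f) := by
  have h := hf.2 i j hij
  rw [weakDeriv, dif_pos h]
  exact h.choose_spec

lemma integral_sq_weakDeriv_le {Ω : Set ℝ²} {k i j : ℕ} (f : ℝ² → ℝ) (hij : i + j ≤ k) :
    ∫ x in Ω, (weakDeriv Ω i j f x) ^ 2 ≤ sobolevNorm Ω k f ^ 2 := by
  have h0 : ∀ i j, 0 ≤ ∫ x in Ω, (weakDeriv Ω i j f x) ^ 2 := fun i j =>
    integral_nonneg fun x => sq_nonneg _
  rw [sobolevNorm, Real.sq_sqrt (Finset.sum_nonneg fun i _ => Finset.sum_nonneg fun j _ => h0 i j)]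
  refine (Finset.single_le_sum (f := fun j => ∫ x in Ω, (weakDeriv Ω i j f x) ^ 2)
    (s := Finset.range (k + 1 - i)) (fun j _ => h0 i j) (Finset.mem_range.2 (by omega))).trans ?_
  exact Finset.single_le_sum
    (f := fun i => ∑ j ∈ Finset.range (k + 1 - i), ∫ x in Ω, (weakDeriv Ω i j f x) ^ 2)
    (s := Finset.range (k + 1)) (fun i _ => Finset.sum_nonneg fun j _ => h0 i j)
    (Finset.mem_range.2 (by omega))

lemma sq_integral_abs_le {Ω : Set ℝ²} (hΩ : volume Ω ≠ ⊤) {v : ℝ² → ℝ} (hv : MemLp v 2 (volume.restrict Ω)) :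
    (∫ x in Ω, |v x|) ^ 2 ≤ volume.real Ω * ∫ x in Ω, v x ^ 2 := by
  have hfin : IsFiniteMeasure (volume.restrict Ω) :=
    ⟨by rw [Measure.restrict_apply_univ]; exact hΩ.lt_top⟩
  have i1 : Integrable (fun x => |v x|) (volume.restrict Ω) := (hv.integrable (by norm_num)).abs
  have i2 : Integrable (fun x => v x ^ 2) (volume.restrict Ω) := hv.integrable_sq
  set V := volume.real Ω with hV
  set L := ∫ x in Ω, |v x| with hL
  set S := ∫ x in Ω, v x ^ 2 with hS
  have hV0 : 0 ≤ V := measureReal_nonneg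
  have key : 0 ≤ ∫ x in Ω, (V * |v x| - L) ^ 2 := integral_nonneg fun x => sq_nonneg _
  have e : ∀ x, (V * |v x| - L) ^ 2 = V ^ 2 * v x ^ 2 - 2 * V * L * |v x| + L ^ 2 := fun x => by
    rw [← sq_abs (v x)]; ring
  simp only [e] at key
  have i3 : Integrable (fun x => V ^ 2 * v x ^ 2 - 2 * V * L * |v x|) (volume.restrict Ω) :=
    (i2.const_mul _).sub (i1.const_mul _)
  rw [integral_add i3 (integrable_const _),
    integral_sub (i2.const_mul _) (i1.const_mul _), integral_const_mul, integral_const_mul,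
    integral_const, ← hL, ← hS, measureReal_restrict_apply_univ, ← hV, smul_eq_mul] at key
  have k2 : 0 ≤ V * (V * S - L ^ 2) := by nlinarith
  rcases hV0.eq_or_lt with h | h
  · have : volume.restrict Ω = 0 := by
      rw [Measure.restrict_eq_zero]
      rcases (ENNReal.toReal_eq_zero_iff _).1 (h.symm : (volume Ω).toReal = 0) with h | h
      · exact h
      · exact absurd h hΩ
    rw [hL, this, integral_zero_measure, ← h]; simp
  · nlinarith [nonneg_of_mul_nonneg_right k2 h]

/-- The constant of the Sobolev embedding in terms of `L²` norms. -/
def embConst (a₀ a₁ z₀ z₁ : ℝ) : ℝ :=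
  sobConst a₀ a₁ z₀ z₁ * (4 * Real.sqrt (volume.real (Ioo a₀ a₁ ×ˢ Ioo z₀ z₁)))

section Embedding

variable {a₀ a₁ z₀ z₁ : ℝ}

local notation "𝓡" => SProd.sprod (Ioo a₀ a₁) (Ioo z₀ z₁)

lemma isCk_and_bound (ha : a₀ < a₁) (hz : z₀ < z₁) {h : ℝ² → ℝ} {w : ℕ → ℕ → ℝ² → ℝ}
    (hh : MemLp h 2 (volume.restrict 𝓡)) (hcont : ContinuousOn h 𝓡) {K : ℕ} {B : ℝ} (hB : 0 ≤ B)
    (hw : ∀ i j, i + j ≤ K + 2 → IsWeakDeriv 𝓡 i j h (w i j) ∧ ∫ x in 𝓡, w i j x ^ 2 ≤ B ^ 2) : IsCk 𝓡 K h ∧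
      ∀ i j, i + j ≤ K → ∀ x ∈ 𝓡, |pd i j h x| ≤ embConst a₀ a₁ z₀ z₁ * B := by
  have hfin : IsFiniteMeasure (volume.restrict 𝓡) :=
    ⟨by rw [Measure.restrict_apply_univ]; exact volume_openRect_ne_top.lt_top⟩
  obtain ⟨W, h0, hW⟩ := sobolev_embedding ha hz (hh.integrable (by norm_num)) hcont
    fun i j hij => (hw i j hij).1
  have hop : IsOpen 𝓡 := isOpen_Ioo.prod isOpen_Ioo
  have hder := fun i j (hlt : i + j < K) => (hW i j hlt.le).2.2 hlt
  refine ⟨IsCk.of_hasDerivAt hop h0 (fun i j hij => (hW i j hij).1) hder, fun i j hij x hx => ?_⟩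
  rw [pd_eq_of_hasDerivAt hop h0 hder i j hij x hx, embConst, mul_assoc]
  refine ((hW i j hij).2.1 x hx).trans (mul_le_mul_of_nonneg_left ?_ ?_)
  · have e : ∀ i j, i + j ≤ K + 2 → ∫ x in 𝓡, |w i j x|
        ≤ Real.sqrt (volume.real 𝓡) * B := by
      intro i j hij
      refine abs_le_of_sq_le_sq' ?_ (by positivity) |>.2
      rw [mul_pow, Real.sq_sqrt measureReal_nonneg]
      exact (sq_integral_abs_le volume_openRect_ne_top (hw i j hij).1.1).trans
        (mul_le_mul_of_nonneg_left (hw i j hij).2 measureReal_nonneg)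
    unfold l1Sum
    linarith [e i j (by omega), e (i + 1) j (by omega), e i (j + 1) (by omega),
      e (i + 1) (j + 1) (by omega)]
  · have h1 : 0 < a₁ - a₀ := by linarith
    have h2 : 0 < z₁ - z₀ := by linarith
    unfold sobConst
    positivity

lemma MemSobolev.isCk_and_bound (ha : a₀ < a₁) (hz : z₀ < z₁) {h : ℝ² → ℝ} {K : ℕ}
    (hh : MemSobolev 𝓡 (K + 2) h) (hcont : ContinuousOn h 𝓡) : IsCk 𝓡 K h ∧ ∀ i j, i + j ≤ K → ∀ x ∈ 𝓡,
      |pd i j h x| ≤ embConst a₀ a₁ z₀ z₁ * sobolevNorm 𝓡 (K + 2) h :=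
  WealthMFG.isCk_and_bound ha hz hh.1 hcont (Real.sqrt_nonneg _)
    fun _ _ hij => ⟨hh.isWeakDeriv hij, integral_sq_weakDeriv_le h hij⟩

/-- A continuous curve in `H^{K+2}` is a continuous curve in `C^K`. -/
lemma MemCSobolev.continuous_pd (ha : a₀ < a₁) (hz : z₀ < z₁) {h : ℝ → ℝ² → ℝ} {K : ℕ} {T : ℝ}
    (hh : MemCSobolev T 𝓡 (K + 2) h) (hcont : ∀ t ∈ Icc 0 T, ContinuousOn (h t) 𝓡) :
    (∀ t ∈ Icc 0 T, IsCk 𝓡 K (h t)) ∧ ∀ t₀ ∈ Icc 0 T, ∀ ε > 0, ∀ᶠ t in 𝓝[Icc 0 T] t₀, ∀ i j, i + j ≤ K →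
      ∀ x ∈ 𝓡, |pd i j (h t) x - pd i j (h t₀) x| ≤ ε := by
  have h1 : ∀ t ∈ Icc 0 T, IsCk 𝓡 K (h t) := fun t ht =>
    ((hh.1 t ht).isCk_and_bound ha hz (hcont t ht)).1
  refine ⟨h1, fun t₀ ht₀ ε hε => ?_⟩
  have h2 := (hh.2 t₀ ht₀).const_mul (embConst a₀ a₁ z₀ z₁)
  rw [mul_zero] at h2
  filter_upwards [h2.eventually (Iio_mem_nhds hε), self_mem_nhdsWithin] with t ht htI i j hij x hx
  rw [← (h1 t htI).pd_sub (isOpen_Ioo.prod isOpen_Ioo) (h1 t₀ ht₀) hij hx]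
  exact ((((hh.1 t htI).sub (hh.1 t₀ ht₀)).isCk_and_bound ha hz
    ((hcont t htI).sub (hcont t₀ ht₀))).2 i j hij x hx).trans (le_of_lt ht)

/-- A continuous curve in `H^{K+2}` is bounded in `C^K`. -/
lemma MemCSobolev.exists_bound_pd (ha : a₀ < a₁) (hz : z₀ < z₁) {h : ℝ → ℝ² → ℝ} {K : ℕ} {T : ℝ}
    (hh : MemCSobolev T 𝓡 (K + 2) h) (hcont : ∀ t ∈ Icc 0 T, ContinuousOn (h t) 𝓡) :
    ∃ M, ∀ t ∈ Icc 0 T, ∀ i j, i + j ≤ K → ∀ x ∈ 𝓡, |pd i j (h t) x| ≤ M := by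
  refine isCompact_Icc.induction_on (p := fun S => ∃ M, ∀ t ∈ S, ∀ i j, i + j ≤ K →
      ∀ x ∈ 𝓡, |pd i j (h t) x| ≤ M) ⟨0, by simp⟩ ?_ ?_ ?_
  · exact fun S S' hS ⟨M, hM⟩ => ⟨M, fun t ht => hM t (hS ht)⟩
  · rintro S S' ⟨M, hM⟩ ⟨M', hM'⟩
    refine ⟨max M M', fun t ht i j hij x hx => ?_⟩
    rcases ht with ht | ht
    · exact (hM t ht i j hij x hx).trans (le_max_left _ _)
    · exact (hM' t ht i j hij x hx).trans (le_max_right _ _)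
  · intro t₀ ht₀
    refine ⟨_, (hh.continuous_pd ha hz hcont).2 t₀ ht₀ 1 one_pos,
      embConst a₀ a₁ z₀ z₁ * sobolevNorm 𝓡 (K + 2) (h t₀) + 1,
      fun t ht i j hij x hx => ?_⟩
    have e1 := ht i j hij x hx
    have e2 := ((hh.1 t₀ ht₀).isCk_and_bound ha hz (hcont t₀ ht₀)).2 i j hij x hx
    rw [abs_le] at e1 e2 ⊢
    constructor <;> linarith [e1.1, e1.2, e2.1, e2.2]

end Embedding

/-! ### Weak closedness of balls in `H^k` -/

/-- A bounded sequence in a Hilbert space has a weak limit along an ultrafilter. -/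
lemma exists_weak_limit {F : Type*} [NormedAddCommGroup F] [InnerProductSpace ℝ F] [CompleteSpace F]
    {v : ℕ → F} {M : ℝ} (hv : ∀ n, ‖v n‖ ≤ M) :
    ∃ (U : Ultrafilter ℕ) (x : F), (U : Filter ℕ) ≤ atTop ∧ ‖x‖ ≤ M ∧
      ∀ w, Tendsto (fun n => inner ℝ (v n) w) U (𝓝 (inner ℝ x w)) := by
  have hc := WeakDual.isCompact_closedBall (𝕜 := ℝ) (E := F) 0 M
  let ψ : ℕ → WeakDual ℝ F := fun n => StrongDual.toWeakDual (InnerProductSpace.toDual ℝ F (v n))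
  obtain ⟨ℓ, hℓ, hlim⟩ := hc.ultrafilter_le_nhds ((hyperfilter ℕ).map ψ) (by
    rw [le_principal_iff]
    refine Filter.mem_map.2 (Filter.univ_mem' fun n => ?_)
    simpa [ψ] using hv n)
  refine ⟨hyperfilter ℕ, (InnerProductSpace.toDual ℝ F).symm (WeakDual.toStrongDual ℓ),
    Nat.hyperfilter_le_atTop, ?_, fun w => ?_⟩
  · rw [LinearIsometryEquiv.norm_map]
    simpa using hℓ
  · have h1 : Tendsto ψ (hyperfilter ℕ) (𝓝 ℓ) := hlim
    have h2 := ((WeakDual.eval_continuous w).tendsto ℓ).comp h1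
    rw [InnerProductSpace.toDual_symm_apply]
    exact h2

lemma tendsto_integral_mul_of_sq {Ω : Set ℝ²} {h : ℕ → ℝ² → ℝ} {k φ : ℝ² → ℝ}
    (hh : ∀ n, MemLp (h n) 2 (volume.restrict Ω)) (hk : MemLp k 2 (volume.restrict Ω))
    (hφ : MemLp φ 2 (volume.restrict Ω)) (hlim : Tendsto (fun n => ∫ x in Ω, (h n x - k x) ^ 2) atTop (𝓝 0)) :
    Tendsto (fun n => ∫ x in Ω, h n x * φ x) atTop (𝓝 (∫ x in Ω, k x * φ x)) := by
  rw [tendsto_iff_norm_sub_tendsto_zero]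
  have hs := (hlim.const_mul (∫ x in Ω, φ x ^ 2)).sqrt
  rw [mul_zero, Real.sqrt_zero] at hs
  refine squeeze_zero (fun n => norm_nonneg _) (fun n => ?_) hs
  have j1 : Integrable (fun x => h n x * φ x) (volume.restrict Ω) := (hh n).integrable_mul hφ
  have j2 : Integrable (fun x => k x * φ x) (volume.restrict Ω) := hk.integrable_mul hφ
  rw [← integral_sub j1 j2, Real.norm_eq_abs]
  refine Real.abs_le_sqrt ?_
  have hd : MemLp (fun x => h n x - k x) 2 (volume.restrict Ω) := (hh n).sub hk
  have i1 := hd.integrable_sq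
  have i2 := hφ.integrable_sq
  have i3 : Integrable (fun x => (h n x - k x) * φ x) (volume.restrict Ω) := hd.integrable_mul hφ
  simp only [← sub_mul]
  set P := ∫ x in Ω, (h n x - k x) ^ 2
  set R := ∫ x in Ω, φ x ^ 2
  set L := ∫ x in Ω, (h n x - k x) * φ x
  have key : ∀ c : ℝ, 0 ≤ P * (c * c) + (2 * L) * c + R := fun c => by
    have : 0 ≤ ∫ x in Ω, (c * (h n x - k x) + φ x) ^ 2 := integral_nonneg fun x => sq_nonneg _
    have e : ∀ x, (c * (h n x - k x) + φ x) ^ 2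
      = c * c * (h n x - k x) ^ 2 + 2 * c * ((h n x - k x) * φ x) + φ x ^ 2 := fun x => by ring
    simp only [e] at this
    have i4 : Integrable (fun x => c * c * (h n x - k x) ^ 2 + 2 * c * ((h n x - k x) * φ x))
      (volume.restrict Ω) := (i1.const_mul _).add (i3.const_mul _)
    rw [integral_add i4 i2,
      integral_add (i1.const_mul _) (i3.const_mul _), integral_const_mul, integral_const_mul] at this
    linarith
  have := discrim_le_zero key
  rw [discrim] at this
  nlinarith

lemma exists_weakDeriv_of_limit {Ω : Set ℝ²} {i j : ℕ} {h : ℕ → ℝ² → ℝ} {k : ℝ² → ℝ}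
    {v : ℕ → ℝ² → ℝ} {M : ℝ} (hM : 0 ≤ M) (hh : ∀ n, MemLp (h n) 2 (volume.restrict Ω))
    (hk : MemLp k 2 (volume.restrict Ω)) (hlim : Tendsto (fun n => ∫ x in Ω, (h n x - k x) ^ 2) atTop (𝓝 0))
    (hv : ∀ n, IsWeakDeriv Ω i j (h n) (v n) ∧ ∫ x in Ω, v n x ^ 2 ≤ M ^ 2) :
    ∃ w, IsWeakDeriv Ω i j k w ∧ ∫ x in Ω, w x ^ 2 ≤ M ^ 2 := by
  have hinner : ∀ {f g : ℝ² → ℝ} (hf : MemLp f 2 (volume.restrict Ω))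
      (hg : MemLp g 2 (volume.restrict Ω)),
      inner ℝ (hf.toLp f) (hg.toLp g) = ∫ x in Ω, f x * g x := by
    intro f g hf hg
    rw [MeasureTheory.L2.inner_def]
    refine integral_congr_ae ?_
    filter_upwards [hf.coeFn_toLp, hg.coeFn_toLp] with x h1 h2
    rw [h1, h2]; simp [mul_comm]
  have hnorm : ∀ n, ‖(hv n).1.1.toLp (v n)‖ ≤ M := fun n => by
    refine abs_le_of_sq_le_sq' ?_ hM |>.2
    rw [← real_inner_self_eq_norm_sq, hinner]
    simpa only [sq] using (hv n).2
  obtain ⟨U, x, hU, hx, hw⟩ := exists_weak_limit hnorm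
  have hxm : MemLp (x : ℝ² → ℝ) 2 (volume.restrict Ω) := Lp.memLp x
  have hxe : hxm.toLp x = x := Lp.toLp_coeFn x hxm
  refine ⟨x, ⟨hxm, fun φ h1 h2 h3 => ?_⟩, ?_⟩
  · have ht : IsTest φ := ⟨h1, h2⟩
    have hφ := ht.memLp Ω
    have hd := ((ht.dZ_iterate j).dA_iterate i).memLp Ω
    have e1 := hw (hφ.toLp φ)
    rw [← hxe, hinner] at e1
    simp only [hinner] at e1
    have e2 := (tendsto_integral_mul_of_sq hh hk hd hlim).mono_left hU
    have e3 : ∀ n, ∫ x in Ω, h n x * (dA^[i] (dZ^[j] φ)) x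
        = (-1) ^ (i + j) * ∫ x in Ω, v n x * φ x := fun n => (hv n).1.2 φ h1 h2 h3
    simp only [e3] at e2
    exact tendsto_nhds_unique e2 (e1.const_mul _)
  · have e := hinner hxm hxm
    rw [hxe, real_inner_self_eq_norm_sq] at e
    simp only [sq] at e ⊢
    rw [← e]
    exact mul_self_le_mul_self (norm_nonneg _) hx

lemma dense_ae_Icc {T : ℝ} (hT : 0 < T) {p : ℝ → Prop} (hp : ∀ᵐ t ∂(volume.restrict (Icc 0 T)), p t)
    {t₀ : ℝ} (ht₀ : t₀ ∈ Icc 0 T) : ∃ τ : ℕ → ℝ, (∀ n, τ n ∈ Icc 0 T ∧ p (τ n)) ∧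
      Tendsto τ atTop (𝓝[Icc 0 T] t₀) := by
  rw [ae_restrict_iff' measurableSet_Icc] at hp
  have key : ∀ n : ℕ, ∃ τ, (τ ∈ Icc 0 T ∧ p τ) ∧ |τ - t₀| ≤ 1 / (n + 1) := by
    intro n
    by_contra! hcon
    have hpos : (0 : ℝ) < 1 / (n + 1) := by positivity
    have hsub : Icc 0 T ∩ Icc (t₀ - 1 / (n + 1)) (t₀ + 1 / (n + 1)) ⊆ {t | ¬(t ∈ Icc 0 T → p t)} := by
      intro t ht hpt
      exact absurd (abs_le.2 ⟨by linarith [ht.2.1], by linarith [ht.2.2]⟩)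
        (not_le.2 (hcon t ⟨ht.1, hpt ht.1⟩))
    have h0 := measure_mono_null hsub hp
    rw [Icc_inter_Icc, Real.volume_Icc, ENNReal.ofReal_eq_zero] at h0
    have : 0 ⊔ (t₀ - 1 / ((n : ℝ) + 1)) < T ⊓ (t₀ + 1 / ((n : ℝ) + 1)) := by
      rw [max_lt_iff, lt_min_iff, lt_min_iff]
      exact ⟨⟨hT, by linarith [ht₀.1]⟩, by linarith [ht₀.2], by linarith⟩
    linarith
  choose τ h1 h2 using key
  refine ⟨τ, h1, tendsto_nhdsWithin_iff.2 ⟨?_, Eventually.of_forall fun n => (h1 n).1⟩⟩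
  rw [tendsto_iff_norm_sub_tendsto_zero]
  exact squeeze_zero (fun n => norm_nonneg _) h2 tendsto_one_div_add_atTop_nhds_zero_nat

lemma weakDeriv_zero_ae {Ω : Set ℝ²} (hΩ : IsOpen Ω) {h : ℝ² → ℝ} (hh : MemSobolev Ω 0 h) :
    ∀ᵐ x ∂(volume.restrict Ω), weakDeriv Ω 0 0 h x = h x := by
  have hw := hh.isWeakDeriv (i := 0) (j := 0) le_rfl
  rw [ae_restrict_iff' hΩ.measurableSet]
  have hd : MemLp (fun x => weakDeriv Ω 0 0 h x - h x) 2 (volume.restrict Ω) := hw.1.sub hh.1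
  have hloc : LocallyIntegrableOn (fun x => weakDeriv Ω 0 0 h x - h x) Ω volume := by
    refine (locallyIntegrableOn_iff hΩ.isLocallyClosed).2 fun k hk hkc => ?_
    have : IsFiniteMeasure (volume.restrict k) :=
      ⟨by rw [Measure.restrict_apply_univ]; exact hkc.measure_lt_top⟩
    exact (hd.mono_measure (Measure.restrict_mono hk le_rfl)).integrable (by norm_num)
  have := hΩ.ae_eq_zero_of_integral_contDiff_smul_eq_zero hloc fun φ h1 h2 h3 => ?_
  · filter_upwards [this] with x hx hxΩ
    linarith [hx hxΩ]
  · have ht : IsTest φ := ⟨h1, h2⟩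
    have hsupp : ∀ x, x ∉ Ω → φ x • (weakDeriv Ω 0 0 h x - h x) = 0 := fun x hx => by
      rw [image_eq_zero_of_notMem_tsupport fun hx' => hx (h3 hx'), zero_smul]
    rw [← setIntegral_eq_integral_of_forall_compl_eq_zero hsupp]
    have e := hw.2 φ h1 h2 h3
    simp only [Function.iterate_zero, id, add_zero, pow_zero, one_mul] at e
    have e2 : ∀ x, φ x • (weakDeriv Ω 0 0 h x - h x) = weakDeriv Ω 0 0 h x * φ x - h x * φ x :=
      fun x => by rw [smul_eq_mul]; ring
    simp only [e2]
    rw [integral_sub (integrable_mul_test hw.1 ht) (integrable_mul_test hh.1 ht), e, sub_self]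

/-- A curve which is bounded in `H^{K+2}` almost everywhere and continuous in `H^0` is bounded in
`C^K` everywhere. -/
lemma isCk_of_linfty {a₀ a₁ z₀ z₁ : ℝ} (ha : a₀ < a₁) (hz : z₀ < z₁) {h : ℝ → ℝ² → ℝ} {K k : ℕ}
    {T : ℝ} (hT : 0 < T) (hk : K + 2 ≤ k) (hL : MemLinftySobolev T (Ioo a₀ a₁ ×ˢ Ioo z₀ z₁) k h)
    (hC : MemCSobolev T (Ioo a₀ a₁ ×ˢ Ioo z₀ z₁) 0 h)
    (hcont : ∀ t ∈ Icc 0 T, ContinuousOn (h t) (Ioo a₀ a₁ ×ˢ Ioo z₀ z₁)) :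
    ∃ M, ∀ t ∈ Icc 0 T, IsCk (Ioo a₀ a₁ ×ˢ Ioo z₀ z₁) K (h t) ∧
      ∀ i j, i + j ≤ K → ∀ x ∈ Ioo a₀ a₁ ×ˢ Ioo z₀ z₁, |pd i j (h t) x| ≤ M := by
  obtain ⟨M, hM⟩ := hL
  refine ⟨embConst a₀ a₁ z₀ z₁ * max M 0, fun t ht => ?_⟩
  obtain ⟨τ, hτ, hlim⟩ := dense_ae_Icc hT hM ht
  have h0 : Tendsto (fun n => ∫ x in Ioo a₀ a₁ ×ˢ Ioo z₀ z₁, (h (τ n) x - h t x) ^ 2) atTop (𝓝 0) := by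
    have e := ((hC.2 t ht).comp hlim).pow 2
    rw [zero_pow two_ne_zero] at e
    refine squeeze_zero (fun n => integral_nonneg fun x => sq_nonneg _) (fun n => ?_) e
    have hd := (hC.1 _ (hτ n).1).sub (hC.1 t ht)
    refine le_trans (le_of_eq ?_) (integral_sq_weakDeriv_le (i := 0) (j := 0) _ le_rfl)
    refine integral_congr_ae ?_
    filter_upwards [weakDeriv_zero_ae (isOpen_Ioo.prod isOpen_Ioo) hd] with x hx
    rw [hx]
  have hw : ∀ i j, i + j ≤ K + 2 → ∃ w, IsWeakDeriv (Ioo a₀ a₁ ×ˢ Ioo z₀ z₁) i j (h t) w ∧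
      ∫ x in Ioo a₀ a₁ ×ˢ Ioo z₀ z₁, w x ^ 2 ≤ (max M 0) ^ 2 := fun i j hij => by
    refine exists_weakDeriv_of_limit (le_max_right _ _) (fun n => (hC.1 _ (hτ n).1).1) (hC.1 t ht).1 h0
      (v := fun n => weakDeriv _ i j (h (τ n))) fun n => ⟨(hτ n).2.1.isWeakDeriv (hij.trans hk), ?_⟩
    refine (integral_sq_weakDeriv_le _ (hij.trans hk)).trans ?_
    exact pow_le_pow_left₀ (Real.sqrt_nonneg _) ((hτ n).2.2.trans (le_max_left _ _)) 2
  choose! w hw using hw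
  exact isCk_and_bound ha hz (hC.1 t ht).1 (hcont t ht) (le_max_right _ _) hw

end

section

/-! ### The coefficients -/

lemma contDiffOn_Icc_facts {a b : ℝ} (hab : a < b) {f : ℝ → ℝ} (hf : ContDiffOn ℝ ∞ f (Icc a b)) :
    ContDiffOn ℝ ∞ (derivWithin f (Icc a b)) (Icc a b) ∧
    (∀ z ∈ Ioo a b, HasDerivAt f (derivWithin f (Icc a b) z) z ∧
      derivWithin f (Icc a b) z = deriv f z) ∧ ∃ L, 0 ≤ L ∧ ∀ z ∈ Icc a b, |f z| ≤ L := by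
  refine ⟨hf.derivWithin (uniqueDiffOn_Icc hab) (by simp), fun z hz => ?_, ?_⟩
  · have h1 := ((hf.differentiableOn (by simp)) z (Ioo_subset_Icc_self hz)).hasDerivWithinAt.hasDerivAt
      (Icc_mem_nhds hz.1 hz.2)
    exact ⟨h1, h1.deriv.symm⟩
  · obtain ⟨L, hL⟩ := isCompact_Icc.exists_bound_of_continuousOn hf.continuousOn
    exact ⟨L, (norm_nonneg _).trans (hL a ⟨le_rfl, hab.le⟩), hL⟩

lemma abs_le_mul_dist {a b L : ℝ} {f : ℝ → ℝ} (hf : ContDiffOn ℝ ∞ f (Icc a b))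
    (hL : ∀ z ∈ Icc a b, |derivWithin f (Icc a b) z| ≤ L) {x y : ℝ} (hx : x ∈ Icc a b)
    (hy : y ∈ Icc a b) : |f y - f x| ≤ L * |y - x| :=
  (convex_Icc a b).norm_image_sub_le_of_norm_derivWithin_le (hf.differentiableOn (by simp)) hL hx hy

/-- The coefficients `D = σ²/2` and `μ`, with the derivatives which occur in the adjoint operator. -/
def Model.coeff (m : Model) : CoeffData where
  D z := m.σ z ^ 2 / 2
  D1 z := m.σ z * deriv m.σ z
  D2 z := deriv m.σ z ^ 2 + m.σ z * deriv (deriv m.σ) z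
  μ := m.μ
  μ1 := deriv m.μ

/-- The coefficients of the model are bounded by `C`. -/
abbrev Model.CoeffRegular (m : Model) (C : ℝ) : Prop := m.coeff.Regular m.zMin m.zMax C

lemma Model.Admissible.exists_coeff_regular {m : Model} (hm : m.Admissible) : ∃ C, m.CoeffRegular C := by
  have hlt := hm.zMin_lt_zMax
  obtain ⟨s1, s2, Lσ0, hLσ0, s3⟩ := contDiffOn_Icc_facts hlt hm.σ_smooth
  obtain ⟨t1, t2, Lσ1, hLσ1, t3⟩ := contDiffOn_Icc_facts hlt s1
  obtain ⟨v1, v2, Lσ2, hLσ2, v3⟩ := contDiffOn_Icc_facts hlt t1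
  obtain ⟨m1, m2, Lμ0, hLμ0, m3⟩ := contDiffOn_Icc_facts hlt hm.μ_smooth
  obtain ⟨n1, n2, Lμ1, hLμ1, n3⟩ := contDiffOn_Icc_facts hlt m1
  obtain ⟨L, hL⟩ : ∃ L, L = Lσ0 + Lσ1 + Lσ2 + Lμ0 + Lμ1 := ⟨_, rfl⟩
  have hL0 : 0 ≤ L := by linarith
  have hIcc : ∀ {z}, z ∈ 𝕁(m) → z ∈ Icc m.zMin m.zMax := fun h => Ioo_subset_Icc_self h
  have eσ' : ∀ z ∈ 𝕁(m), derivWithin m.σ (Icc m.zMin m.zMax) z = deriv m.σ z :=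
    fun z hz => (s2 z hz).2
  have hσ'd : ∀ z ∈ 𝕁(m), HasDerivAt (deriv m.σ) (deriv (deriv m.σ) z) z ∧
      deriv (deriv m.σ) z
        = derivWithin (derivWithin m.σ (Icc m.zMin m.zMax)) (Icc m.zMin m.zMax) z := by
    intro z hz
    have h : HasDerivAt (deriv m.σ)
        (derivWithin (derivWithin m.σ (Icc m.zMin m.zMax)) (Icc m.zMin m.zMax) z) z := by
      refine (t2 z hz).1.congr_of_eventuallyEq ?_
      filter_upwards [Ioo_mem_nhds hz.1 hz.2] with x hx using (eσ' x hx).symm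
    exact ⟨by rw [h.deriv]; exact h, h.deriv⟩
  have bσ1 : ∀ z ∈ 𝕁(m), |deriv m.σ z| ≤ L := fun z hz => by
    rw [← eσ' z hz]; exact (t3 z (hIcc hz)).trans (by linarith)
  have bσ2 : ∀ z ∈ 𝕁(m), |deriv (deriv m.σ) z| ≤ L := fun z hz => by
    rw [(hσ'd z hz).2]; exact (v3 z (hIcc hz)).trans (by linarith)
  have bμ1 : ∀ z ∈ 𝕁(m), |deriv m.μ z| ≤ L := fun z hz => by
    rw [← (m2 z hz).2]; exact (n3 z (hIcc hz)).trans (by linarith)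
  have hl : m.zMin ∈ Icc m.zMin m.zMax := ⟨le_rfl, hlt.le⟩
  have hr : m.zMax ∈ Icc m.zMin m.zMax := ⟨hlt.le, le_rfl⟩
  have t3' : ∀ z ∈ Icc m.zMin m.zMax, |derivWithin m.σ (Icc m.zMin m.zMax) z| ≤ L := fun z hz =>
    (t3 z hz).trans (by linarith)
  have n3' : ∀ z ∈ Icc m.zMin m.zMax, |derivWithin m.μ (Icc m.zMin m.zMax) z| ≤ L := fun z hz =>
    (n3 z hz).trans (by linarith)
  have lip : ∀ f : ℝ → ℝ, ContDiffOn ℝ ∞ f (Icc m.zMin m.zMax) → f m.zMin = 0 → f m.zMax = 0 →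
      (∀ z ∈ Icc m.zMin m.zMax, |derivWithin f (Icc m.zMin m.zMax) z| ≤ L) →
      ∀ z ∈ 𝕁(m), |f z| ≤ L * (z - m.zMin) ∧ |f z| ≤ L * (m.zMax - z) := by
    intro f hf f0 f1 hb z hz
    have e1 := abs_le_mul_dist hf hb hl (hIcc hz)
    have e2 := abs_le_mul_dist hf hb hr (hIcc hz)
    rw [f0, sub_zero, abs_of_pos (by linarith [hz.1] : 0 < z - m.zMin)] at e1
    rw [f1, sub_zero, abs_sub_comm z, abs_of_pos (by linarith [hz.2] : 0 < m.zMax - z)] at e2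
    exact ⟨e1, e2⟩
  have lσ := lip m.σ hm.σ_smooth hm.σ_zMin hm.σ_zMax t3'
  have lμ := lip m.μ hm.μ_smooth hm.μ_zMin hm.μ_zMax n3'
  have bσ0 : ∀ z ∈ 𝕁(m), |m.σ z| ≤ L := fun z hz => (s3 z (hIcc hz)).trans (by linarith)
  have hC : 0 ≤ 2 * L ^ 2 + L := by positivity
  have hLC : L ≤ 2 * L ^ 2 + L := by nlinarith [sq_nonneg L]
  have hLC2 : L ^ 2 ≤ 2 * L ^ 2 + L := by nlinarith [sq_nonneg L]
  have sqb : ∀ z, ∀ d, 0 ≤ d → |m.σ z| ≤ L * d → m.σ z ^ 2 / 2 ≤ (2 * L ^ 2 + L) * d ^ 2 := by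
    intro z d hd h
    have : m.σ z ^ 2 ≤ (L * d) ^ 2 := sq_le_sq' (by linarith [neg_abs_le (m.σ z)]) ((le_abs_self _).trans h)
    nlinarith [sq_nonneg d, sq_nonneg L, sq_nonneg (m.σ z), mul_nonneg hL0 (sq_nonneg d),
      mul_nonneg (sq_nonneg L) (sq_nonneg d)]
  have sqb' : ∀ z ∈ 𝕁(m), ∀ d, 0 ≤ d → |m.σ z| ≤ L * d →
      |m.σ z ^ 2 / 2| ≤ (2 * L ^ 2 + L) * d := by
    intro z hz d hd h
    rw [abs_div, abs_pow, abs_two]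
    nlinarith [mul_le_mul h (bσ0 z hz) (abs_nonneg _) (by positivity), sq_nonneg L,
      mul_nonneg hL0 hd, mul_nonneg (sq_nonneg L) hd, abs_nonneg (m.σ z)]
  have d1b : ∀ z ∈ 𝕁(m), ∀ d, 0 ≤ d → |m.σ z| ≤ L * d →
      |m.σ z * deriv m.σ z| ≤ (2 * L ^ 2 + L) * d := by
    intro z hz d hd h
    rw [abs_mul]
    nlinarith [mul_le_mul h (bσ1 z hz) (abs_nonneg _) (by positivity), 
      mul_nonneg hL0 hd, mul_nonneg (sq_nonneg L) hd]
  have hpl : ∀ {z}, z ∈ 𝕁(m) → 0 ≤ z - m.zMin := fun h => by linarith [h.1]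
  have hpr : ∀ {z}, z ∈ 𝕁(m) → 0 ≤ m.zMax - z := fun h => by linarith [h.2]
  refine ⟨2 * L ^ 2 + L, hlt, hC, fun z hz => ?_, fun z hz => ?_, fun z hz => ?_, ?_, ?_,
    ⟨fun z hz => ?_, fun z hz => ?_, fun z hz => ?_, fun z hz => ?_, fun z hz => ?_⟩,
    fun z hz => ?_, fun z hz => ?_, fun z hz => ?_, fun z hz => ?_, fun z hz => ?_, fun z hz => ?_,
    fun z hz => ?_, fun z hz => ?_, fun z hz => ?_⟩
  · have h := (s2 z hz).1
    rw [eσ' z hz] at h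
    refine ((h.fun_pow 2).div_const 2).congr_deriv ?_
    simp [Model.coeff]; ring
  · have h := (s2 z hz).1
    rw [eσ' z hz] at h
    refine (h.fun_mul (hσ'd z hz).1).congr_deriv ?_
    simp [Model.coeff]; ring
  · have h := (m2 z hz).1
    rw [(m2 z hz).2] at h
    exact h
  · have c1 : ContinuousOn (deriv m.σ) (𝕁(m)) := fun z hz =>
      (hσ'd z hz).1.continuousAt.continuousWithinAt
    have c0 : ContinuousOn m.σ (𝕁(m)) := fun z hz =>
      (s2 z hz).1.continuousAt.continuousWithinAt
    have c2 : ContinuousOn (deriv (deriv m.σ)) (𝕁(m)) :=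
      (t1.continuousOn.mono Ioo_subset_Icc_self).congr fun z hz => (hσ'd z hz).2
    exact (c1.pow 2).add (c0.mul c2)
  · exact (m1.continuousOn.mono Ioo_subset_Icc_self).congr fun z hz => (m2 z hz).2.symm
  · exact div_nonneg (sq_nonneg _) zero_le_two
  · exact sqb z _ (hpl hz) (lσ z hz).1
  · exact sqb z _ (hpr hz) (lσ z hz).2
  · exact (lμ z hz).1.trans (mul_le_mul_of_nonneg_right hLC (hpl hz))
  · exact (lμ z hz).2.trans (mul_le_mul_of_nonneg_right hLC (hpr hz))
  · exact sqb' z hz _ (hpl hz) (lσ z hz).1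
  · exact sqb' z hz _ (hpr hz) (lσ z hz).2
  · exact d1b z hz _ (hpl hz) (lσ z hz).1
  · exact d1b z hz _ (hpr hz) (lσ z hz).2
  · have := sqb' z hz 1 zero_le_one (by simpa using bσ0 z hz)
    rwa [mul_one] at this
  · have := d1b z hz 1 zero_le_one (by simpa using bσ0 z hz)
    rwa [mul_one] at this
  · have e1 : |deriv m.σ z ^ 2| ≤ L ^ 2 := by
      rw [abs_pow]; exact pow_le_pow_left₀ (abs_nonneg _) (bσ1 z hz) 2
    have e2 : |m.σ z * deriv (deriv m.σ) z| ≤ L * L := by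
      rw [abs_mul]; exact mul_le_mul (bσ0 z hz) (bσ2 z hz) (abs_nonneg _) hL0
    refine (abs_add_le _ _).trans ?_
    nlinarith
  · exact (m3 z (hIcc hz)).trans (by linarith)
  · exact (bμ1 z hz).trans hLC

/-! ### Extension by zero in the wealth variable -/

/-- The extension of a function on `(-R, R) × (zl, zr)` by zero. -/
def ext (R : ℝ) (h : ℝ² → ℝ) (a z : ℝ) : ℝ := if |a| < R then h (a, z) else 0

notation "𝔼(" m ")" => ext (3 * Model.A m)

section Extension

variable {R R' zl zr : ℝ} {h : ℝ² → ℝ}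

lemma ext_of_lt {a z : ℝ} (ha : |a| < R) : ext R h a z = h (a, z) := if_pos ha

lemma ext_of_ge {a z : ℝ} (hs : ∀ a, ∀ z ∈ Ioo zl zr, R' < |a| → |a| < R → h (a, z) = 0)
    (hz : z ∈ Ioo zl zr) (ha : R' < |a|) : ext R h a z = 0 := by
  unfold ext
  split_ifs with h1
  · exact hs a z hz ha h1
  · rfl

lemma mem_box {a z : ℝ} (ha : |a| < R) (hz : z ∈ Ioo zl zr) : (a, z) ∈ box R zl zr :=
  ⟨abs_lt.1 ha, hz⟩

lemma eventually_abs_lt {a : ℝ} (ha : |a| < R) : ∀ᶠ a' in 𝓝 a, |a'| < R :=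
  (continuous_abs.isOpen_preimage _ isOpen_Iio).mem_nhds (show a ∈ abs ⁻¹' Iio R from ha)

lemma eventually_lt_abs {a : ℝ} (ha : R < |a|) : ∀ᶠ a' in 𝓝 a, R < |a'| :=
  (continuous_abs.isOpen_preimage _ isOpen_Ioi).mem_nhds (show a ∈ abs ⁻¹' Ioi R from ha)

lemma continuousOn_ext (hR : R' < R) (hc : ContinuousOn h (box R zl zr))
    (hs : ∀ a, ∀ z ∈ Ioo zl zr, R' < |a| → |a| < R → h (a, z) = 0) :
    ContinuousOn (fun x : ℝ² => ext R h x.1 x.2) (univ ×ˢ Ioo zl zr) := by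
  rintro ⟨a, z⟩ ⟨-, hz⟩
  refine ContinuousAt.continuousWithinAt ?_
  have hzn : ∀ᶠ x : ℝ² in 𝓝 (a, z), x.2 ∈ Ioo zl zr :=
    continuous_snd.continuousAt.eventually (Ioo_mem_nhds hz.1 hz.2)
  rcases lt_or_ge |a| R with ha | ha
  · refine (hc.continuousAt (isOpen_box.mem_nhds (mem_box ha hz))).congr ?_
    have : ∀ᶠ x : ℝ² in 𝓝 (a, z), |x.1| < R :=
      continuous_fst.continuousAt.eventually (eventually_abs_lt ha)
    filter_upwards [this] with x hx using (ext_of_lt hx).symm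
  · refine (continuousAt_const (y := (0 : ℝ))).congr ?_
    have : ∀ᶠ x : ℝ² in 𝓝 (a, z), R' < |x.1| :=
      continuous_fst.continuousAt.eventually (eventually_lt_abs (hR.trans_le ha))
    filter_upwards [this, hzn] with x hx hxz using (ext_of_ge hs hxz hx).symm

lemma IsCk.pd_eq_zero {K : ℕ} (hk : IsCk (box R zl zr) K h)
    (hs : ∀ a, ∀ z ∈ Ioo zl zr, R' < |a| → |a| < R → h (a, z) = 0) {i j : ℕ} (hij : i + j ≤ K) :
    ∀ a, ∀ z ∈ Ioo zl zr, R' < |a| → |a| < R → pd i j h (a, z) = 0 := by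
  have hz : ∀ j, j ≤ K → ∀ a, ∀ z ∈ Ioo zl zr, R' < |a| → |a| < R → pd 0 j h (a, z) = 0 := by
    intro j
    induction j with
    | zero => exact fun _ => hs
    | succ j ih =>
      intro hj a z hz h1 h2
      refine (((hk 0 j (by omega)).2 (by omega) _ (mem_box h2 hz)).2).unique
        ((hasDerivAt_const z (0 : ℝ)).congr_of_eventuallyEq ?_)
      filter_upwards [Ioo_mem_nhds hz.1 hz.2] with z' hz' using ih (by omega) a z' hz' h1 h2
  revert j
  induction i with
  | zero => exact fun {j} hj => hz j (by omega)
  | succ i ih =>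
    intro j hj a z hz h1 h2
    refine (((hk i j (by omega)).2 (by omega) _ (mem_box h2 hz)).1).unique
      ((hasDerivAt_const a (0 : ℝ)).congr_of_eventuallyEq ?_)
    filter_upwards [eventually_lt_abs h1, eventually_abs_lt h2] with a' h1' h2'
      using ih (by omega) a' z hz h1' h2'

/-- The extended partial derivatives are the partial derivatives of the extended function. -/
lemma IsCk.ext_facts {K : ℕ} {M : ℝ} (hR : R' < R) (hM : 0 ≤ M) (hk : IsCk (box R zl zr) K h)
    (hb : ∀ i j, i + j ≤ K → ∀ x ∈ box R zl zr, |pd i j h x| ≤ M)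
    (hs : ∀ a, ∀ z ∈ Ioo zl zr, R' < |a| → |a| < R → h (a, z) = 0) {i j : ℕ} (hij : i + j ≤ K) :
    ContinuousOn (fun x : ℝ² => ext R (pd i j h) x.1 x.2) (univ ×ˢ Ioo zl zr) ∧
    (∀ a, ∀ z ∈ Ioo zl zr, |ext R (pd i j h) a z| ≤ M) ∧
    (∀ a, ∀ z ∈ Ioo zl zr, R' < |a| → ext R (pd i j h) a z = 0) ∧ (i + j < K → ∀ a, ∀ z ∈ Ioo zl zr,
      HasDerivAt (fun a => ext R (pd i j h) a z) (ext R (pd (i + 1) j h) a z) a ∧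
      HasDerivAt (fun z => ext R (pd i j h) a z) (ext R (pd i (j + 1) h) a z) z) := by
  have hz0 := fun {i j} (hij : i + j ≤ K) => hk.pd_eq_zero hs (i := i) (j := j) hij
  refine ⟨continuousOn_ext hR (hk i j hij).1 (hz0 hij), fun a z hz => ?_,
    fun a z hz ha => ext_of_ge (hz0 hij) hz ha, fun hlt a z hz => ?_⟩
  · unfold ext
    split_ifs with h1
    · exact hb i j hij _ (mem_box h1 hz)
    · simpa using hM
  · rcases lt_or_ge |a| R with ha | ha
    · have hd := (hk i j hij).2 hlt _ (mem_box ha hz)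
      rw [ext_of_lt ha, ext_of_lt ha]
      refine ⟨hd.1.congr_of_eventuallyEq ?_, hd.2.congr_of_eventuallyEq ?_⟩
      · filter_upwards [eventually_abs_lt ha] with a' ha' using ext_of_lt ha'
      · exact Eventually.of_forall fun z' => ext_of_lt ha
    · have ha' := hR.trans_le ha
      rw [ext_of_ge (hz0 (show i + 1 + j ≤ K by omega)) hz ha',
        ext_of_ge (hz0 (show i + (j + 1) ≤ K by omega)) hz ha']
      refine ⟨(hasDerivAt_const a (0 : ℝ)).congr_of_eventuallyEq ?_,
        (hasDerivAt_const z (0 : ℝ)).congr_of_eventuallyEq ?_⟩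
      · filter_upwards [eventually_lt_abs ha'] with a'' ha'' using ext_of_ge (hz0 hij) hz ha''
      · filter_upwards [Ioo_mem_nhds hz.1 hz.2] with z' hz' using ext_of_ge (hz0 hij) hz' ha'

lemma abs_ext_sub_le {k : ℝ² → ℝ} {ε : ℝ} (hε : 0 ≤ ε)
    (hb : ∀ x ∈ box R zl zr, |h x - k x| ≤ ε) (a : ℝ) {z : ℝ} (hz : z ∈ Ioo zl zr) :
    |ext R h a z - ext R k a z| ≤ ε := by
  unfold ext
  split_ifs with h1
  · exact hb _ (mem_box h1 hz)
  · simpa using hε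

end Extension

lemma continuousOn_of_equicontinuous {F : ℝ → ℝ → ℝ → ℝ} {I J : Set ℝ}
    (hc : ∀ t ∈ I, ContinuousOn (fun x : ℝ² => F t x.1 x.2) (univ ×ˢ J))
    (he : ∀ t₀ ∈ I, ∀ ε > 0, ∀ᶠ t in 𝓝[I] t₀, ∀ a, ∀ z ∈ J, |F t a z - F t₀ a z| ≤ ε) :
    ContinuousOn (fun x : ℝ × ℝ × ℝ => F x.1 x.2.1 x.2.2) (I ×ˢ univ ×ˢ J) := by
  rintro ⟨t₀, a₀, z₀⟩ ⟨ht₀, -, hz₀⟩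
  rw [ContinuousWithinAt, Metric.tendsto_nhds]
  intro ε hε
  have h1 := he t₀ ht₀ (ε / 2) (by linarith)
  have h2 := Metric.tendsto_nhds.1 (hc t₀ ht₀ (a₀, z₀) ⟨mem_univ _, hz₀⟩) (ε / 2) (by linarith)
  rw [nhdsWithin_prod_eq]
  filter_upwards [h1.prod_mk (h2.and self_mem_nhdsWithin)] with x hx
  have e1 := hx.1 x.2.1 x.2.2 hx.2.2.2
  have e2 := hx.2.1
  rw [Real.dist_eq] at e2 ⊢
  calc |F x.1 x.2.1 x.2.2 - F t₀ a₀ z₀|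
      ≤ |F x.1 x.2.1 x.2.2 - F t₀ x.2.1 x.2.2| + |F t₀ x.2.1 x.2.2 - F t₀ a₀ z₀| := abs_sub_le _ _ _
    _ < ε := by linarith

end

/-! ### Solutions as functions on a strip -/

/-- The function of time and space with the given slices, extended by zero in the wealth variable. -/
def pathOf (R : ℝ) (h : ℝ → ℝ² → ℝ) (ht : ℝ → ℝ → ℝ → ℝ) : StripPath where
  val t := ext R (h t)
  da t := ext R (pd 1 0 (h t))
  dz t := ext R (pd 0 1 (h t))
  dzz t := ext R (pd 0 2 (h t))
  dt := ht

/-- A function of space, considered as independent of time. -/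
def static (R : ℝ) (h : ℝ² → ℝ) : StripPath := pathOf R (fun _ => h) fun _ _ _ => 0

notation "𝕊(" m ")" => static (3 * Model.A m)

/-- The equations of the system on the strip `ℝ × (zl, zr)`. -/
structure Model.RegSol (m : Model) (T M : ℝ) (yT g₀ : ℝ → ℝ → ℝ) (y g : StripPath) (f r : ℝ → ℝ) :
    Prop where
  T_pos : 0 < T
  y_reg : y.Regular m.zMin m.zMax T M
  g_reg : g.Regular m.zMin m.zMax T M
  y_supp : ∀ t ∈ Icc 0 T, ∀ a, ∀ z ∈ 𝕁(m), 2 * m.A ≤ |a| → y.val t a z = 0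
  g_supp : ∀ t ∈ Icc 0 T, ∀ a, ∀ z ∈ 𝕁(m), 2 * m.A ≤ |a| → g.val t a z = 0
  y_da_cont : ∀ t₀ ∈ Icc 0 T, ∀ ε > 0, ∀ᶠ t in 𝓝[Icc 0 T] t₀, ∀ a, ∀ z ∈ 𝕁(m),
    |y.da t a z - y.da t₀ a z| ≤ ε
  f_cont : ContinuousOn f (Icc 0 T)
  pos : ∃ δ > 0, ∀ t ∈ Icc 0 T, ∀ a, ∀ z ∈ 𝕁(m), δ ≤ y.val t a z + f t * m.wInf
  f_deriv : ∀ t ∈ Ioo 0 T, HasDerivAt f ((m.ρ - r t) * f t) t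
  r_bdd : ∀ t ∈ Ioo 0 T, |r t| ≤ M
  f_T : f T = 1
  y_eq : ∀ t ∈ Ioo 0 T, ∀ a, ∀ z ∈ 𝕁(m), y.dt t a z
    = -(m.coeff.D z * y.dzz t a z + m.coeff.μ z * y.dz t a z + (r t - m.ρ) * y.val t a z
        + (z + r t * a + Hp m.u (y.val t a z + f t * m.wInf)) * y.da t a z)
  g_eq : ∀ t ∈ Ioo 0 T, ∀ a, ∀ z ∈ 𝕁(m), g.dt t a z
    = m.coeff.fwd z (g.val t a z) (g.dz t a z) (g.dzz t a z)
      - ((r t + Hpp m.u (y.val t a z + f t * m.wInf) * y.da t a z) * g.val t a z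
        + (z + r t * a + Hp m.u (y.val t a z + f t * m.wInf)) * g.da t a z)
  rate_eq : ∀ t ∈ Ioo 0 T, r t =
    (-(∫ x in 𝔹(m),
        x.2 * (m.coeff.μ1 x.2 * g.val t x.1 x.2 + m.coeff.μ x.2 * g.dz t x.1 x.2))
      + (∫ x in 𝔹(m),
        g.val t x.1 x.2 * Hpp m.u (y.val t x.1 x.2 + f t * m.wInf) *
          (-(m.coeff.D x.2) * y.dzz t x.1 x.2 - m.coeff.μ x.2 * y.dz t x.1 x.2
            - Hp m.u (y.val t x.1 x.2 + f t * m.wInf) * y.da t x.1 x.2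
            + m.ρ * (y.val t x.1 x.2 + f t * m.wInf)))
      + ∫ x in 𝔹(m), Hp m.u (y.val t x.1 x.2 + f t * m.wInf) *
          (m.coeff.fwd x.2 (g.val t x.1 x.2) (g.dz t x.1 x.2) (g.dzz t x.1 x.2)
            - (Hpp m.u (y.val t x.1 x.2 + f t * m.wInf) * y.da t x.1 x.2 * g.val t x.1 x.2
              + Hp m.u (y.val t x.1 x.2 + f t * m.wInf) * g.da t x.1 x.2)))
    / ∫ x in 𝔹(m), g.val t x.1 x.2 *
        Hpp m.u (y.val t x.1 x.2 + f t * m.wInf) * (y.val t x.1 x.2 + f t * m.wInf)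
  y_T : ∀ a, ∀ z ∈ 𝕁(m), y.val T a z = yT a z
  g_0 : ∀ a, ∀ z ∈ 𝕁(m), g.val 0 a z = g₀ a z

lemma IsUtility.hasDerivAt_Hp {u : ℝ → ℝ} (hu : IsUtility u) {p : ℝ} (hp : 0 < p) :
    HasDerivAt (Hp u) (Hpp u p) p :=
  ((hu.Hp_props.1.contDiffAt (Ioi_mem_nhds hp)).differentiableAt (by simp)).hasDerivAt

lemma IsUtility.contDiffOn_Hpp {u : ℝ → ℝ} (hu : IsUtility u) : ContDiffOn ℝ ∞ (Hpp u) (Ioi 0) :=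
  ((contDiffOn_infty_iff_deriv_of_isOpen isOpen_Ioi).1 hu.Hp_props.1).2

lemma IsUtility.continuousOn_Hp {u : ℝ → ℝ} (hu : IsUtility u) : ContinuousOn (Hp u) (Ioi 0) :=
  hu.Hp_props.1.continuousOn

lemma IsUtility.continuousOn_Hpp {u : ℝ → ℝ} (hu : IsUtility u) : ContinuousOn (Hpp u) (Ioi 0) :=
  hu.contDiffOn_Hpp.continuousOn

lemma exists_bound_comp {φ : ℝ → ℝ} (hφ : ContinuousOn φ (Ioi 0)) {δ : ℝ} (hδ : 0 < δ) (B : ℝ) :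
    ∃ L, 0 ≤ L ∧ ∀ p, δ ≤ p → p ≤ B → |φ p| ≤ L := by
  obtain ⟨L, hL⟩ := isCompact_Icc.exists_bound_of_continuousOn
    (hφ.mono fun x (hx : x ∈ Icc δ B) => hδ.trans_le hx.1)
  exact ⟨max L 0, le_max_right _ _, fun p h1 h2 => (hL p ⟨h1, h2⟩).trans (le_max_left _ _)⟩

lemma Model.eq_zero_of_aSupport {m : Model} {h : ℝ² → ℝ} {R : ℝ} (hs : m.aSupport h ⊆ Ioo (-R) R)
    {a z : ℝ} (ha : R ≤ |a|) (ha' : |a| < 3 * m.A) (hz : z ∈ 𝕁(m)) : h (a, z) = 0 := by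
  by_contra hne
  have hmem : a ∈ m.aSupport h := subset_closure
    ⟨z, ⟨⟨(abs_lt.1 ha').1.le, (abs_lt.1 ha').2.le⟩, Ioo_subset_Icc_self hz⟩, hne⟩
  exact absurd (abs_lt.2 (hs hmem)) (not_lt.2 ha)

lemma Model.setIntegral_D (m : Model) (F : ℝ² → ℝ) : ∫ x in m.D, F x = ∫ x in 𝔹(m), F x := by
  refine setIntegral_congr_set ?_
  rw [Model.D, box, Measure.volume_eq_prod]
  exact (Measure.set_prod_ae_eq Ioo_ae_eq_Icc Ioo_ae_eq_Icc).symm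

lemma static_regular {R R' N zl zr : ℝ} {h : ℝ² → ℝ} (hR : R' < R) (hN : 0 ≤ N) (hk : IsCk (box R zl zr) 2 h)
    (hb : ∀ i j, i + j ≤ 2 → ∀ x ∈ box R zl zr, |pd i j h x| ≤ N)
    (hs : ∀ a, ∀ z ∈ Ioo zl zr, R' < |a| → |a| < R → h (a, z) = 0) (T : ℝ) :
    (static R h).Regular zl zr T N := by
  have e := fun {i j} (hij : i + j ≤ 2) => hk.ext_facts hR hN hb hs (i := i) (j := j) hij
  have hmap : ContinuousOn (fun x : ℝ × ℝ × ℝ => ((x.2.1, x.2.2) : ℝ²))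
    (Icc 0 T ×ˢ univ ×ˢ Ioo zl zr) := by fun_prop
  exact
  { cont := (e (i := 0) (j := 0) (by norm_num)).1.comp hmap fun x hx => hx.2
    cont_da := (e (i := 1) (j := 0) (by norm_num)).1.comp hmap fun x hx => hx.2
    cont_dz := fun _ _ => (e (i := 0) (j := 1) (by norm_num)).1
    cont_dzz := fun _ _ => (e (i := 0) (j := 2) (by norm_num)).1
    cont_dt := fun _ _ => continuousOn_const
    has_da := fun _ _ a z hz => ((e (i := 0) (j := 0) (by norm_num)).2.2.2 (by norm_num) a z hz).1
    has_dz := fun _ _ a z hz => ((e (i := 0) (j := 0) (by norm_num)).2.2.2 (by norm_num) a z hz).2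
    has_dzz := fun _ _ a z hz => ((e (i := 0) (j := 1) (by norm_num)).2.2.2 (by norm_num) a z hz).2
    has_dt := fun _ _ _ _ _ => hasDerivAt_const _ _
    bound := fun _ _ => (e (i := 0) (j := 0) (by norm_num)).2.1
    bound_da := fun _ _ => (e (i := 1) (j := 0) (by norm_num)).2.1
    bound_dz := fun _ _ => (e (i := 0) (j := 1) (by norm_num)).2.1
    bound_dzz := fun _ _ => (e (i := 0) (j := 2) (by norm_num)).2.1
    bound_dt := fun _ _ _ _ _ => by simpa [static, pathOf] using hN }

/-- A derivative in `a` gives a Lipschitz bound. -/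
lemma abs_sub_le_of_hasDerivAt {F F' : ℝ → ℝ} {N : ℝ} (h : ∀ a, HasDerivAt F (F' a) a)
    (hb : ∀ a, |F' a| ≤ N) (x y : ℝ) : |F x - F y| ≤ N * |x - y| :=
  (convex_univ).norm_image_sub_le_of_norm_hasDerivWithin_le (fun a _ => (h a).hasDerivWithinAt)
    (fun a _ => hb a) (mem_univ y) (mem_univ x)

lemma static_lipschitz {R R' N zl zr : ℝ} {h : ℝ² → ℝ} (hR : R' < R) (hN : 0 ≤ N)
    (hk : IsCk (box R zl zr) 3 h) (hb : ∀ i j, i + j ≤ 3 → ∀ x ∈ box R zl zr, |pd i j h x| ≤ N)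
    (hs : ∀ a, ∀ z ∈ Ioo zl zr, R' < |a| → |a| < R → h (a, z) = 0) {t : ℝ} : ∀ a b, ∀ z ∈ Ioo zl zr,
      |(static R h).da t a z - (static R h).da t b z| ≤ N * |a - b| ∧
      |(static R h).dz t a z - (static R h).dz t b z| ≤ N * |a - b| ∧
      |(static R h).dzz t a z - (static R h).dzz t b z| ≤ N * |a - b| := by
  have e := fun {i j} (hij : i + j ≤ 3) => hk.ext_facts hR hN hb hs (i := i) (j := j) hij
  intro a b z hz
  refine ⟨?_, ?_, ?_⟩
  · exact abs_sub_le_of_hasDerivAt (fun a => ((e (i := 1) (j := 0) (by norm_num)).2.2.2 (by norm_num) a z hz).1)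
      (fun a => (e (i := 2) (j := 0) (by norm_num)).2.1 a z hz) a b
  · exact abs_sub_le_of_hasDerivAt (fun a => ((e (i := 0) (j := 1) (by norm_num)).2.2.2 (by norm_num) a z hz).1)
      (fun a => (e (i := 1) (j := 1) (by norm_num)).2.1 a z hz) a b
  · exact abs_sub_le_of_hasDerivAt (fun a => ((e (i := 0) (j := 2) (by norm_num)).2.2.2 (by norm_num) a z hz).1)
      (fun a => (e (i := 1) (j := 2) (by norm_num)).2.1 a z hz) a b

lemma Model.Ω_subset_D (m : Model) : m.Ω ⊆ m.D := prod_mono Ioo_subset_Icc_self Ioo_subset_Icc_self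

namespace Model.IsSolution

variable {m : Model} {s : ℕ} {yT g₀ : ℝ² → ℝ} {T : ℝ} {y g : ℝ → ℝ² → ℝ} {f : ℝ → ℝ}

lemma exists_pos_bound (hm : m.Admissible) (hs : 4 ≤ s) (h : m.IsSolution s yT g₀ T y g f) :
    ∃ δ > 0, ∀ t ∈ Icc 0 T, ∀ x ∈ m.Ω, δ ≤ y t x + f t * m.wInf := by
  have hA := hm.A_pos
  have hyc : ∀ t ∈ Icc 0 T, ContinuousOn (y t) m.Ω := fun t ht => (h.y_cont t ht).mono m.Ω_subset_D
  have hy := (h.y_C 1 (by omega)).continuous_pd (K := 0) (by linarith) hm.zMin_lt_zMax hyc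
  have hDc : IsCompact m.D := isCompact_Icc.prod isCompact_Icc
  have hDn : m.D.Nonempty := ⟨(0, m.zMin), ⟨by simp only; linarith, by simp only; linarith⟩, le_rfl,
    hm.zMin_lt_zMax.le⟩
  refine isCompact_Icc.induction_on (p := fun S => ∃ δ > 0, ∀ t ∈ S, ∀ x ∈ m.Ω,
    δ ≤ y t x + f t * m.wInf) ⟨1, one_pos, by simp⟩ ?_ ?_ ?_
  · exact fun S S' hS ⟨δ, hδ, hb⟩ => ⟨δ, hδ, fun t ht => hb t (hS ht)⟩
  · rintro S S' ⟨δ, hδ, hb⟩ ⟨δ', hδ', hb'⟩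
    refine ⟨min δ δ', lt_min hδ hδ', fun t ht x hx => ?_⟩
    rcases ht with ht | ht
    · exact (min_le_left _ _).trans (hb t ht x hx)
    · exact (min_le_right _ _).trans (hb' t ht x hx)
  · intro t₀ ht₀
    obtain ⟨x₀, hx₀, hmin⟩ := hDc.exists_isMinOn hDn ((h.y_cont t₀ ht₀).add continuousOn_const
      (g := fun _ => f t₀ * m.wInf))
    set δ := y t₀ x₀ + f t₀ * m.wInf with hδ
    have hδ0 : 0 < δ := h.pos t₀ ht₀ x₀ hx₀
    have hfc : ∀ᶠ t in 𝓝[Icc 0 T] t₀, |f t * m.wInf - f t₀ * m.wInf| < δ / 4 :=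
      Metric.tendsto_nhds.1 ((h.f_C1.continuousOn.mul continuousOn_const) t₀ ht₀) (δ / 4) (by linarith)
    refine ⟨_, (hy.2 t₀ ht₀ (δ / 4) (by linarith)).and hfc, δ / 2, by linarith, fun t ht x hx => ?_⟩
    have e1 := (abs_le.1 (ht.1 0 0 le_rfl x hx)).1
    have e2 := (abs_lt.1 ht.2).1
    have e3 := isMinOn_iff.1 hmin x (m.Ω_subset_D hx)
    simp only [pd, Function.iterate_zero, id, Pi.add_apply] at e1 e3
    linarith

lemma f_facts (h : m.IsSolution s yT g₀ T y g f) (hT : 0 < T) :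
    ∃ B, ∀ t ∈ Ioo 0 T, HasDerivAt f (deriv f t) t ∧ |deriv f t| ≤ B := by
  have hc := h.f_C1.continuousOn_derivWithin (uniqueDiffOn_Icc hT) le_rfl
  obtain ⟨B, hB⟩ := isCompact_Icc.exists_bound_of_continuousOn hc
  refine ⟨B, fun t ht => ?_⟩
  have hd := ((h.f_C1.differentiableOn (by simp)) t (Ioo_subset_Icc_self ht)).hasDerivWithinAt.hasDerivAt
    (Icc_mem_nhds ht.1 ht.2)
  rw [hd.deriv]
  exact ⟨hd, hB t (Ioo_subset_Icc_self ht)⟩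

lemma _root_.WealthMFG.abs_mul_le {x y X Y : ℝ} (hx : |x| ≤ X) (hy : |y| ≤ Y) : |x * y| ≤ X * Y := by
  rw [abs_mul]
  exact mul_le_mul hx hy (abs_nonneg _) ((abs_nonneg _).trans hx)

/-- The derivatives in `z` of `σ² g` and `μ g`. -/
lemma dZ_coeff {C : ℝ} (hk : m.CoeffRegular C) {h : ℝ² → ℝ} (hh : IsCk m.Ω 2 h) {x : ℝ²} (hx : x ∈ m.Ω) :
    1 / 2 * dZ (dZ (fun x' => m.σ x'.2 ^ 2 * h x')) x - dZ (fun x' => m.μ x'.2 * h x') x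
      = m.coeff.fwd x.2 (h x) (pd 0 1 h x) (pd 0 2 h x) ∧
    dZ (fun x' => m.μ x'.2 * h x') x = m.coeff.μ1 x.2 * h x + m.coeff.μ x.2 * pd 0 1 h x := by
  have hop : IsOpen m.Ω := isOpen_Ioo.prod isOpen_Ioo
  have h1 : ∀ x ∈ m.Ω, HasDerivAt (fun z => h (x.1, z)) (pd 0 1 h x) x.2 := fun x hx =>
    ((hh 0 0 (by norm_num)).2 (by norm_num) x hx).2
  have h2 : ∀ x ∈ m.Ω, HasDerivAt (fun z => pd 0 1 h (x.1, z)) (pd 0 2 h x) x.2 := fun x hx =>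
    ((hh 0 1 (by norm_num)).2 (by norm_num) x hx).2
  have e1 : dZ (fun x' => m.μ x'.2 * h x') x = m.coeff.μ1 x.2 * h x + m.coeff.μ x.2 * pd 0 1 h x :=
    ((hk.has_μ1 _ hx.2).fun_mul (h1 x hx)).deriv
  have hσ : ∀ x ∈ m.Ω, HasDerivAt (fun z => m.σ z ^ 2) (2 * m.coeff.D1 x.2) x.2 := fun x hx => by
    refine ((hk.has_D1 _ hx.2).const_mul 2).congr_of_eventuallyEq (Eventually.of_forall fun z => ?_)
    simp only [Model.coeff]; ring
  have e2 : ∀ x ∈ m.Ω, dZ (fun x' => m.σ x'.2 ^ 2 * h x') x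
      = 2 * m.coeff.D1 x.2 * h x + m.σ x.2 ^ 2 * pd 0 1 h x := fun x hx =>
    ((hσ x hx).fun_mul (h1 x hx)).deriv
  have e3 : dZ (dZ (fun x' => m.σ x'.2 ^ 2 * h x')) x
      = 2 * m.coeff.D2 x.2 * h x + 2 * m.coeff.D1 x.2 * pd 0 1 h x
        + (2 * m.coeff.D1 x.2 * pd 0 1 h x + m.σ x.2 ^ 2 * pd 0 2 h x) := by
    refine HasDerivAt.deriv ?_
    refine ((((hk.has_D2 _ hx.2).const_mul 2).fun_mul (h1 x hx)).fun_add
      ((hσ x hx).fun_mul (h2 x hx))).congr_of_eventuallyEq ?_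
    filter_upwards [eventually_line_snd hop hx] with z hz using e2 _ hz
  refine ⟨?_, e1⟩
  rw [e3, e1]
  simp only [CoeffData.fwd, Model.coeff]
  ring

lemma dA_prod {u : ℝ → ℝ} (hu : IsUtility u) {h k : ℝ² → ℝ} {Ω : Set ℝ²} (hh : IsCk Ω 1 h)
    (hk : IsCk Ω 1 k) {x : ℝ²} (hx : x ∈ Ω) {c : ℝ} (hp : 0 < k x + c) (r : ℝ) :
    dA (fun x' => (x'.2 + r * x'.1 + Hp u (k x' + c)) * h x') x = (r + Hpp u (k x + c) * pd 1 0 k x) * h x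
        + (x.2 + r * x.1 + Hp u (k x + c)) * pd 1 0 h x ∧ dA (fun x' => h x' * Hp u (k x' + c)) x
      = Hpp u (k x + c) * pd 1 0 k x * h x + Hp u (k x + c) * pd 1 0 h x := by
  have h1 : HasDerivAt (fun a => h (a, x.2)) (pd 1 0 h x) x.1 :=
    ((hh 0 0 (by norm_num)).2 (by norm_num) x hx).1
  have k1 : HasDerivAt (fun a => k (a, x.2)) (pd 1 0 k x) x.1 :=
    ((hk 0 0 (by norm_num)).2 (by norm_num) x hx).1
  have hH : HasDerivAt (fun a => Hp u (k (a, x.2) + c)) (Hpp u (k x + c) * pd 1 0 k x) x.1 :=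
    (hu.hasDerivAt_Hp hp).comp x.1 (k1.add_const c)
  constructor
  · refine HasDerivAt.deriv ?_
    refine ((((hasDerivAt_id' x.1).const_mul r).const_add x.2).fun_add hH).fun_mul h1 |>.congr_deriv ?_
    simp
  · refine HasDerivAt.deriv ?_
    refine (h1.fun_mul hH).congr_deriv ?_
    simp; ring

/-- A solution is a regular function on the strip and satisfies the equations there. -/
lemma exists_regSol (hm : m.Admissible) (hs : 4 ≤ s) (hT : 0 < T) (h : m.IsSolution s yT g₀ T y g f) :
    ∃ M r y' g', m.RegSol T M (𝔼(m) yT) (𝔼(m) g₀) y' g' f r ∧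
      ∀ t ∈ Icc 0 T, ∀ x ∈ m.Ω, y'.val t x.1 x.2 = y t x ∧ g'.val t x.1 x.2 = g t x := by
  have hA := hm.A_pos
  have hz := hm.zMin_lt_zMax
  have hR : 2 * m.A < 3 * m.A := by linarith
  have h3A : -(3 * m.A) < 3 * m.A := by linarith
  have hu := hm.utility
  have hw := hm.wInf_pos
  obtain ⟨C, hk⟩ := hm.exists_coeff_regular
  have hyc : ∀ t ∈ Icc 0 T, ContinuousOn (y t) m.Ω := fun t ht => (h.y_cont t ht).mono m.Ω_subset_D
  have hgc : ∀ t ∈ Icc 0 T, ContinuousOn (g t) m.Ω := fun t ht => (h.g_cont t ht).mono m.Ω_subset_D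
  obtain ⟨hyk, hye⟩ := (h.y_C 3 (by omega)).continuous_pd (K := 2) h3A hz hyc
  obtain ⟨My, hMy⟩ := (h.y_C 3 (by omega)).exists_bound_pd (K := 2) h3A hz hyc
  obtain ⟨-, hge⟩ := (h.g_C 3 (by omega)).continuous_pd (K := 1) h3A hz hgc
  obtain ⟨Mg, hMg⟩ := isCk_of_linfty (K := 2) h3A hz hT hs h.g_Linfty (h.g_C 0 (by omega)) hgc
  obtain ⟨δ, hδ, hpos⟩ := exists_pos_bound hm hs h
  obtain ⟨B, hB⟩ := h.f_facts hT
  obtain ⟨Mf, hMf⟩ := isCompact_Icc.exists_bound_of_continuousOn h.f_C1.continuousOn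
  obtain ⟨M₀, hM₀⟩ : ∃ M₀, M₀ = max (max My Mg) (max Mf 0) := ⟨_, rfl⟩
  have hM₀0 : 0 ≤ M₀ := by rw [hM₀]; exact (le_max_right _ _).trans (le_max_right _ _)
  have hyM : ∀ t ∈ Icc 0 T, ∀ i j, i + j ≤ 2 → ∀ x ∈ m.Ω, |pd i j (y t) x| ≤ M₀ := fun t ht i j hij x hx =>
    (hMy t ht i j hij x hx).trans (by rw [hM₀]; exact (le_max_left _ _).trans (le_max_left _ _))
  have hgM : ∀ t ∈ Icc 0 T, ∀ i j, i + j ≤ 2 → ∀ x ∈ m.Ω, |pd i j (g t) x| ≤ M₀ := fun t ht i j hij x hx =>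
    ((hMg t ht).2 i j hij x hx).trans (by rw [hM₀]; exact (le_max_right _ _).trans (le_max_left _ _))
  have hfM : ∀ t ∈ Icc 0 T, |f t| ≤ M₀ := fun t ht =>
    (hMf t ht).trans (by rw [hM₀]; exact (le_max_left _ _).trans (le_max_right _ _))
  have hys : ∀ t ∈ Icc 0 T, ∀ a, ∀ z ∈ 𝕁(m), 2 * m.A < |a| → |a| < 3 * m.A → y t (a, z) = 0 :=
    fun t ht a z hz h1 h2 => m.eq_zero_of_aSupport (h.y_supp t ht) h1.le h2 hz
  have hgs : ∀ t ∈ Icc 0 T, ∀ a, ∀ z ∈ 𝕁(m), 2 * m.A < |a| → |a| < 3 * m.A → g t (a, z) = 0 :=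
    fun t ht a z hz h1 h2 => m.eq_zero_of_aSupport (h.g_supp t ht) h1.le h2 hz
  have ey := fun {t} (ht : t ∈ Icc 0 T) i j (hij : i + j ≤ 2) =>
    (hyk t ht).ext_facts hR hM₀0 (hyM t ht) (hys t ht) (i := i) (j := j) hij
  have eg := fun {t} (ht : t ∈ Icc 0 T) i j (hij : i + j ≤ 2) =>
    (hMg t ht).1.ext_facts hR hM₀0 (hgM t ht) (hgs t ht) (i := i) (j := j) hij
  have hfw : ∀ t ∈ Icc 0 T, δ ≤ f t * m.wInf := fun t ht => by
    have hzm : (m.zMin + m.zMax) / 2 ∈ 𝕁(m) := ⟨by linarith, by linarith⟩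
    have h5 : |5 / 2 * m.A| < 3 * m.A := by rw [abs_of_pos (by linarith)]; linarith
    have := hpos t ht _ (mem_box h5 hzm)
    rw [hys t ht _ _ hzm (by rw [abs_of_pos (by linarith)]; linarith) h5, zero_add] at this
    exact this
  have hq : ∀ t ∈ Icc 0 T, ∀ a, ∀ z ∈ 𝕁(m), δ ≤ 𝔼(m) (y t) a z + f t * m.wInf := by
    intro t ht a z hz
    unfold ext
    split_ifs with h1
    · exact hpos t ht _ (mem_box h1 hz)
    · rw [zero_add]; exact hfw t ht
  have hfpos : ∀ t ∈ Icc 0 T, δ / m.wInf ≤ f t := fun t ht => by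
    rw [div_le_iff₀ hw]; exact hfw t ht
  have hfpos' : ∀ t ∈ Icc 0 T, 0 < f t := fun t ht => (div_pos hδ hw).trans_le (hfpos t ht)
  obtain ⟨r, hr⟩ : ∃ r, r = m.rate y g f := ⟨_, rfl⟩
  have hreq : ∀ t ∈ Ioo 0 T, deriv f t = (m.ρ - r t) * f t := fun t ht => by
    have := h.f_eq t ht
    rw [← hr] at this
    linarith
  have hrb : ∀ t ∈ Ioo 0 T, |r t| ≤ |m.ρ| + B * m.wInf / δ := fun t ht => by
    have hp := hfpos' t (Ioo_subset_Icc_self ht)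
    have e : r t = m.ρ - deriv f t / f t := by rw [hreq t ht]; field_simp; ring
    rw [e]
    refine (abs_sub _ _).trans (add_le_add le_rfl ?_)
    rw [abs_div, abs_of_pos hp, div_le_div_iff₀ hp hδ]
    have h1 := (hB t ht).2
    have h2 := hfw t (Ioo_subset_Icc_self ht)
    have h0 : 0 ≤ |deriv f t| := abs_nonneg _
    nlinarith [mul_le_mul h1 h2 hδ.le (h0.trans h1)]
  obtain ⟨Mr, hMr⟩ : ∃ Mr, Mr = |m.ρ| + B * m.wInf / δ := ⟨_, rfl⟩
  rw [← hMr] at hrb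
  obtain ⟨L0, hL0, hH0⟩ := exists_bound_comp hu.continuousOn_Hp hδ (M₀ + M₀ * m.wInf)
  obtain ⟨L1, hL1, hH1⟩ := exists_bound_comp hu.continuousOn_Hpp hδ (M₀ + M₀ * m.wInf)
  have hqM : ∀ t ∈ Icc 0 T, ∀ a, ∀ z ∈ 𝕁(m),
      𝔼(m) (y t) a z + f t * m.wInf ≤ M₀ + M₀ * m.wInf := fun t ht a z hz =>
    add_le_add ((le_abs_self _).trans ((ey ht 0 0 (by norm_num)).2.1 a z hz))
      (mul_le_mul_of_nonneg_right ((le_abs_self _).trans (hfM t ht)) hw.le)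
  have hqc : ∀ t ∈ Icc 0 T, ContinuousOn
      (fun x : ℝ² => 𝔼(m) (y t) x.1 x.2 + f t * m.wInf) (univ ×ˢ 𝕁(m)) :=
    fun t ht => (ey ht 0 0 (by norm_num)).1.add continuousOn_const
  have bH : ∀ {φ : ℝ → ℝ} {L : ℝ}, ContinuousOn φ (Ioi 0) →
      (∀ p, δ ≤ p → p ≤ M₀ + M₀ * m.wInf → |φ p| ≤ L) → ∀ t ∈ Icc 0 T,
      BddCont (univ ×ˢ 𝕁(m)) fun x => φ (𝔼(m) (y t) x.1 x.2 + f t * m.wInf) :=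
    fun hφ hL t ht => ⟨hφ.comp (hqc t ht) fun x hx => hδ.trans_le (hq t ht x.1 x.2 hx.2), _,
      fun x hx => hL _ (hq t ht x.1 x.2 hx.2) (hqM t ht x.1 x.2 hx.2)⟩
  obtain ⟨ydt, hydt⟩ : ∃ ydt : ℝ → ℝ → ℝ → ℝ, ydt = fun t a z =>
    -(m.coeff.D z * 𝔼(m) (pd 0 2 (y t)) a z + m.coeff.μ z * 𝔼(m) (pd 0 1 (y t)) a z
      + (r t - m.ρ) * 𝔼(m) (y t) a z
      + (z + r t * a + Hp m.u (𝔼(m) (y t) a z + f t * m.wInf))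
        * 𝔼(m) (pd 1 0 (y t)) a z) := ⟨_, rfl⟩
  obtain ⟨gdt, hgdt⟩ : ∃ gdt : ℝ → ℝ → ℝ → ℝ, gdt = fun t a z =>
    m.coeff.fwd z (𝔼(m) (g t) a z) (𝔼(m) (pd 0 1 (g t)) a z)
        (𝔼(m) (pd 0 2 (g t)) a z)
      - ((r t + Hpp m.u (𝔼(m) (y t) a z + f t * m.wInf) * 𝔼(m) (pd 1 0 (y t)) a z)
          * 𝔼(m) (g t) a z
        + (z + r t * a + Hp m.u (𝔼(m) (y t) a z + f t * m.wInf))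
          * 𝔼(m) (pd 1 0 (g t)) a z) := ⟨_, rfl⟩
  obtain ⟨Z, hZ⟩ : ∃ Z, ∀ z ∈ 𝕁(m), |z| ≤ Z := ⟨𝕫(m), fun z hz =>
    abs_le_max_abs_abs hz.1.le hz.2.le⟩
  have hdrift : ∀ t ∈ Ioo 0 T, ∀ a, ∀ z ∈ 𝕁(m), ∀ k : ℝ² → ℝ,
      |𝔼(m) k a z| ≤ M₀ →
      |(z + r t * a + Hp m.u (𝔼(m) (y t) a z + f t * m.wInf)) * 𝔼(m) k a z|
        ≤ (Z + Mr * (3 * m.A) + L0) * M₀ := by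
    intro t ht a z hz k hk
    have htI := Ioo_subset_Icc_self ht
    have hMr0 : 0 ≤ Mr := (abs_nonneg _).trans (hrb t ht)
    have hZ0 : 0 ≤ Z := (abs_nonneg _).trans (hZ z hz)
    rcases lt_or_ge |a| (3 * m.A) with ha | ha
    · refine abs_mul_le ?_ hk
      refine (abs_add_three _ _ _).trans (add_le_add (add_le_add (hZ z hz) ?_) ?_)
      · exact abs_mul_le (hrb t ht) ha.le
      · exact hH0 _ (hq t htI a z hz) (hqM t htI a z hz)
    · rw [show 𝔼(m) k a z = 0 from if_neg (not_lt.2 ha), mul_zero, abs_zero]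
      positivity
  have hydtb : ∀ t ∈ Ioo 0 T, ∀ a, ∀ z ∈ 𝕁(m), |ydt t a z|
      ≤ C * M₀ + C * M₀ + (Mr + |m.ρ|) * M₀ + (Z + Mr * (3 * m.A) + L0) * M₀ := by
    intro t ht a z hz
    have htI := Ioo_subset_Icc_self ht
    rw [hydt]
    simp only [abs_neg]
    refine (abs_add_le _ _).trans (add_le_add ((abs_add_three _ _ _).trans
      (add_le_add (add_le_add ?_ ?_) ?_)) ?_)
    · exact abs_mul_le (hk.D_bdd z hz) ((ey htI 0 2 (by norm_num)).2.1 a z hz)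
    · exact abs_mul_le (hk.μ_bdd z hz) ((ey htI 0 1 (by norm_num)).2.1 a z hz)
    · exact abs_mul_le ((abs_sub _ _).trans (add_le_add (hrb t ht) le_rfl))
        ((ey htI 0 0 (by norm_num)).2.1 a z hz)
    · exact hdrift t ht a z hz _ ((ey htI 1 0 (by norm_num)).2.1 a z hz)
  have hgdtb : ∀ t ∈ Ioo 0 T, ∀ a, ∀ z ∈ 𝕁(m), |gdt t a z|
      ≤ (C * M₀ + (2 * C + C) * M₀ + (C + C) * M₀)
        + ((Mr + L1 * M₀) * M₀ + (Z + Mr * (3 * m.A) + L0) * M₀) := by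
    intro t ht a z hz
    have htI := Ioo_subset_Icc_self ht
    rw [hgdt]
    refine (abs_sub _ _).trans (add_le_add ((abs_add_three _ _ _).trans
      (add_le_add (add_le_add ?_ ?_) ?_)) ((abs_add_le _ _).trans (add_le_add ?_ ?_)))
    · exact abs_mul_le (hk.D_bdd z hz) ((eg htI 0 2 (by norm_num)).2.1 a z hz)
    · refine abs_mul_le ((abs_sub _ _).trans (add_le_add ?_ (hk.μ_bdd z hz)))
        ((eg htI 0 1 (by norm_num)).2.1 a z hz)
      exact abs_mul_le (by simp) (hk.D1_bdd z hz)
    · exact abs_mul_le ((abs_sub _ _).trans (add_le_add (hk.D2_bdd z hz) (hk.μ1_bdd z hz)))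
        ((eg htI 0 0 (by norm_num)).2.1 a z hz)
    · refine abs_mul_le ((abs_add_le _ _).trans (add_le_add (hrb t ht) ?_))
        ((eg htI 0 0 (by norm_num)).2.1 a z hz)
      exact abs_mul_le (hH1 _ (hq t htI a z hz) (hqM t htI a z hz))
        ((ey htI 1 0 (by norm_num)).2.1 a z hz)
    · exact hdrift t ht a z hz _ ((eg htI 1 0 (by norm_num)).2.1 a z hz)
  have hlin : ∀ t, ContinuousOn (fun x : ℝ² => x.2 + r t * x.1) (univ ×ˢ 𝕁(m)) :=
    fun t => by fun_prop
  have cH := fun t ht => (bH hu.continuousOn_Hp hH0 t ht).1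
  have cH1 := fun t ht => (bH hu.continuousOn_Hpp hH1 t ht).1
  have hydtc : ∀ t ∈ Ioo 0 T, ContinuousOn (fun x : ℝ² => ydt t x.1 x.2) (univ ×ˢ 𝕁(m)) := by
    intro t ht
    have htI := Ioo_subset_Icc_self ht
    rw [hydt]
    exact ((((hk.bdd_D.1.mul (ey htI 0 2 (by norm_num)).1).add
      (hk.bdd_μ.1.mul (ey htI 0 1 (by norm_num)).1)).add
      (continuousOn_const.mul (ey htI 0 0 (by norm_num)).1)).add
      (((hlin t).add (cH t htI)).mul (ey htI 1 0 (by norm_num)).1)).neg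
  have hgdtc : ∀ t ∈ Ioo 0 T, ContinuousOn (fun x : ℝ² => gdt t x.1 x.2) (univ ×ˢ 𝕁(m)) := by
    intro t ht
    have htI := Ioo_subset_Icc_self ht
    rw [hgdt]
    exact (((hk.bdd_D.1.mul (eg htI 0 2 (by norm_num)).1).add
      (((continuousOn_const.mul hk.bdd_D1.1).sub hk.bdd_μ.1).mul
        (eg htI 0 1 (by norm_num)).1)).add
      ((hk.bdd_D2.1.sub hk.bdd_μ1.1).mul (eg htI 0 0 (by norm_num)).1)).sub
      (((continuousOn_const.add ((cH1 t htI).mul (ey htI 1 0 (by norm_num)).1)).mul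
        (eg htI 0 0 (by norm_num)).1).add
      (((hlin t).add (cH t htI)).mul (eg htI 1 0 (by norm_num)).1))
  have hydth : ∀ t ∈ Ioo 0 T, ∀ a, ∀ z ∈ 𝕁(m),
      HasDerivAt (fun t => 𝔼(m) (y t) a z) (ydt t a z) t := by
    intro t ht a z hz
    rw [hydt]
    rcases lt_or_ge |a| (3 * m.A) with ha | ha
    · simp only [ext_of_lt ha]
      refine (h.y_diff t ht _ (mem_box ha hz)).hasDerivAt.congr_deriv ?_
      have := h.y_eq t ht _ (mem_box ha hz)
      rw [← hr] at this
      simp only [Model.Θ, Model.coeff] at this ⊢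
      simp only [pd, Function.iterate_succ, Function.iterate_zero, Function.comp_apply, id]
      linarith
    · simp only [ext, if_neg (not_lt.2 ha)]
      simpa using hasDerivAt_const t (0 : ℝ)
  have hgdth : ∀ t ∈ Ioo 0 T, ∀ a, ∀ z ∈ 𝕁(m),
      HasDerivAt (fun t => 𝔼(m) (g t) a z) (gdt t a z) t := by
    intro t ht a z hz
    have htI := Ioo_subset_Icc_self ht
    rw [hgdt]
    rcases lt_or_ge |a| (3 * m.A) with ha | ha
    · simp only [ext_of_lt ha]
      refine (h.g_diff t ht _ (mem_box ha hz)).hasDerivAt.congr_deriv ?_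
      have := h.g_eq t ht _ (mem_box ha hz)
      rw [← hr] at this
      have e1 := (dZ_coeff hk (hMg t htI).1 (mem_box ha hz)).1
      have e2 := (dA_prod hu ((hMg t htI).1.mono one_le_two) ((hyk t htI).mono one_le_two)
        (mem_box ha hz) (h.pos t htI _ (m.Ω_subset_D (mem_box ha hz))) (r t)).1
      simp only [Model.Θ] at this
      rw [e2] at this
      simp only at e1 this
      linarith
    · simp only [ext, if_neg (not_lt.2 ha)]
      simpa [CoeffData.fwd] using hasDerivAt_const t (0 : ℝ)
  obtain ⟨M, hM⟩ : ∃ M, M = max M₀ (max Mr (max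
    (C * M₀ + C * M₀ + (Mr + |m.ρ|) * M₀ + (Z + Mr * (3 * m.A) + L0) * M₀)
    ((C * M₀ + (2 * C + C) * M₀ + (C + C) * M₀)
        + ((Mr + L1 * M₀) * M₀ + (Z + Mr * (3 * m.A) + L0) * M₀)))) := ⟨_, rfl⟩
  have hM1 : M₀ ≤ M := by rw [hM]; exact le_max_left _ _
  have hM2 : Mr ≤ M := by rw [hM]; exact (le_max_left _ _).trans (le_max_right _ _)
  have hM3 := (le_max_left _ _).trans ((le_max_right _ _).trans ((le_max_right _ _).trans hM.ge))
  have hM4 := (le_max_right _ _).trans ((le_max_right _ _).trans ((le_max_right _ _).trans hM.ge))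
  have hyeq : ∀ i j, i + j ≤ 2 → ∀ t₀ ∈ Icc 0 T, ∀ ε > 0, ∀ᶠ t in 𝓝[Icc 0 T] t₀, ∀ a,
      ∀ z ∈ 𝕁(m),
      |𝔼(m) (pd i j (y t)) a z - 𝔼(m) (pd i j (y t₀)) a z| ≤ ε := by
    intro i j hij t₀ ht₀ ε hε
    filter_upwards [hye t₀ ht₀ ε hε] with t ht a z hz
    exact abs_ext_sub_le hε.le (ht i j hij) a hz
  have hgeq : ∀ i j, i + j ≤ 1 → ∀ t₀ ∈ Icc 0 T, ∀ ε > 0, ∀ᶠ t in 𝓝[Icc 0 T] t₀, ∀ a,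
      ∀ z ∈ 𝕁(m),
      |𝔼(m) (pd i j (g t)) a z - 𝔼(m) (pd i j (g t₀)) a z| ≤ ε := by
    intro i j hij t₀ ht₀ ε hε
    filter_upwards [hge t₀ ht₀ ε hε] with t ht a z hz
    exact abs_ext_sub_le hε.le (ht i j hij) a hz
  refine ⟨M, r, pathOf (3 * m.A) y ydt, pathOf (3 * m.A) g gdt, ?_, fun t ht x hx =>
    ⟨ext_of_lt (abs_lt.2 hx.1), ext_of_lt (abs_lt.2 hx.1)⟩⟩
  refine
  { T_pos := hT
    y_reg :=
    { cont := continuousOn_of_equicontinuous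
        (fun t ht => (ey ht 0 0 (by norm_num)).1) (hyeq 0 0 (by norm_num))
      cont_da := continuousOn_of_equicontinuous
        (fun t ht => (ey ht 1 0 (by norm_num)).1) (hyeq 1 0 (by norm_num))
      cont_dz := fun t ht => (ey ht 0 1 (by norm_num)).1
      cont_dzz := fun t ht => (ey ht 0 2 (by norm_num)).1
      cont_dt := hydtc
      has_da := fun t ht a z hz => ((ey ht 0 0 (by norm_num)).2.2.2 (by norm_num) a z hz).1
      has_dz := fun t ht a z hz => ((ey ht 0 0 (by norm_num)).2.2.2 (by norm_num) a z hz).2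
      has_dzz := fun t ht a z hz => ((ey ht 0 1 (by norm_num)).2.2.2 (by norm_num) a z hz).2
      has_dt := hydth
      bound := fun t ht a z hz => ((ey ht 0 0 (by norm_num)).2.1 a z hz).trans hM1
      bound_da := fun t ht a z hz => ((ey ht 1 0 (by norm_num)).2.1 a z hz).trans hM1
      bound_dz := fun t ht a z hz => ((ey ht 0 1 (by norm_num)).2.1 a z hz).trans hM1
      bound_dzz := fun t ht a z hz => ((ey ht 0 2 (by norm_num)).2.1 a z hz).trans hM1
      bound_dt := fun t ht a z hz => (hydtb t ht a z hz).trans hM3 }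
    g_reg :=
    { cont := continuousOn_of_equicontinuous
        (fun t ht => (eg ht 0 0 (by norm_num)).1) (hgeq 0 0 (by norm_num))
      cont_da := continuousOn_of_equicontinuous
        (fun t ht => (eg ht 1 0 (by norm_num)).1) (hgeq 1 0 (by norm_num))
      cont_dz := fun t ht => (eg ht 0 1 (by norm_num)).1
      cont_dzz := fun t ht => (eg ht 0 2 (by norm_num)).1
      cont_dt := hgdtc
      has_da := fun t ht a z hz => ((eg ht 0 0 (by norm_num)).2.2.2 (by norm_num) a z hz).1
      has_dz := fun t ht a z hz => ((eg ht 0 0 (by norm_num)).2.2.2 (by norm_num) a z hz).2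
      has_dzz := fun t ht a z hz => ((eg ht 0 1 (by norm_num)).2.2.2 (by norm_num) a z hz).2
      has_dt := hgdth
      bound := fun t ht a z hz => ((eg ht 0 0 (by norm_num)).2.1 a z hz).trans hM1
      bound_da := fun t ht a z hz => ((eg ht 1 0 (by norm_num)).2.1 a z hz).trans hM1
      bound_dz := fun t ht a z hz => ((eg ht 0 1 (by norm_num)).2.1 a z hz).trans hM1
      bound_dzz := fun t ht a z hz => ((eg ht 0 2 (by norm_num)).2.1 a z hz).trans hM1
      bound_dt := fun t ht a z hz => (hgdtb t ht a z hz).trans hM4 }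
    y_supp := fun t ht a z hz ha => by
      change 𝔼(m) (y t) a z = 0
      unfold ext
      split_ifs with h1
      exacts [m.eq_zero_of_aSupport (h.y_supp t ht) ha h1 hz, rfl]
    g_supp := fun t ht a z hz ha => by
      change 𝔼(m) (g t) a z = 0
      unfold ext
      split_ifs with h1
      exacts [m.eq_zero_of_aSupport (h.g_supp t ht) ha h1 hz, rfl]
    y_da_cont := hyeq 1 0 (by norm_num)
    f_cont := h.f_C1.continuousOn
    pos := ⟨δ, hδ, hq⟩
    f_deriv := fun t ht => by rw [← hreq t ht]; exact (hB t ht).1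
    r_bdd := fun t ht => (hrb t ht).trans hM2
    f_T := h.f_terminal
    y_eq := fun t ht a z hz => by simp only [pathOf, hydt]
    g_eq := fun t ht a z hz => by simp only [pathOf, hgdt]
    rate_eq := ?_
    y_T := fun a z hz => by
      simp only [pathOf, ext]
      split_ifs with h1
      exacts [h.y_terminal _ (m.Ω_subset_D (mem_box h1 hz)), rfl]
    g_0 := fun a z hz => by
      simp only [pathOf, ext]
      split_ifs with h1
      exacts [h.g_initial _ (m.Ω_subset_D (mem_box h1 hz)), rfl] }
  intro t ht
  have htI := Ioo_subset_Icc_self ht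
  rw [hr, Model.rate, Model.P, Model.K]
  simp only [m.setIntegral_D]
  have e := fun {x : ℝ²} (hx : x ∈ 𝔹(m)) (k : ℝ² → ℝ) =>
    ext_of_lt (h := k) (z := x.2) (abs_lt.2 hx.1)
  congr 1
  · congr 1
    · congr 1
      · congr 1
        refine setIntegral_congr_fun measurableSet_box fun x hx => ?_
        simp only [pathOf, e hx, Prod.mk.eta]
        rw [(dZ_coeff hk (hMg t htI).1 hx).2]
      · refine setIntegral_congr_fun measurableSet_box fun x hx => ?_
        simp only [pathOf, e hx, Prod.mk.eta, Model.coeff, pd, Function.iterate_succ,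
          Function.iterate_zero, Function.comp_apply, id]
        ring
    · refine setIntegral_congr_fun measurableSet_box fun x hx => ?_
      simp only [pathOf, e hx, Prod.mk.eta]
      rw [(dZ_coeff hk (hMg t htI).1 hx).1, (dA_prod hu ((hMg t htI).1.mono one_le_two)
        ((hyk t htI).mono one_le_two) hx (h.pos t htI _ (m.Ω_subset_D hx)) 0).2]
  · refine setIntegral_congr_fun measurableSet_box fun x hx => ?_
    simp only [pathOf, e hx, Prod.mk.eta]

end Model.IsSolution

section

variable {zl zr T M R : ℝ}

lemma abs_sub_le_of_deriv_le {F F' : ℝ → ℝ} {B : ℝ} (hc : ContinuousOn F (Icc 0 T))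
    (hd : ∀ t ∈ Ioo 0 T, HasDerivAt F (F' t) t) (hB : ∀ t ∈ Ioo 0 T, |F' t| ≤ B) {t s : ℝ}
    (ht : t ∈ Icc 0 T) (hs : s ∈ Icc 0 T) : |F t - F s| ≤ B * |t - s| := by
  have key : ∀ t ∈ Icc 0 T, ∀ s ∈ Icc 0 T, s ≤ t → |F t - F s| ≤ B * |t - s| := by
    intro t ht s hs hst
    have hdiff : DifferentiableOn ℝ F (interior (Icc 0 T)) := by
      rw [interior_Icc]; exact fun x hx => (hd x hx).differentiableAt.differentiableWithinAt
    have h1 := (convex_Icc 0 T).image_sub_le_mul_sub_of_deriv_le hc hdiff (C := B)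
      (by rw [interior_Icc]; exact fun x hx => by rw [(hd x hx).deriv]; exact (abs_le.1 (hB x hx)).2)
      s hs t ht hst
    have h2 := (convex_Icc 0 T).mul_sub_le_image_sub_of_le_deriv hc hdiff (C := -B)
      (by rw [interior_Icc]; exact fun x hx => by rw [(hd x hx).deriv]; exact (abs_le.1 (hB x hx)).1)
      s hs t ht hst
    rw [abs_of_nonneg (sub_nonneg.2 hst), abs_le]
    constructor <;> linarith
  rcases le_total s t with h | h
  · exact key t ht s hs h
  · rw [abs_sub_comm, abs_sub_comm t]; exact key s hs t ht h

lemma exists_clamp {F : ℝ → ℝ} (hR : 0 ≤ R) (hF : ∀ a, R ≤ |a| → F a = 0) (a : ℝ) :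
    ∃ a' ∈ Icc (-R) R, F a ≤ F a' := by
  rcases le_total |a| R with h | h
  · exact ⟨a, abs_le.1 h, le_rfl⟩
  · exact ⟨R, ⟨by linarith, le_rfl⟩, by rw [hF a h, hF R (le_abs_self R)]⟩

/-! ### The forward equation -/

/-- `p` solves `p_t = (D p)_zz - (μ p)_z - (b p)_a` and has bounded support in `a`. -/
structure StripPath.Forward (p : StripPath) (k : CoeffData) (b ba : ℝ → ℝ → ℝ → ℝ)
    (zl zr T R : ℝ) : Prop where
  R_nonneg : 0 ≤ R
  supp : ∀ t ∈ Icc 0 T, ∀ a, ∀ z ∈ Ioo zl zr, R ≤ |a| → p.val t a z = 0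
  has_ba : ∀ t ∈ Ioo 0 T, ∀ a, ∀ z ∈ Ioo zl zr, HasDerivAt (fun a => b t a z) (ba t a z) a
  cont_b : ∀ t ∈ Ioo 0 T, ContinuousOn (fun x : ℝ² => b t x.1 x.2) (univ ×ˢ Ioo zl zr)
  cont_ba : ∀ t ∈ Ioo 0 T, ContinuousOn (fun x : ℝ² => ba t x.1 x.2) (univ ×ˢ Ioo zl zr)
  bdd_b : ∀ t ∈ Ioo 0 T, ∀ R', ∃ K, ∀ x ∈ box R' zl zr, |b t x.1 x.2| ≤ K
  bdd_ba : ∃ K, ∀ t ∈ Ioo 0 T, ∀ a, ∀ z ∈ Ioo zl zr, |ba t a z| ≤ K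
  eq : ∀ t ∈ Ioo 0 T, ∀ a, ∀ z ∈ Ioo zl zr, p.dt t a z
    = k.fwd z (p.val t a z) (p.dz t a z) (p.dzz t a z)
      - (ba t a z * p.val t a z + b t a z * p.da t a z)

namespace StripPath.Forward

variable {p q : StripPath} {k : CoeffData} {b ba : ℝ → ℝ → ℝ → ℝ} {C M' : ℝ}

lemma continuousOn_integral (hp : p.Regular zl zr T M) (hq : q.Regular zl zr T M') (R : ℝ) :
    ContinuousOn (fun t => ∫ x in box R zl zr, q.val t x.1 x.2 * p.val t x.1 x.2) (Icc 0 T) := by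
  refine continuousOn_setIntegral_box (K := M' * M)
    (fun t ht => ((hq.bdd_val ht).mul (hp.bdd_val ht)).1.mono box_subset_strip) (fun x hx => ?_)
    fun t ht x hx => abs_mul_le (hq.bound t ht _ _ hx.2) (hp.bound t ht _ _ hx.2)
  have hmap : ContinuousOn (fun t : ℝ => ((t, x.1, x.2) : ℝ × ℝ × ℝ)) (Icc 0 T) := by fun_prop
  exact (hq.cont.comp hmap fun t ht => ⟨ht, mem_univ _, hx.2⟩).mul
    (hp.cont.comp hmap fun t ht => ⟨ht, mem_univ _, hx.2⟩)

lemma hasDerivAt_integral (h : p.Forward k b ba zl zr T R) (hk : k.Regular zl zr C)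
    (hp : p.Regular zl zr T M) (hq : q.Regular zl zr T M') {t : ℝ} (ht : t ∈ Ioo 0 T) :
    HasDerivAt (fun t => ∫ x in box R zl zr, q.val t x.1 x.2 * p.val t x.1 x.2)
      (∫ x in box R zl zr, p.val t x.1 x.2 * (q.dt t x.1 x.2 + (k.D x.2 * q.dzz t x.1 x.2
        + k.μ x.2 * q.dz t x.1 x.2 + b t x.1 x.2 * q.da t x.1 x.2))) t := by
  have hI {t} (h : t ∈ Ioo 0 T) := Ioo_subset_Icc_self h
  have hqdt : ∀ t ∈ Ioo 0 T, BddCont (box R zl zr) fun x => q.dt t x.1 x.2 := fun t ht =>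
    ⟨(hq.cont_dt t ht).mono box_subset_strip, M', fun x hx => hq.bound_dt t ht _ _ hx.2⟩
  have hpdt : ∀ t ∈ Ioo 0 T, BddCont (box R zl zr) fun x => p.dt t x.1 x.2 := fun t ht =>
    ⟨(hp.cont_dt t ht).mono box_subset_strip, M, fun x hx => hp.bound_dt t ht _ _ hx.2⟩
  have bv := fun {t} (ht : t ∈ Ioo 0 T) => (hp.bdd_val (hI ht)).mono (box_subset_strip (R := R))
  have bq := fun {t} (ht : t ∈ Ioo 0 T) => (hq.bdd_val (hI ht)).mono (box_subset_strip (R := R))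
  have key := hasDerivAt_setIntegral_box (T := T) (R := R) (K := M' * M + M' * M)
    (h := fun t x => q.val t x.1 x.2 * p.val t x.1 x.2)
    (ht := fun t x => q.dt t x.1 x.2 * p.val t x.1 x.2 + q.val t x.1 x.2 * p.dt t x.1 x.2)
    (zl := zl) (zr := zr)
    (fun t ht x hx => (hq.has_dt t ht _ _ hx.2).fun_mul (hp.has_dt t ht _ _ hx.2))
    (fun t ht => (bq ht).mul (bv ht))
    (fun t ht => (((hqdt t ht).mul (bv ht)).add ((bq ht).mul (hpdt t ht))).1)
    (fun t ht x hx => (abs_add_le _ _).trans (add_le_add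
      (abs_mul_le (hq.bound_dt t ht _ _ hx.2) (hp.bound t (hI ht) _ _ hx.2))
      (abs_mul_le (hq.bound t (hI ht) _ _ hx.2) (hp.bound_dt t ht _ _ hx.2)))) t ht
  refine key.congr_deriv ?_
  obtain ⟨K, hK⟩ := h.bdd_ba
  have hw := setIntegral_box_weak hk hp hq (hI ht) h.R_nonneg (h.supp t (hI ht)) (h.has_ba t ht)
    (h.cont_b t ht) (h.cont_ba t ht) (h.bdd_b t ht R) ⟨K, fun x hx => hK t ht _ _ hx.2⟩
  have e1 : ∀ x ∈ box R zl zr, q.val t x.1 x.2 * p.dt t x.1 x.2 = q.val t x.1 x.2 *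
      (k.fwd x.2 (p.val t x.1 x.2) (p.dz t x.1 x.2) (p.dzz t x.1 x.2)
        - (ba t x.1 x.2 * p.val t x.1 x.2 + b t x.1 x.2 * p.da t x.1 x.2)) := fun x hx => by
    rw [h.eq t ht _ _ hx.2]
  have hb : BddCont (box R zl zr) fun x => b t x.1 x.2 :=
    ⟨(h.cont_b t ht).mono box_subset_strip, h.bdd_b t ht R⟩
  have e2 : BddCont (box R zl zr) fun x => p.val t x.1 x.2 * (k.D x.2 * q.dzz t x.1 x.2
      + k.μ x.2 * q.dz t x.1 x.2 + b t x.1 x.2 * q.da t x.1 x.2) :=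
    (bv ht).mul ((((hk.bdd_D.mul (hq.bdd_dzz (hI ht))).add
      (hk.bdd_μ.mul (hq.bdd_dz (hI ht)))).mono box_subset_strip).add
      (hb.mul ((hq.bdd_da (hI ht)).mono box_subset_strip)))
  rw [integral_add ((hqdt t ht).mul (bv ht)).integrableOn ((bq ht).mul (hpdt t ht)).integrableOn,
    setIntegral_congr_fun measurableSet_box e1, hw,
    ← integral_add ((hqdt t ht).mul (bv ht)).integrableOn e2.integrableOn]
  refine setIntegral_congr_fun measurableSet_box fun x _ => ?_
  ring

lemma nonneg (h : p.Forward k b ba zl zr T R) (hk : k.Regular zl zr C)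
    (hp : p.Regular zl zr T M) (h0 : ∀ a, ∀ z ∈ Ioo zl zr, 0 ≤ p.val 0 a z) :
    ∀ t ∈ Icc 0 T, ∀ a, ∀ z ∈ Ioo zl zr, 0 ≤ p.val t a z := by
  intro t ht a z hz
  obtain ⟨K, hK⟩ := h.bdd_ba
  have hC := hk.C_nonneg
  have key := (hp.comb hp (-1) 0).le_of_forward (mul_nonneg (by norm_num) hC) hk.degenerate_fwd
    (b := fun t a z => -b t a z) (R := R) (K := 0) (S := 0) (c := 2 * C + |K|) le_rfl le_rfl (by positivity)
    (fun t ht a z hz => exists_clamp h.R_nonneg (F := fun a => (p.comb (-1) p 0).val t a z)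
      (fun a ha => by simp [StripPath.comb, h.supp t ht a z hz ha]) a)
    (fun a z hz => by simpa [StripPath.comb] using h0 a z hz)
    (fun t ht a z hz hv => by
      simp only [StripPath.comb] at hv ⊢
      rw [h.eq t ht a z hz, CoeffData.fwd]
      have e1 := (abs_le.1 (hk.D2_bdd z hz))
      have e2 := (abs_le.1 (hk.μ1_bdd z hz))
      have e3 := (abs_le.1 ((hK t ht a z hz).trans (le_abs_self K)))
      have e4 : 0 < -p.val t a z := by linarith
      nlinarith [mul_le_mul_of_nonneg_right
        (show k.D2 z - k.μ1 z - ba t a z ≤ 2 * C + |K| by linarith [e1.2, e2.1, e3.1]) e4.le]) t ht a z hz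
  simp only [StripPath.comb] at key
  linarith

lemma le_exp (h : p.Forward k b ba zl zr T R) (hk : k.Regular zl zr C)
    (hp : p.Regular zl zr T M) {K N : ℝ} (hN : 0 ≤ N)
    (hK : ∀ t ∈ Ioo 0 T, ∀ a, ∀ z ∈ Ioo zl zr, |ba t a z| ≤ K) (hK0 : 0 ≤ K)
    (h0 : ∀ a, ∀ z ∈ Ioo zl zr, p.val 0 a z ≤ N) :
    ∀ t ∈ Icc 0 T, ∀ a, ∀ z ∈ Ioo zl zr, p.val t a z ≤ N * Real.exp ((2 * C + K) * t) := by
  intro t ht a z hz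
  have hC := hk.C_nonneg
  have key := hp.le_of_forward (mul_nonneg (by norm_num) hC) hk.degenerate_fwd
    (b := fun t a z => -b t a z) (R := R) (K := N) (S := 0) (c := 2 * C + K) hN le_rfl (by positivity)
    (fun t ht a z hz => exists_clamp h.R_nonneg (h.supp t ht · z hz) a) h0
    (fun t ht a z hz hv => by
      rw [h.eq t ht a z hz, CoeffData.fwd]
      have e1 := (abs_le.1 (hk.D2_bdd z hz))
      have e2 := (abs_le.1 (hk.μ1_bdd z hz))
      have e3 := (abs_le.1 (hK t ht a z hz))
      nlinarith [mul_le_mul_of_nonneg_right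
        (show k.D2 z - k.μ1 z - ba t a z ≤ 2 * C + K by linarith [e1.2, e2.1, e3.1]) hv.le]) t ht a z hz
  simpa using key

end StripPath.Forward

/-- The function `c + d z`. -/
def affine (c d : ℝ) : StripPath where
  val _ _ z := c + d * z
  da _ _ _ := 0
  dz _ _ _ := d
  dzz _ _ _ := 0
  dt _ _ _ := 0

lemma affine_regular (c d : ℝ) : (affine c d).Regular zl zr T (|c| + |d| * max |zl| |zr| + |d|) := by
  have hm : 0 ≤ max |zl| |zr| := (abs_nonneg _).trans (le_max_left _ _)
  have h0 : 0 ≤ |c| + |d| * max |zl| |zr| + |d| := by positivity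
  have h1 : 0 ≤ |d| * max |zl| |zr| := by positivity
  constructor <;> simp only [affine]
  · fun_prop
  · exact continuousOn_const
  · exact fun _ _ => continuousOn_const
  · exact fun _ _ => continuousOn_const
  · exact fun _ _ => continuousOn_const
  · exact fun _ _ a z _ => hasDerivAt_const a _
  · exact fun _ _ _ z _ => by simpa using ((hasDerivAt_id' z).const_mul d).const_add c
  · exact fun _ _ _ z _ => hasDerivAt_const z _
  · exact fun t _ _ z _ => hasDerivAt_const t _
  · intro _ _ _ z hz
    refine (abs_add_le _ _).trans ?_
    rw [abs_mul]
    have := mul_le_mul_of_nonneg_left (abs_le_max_abs_abs hz.1.le hz.2.le) (abs_nonneg d)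
    linarith [abs_nonneg d]
  · exact fun _ _ _ _ _ => by simpa using h0
  · exact fun _ _ _ _ _ => by linarith [abs_nonneg c]
  · exact fun _ _ _ _ _ => by simpa using h0
  · exact fun _ _ _ _ _ => by simpa using h0

namespace Model.RegSol

variable {m : Model} {yT g₀ : ℝ → ℝ → ℝ} {y g : StripPath} {f r : ℝ → ℝ} {C : ℝ}

lemma exists_f_bound (h : m.RegSol T M yT g₀ y g f r) : ∃ B, ∀ t ∈ Icc 0 T, |f t| ≤ B :=
  isCompact_Icc.exists_bound_of_continuousOn h.f_cont

lemma exists_q_bounds (h : m.RegSol T M yT g₀ y g f r) : ∃ δ > 0, ∃ B, ∀ t ∈ Icc 0 T, ∀ a,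
    ∀ z ∈ 𝕁(m), δ ≤ y.val t a z + f t * m.wInf ∧ y.val t a z + f t * m.wInf ≤ B := by
  obtain ⟨δ, hδ, h1⟩ := h.pos
  obtain ⟨B, hB⟩ := h.exists_f_bound
  refine ⟨δ, hδ, M + B * |m.wInf|, fun t ht a z hz => ⟨h1 t ht a z hz, ?_⟩⟩
  have e1 := (le_abs_self _).trans (h.y_reg.bound t ht a z hz)
  have e2 := (le_abs_self _).trans (abs_mul_le (hB t ht) (le_refl |m.wInf|))
  linarith

lemma bdd_comp (h : m.RegSol T M yT g₀ y g f r) {φ : ℝ → ℝ} (hφ : ContinuousOn φ (Ioi 0)) :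
    ∃ L, 0 ≤ L ∧ (∀ t ∈ Icc 0 T, ∀ a, ∀ z ∈ 𝕁(m), |φ (y.val t a z + f t * m.wInf)| ≤ L) ∧
    ∀ t ∈ Icc 0 T, BddCont (univ ×ˢ 𝕁(m)) fun x => φ (y.val t x.1 x.2 + f t * m.wInf) := by
  obtain ⟨δ, hδ, B, hB⟩ := h.exists_q_bounds
  obtain ⟨L, hL, hb⟩ := exists_bound_comp hφ hδ B
  refine ⟨L, hL, fun t ht a z hz => hb _ (hB t ht a z hz).1 (hB t ht a z hz).2, fun t ht => ⟨?_, L,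
    fun x hx => hb _ (hB t ht _ _ hx.2).1 (hB t ht _ _ hx.2).2⟩⟩
  exact hφ.comp ((h.y_reg.cont_slice ht).add continuousOn_const)
    fun x hx => hδ.trans_le (hB t ht _ _ hx.2).1

lemma q_pos (h : m.RegSol T M yT g₀ y g f r) {t : ℝ} (ht : t ∈ Icc 0 T) (a : ℝ) {z : ℝ}
    (hz : z ∈ 𝕁(m)) : 0 < y.val t a z + f t * m.wInf := by
  obtain ⟨δ, hδ, h1⟩ := h.pos
  exact hδ.trans_le (h1 t ht a z hz)

/-- The drift of wealth. -/
def drift (m : Model) (y : StripPath) (f r : ℝ → ℝ) (t a z : ℝ) : ℝ :=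
  z + r t * a + Hp m.u (y.val t a z + f t * m.wInf)

lemma hasDerivAt_Hp (hm : m.Admissible) (h : m.RegSol T M yT g₀ y g f r) {t : ℝ} (ht : t ∈ Icc 0 T)
    (a : ℝ) {z : ℝ} (hz : z ∈ 𝕁(m)) : HasDerivAt (fun a => Hp m.u (y.val t a z + f t * m.wInf))
      (Hpp m.u (y.val t a z + f t * m.wInf) * y.da t a z) a :=
  (hm.utility.hasDerivAt_Hp (h.q_pos ht a hz)).comp a ((h.y_reg.has_da t ht a z hz).add_const _)

lemma forward (hm : m.Admissible) (h : m.RegSol T M yT g₀ y g f r) : g.Forward m.coeff (drift m y f r)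
      (fun t a z => r t + Hpp m.u (y.val t a z + f t * m.wInf) * y.da t a z) m.zMin m.zMax T (3 * m.A) := by
  have hA := hm.A_pos
  obtain ⟨L0, hL0, h0b, h0⟩ := h.bdd_comp hm.utility.continuousOn_Hp
  obtain ⟨L1, hL1, h1b, h1⟩ := h.bdd_comp hm.utility.continuousOn_Hpp
  have hI {t} (h : t ∈ Ioo 0 T) := Ioo_subset_Icc_self h
  exact
  { R_nonneg := by linarith
    supp := fun t ht a z hz ha => h.g_supp t ht a z hz (by linarith)
    has_ba := fun t ht a z hz => by
      have := (((hasDerivAt_id' a).const_mul (r t)).const_add z).fun_add (h.hasDerivAt_Hp hm (hI ht) a hz)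
      exact this.congr_deriv (by simp)
    cont_b := fun t ht => ContinuousOn.add (by fun_prop) (h0 t (hI ht)).1
    cont_ba := fun t ht => continuousOn_const.add
      ((h1 t (hI ht)).mul (h.y_reg.bdd_da (hI ht))).1
    bdd_b := fun t ht R' => by
      refine ⟨𝕫(m) + M * |R'| + L0, fun x hx => ?_⟩
      refine (abs_add_three _ _ _).trans (add_le_add (add_le_add ?_ ?_) ?_)
      · exact abs_le_max_abs_abs hx.2.1.le hx.2.2.le
      · exact abs_mul_le (h.r_bdd t ht) ((abs_lt.2 hx.1).le.trans (le_abs_self _))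
      · exact h0b t (hI ht) _ _ hx.2
    bdd_ba := ⟨M + L1 * M, fun t ht a z hz => (abs_add_le _ _).trans (add_le_add (h.r_bdd t ht)
      (abs_mul_le (h1b t (hI ht) a z hz) (h.y_reg.bound_da t (hI ht) a z hz)))⟩
    eq := h.g_eq }

lemma g_nonneg (hm : m.Admissible) (hk : m.CoeffRegular C)
    (h : m.RegSol T M yT g₀ y g f r) (h0 : ∀ a, ∀ z ∈ 𝕁(m), 0 ≤ g₀ a z) :
    ∀ t ∈ Icc 0 T, ∀ a, ∀ z ∈ 𝕁(m), 0 ≤ g.val t a z :=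
  (h.forward hm).nonneg hk h.g_reg fun a z hz => by rw [h.g_0 a z hz]; exact h0 a z hz

lemma zero_mem (h : m.RegSol T M yT g₀ y g f r) : (0 : ℝ) ∈ Icc 0 T := ⟨le_rfl, h.T_pos.le⟩

lemma T_mem (h : m.RegSol T M yT g₀ y g f r) : T ∈ Icc 0 T := ⟨h.T_pos.le, le_rfl⟩

lemma mass (hm : m.Admissible) (hk : m.CoeffRegular C) (h : m.RegSol T M yT g₀ y g f r) :
    ∀ t ∈ Icc 0 T, ∫ x in 𝔹(m), g.val t x.1 x.2 = ∫ x in 𝔹(m), g₀ x.1 x.2 := by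
  intro t ht
  have hq := affine_regular (zl := m.zMin) (zr := m.zMax) (T := T) 1 0
  have := abs_sub_le_of_deriv_le (B := 0) (StripPath.Forward.continuousOn_integral h.g_reg hq (3 * m.A))
    (fun t ht => (h.forward hm).hasDerivAt_integral hk h.g_reg hq ht)
    (fun t ht => by simp [affine]) ht h.zero_mem
  rw [zero_mul, abs_nonpos_iff, sub_eq_zero] at this
  simp only [affine, zero_mul, add_zero, one_mul] at this
  rw [this]
  exact setIntegral_congr_fun measurableSet_box fun x hx => h.g_0 _ _ hx.2

/-- The mean income changes at a bounded rate. -/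
lemma moment (hm : m.Admissible) (hk : m.CoeffRegular C)
    (h : m.RegSol T M yT g₀ y g f r) (h0 : ∀ a, ∀ z ∈ 𝕁(m), 0 ≤ g₀ a z)
    (h1 : ∫ x in 𝔹(m), g₀ x.1 x.2 = 1) {t s : ℝ} (ht : t ∈ Icc 0 T) (hs : s ∈ Icc 0 T) :
    |(∫ x in 𝔹(m), x.2 * g.val t x.1 x.2) - ∫ x in 𝔹(m), x.2 * g.val s x.1 x.2| ≤ C * |t - s| := by
  have hq := affine_regular (zl := m.zMin) (zr := m.zMax) (T := T) 0 1
  have := abs_sub_le_of_deriv_le (B := C) (StripPath.Forward.continuousOn_integral h.g_reg hq (3 * m.A))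
    (fun t ht => (h.forward hm).hasDerivAt_integral hk h.g_reg hq ht)
    (fun t ht => ?_) ht hs
  · simpa [affine] using this
  · have htI := Ioo_subset_Icc_self ht
    have hg := ((h.g_reg.bdd_val htI).mono (box_subset_strip (R := 3 * m.A))).integrableOn
    have e : C = ∫ x in 𝔹(m), C * g.val t x.1 x.2 := by
      rw [integral_const_mul, h.mass hm hk t htI, h1, mul_one]
    rw [e]
    refine norm_integral_le_of_norm_le (g := fun x : ℝ² => C * g.val t x.1 x.2)
      (f := fun x : ℝ² => g.val t x.1 x.2 * ((affine 0 1).dt t x.1 x.2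
        + (m.coeff.D x.2 * (affine 0 1).dzz t x.1 x.2 + m.coeff.μ x.2 * (affine 0 1).dz t x.1 x.2
        + drift m y f r t x.1 x.2 * (affine 0 1).da t x.1 x.2))) (hg.const_mul C) ((ae_restrict_iff' measurableSet_box).2
      (Eventually.of_forall fun x hx => ?_))
    have e0 := h.g_nonneg hm hk h0 t htI x.1 x.2 hx.2
    simp only [affine, mul_zero, zero_add, mul_one, add_zero, Real.norm_eq_abs]
    rw [abs_mul, abs_of_nonneg e0, mul_comm]
    exact mul_le_mul_of_nonneg_right (hk.μ_bdd _ hx.2) e0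

end Model.RegSol

end

section

variable {T M : ℝ}

lemma exists_pos_lower {φ : ℝ → ℝ} (hφ : ContinuousOn φ (Ioi 0)) (hpos : ∀ p, 0 < p → 0 < φ p)
    {δ : ℝ} (hδ : 0 < δ) (B : ℝ) : ∃ κ > 0, ∀ p, δ ≤ p → p ≤ B → κ ≤ φ p := by
  rcases (Icc δ B).eq_empty_or_nonempty with h | h
  · exact ⟨1, one_pos, fun p h1 h2 => absurd (show p ∈ Icc δ B from ⟨h1, h2⟩) (by rw [h]; simp)⟩
  · obtain ⟨x, hx, hmin⟩ := isCompact_Icc.exists_isMinOn h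
      (hφ.mono fun x (hx : x ∈ Icc δ B) => hδ.trans_le hx.1)
    exact ⟨φ x, hpos x (hδ.trans_le hx.1), fun p h1 h2 => isMinOn_iff.1 hmin p ⟨h1, h2⟩⟩

lemma integral_combination {α : Type*} [MeasurableSpace α] {ν : Measure α}
    {f₁ f₂ f₃ f₄ f₅ f₆ f₇ : α → ℝ} (h₁ : Integrable f₁ ν) (h₂ : Integrable f₂ ν) (h₃ : Integrable f₃ ν)
    (h₄ : Integrable f₄ ν) (h₅ : Integrable f₅ ν) (h₆ : Integrable f₆ ν) (h₇ : Integrable f₇ ν) (c : ℝ) :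
    ∫ x, (-f₁ x + f₂ x + f₃ x - c * f₄ x + f₅ x + f₆ x - f₇ x) ∂ν
      = -(∫ x, f₁ x ∂ν) + (∫ x, f₂ x ∂ν) + (∫ x, f₃ x ∂ν) - c * (∫ x, f₄ x ∂ν) + (∫ x, f₅ x ∂ν)
        + (∫ x, f₆ x ∂ν) - ∫ x, f₇ x ∂ν := by
  have j1 : Integrable (fun x => -f₁ x) ν := h₁.neg
  have j2 : Integrable (fun x => -f₁ x + f₂ x) ν := j1.add h₂
  have j3 : Integrable (fun x => -f₁ x + f₂ x + f₃ x) ν := j2.add h₃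
  have j4 : Integrable (fun x => -f₁ x + f₂ x + f₃ x - c * f₄ x) ν := j3.sub (h₄.const_mul c)
  have j5 : Integrable (fun x => -f₁ x + f₂ x + f₃ x - c * f₄ x + f₅ x) ν := j4.add h₅
  have j6 : Integrable (fun x => -f₁ x + f₂ x + f₃ x - c * f₄ x + f₅ x + f₆ x) ν := j5.add h₆
  rw [integral_sub j6 h₇, integral_add j5 h₆, integral_add j4 h₅, integral_sub j3 (h₄.const_mul c),
    integral_add j2 h₃, integral_add j1 h₂, integral_neg, integral_const_mul]

namespace Model.RegSol

variable {m : Model} {yT g₀ : ℝ → ℝ → ℝ} {y g : StripPath} {f r : ℝ → ℝ} {C : ℝ}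

/-- The denominator of the interest rate is positive. -/
lemma K_pos (hm : m.Admissible) (hk : m.CoeffRegular C)
    (h : m.RegSol T M yT g₀ y g f r) (h0 : ∀ a, ∀ z ∈ 𝕁(m), 0 ≤ g₀ a z)
    (h1 : ∫ x in 𝔹(m), g₀ x.1 x.2 = 1) {t : ℝ} (ht : t ∈ Icc 0 T) : 0 < ∫ x in 𝔹(m), g.val t x.1 x.2 *
        Hpp m.u (y.val t x.1 x.2 + f t * m.wInf) * (y.val t x.1 x.2 + f t * m.wInf) := by
  obtain ⟨δ, hδ, B, hB⟩ := h.exists_q_bounds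
  obtain ⟨κ, hκ, hκb⟩ := exists_pos_lower hm.utility.continuousOn_Hpp hm.utility.Hp_props.2 hδ B
  obtain ⟨L1, hL1, h1b, h1c⟩ := h.bdd_comp hm.utility.continuousOn_Hpp
  obtain ⟨L2, hL2, h2b, h2c⟩ := h.bdd_comp (φ := fun p => p) continuousOn_id
  have hg := (h.g_reg.bdd_val ht).mono (box_subset_strip (R := 3 * m.A))
  have e : κ * δ = ∫ x in 𝔹(m), κ * δ * g.val t x.1 x.2 := by
    rw [integral_const_mul, h.mass hm hk t ht, h1, mul_one]
  have hκδ : 0 < κ * δ := by positivity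
  refine hκδ.trans_le (e.le.trans ?_)
  refine setIntegral_mono_on (hg.integrableOn.const_mul _)
    (((h.g_reg.bdd_val ht).mul (h1c t ht)).mul (h2c t ht) |>.mono box_subset_strip).integrableOn
    measurableSet_box fun x hx => ?_
  have q1 := hB t ht x.1 x.2 hx.2
  have e0 := h.g_nonneg hm hk h0 t ht x.1 x.2 hx.2
  rw [mul_assoc (g.val t x.1 x.2), mul_comm (κ * δ)]
  exact mul_le_mul_of_nonneg_left (mul_le_mul (hκb _ q1.1 q1.2) q1.1 hδ.le
    (hκ.le.trans (hκb _ q1.1 q1.2))) e0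

/-- Aggregate income minus aggregate consumption is conserved. -/
lemma conservation (hm : m.Admissible) (hk : m.CoeffRegular C)
    (h : m.RegSol T M yT g₀ y g f r) (h0 : ∀ a, ∀ z ∈ 𝕁(m), 0 ≤ g₀ a z)
    (h1 : ∫ x in 𝔹(m), g₀ x.1 x.2 = 1) {t : ℝ} (ht : t ∈ Icc 0 T) : ∫ x in 𝔹(m),
        (x.2 + Hp m.u (y.val t x.1 x.2 + f t * m.wInf)) * g.val t x.1 x.2 = ∫ x in 𝔹(m),
        (x.2 + Hp m.u (y.val T x.1 x.2 + f T * m.wInf)) * g.val T x.1 x.2 := by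
  have hA := hm.A_pos
  have h3A : 0 ≤ 3 * m.A := by linarith
  obtain ⟨L0, hL0, h0b, h0c⟩ := h.bdd_comp hm.utility.continuousOn_Hp
  obtain ⟨L1, hL1, h1b, h1c⟩ := h.bdd_comp hm.utility.continuousOn_Hpp
  obtain ⟨B, hB⟩ := h.exists_f_bound
  have hI {t} (h : t ∈ Ioo 0 T) := Ioo_subset_Icc_self h
  have hM0 : 0 ≤ M := (abs_nonneg _).trans
    (h.y_reg.bound 0 h.zero_mem 0 ((m.zMin + m.zMax) / 2)
      ⟨by linarith [hm.zMin_lt_zMax], by linarith [hm.zMin_lt_zMax]⟩)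
  have bz := m.bddCont_z
  have bz' := bz.mono (box_subset_strip (R := 3 * m.A))
  have ba' : BddCont (𝔹(m)) fun x => x.1 :=
    ⟨continuousOn_fst, 3 * m.A, fun x hx => (abs_lt.2 hx.1).le⟩
  have S : 𝔹(m) ⊆ univ ×ˢ 𝕁(m) := box_subset_strip
  have bydt : ∀ t ∈ Ioo 0 T, BddCont (univ ×ˢ 𝕁(m)) fun x => y.dt t x.1 x.2 := fun t ht =>
    ⟨h.y_reg.cont_dt t ht, M, fun x hx => h.y_reg.bound_dt t ht _ _ hx.2⟩
  have bgdt : ∀ t ∈ Ioo 0 T, BddCont (univ ×ˢ 𝕁(m)) fun x => g.dt t x.1 x.2 := fun t ht =>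
    ⟨h.g_reg.cont_dt t ht, M, fun x hx => h.g_reg.bound_dt t ht _ _ hx.2⟩
  have hfd : ∀ t ∈ Ioo 0 T, |(m.ρ - r t) * f t| ≤ (|m.ρ| + M) * B := fun t ht =>
    abs_mul_le ((abs_sub _ _).trans (add_le_add le_rfl (h.r_bdd t ht))) (hB t (hI ht))
  have hcont : ContinuousOn (fun t => ∫ x in 𝔹(m),
      (x.2 + Hp m.u (y.val t x.1 x.2 + f t * m.wInf)) * g.val t x.1 x.2) (Icc 0 T) := by
    refine continuousOn_setIntegral_box (K := (𝕫(m) + L0) * M)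
      (fun t ht => ((bz.add (h0c t ht)).mul (h.g_reg.bdd_val ht)).1.mono S) (fun x hx => ?_)
      fun t ht x hx => abs_mul_le ((abs_add_le _ _).trans (add_le_add
        (abs_le_max_abs_abs hx.2.1.le hx.2.2.le) (h0b t ht _ _ hx.2))) (h.g_reg.bound t ht _ _ hx.2)
    have hmap : ContinuousOn (fun t : ℝ => ((t, x.1, x.2) : ℝ × ℝ × ℝ)) (Icc 0 T) := by fun_prop
    have hyl : ContinuousOn (fun t => y.val t x.1 x.2) (Icc 0 T) :=
      h.y_reg.cont.comp hmap fun t ht => ⟨ht, mem_univ _, hx.2⟩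
    have hgl : ContinuousOn (fun t => g.val t x.1 x.2) (Icc 0 T) :=
      h.g_reg.cont.comp hmap fun t ht => ⟨ht, mem_univ _, hx.2⟩
    exact (continuousOn_const.add (hm.utility.continuousOn_Hp.comp
      (hyl.add (h.f_cont.mul continuousOn_const)) fun t ht => h.q_pos ht _ hx.2)).mul hgl
  have hder := hasDerivAt_setIntegral_box (T := T) (R := 3 * m.A)
    (K := L1 * (M + (|m.ρ| + M) * B * |m.wInf|) * M + (𝕫(m) + L0) * M)
    (zl := m.zMin) (zr := m.zMax)
    (h := fun t x => (x.2 + Hp m.u (y.val t x.1 x.2 + f t * m.wInf)) * g.val t x.1 x.2)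
    (ht := fun t x => Hpp m.u (y.val t x.1 x.2 + f t * m.wInf) * (y.dt t x.1 x.2
        + (m.ρ - r t) * f t * m.wInf) * g.val t x.1 x.2
      + (x.2 + Hp m.u (y.val t x.1 x.2 + f t * m.wInf)) * g.dt t x.1 x.2)
    (fun t ht x hx => (((hm.utility.hasDerivAt_Hp (h.q_pos (hI ht) _ hx.2)).comp t
      ((h.y_reg.has_dt t ht _ _ hx.2).fun_add ((h.f_deriv t ht).mul_const m.wInf))).const_add
        x.2).fun_mul (h.g_reg.has_dt t ht _ _ hx.2))
    (fun t ht => ((bz.add (h0c t (hI ht))).mul (h.g_reg.bdd_val (hI ht))).mono S)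
    (fun t ht => ((((h1c t (hI ht)).mul ((bydt t ht).add (BddCont.const _))).mul
      (h.g_reg.bdd_val (hI ht))).add ((bz.add (h0c t (hI ht))).mul (bgdt t ht))).1.mono S)
    (fun t ht x hx => (abs_add_le _ _).trans (add_le_add (abs_mul_le (abs_mul_le (h1b t (hI ht) _ _ hx.2)
      ((abs_add_le _ _).trans (add_le_add (h.y_reg.bound_dt t ht _ _ hx.2)
        (abs_mul_le (hfd t ht) le_rfl)))) (h.g_reg.bound t (hI ht) _ _ hx.2))
      (abs_mul_le ((abs_add_le _ _).trans (add_le_add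
        (abs_le_max_abs_abs hx.2.1.le hx.2.2.le) (h0b t (hI ht) _ _ hx.2))) (h.g_reg.bound_dt t ht _ _ hx.2))))
  have hzero : ∀ t ∈ Ioo 0 T, ∫ x in 𝔹(m),
      (Hpp m.u (y.val t x.1 x.2 + f t * m.wInf) * (y.dt t x.1 x.2
        + (m.ρ - r t) * f t * m.wInf) * g.val t x.1 x.2
      + (x.2 + Hp m.u (y.val t x.1 x.2 + f t * m.wInf)) * g.dt t x.1 x.2) = 0 := by
    intro t ht
    have htI := hI ht
    have hK := (h.K_pos hm hk h0 h1 htI).ne'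
    have hr := h.rate_eq t ht
    rw [eq_div_iff hK] at hr
    have c0 := h0c t htI
    have c1 := h1c t htI
    have by0 := h.y_reg.bdd_val htI
    have by1 := h.y_reg.bdd_da htI
    have bq : BddCont (univ ×ˢ 𝕁(m)) fun x => y.val t x.1 x.2 + f t * m.wInf :=
      by0.add (BddCont.const _)
    have bg0 := h.g_reg.bdd_val htI
    have bg1 := h.g_reg.bdd_da htI
    have bfwd := hk.bdd_fwd bg0 (h.g_reg.bdd_dz htI) (h.g_reg.bdd_dzz htI)
    have hq := affine_regular (zl := m.zMin) (zr := m.zMax) (T := T) 0 1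
    have z1 := setIntegral_box_fwd (R := 3 * m.A) hk h.g_reg hq htI
    have b1 := (bz.mul bfwd).sub (bg0.mul hk.bdd_μ)
    have z2 : ∫ x in 𝔹(m), (m.coeff.μ x.2 * g.val t x.1 x.2
        + x.2 * (m.coeff.μ1 x.2 * g.val t x.1 x.2 + m.coeff.μ x.2 * g.dz t x.1 x.2)) = 0 := by
      refine setIntegral_box_deriv_z (M := C * (𝕫(m) * M)) hm.zMin_lt_zMax
        (Φ := fun a z => m.coeff.μ z * (z * g.val t a z))
        (F := fun a z => m.coeff.μ z * g.val t a z + z * (m.coeff.μ1 z * g.val t a z + m.coeff.μ z * g.dz t a z))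
        (fun a _ z hz => ?_) (((hk.bdd_μ.mul bg0).add (bz.mul ((hk.bdd_μ1.mul bg0).add
          (hk.bdd_μ.mul (h.g_reg.bdd_dz htI))))).mono S) (fun a _ z hz => ?_) (fun a _ z hz => ?_)
      · have := (hk.has_μ1 z hz).fun_mul ((hasDerivAt_id' z).fun_mul (h.g_reg.has_dz t htI a z hz))
        exact this.congr_deriv (by ring)
      · have := abs_mul_le (hk.degenerate.drift_left z hz)
          (abs_mul_le (abs_le_max_abs_abs hz.1.le hz.2.le) (h.g_reg.bound t htI a z hz))
        linarith
      · have := abs_mul_le (hk.degenerate.drift_right z hz)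
          (abs_mul_le (abs_le_max_abs_abs hz.1.le hz.2.le) (h.g_reg.bound t htI a z hz))
        linarith
    have b2 := (hk.bdd_μ.mul bg0).add (bz.mul ((hk.bdd_μ1.mul bg0).add
          (hk.bdd_μ.mul (h.g_reg.bdd_dz htI))))
    have b3 : BddCont (𝔹(m)) fun x =>
        (x.2 * (r t + Hpp m.u (y.val t x.1 x.2 + f t * m.wInf) * y.da t x.1 x.2)
          + (Hpp m.u (y.val t x.1 x.2 + f t * m.wInf) * y.da t x.1 x.2 * (x.2 + r t * x.1)
            + Hp m.u (y.val t x.1 x.2 + f t * m.wInf) * r t)) * g.val t x.1 x.2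
        + (x.2 * (x.2 + r t * x.1 + Hp m.u (y.val t x.1 x.2 + f t * m.wInf))
          + Hp m.u (y.val t x.1 x.2 + f t * m.wInf) * (x.2 + r t * x.1)) * g.da t x.1 x.2 :=
      (((bz'.mul ((BddCont.const _).add ((c1.mul by1).mono S))).add
        ((((c1.mul by1).mono S).mul (bz'.add ((BddCont.const _).mul ba'))).add
          ((c0.mono S).mul (BddCont.const _)))).mul (bg0.mono S)).add
      (((bz'.mul ((bz'.add ((BddCont.const _).mul ba')).add (c0.mono S))).add
        ((c0.mono S).mul (bz'.add ((BddCont.const _).mul ba')))).mul (bg1.mono S))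
    have z3 : ∫ x in 𝔹(m),
        ((x.2 * (r t + Hpp m.u (y.val t x.1 x.2 + f t * m.wInf) * y.da t x.1 x.2)
          + (Hpp m.u (y.val t x.1 x.2 + f t * m.wInf) * y.da t x.1 x.2 * (x.2 + r t * x.1)
            + Hp m.u (y.val t x.1 x.2 + f t * m.wInf) * r t)) * g.val t x.1 x.2
        + (x.2 * (x.2 + r t * x.1 + Hp m.u (y.val t x.1 x.2 + f t * m.wInf))
          + Hp m.u (y.val t x.1 x.2 + f t * m.wInf) * (x.2 + r t * x.1)) * g.da t x.1 x.2) = 0 := by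
      have hlin : ContinuousOn (fun x : ℝ² => x.2 + r t * x.1) (univ ×ˢ 𝕁(m)) := by
        fun_prop
      refine setIntegral_box_deriv_a h3A
        (Ψ := fun a z => (z * (z + r t * a + Hp m.u (y.val t a z + f t * m.wInf))
          + Hp m.u (y.val t a z + f t * m.wInf) * (z + r t * a)) * g.val t a z)
        (F := fun a z => (z * (r t + Hpp m.u (y.val t a z + f t * m.wInf) * y.da t a z)
          + (Hpp m.u (y.val t a z + f t * m.wInf) * y.da t a z * (z + r t * a)
            + Hp m.u (y.val t a z + f t * m.wInf) * r t)) * g.val t a z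
        + (z * (z + r t * a + Hp m.u (y.val t a z + f t * m.wInf))
          + Hp m.u (y.val t a z + f t * m.wInf) * (z + r t * a)) * g.da t a z)
        (fun a z hz => ?_) ?_ b3.2 (fun z hz => ?_) (fun z hz => ?_)
      · have hl : HasDerivAt (fun a => z + r t * a) (r t) a := by
          simpa using ((hasDerivAt_id' a).const_mul (r t)).const_add z
        have hH := h.hasDerivAt_Hp hm htI a hz
        exact (((hl.fun_add hH).const_mul z).fun_add (hH.fun_mul hl)).fun_mul (h.g_reg.has_da t htI a z hz)
      · exact (((bz.1.mul (continuousOn_const.add (c1.1.mul by1.1))).add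
          (((c1.1.mul by1.1).mul hlin).add (c0.1.mul continuousOn_const))).mul bg0.1).add
          (((bz.1.mul (hlin.add c0.1)).add (c0.1.mul hlin)).mul bg1.1)
      · rw [h.g_supp t htI _ z hz (by rw [abs_neg, abs_of_nonneg h3A]; linarith), mul_zero]
      · rw [h.g_supp t htI _ z hz (by rw [abs_of_nonneg h3A]; linarith), mul_zero]
    have p1 := (bz.mul ((hk.bdd_μ1.mul bg0).add (hk.bdd_μ.mul (h.g_reg.bdd_dz htI)))).mono S
    have p2 := ((bg0.mul c1).mul ((((hk.bdd_D.neg.mul (h.y_reg.bdd_dzz htI)).sub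
      (hk.bdd_μ.mul (h.y_reg.bdd_dz htI))).sub (c0.mul by1)).add ((BddCont.const m.ρ).mul bq))).mono S
    have p3 := (c0.mul (bfwd.sub (((c1.mul by1).mul bg0).add (c0.mul bg1)))).mono S
    have p4 := (((bg0.mul c1).mul bq)).mono S
    have e := integral_combination p1.integrableOn p2.integrableOn p3.integrableOn p4.integrableOn
      (b1.mono S).integrableOn (b2.mono S).integrableOn b3.integrableOn (r t)
    have z1' : ∫ x in 𝔹(m), (x.2 * m.coeff.fwd x.2 (g.val t x.1 x.2)
        (g.dz t x.1 x.2) (g.dzz t x.1 x.2) - g.val t x.1 x.2 * m.coeff.μ x.2) = 0 := by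
      simpa [affine] using z1
    rw [z1', z2, z3] at e
    refine (setIntegral_congr_fun measurableSet_box fun x hx => ?_).trans (e.trans (by linarith))
    rw [h.y_eq t ht _ _ hx.2, h.g_eq t ht _ _ hx.2]
    ring
  have := abs_sub_le_of_deriv_le (B := 0) hcont hder
    (fun t ht => by rw [hzero t ht, abs_zero]) ht h.T_mem
  rwa [zero_mul, abs_nonpos_iff, sub_eq_zero] at this

end Model.RegSol

end

section

variable {T M : ℝ}

/-! ### The data -/

/-- The bounds on the data which determine the length of the time interval. -/
structure Model.RegData (m : Model) (N W : ℝ) (yT g₀ : ℝ² → ℝ) : Prop where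
  N_pos : 0 < N
  W_pos : 0 < W
  W_le : W ≤ m.wInf
  yT_reg : ∀ T, (𝕊(m) yT).Regular m.zMin m.zMax T N
  g₀_reg : ∀ T, (𝕊(m) g₀).Regular m.zMin m.zMax T N
  yT_lip : ∀ t a b, ∀ z ∈ 𝕁(m),
      |(𝕊(m) yT).da t a z - (𝕊(m) yT).da t b z| ≤ N * |a - b| ∧
      |(𝕊(m) yT).dz t a z - (𝕊(m) yT).dz t b z| ≤ N * |a - b| ∧
      |(𝕊(m) yT).dzz t a z - (𝕊(m) yT).dzz t b z| ≤ N * |a - b|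
  yT_supp : ∀ a, ∀ z ∈ 𝕁(m), 2 * m.A ≤ |a| → 𝔼(m) yT a z = 0
  le_v : ∀ a, ∀ z ∈ 𝕁(m), W ≤ 𝔼(m) yT a z + m.wInf
  g₀_nonneg : ∀ a, ∀ z ∈ 𝕁(m), 0 ≤ 𝔼(m) g₀ a z
  g₀_mass : ∫ x in 𝔹(m), 𝔼(m) g₀ x.1 x.2 = 1

lemma Model.IsData.exists_regData {m : Model} (hm : m.Admissible) {s : ℕ} (hs : 4 ≤ s)
    {yT g₀ : ℝ² → ℝ} (h : m.IsData s yT g₀) : ∃ N W, m.RegData N W yT g₀ := by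
  have hA := hm.A_pos
  have hz := hm.zMin_lt_zMax
  have hR : 2 * m.A < 3 * m.A := by linarith
  have h3A : -(3 * m.A) < 3 * m.A := by linarith
  have hys : ∀ a, ∀ z ∈ 𝕁(m), m.A ≤ |a| → |a| < 3 * m.A → yT (a, z) = 0 :=
    fun a z hz h1 h2 => m.eq_zero_of_aSupport h.yT_supp h1 h2 hz
  have hgs : ∀ a, ∀ z ∈ 𝕁(m), m.A ≤ |a| → |a| < 3 * m.A → g₀ (a, z) = 0 :=
    fun a z hz h1 h2 => m.eq_zero_of_aSupport h.g₀_supp h1 h2 hz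
  obtain ⟨ky, by'⟩ := (h.yT_mem.mono (show 3 + 2 ≤ s + 1 by omega)).isCk_and_bound h3A hz
    (h.yT_cont.mono m.Ω_subset_D)
  obtain ⟨kg, bg⟩ := (h.g₀_mem.mono (show 2 + 2 ≤ s by omega)).isCk_and_bound h3A hz
    (h.g₀_cont.mono m.Ω_subset_D)
  set Ny := embConst (-(3 * m.A)) (3 * m.A) m.zMin m.zMax *
    sobolevNorm (Ioo (-(3 * m.A)) (3 * m.A) ×ˢ 𝕁(m)) (3 + 2) yT with hNy
  set Ng := embConst (-(3 * m.A)) (3 * m.A) m.zMin m.zMax *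
    sobolevNorm (Ioo (-(3 * m.A)) (3 * m.A) ×ˢ 𝕁(m)) (2 + 2) g₀ with hNg
  obtain ⟨N, hN⟩ : ∃ N, N = max (max Ny Ng) 1 := ⟨_, rfl⟩
  have hN1 : Ny ≤ N := by rw [hN]; exact (le_max_left _ _).trans (le_max_left _ _)
  have hN2 : Ng ≤ N := by rw [hN]; exact (le_max_right _ _).trans (le_max_left _ _)
  have hN0 : 0 < N := by rw [hN]; exact one_pos.trans_le (le_max_right _ _)
  have hbb : BddBelow ((fun x => yT x + m.wInf) '' m.D) :=
    ((isCompact_Icc.prod isCompact_Icc).image_of_continuousOn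
      (h.yT_cont.add continuousOn_const)).bddBelow
  have hWle : ∀ x ∈ m.D, m.W yT ≤ yT x + m.wInf := fun x hx => csInf_le hbb ⟨x, hx, rfl⟩
  have hzm : (m.zMin + m.zMax) / 2 ∈ 𝕁(m) := ⟨by linarith, by linarith⟩
  have h2A : |2 * m.A| < 3 * m.A := by rw [abs_of_pos (by linarith)]; linarith
  have hWw : m.W yT ≤ m.wInf := by
    have := hWle _ (m.Ω_subset_D (mem_box h2A hzm))
    rwa [hys _ _ hzm (by rw [abs_of_pos (by linarith)]; linarith) h2A, zero_add] at this
  refine ⟨N, m.W yT, hN0, h.W_pos, hWw, fun T => ?_, fun T => ?_, fun t => ?_, fun a z hz ha => ?_,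
    fun a z hz => ?_, fun a z hz => ?_, ?_⟩
  · exact static_regular hR hN0.le (ky.mono (by norm_num))
      (fun i j hij x hx => (by' i j (by omega) x hx).trans hN1)
      (fun a z hz h1 h2 => hys a z hz (by linarith) h2) T
  · exact static_regular hR hN0.le kg (fun i j hij x hx => (bg i j (by omega) x hx).trans hN2)
      (fun a z hz h1 h2 => hgs a z hz (by linarith) h2) T
  · exact static_lipschitz hR hN0.le ky (fun i j hij x hx => (by' i j (by omega) x hx).trans hN1)
      (fun a z hz h1 h2 => hys a z hz (by linarith) h2)
  · unfold ext
    split_ifs with h1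
    exacts [hys a z hz (by linarith) h1, rfl]
  · unfold ext
    split_ifs with h1
    · exact hWle _ (m.Ω_subset_D (mem_box h1 hz))
    · rw [zero_add]; exact hWw
  · unfold ext
    split_ifs with h1
    exacts [h.g₀_nonneg _ (m.Ω_subset_D (mem_box h1 hz)), le_rfl]
  · rw [← h.g₀_mass, m.setIntegral_D]
    exact setIntegral_congr_fun measurableSet_box fun x hx => ext_of_lt (abs_lt.2 hx.1)

/-! ### Change of variables -/

lemma setIntegral_box_scale {zl zr E R : ℝ} (hE : 0 < E) (hR : 0 ≤ R) {F : ℝ → ℝ → ℝ}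
    (hF : BddCont (univ ×ˢ Ioo zl zr) fun x => F x.1 x.2) :
    ∫ x in box (E * R) zl zr, F x.1 x.2 = E * ∫ x in box R zl zr, F (E * x.1) x.2 := by
  have hF' : BddCont (univ ×ˢ Ioo zl zr) fun x => F (E * x.1) x.2 := by
    obtain ⟨h1, K, hK⟩ := hF
    exact ⟨h1.comp (f := fun x : ℝ² => ((E * x.1, x.2) : ℝ²)) (by fun_prop)
      fun x hx => ⟨mem_univ _, hx.2⟩, K, fun x hx => hK (E * x.1, x.2) ⟨mem_univ _, hx.2⟩⟩
  have i1 := (hF.mono (box_subset_strip (R := E * R))).integrableOn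
  have i2 := (hF'.mono (box_subset_strip (R := R))).integrableOn
  rw [IntegrableOn, volume_restrict_box] at i1 i2
  rw [volume_restrict_box, volume_restrict_box, integral_prod_symm _ i1, integral_prod_symm _ i2,
    ← integral_const_mul]
  refine setIntegral_congr_fun measurableSet_Ioo fun z _ => ?_
  change ∫ a in Ioo (-(E * R)) (E * R), F a z = E * ∫ a in Ioo (-R) R, F (E * a) z
  rw [← integral_Ioc_eq_integral_Ioo, ← integral_Ioc_eq_integral_Ioo,
    ← intervalIntegral.integral_of_le (by nlinarith), ← intervalIntegral.integral_of_le (by linarith),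
    intervalIntegral.mul_integral_comp_mul_left (f := fun a => F a z), mul_neg]

lemma setIntegral_box_mono {zl zr R R' : ℝ} (hR : R ≤ R') {F : ℝ → ℝ → ℝ}
    (hs : ∀ a, ∀ z ∈ Ioo zl zr, R ≤ |a| → F a z = 0) :
    ∫ x in box R' zl zr, F x.1 x.2 = ∫ x in box R zl zr, F x.1 x.2 := by
  refine setIntegral_eq_of_subset_of_forall_sdiff_eq_zero (s := box R zl zr) (t := box R' zl zr)
    (μ := volume) (f := fun x : ℝ² => F x.1 x.2) measurableSet_box
    (prod_mono (Ioo_subset_Ioo (neg_le_neg hR) hR) le_rfl) fun x hx => ?_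
  refine hs x.1 x.2 hx.1.2 (not_lt.1 fun hlt => ?_)
  exact hx.2 ⟨abs_lt.1 hlt, hx.1.2⟩

/-! ### The normalized solution -/

/-- The scale of wealth. -/
def Model.scl (m : Model) (T : ℝ) (f : ℝ → ℝ) (t : ℝ) : ℝ := f t * Real.exp (m.ρ * (T - t))

/-- The normalized function `Y = y / f`, as a function of the normalized wealth. -/
def Model.normY (m : Model) (T : ℝ) (y : StripPath) (f r : ℝ → ℝ) : StripPath :=
  y.scale (m.scl T f) (fun t => -(r t) * m.scl T f t) (fun t => (f t)⁻¹) fun t => (r t - m.ρ) * (f t)⁻¹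

/-- The density with respect to the normalized wealth. -/
def Model.normG (m : Model) (T : ℝ) (g : StripPath) (f r : ℝ → ℝ) : StripPath :=
  g.scale (m.scl T f) (fun t => -(r t) * m.scl T f t) (fun t => (m.scl T f t)⁻¹)
    fun t => r t * (m.scl T f t)⁻¹

namespace Model.RegSol

variable {m : Model} {yT g₀ : ℝ → ℝ → ℝ} {y g : StripPath} {f r : ℝ → ℝ} {C : ℝ}

lemma f_pos (hm : m.Admissible) (h : m.RegSol T M yT g₀ y g f r) : ∃ δ > 0, ∀ t ∈ Icc 0 T, δ ≤ f t := by
  obtain ⟨δ, hδ, hb⟩ := h.pos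
  have hw := hm.wInf_pos
  have hzm : (m.zMin + m.zMax) / 2 ∈ 𝕁(m) :=
    ⟨by linarith [hm.zMin_lt_zMax], by linarith [hm.zMin_lt_zMax]⟩
  refine ⟨δ / m.wInf, div_pos hδ hw, fun t ht => ?_⟩
  have := hb t ht (2 * m.A) _ hzm
  rw [h.y_supp t ht _ _ hzm (le_abs_self _), zero_add] at this
  rwa [div_le_iff₀ hw]

lemma scl_cont (h : m.RegSol T M yT g₀ y g f r) : ContinuousOn (m.scl T f) (Icc 0 T) :=
  h.f_cont.mul (by fun_prop)

lemma scl_deriv (h : m.RegSol T M yT g₀ y g f r) {t : ℝ} (ht : t ∈ Ioo 0 T) :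
    HasDerivAt (m.scl T f) (-(r t) * m.scl T f t) t := by
  have h1 : HasDerivAt (fun t => Real.exp (m.ρ * (T - t))) (Real.exp (m.ρ * (T - t)) * (m.ρ * -1)) t :=
    (((hasDerivAt_id' t).const_sub T).const_mul m.ρ).exp
  refine ((h.f_deriv t ht).fun_mul h1).congr_deriv ?_
  simp only [Model.scl]; ring

lemma scl_pos (hm : m.Admissible) (h : m.RegSol T M yT g₀ y g f r) :
    ∃ δ > 0, ∀ t ∈ Icc 0 T, δ ≤ m.scl T f t := by
  obtain ⟨δ, hδ, hb⟩ := h.f_pos hm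
  refine ⟨δ * Real.exp (-(|m.ρ| * T)), by positivity, fun t ht => ?_⟩
  refine mul_le_mul (hb t ht) (Real.exp_le_exp.2 ?_) (Real.exp_pos _).le (hδ.le.trans (hb t ht))
  have h1 : -(|m.ρ| * (T - t)) ≤ m.ρ * (T - t) := by
    nlinarith [neg_abs_le m.ρ, ht.2]
  nlinarith [abs_nonneg m.ρ, ht.1]

lemma exists_norm_regular (hm : m.Admissible) (h : m.RegSol T M yT g₀ y g f r) :
    ∃ M', (m.normY T y f r).Regular m.zMin m.zMax T M' ∧ (m.normG T g f r).Regular m.zMin m.zMax T M' := by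
  have hA := hm.A_pos
  obtain ⟨δ, hδ, hf⟩ := h.f_pos hm
  obtain ⟨e, he, hE⟩ := h.scl_pos hm
  obtain ⟨L, hL⟩ := isCompact_Icc.exists_bound_of_continuousOn h.scl_cont
  have hI {t} (h : t ∈ Ioo 0 T) := Ioo_subset_Icc_self h
  have hM0 : 0 ≤ M := (abs_nonneg _).trans (h.r_bdd (T / 2) ⟨by linarith [h.T_pos], by linarith [h.T_pos]⟩)
  have hL0 : 0 ≤ L := (norm_nonneg _).trans (hL 0 h.zero_mem)
  have finv : ∀ t ∈ Icc 0 T, |(f t)⁻¹| ≤ δ⁻¹ := fun t ht => by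
    rw [abs_inv, abs_of_pos (hδ.trans_le (hf t ht))]; exact inv_anti₀ hδ (hf t ht)
  have Einv : ∀ t ∈ Icc 0 T, |(m.scl T f t)⁻¹| ≤ e⁻¹ := fun t ht => by
    rw [abs_inv, abs_of_pos (he.trans_le (hE t ht))]; exact inv_anti₀ he (hE t ht)
  have EL' : ∀ t ∈ Ioo 0 T, |-(r t) * m.scl T f t| ≤ M * L := fun t ht =>
    abs_mul_le (by rw [abs_neg]; exact h.r_bdd t ht) (hL t (hI ht))
  have hδ' : 0 ≤ δ⁻¹ := by positivity
  have he' : 0 ≤ e⁻¹ := by positivity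
  have hρ := abs_nonneg m.ρ
  have n1 : 0 ≤ M * L := by positivity
  have n2 : 0 ≤ (M + |m.ρ|) * δ⁻¹ := by positivity
  have n3 : 0 ≤ M * e⁻¹ := by positivity
  have ydz := h.y_reg.da_eq_zero h.y_supp
  have gdz := h.g_reg.da_eq_zero h.g_supp
  obtain ⟨M1, hM1⟩ := h.y_reg.scale (E := m.scl T f) (E' := fun t => -(r t) * m.scl T f t)
    (c := fun t => (f t)⁻¹) (c' := fun t => (r t - m.ρ) * (f t)⁻¹)
    (L := M * L + (δ⁻¹ + (M + |m.ρ|) * δ⁻¹)) (R := 2 * m.A) he (by linarith)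
    h.scl_cont (h.f_cont.inv₀ fun t ht => (hδ.trans_le (hf t ht)).ne') hE (fun t ht => h.scl_deriv ht)
    (fun t ht => by
      have hne := (hδ.trans_le (hf t (hI ht))).ne'
      refine ((h.f_deriv t ht).fun_inv hne).congr_deriv ?_
      field_simp; ring)
    (fun t ht => (finv t ht).trans (by linarith))
    (fun t ht => (abs_mul_le ((abs_sub _ _).trans (add_le_add (h.r_bdd t ht) le_rfl))
      (finv t (hI ht))).trans (by linarith))
    (fun t ht => (EL' t ht).trans (by linarith)) ydz
  obtain ⟨M2, hM2⟩ := h.g_reg.scale (E := m.scl T f) (E' := fun t => -(r t) * m.scl T f t)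
    (c := fun t => (m.scl T f t)⁻¹) (c' := fun t => r t * (m.scl T f t)⁻¹)
    (L := M * L + (e⁻¹ + M * e⁻¹)) (R := 2 * m.A) he (by linarith)
    h.scl_cont (h.scl_cont.inv₀ fun t ht => (he.trans_le (hE t ht)).ne') hE (fun t ht => h.scl_deriv ht)
    (fun t ht => by
      have hne := (he.trans_le (hE t (hI ht))).ne'
      refine ((h.scl_deriv ht).fun_inv hne).congr_deriv ?_
      field_simp)
    (fun t ht => (Einv t ht).trans (by linarith))
    (fun t ht => (abs_mul_le (h.r_bdd t ht) (Einv t (hI ht))).trans (by linarith))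
    (fun t ht => (EL' t ht).trans (by linarith)) gdz
  exact ⟨max M1 M2, hM1.mono (le_max_left _ _), hM2.mono (le_max_right _ _)⟩

/-- The drift of normalized wealth. -/
def _root_.WealthMFG.Model.ndrift (m : Model) (T : ℝ) (Y : StripPath) (f : ℝ → ℝ) (t a z : ℝ) : ℝ :=
  m.scl T f t * (z + Hp m.u (f t * (Y.val t a z + m.wInf)))

lemma normY_q (hm : m.Admissible) (h : m.RegSol T M yT g₀ y g f r) {t : ℝ} (ht : t ∈ Icc 0 T) (a z : ℝ) :
    f t * ((m.normY T y f r).val t a z + m.wInf) = y.val t (a / m.scl T f t) z + f t * m.wInf := by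
  obtain ⟨δ, hδ, hf⟩ := h.f_pos hm
  have := (hδ.trans_le (hf t ht)).ne'
  simp only [Model.normY, StripPath.scale]
  field_simp

lemma normY_eq (hm : m.Admissible) (h : m.RegSol T M yT g₀ y g f r) {t : ℝ} (ht : t ∈ Ioo 0 T) (a : ℝ)
    {z : ℝ} (hz : z ∈ 𝕁(m)) : (m.normY T y f r).dt t a z = -(m.coeff.D z * (m.normY T y f r).dzz t a z
      + m.coeff.μ z * (m.normY T y f r).dz t a z
      + m.ndrift T (m.normY T y f r) f t a z * (m.normY T y f r).da t a z) := by
  have htI := Ioo_subset_Icc_self ht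
  obtain ⟨δ, hδ, hf⟩ := h.f_pos hm
  obtain ⟨e, he, hE⟩ := h.scl_pos hm
  have hf0 := (hδ.trans_le (hf t htI)).ne'
  have hE0 := (he.trans_le (hE t htI)).ne'
  rw [Model.ndrift, h.normY_q hm htI]
  simp only [Model.normY, StripPath.scale]
  rw [h.y_eq t ht _ z hz]
  field_simp
  ring

lemma normG_eq (hm : m.Admissible) (h : m.RegSol T M yT g₀ y g f r) {t : ℝ} (ht : t ∈ Ioo 0 T) (a : ℝ)
    {z : ℝ} (hz : z ∈ 𝕁(m)) : (m.normG T g f r).dt t a z = m.coeff.fwd z ((m.normG T g f r).val t a z)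
        ((m.normG T g f r).dz t a z) ((m.normG T g f r).dzz t a z)
      - (m.scl T f t * (Hpp m.u (f t * ((m.normY T y f r).val t a z + m.wInf)) *
          (f t * (m.normY T y f r).da t a z)) * (m.normG T g f r).val t a z
        + m.ndrift T (m.normY T y f r) f t a z * (m.normG T g f r).da t a z) := by
  have htI := Ioo_subset_Icc_self ht
  obtain ⟨δ, hδ, hf⟩ := h.f_pos hm
  obtain ⟨e, he, hE⟩ := h.scl_pos hm
  have hf0 := (hδ.trans_le (hf t htI)).ne'
  have hE0 := (he.trans_le (hE t htI)).ne'
  rw [Model.ndrift, h.normY_q hm htI]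
  simp only [Model.normY, Model.normG, StripPath.scale, CoeffData.fwd]
  rw [h.g_eq t ht _ z hz, CoeffData.fwd]
  field_simp
  ring

end Model.RegSol

end

section

variable {T M : ℝ}

/-- A normalized solution, with the bounds which depend only on the data. -/
structure Model.NormSol (m : Model) (N W Λ : ℝ) (yT g₀ : ℝ² → ℝ) (T M : ℝ) (Y G : StripPath)
    (f : ℝ → ℝ) : Prop where
  T_pos : 0 < T
  Y_reg : Y.Regular m.zMin m.zMax T M
  G_reg : G.Regular m.zMin m.zMax T M
  Y_supp : ∀ t ∈ Icc 0 T, ∀ a, ∀ z ∈ 𝕁(m), 3 * m.A * Λ ≤ |a| → Y.val t a z = 0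
  Y_da_usc : ∀ t₀ ∈ Icc 0 T, ∀ c, (∀ a, ∀ z ∈ 𝕁(m), |Y.da t₀ a z| ≤ c) → ∀ ε > 0,
    ∀ᶠ t in 𝓝[Icc 0 T] t₀, ∀ a, ∀ z ∈ 𝕁(m), |Y.da t a z| ≤ c + ε
  f_mem : ∀ t ∈ Icc 0 T, f t ∈ Icc Λ⁻¹ Λ
  scl_mem : ∀ t ∈ Icc 0 T, m.scl T f t ∈ Icc Λ⁻¹ Λ
  f_T : f T = 1
  le_v : ∀ t ∈ Icc 0 T, ∀ a, ∀ z ∈ 𝕁(m), W ≤ Y.val t a z + m.wInf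
  v_le : ∀ t ∈ Icc 0 T, ∀ a, ∀ z ∈ 𝕁(m), Y.val t a z + m.wInf ≤ N + m.wInf
  Y_eq : ∀ t ∈ Ioo 0 T, ∀ a, ∀ z ∈ 𝕁(m), Y.dt t a z = -(m.coeff.D z * Y.dzz t a z
      + m.coeff.μ z * Y.dz t a z + m.ndrift T Y f t a z * Y.da t a z)
  G_forward : G.Forward m.coeff (m.ndrift T Y f)
    (fun t a z => m.scl T f t * (Hpp m.u (f t * (Y.val t a z + m.wInf)) * (f t * Y.da t a z)))
    m.zMin m.zMax T (3 * m.A * Λ)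
  G_nonneg : ∀ t ∈ Icc 0 T, ∀ a, ∀ z ∈ 𝕁(m), 0 ≤ G.val t a z
  mass : ∀ t ∈ Icc 0 T, ∫ x in 𝔹(m,Λ), G.val t x.1 x.2 = 1
  cons : ∀ t ∈ Icc 0 T, ∫ x in 𝔹(m,Λ),
      (x.2 + Hp m.u (f t * (Y.val t x.1 x.2 + m.wInf))) * G.val t x.1 x.2
    = ∫ x in 𝔹(m,Λ),
      (x.2 + Hp m.u (f T * (Y.val T x.1 x.2 + m.wInf))) * G.val T x.1 x.2
  Y_T : ∀ a, ∀ z ∈ 𝕁(m), Y.val T a z = 𝔼(m) yT a z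
  G_0 : ∀ a, ∀ z ∈ 𝕁(m),
    G.val 0 a z = (m.scl T f 0)⁻¹ * 𝔼(m) g₀ (a / m.scl T f 0) z

/-- `H_p` is increasing. -/
lemma IsUtility.strictMonoOn_Hp {u : ℝ → ℝ} (hu : IsUtility u) : StrictMonoOn (Hp u) (Ioi 0) := by
  refine strictMonoOn_of_deriv_pos (convex_Ioi 0) hu.continuousOn_Hp fun x hx => ?_
  rw [interior_Ioi] at hx
  exact hu.Hp_props.2 x hx

namespace Model.RegSol

variable {m : Model} {yT g₀ : ℝ² → ℝ} {y g : StripPath} {f r : ℝ → ℝ} {C N W : ℝ}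

lemma scl_T (h : m.RegSol T M (𝔼(m) yT) (𝔼(m) g₀) y g f r) : m.scl T f T = 1 := by
  simp [Model.scl, h.f_T]

lemma normY_T (h : m.RegSol T M (𝔼(m) yT) (𝔼(m) g₀) y g f r) (a : ℝ) {z : ℝ}
    (hz : z ∈ 𝕁(m)) : (m.normY T y f r).val T a z = 𝔼(m) yT a z := by
  simp only [Model.normY, StripPath.scale]
  rw [h.scl_T, h.f_T, h.y_T _ z hz]
  simp

lemma normY_supp (hm : m.Admissible) (h : m.RegSol T M (𝔼(m) yT) (𝔼(m) g₀) y g f r) {L : ℝ}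
    (hL : ∀ t ∈ Icc 0 T, m.scl T f t ≤ L) {t : ℝ} (ht : t ∈ Icc 0 T) {a z : ℝ}
    (hz : z ∈ 𝕁(m)) (ha : 3 * m.A * L ≤ |a|) :
    (m.normY T y f r).val t a z = 0 ∧ (m.normG T g f r).val t a z = 0 := by
  obtain ⟨e, he, hE⟩ := h.scl_pos hm
  have hA := hm.A_pos
  have hEp := he.trans_le (hE t ht)
  have : 2 * m.A ≤ |a / m.scl T f t| := by
    rw [abs_div, abs_of_pos hEp, le_div_iff₀ hEp]
    nlinarith [hL t ht]
  simp only [Model.normY, Model.normG, StripPath.scale]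
  rw [h.y_supp t ht _ z hz this, h.g_supp t ht _ z hz this, mul_zero, mul_zero]
  exact ⟨rfl, rfl⟩

lemma v_bounds (hm : m.Admissible) (hk : m.CoeffRegular C)
    (hd : m.RegData N W yT g₀) (h : m.RegSol T M (𝔼(m) yT) (𝔼(m) g₀) y g f r) :
    ∀ t ∈ Icc 0 T, ∀ a, ∀ z ∈ 𝕁(m), W ≤ (m.normY T y f r).val t a z + m.wInf ∧
      (m.normY T y f r).val t a z + m.wInf ≤ N + m.wInf := by
  obtain ⟨M', hY, -⟩ := h.exists_norm_regular hm
  obtain ⟨L, hL⟩ := isCompact_Icc.exists_bound_of_continuousOn h.scl_cont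
  have hL' : ∀ t ∈ Icc 0 T, m.scl T f t ≤ L := fun t ht => (le_abs_self _).trans (hL t ht)
  have hL0 : 0 ≤ L := (norm_nonneg _).trans (hL 0 h.zero_mem)
  have hA := hm.A_pos
  have hs : ∀ t ∈ Icc 0 T, ∀ z ∈ 𝕁(m), ∀ a, 3 * m.A * L ≤ |a| →
      (m.normY T y f r).val t a z = 0 := fun t ht z hz a ha => (h.normY_supp hm hL' ht hz ha).1
  intro t ht a z hz
  have up := hY.le_of_backward hk.C_nonneg hk.degenerate (b := m.ndrift T (m.normY T y f r) f)
    (R := 3 * m.A * L) (K := N) (S := 0) (c := 0) le_rfl hd.N_pos.le le_rfl le_rfl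
    (fun t ht a z hz => exists_clamp (by positivity) (hs t ht z hz) a)
    (fun a z hz => by
      rw [h.normY_T a hz]
      exact (le_abs_self _).trans ((hd.yT_reg T).bound T h.T_mem a z hz))
    (fun t ht a z hz _ => by rw [h.normY_eq hm ht a hz]; linarith) t ht a z hz
  have lo := (hY.comb hY (-1) 0).le_of_backward hk.C_nonneg hk.degenerate
    (b := m.ndrift T (m.normY T y f r) f)
    (R := 3 * m.A * L) (K := m.wInf - W) (S := 0) (c := 0) le_rfl (by linarith [hd.W_le]) le_rfl le_rfl
    (fun t ht a z hz => exists_clamp (F := fun a => ((m.normY T y f r).comb (-1) (m.normY T y f r) 0).val t a z)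
      (by positivity) (fun a ha => by simp [StripPath.comb, hs t ht z hz a ha]) a)
    (fun a z hz => by
      simp only [StripPath.comb]
      rw [h.normY_T a hz]
      linarith [hd.le_v a z hz])
    (fun t ht a z hz _ => by
      simp only [StripPath.comb]
      rw [h.normY_eq hm ht a hz]; linarith) t ht a z hz
  simp only [StripPath.comb] at lo
  simp only [zero_mul, add_zero, Real.exp_zero, mul_one] at up lo
  constructor <;> linarith

lemma q_bounds (hm : m.Admissible) (hk : m.CoeffRegular C)
    (hd : m.RegData N W yT g₀) (h : m.RegSol T M (𝔼(m) yT) (𝔼(m) g₀) y g f r) :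
    ∀ t ∈ Icc 0 T, ∀ a, ∀ z ∈ 𝕁(m), f t * W ≤ y.val t a z + f t * m.wInf ∧
      y.val t a z + f t * m.wInf ≤ f t * (N + m.wInf) := by
  intro t ht a z hz
  obtain ⟨δ, hδ, hf⟩ := h.f_pos hm
  obtain ⟨e, he, hE⟩ := h.scl_pos hm
  have hfp := hδ.trans_le (hf t ht)
  have hEp := he.trans_le (hE t ht)
  have e1 := h.normY_q hm ht (m.scl T f t * a) z
  rw [mul_div_cancel_left₀ _ hEp.ne'] at e1
  have e2 := h.v_bounds hm hk hd t ht (m.scl T f t * a) z hz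
  rw [← e1]
  exact ⟨mul_le_mul_of_nonneg_left e2.1 hfp.le, mul_le_mul_of_nonneg_left e2.2 hfp.le⟩

lemma mean_bounds (hm : m.Admissible) (hk : m.CoeffRegular C)
    (hd : m.RegData N W yT g₀) (h : m.RegSol T M (𝔼(m) yT) (𝔼(m) g₀) y g f r) {t : ℝ} (ht : t ∈ Icc 0 T) :
    Hp m.u (f t * W) ≤ ∫ x in 𝔹(m), Hp m.u (y.val t x.1 x.2 + f t * m.wInf) * g.val t x.1 x.2 ∧
    ∫ x in 𝔹(m), Hp m.u (y.val t x.1 x.2 + f t * m.wInf) * g.val t x.1 x.2 ≤ Hp m.u (f t * (N + m.wInf)) := by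
  obtain ⟨δ, hδ, hf⟩ := h.f_pos hm
  have hfp := hδ.trans_le (hf t ht)
  have hmono := hm.utility.strictMonoOn_Hp.monotoneOn
  obtain ⟨L0, hL0, h0b, h0c⟩ := h.bdd_comp hm.utility.continuousOn_Hp
  have hg := (h.g_reg.bdd_val ht).mono (box_subset_strip (R := 3 * m.A))
  have hφg := ((h0c t ht).mul (h.g_reg.bdd_val ht)).mono (box_subset_strip (R := 3 * m.A))
  have e : ∀ c : ℝ, c = ∫ x in 𝔹(m), c * g.val t x.1 x.2 := fun c => by
    rw [integral_const_mul, h.mass hm hk t ht, hd.g₀_mass, mul_one]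
  have hw := hm.wInf_pos
  constructor
  · rw [e (Hp m.u (f t * W))]
    refine setIntegral_mono_on (hg.integrableOn.const_mul _) hφg.integrableOn measurableSet_box
      fun x hx => mul_le_mul_of_nonneg_right ?_ (h.g_nonneg hm hk hd.g₀_nonneg t ht _ _ hx.2)
    exact hmono (mul_pos hfp hd.W_pos) (h.q_pos ht _ hx.2) (h.q_bounds hm hk hd t ht _ _ hx.2).1
  · rw [e (Hp m.u (f t * (N + m.wInf)))]
    refine setIntegral_mono_on hφg.integrableOn (hg.integrableOn.const_mul _) measurableSet_box
      fun x hx => mul_le_mul_of_nonneg_right ?_ (h.g_nonneg hm hk hd.g₀_nonneg t ht _ _ hx.2)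
    exact hmono (h.q_pos ht _ hx.2) (mul_pos hfp (by linarith [hd.N_pos]))
      (h.q_bounds hm hk hd t ht _ _ hx.2).2

lemma mean_diff (hm : m.Admissible) (hk : m.CoeffRegular C)
    (hd : m.RegData N W yT g₀) (h : m.RegSol T M (𝔼(m) yT) (𝔼(m) g₀) y g f r) {t : ℝ} (ht : t ∈ Icc 0 T) :
    |(∫ x in 𝔹(m), Hp m.u (y.val t x.1 x.2 + f t * m.wInf) * g.val t x.1 x.2)
      - ∫ x in 𝔹(m), Hp m.u (y.val T x.1 x.2 + f T * m.wInf) * g.val T x.1 x.2| ≤ C * T := by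
  obtain ⟨L0, hL0, h0b, h0c⟩ := h.bdd_comp hm.utility.continuousOn_Hp
  have bz := m.bddCont_z
  have e1 := h.conservation hm hk hd.g₀_nonneg hd.g₀_mass ht
  have e2 := h.moment hm hk hd.g₀_nonneg hd.g₀_mass ht h.T_mem
  have e3 : ∀ s ∈ Icc 0 T, ∫ x in 𝔹(m),
      (x.2 + Hp m.u (y.val s x.1 x.2 + f s * m.wInf)) * g.val s x.1 x.2
      = (∫ x in 𝔹(m), x.2 * g.val s x.1 x.2)
        + ∫ x in 𝔹(m), Hp m.u (y.val s x.1 x.2 + f s * m.wInf) * g.val s x.1 x.2 :=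
    fun s hs => by
      simp only [add_mul]
      exact integral_add ((bz.mul (h.g_reg.bdd_val hs)).mono box_subset_strip).integrableOn
        (((h0c s hs).mul (h.g_reg.bdd_val hs)).mono box_subset_strip).integrableOn
  rw [e3 t ht, e3 T h.T_mem] at e1
  have hC := hk.C_nonneg
  rw [abs_sub_comm t T, abs_of_nonneg (show 0 ≤ T - t by linarith [ht.2])] at e2
  have e4 : C * (T - t) ≤ C * T := by nlinarith [ht.1]
  rw [abs_le] at e2 ⊢
  constructor <;> linarith [e2.1, e2.2]

end Model.RegSol

/-- For short times the scales `f` and `E` are bounded above and below. -/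
lemma Model.RegData.exists_scale_bounds {m : Model} (hm : m.Admissible) {C N W : ℝ}
    (hk : m.CoeffRegular C) {yT g₀ : ℝ² → ℝ} (hd : m.RegData N W yT g₀) :
    ∃ Λ, 1 ≤ Λ ∧ ∃ τ > 0, τ ≤ 1 ∧ ∀ T < τ, ∀ M y g f r, m.RegSol T M (𝔼(m) yT) (𝔼(m) g₀) y g f r →
      ∀ t ∈ Icc 0 T, f t ∈ Icc Λ⁻¹ Λ ∧ m.scl T f t ∈ Icc Λ⁻¹ Λ := by
  have hN := hd.N_pos
  have hW := hd.W_pos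
  have hw := hm.wInf_pos
  have hC := hk.C_nonneg
  have hWN : W ≤ N + m.wInf := by linarith [hd.W_le]
  have hsm := hm.utility.strictMonoOn_Hp
  obtain ⟨V, hV⟩ : ∃ V, V = N + m.wInf := ⟨_, rfl⟩
  have hVp : 0 < V := by linarith
  have g1 : 0 < Hp m.u (2 * V) - Hp m.u V :=
    sub_pos.2 (hsm (show 0 < V from hVp) (show 0 < 2 * V by linarith) (by linarith))
  have g2 : 0 < Hp m.u W - Hp m.u (W / 2) :=
    sub_pos.2 (hsm (show 0 < W / 2 by linarith) (show 0 < W from hW) (by linarith))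
  obtain ⟨η, hη⟩ : ∃ η, η = min (Hp m.u (2 * V) - Hp m.u V) (Hp m.u W - Hp m.u (W / 2)) := ⟨_, rfl⟩
  have hη0 : 0 < η := by rw [hη]; exact lt_min g1 g2
  have hη1 : η ≤ Hp m.u (2 * V) - Hp m.u V := by rw [hη]; exact min_le_left _ _
  have hη2 : η ≤ Hp m.u W - Hp m.u (W / 2) := by rw [hη]; exact min_le_right _ _
  obtain ⟨Λ₀, hΛ₀⟩ : ∃ Λ₀, Λ₀ = 2 * V / W := ⟨_, rfl⟩
  have hΛ₀1 : 1 ≤ Λ₀ := by rw [hΛ₀, le_div_iff₀ hW]; linarith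
  have hΛ₀p : 0 < Λ₀ := by linarith
  have hexp1 : 1 ≤ Real.exp |m.ρ| := Real.one_le_exp (abs_nonneg _)
  refine ⟨Λ₀ * Real.exp |m.ρ|, one_le_mul_of_one_le_of_one_le hΛ₀1 hexp1, min 1 (η / (C + 1)), by positivity,
    min_le_left _ _, ?_⟩
  intro T hT M y g f r h t ht
  have hT1 : T ≤ 1 := hT.le.trans (min_le_left _ _)
  have hCT : C * T ≤ η := by
    have : T ≤ η / (C + 1) := hT.le.trans (min_le_right _ _)
    rw [le_div_iff₀ (by linarith)] at this
    nlinarith [h.T_pos]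
  obtain ⟨δ, hδ, hf⟩ := h.f_pos hm
  have hfp := hδ.trans_le (hf t ht)
  have m1 := h.mean_bounds hm hk hd ht
  have m2 := h.mean_bounds hm hk hd h.T_mem
  have m3 := abs_le.1 (h.mean_diff hm hk hd ht)
  simp only [h.f_T, one_mul] at m2 m3
  rw [← hV] at m1 m2
  have hfu : f t ≤ Λ₀ := by
    have : f t * W ≤ 2 * V := by
      by_contra! hlt
      have := hsm (show 0 < 2 * V by linarith) (show 0 < f t * W by positivity) hlt
      linarith [m1.1, m2.2, m3.2]
    rw [hΛ₀, le_div_iff₀ hW]; exact this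
  have hfl : Λ₀⁻¹ ≤ f t := by
    have : W / 2 ≤ f t * V := by
      by_contra! hlt
      have := hsm (show 0 < f t * V by positivity) (show 0 < W / 2 by linarith) hlt
      linarith [m1.2, m2.1, m3.1]
    rw [hΛ₀, inv_div, div_le_iff₀ (by linarith)]; linarith
  have hsρ : |m.ρ * (T - t)| ≤ |m.ρ| := by
    have := abs_mul_le (le_refl |m.ρ|) (show |T - t| ≤ 1 by
      rw [abs_of_nonneg (by linarith [ht.2])]; linarith [ht.1])
    linarith
  have eu : Real.exp (m.ρ * (T - t)) ≤ Real.exp |m.ρ| := Real.exp_le_exp.2 ((le_abs_self _).trans hsρ)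
  have el : (Real.exp |m.ρ|)⁻¹ ≤ Real.exp (m.ρ * (T - t)) := by
    rw [← Real.exp_neg]; exact Real.exp_le_exp.2 (abs_le.1 hsρ).1
  have hinv : (Λ₀ * Real.exp |m.ρ|)⁻¹ = Λ₀⁻¹ * (Real.exp |m.ρ|)⁻¹ := mul_inv _ _
  have hi1 : (Real.exp |m.ρ|)⁻¹ ≤ 1 := inv_le_one_of_one_le₀ hexp1
  have hΛi : 0 < Λ₀⁻¹ := by positivity
  refine ⟨⟨?_, ?_⟩, ?_, ?_⟩
  · rw [hinv]; nlinarith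
  · nlinarith
  · rw [hinv]; exact mul_le_mul hfl el (by positivity) hfp.le
  · exact mul_le_mul hfu eu (Real.exp_pos _).le hΛ₀p.le

namespace Model.RegSol

variable {m : Model} {yT g₀ : ℝ² → ℝ} {y g : StripPath} {f r : ℝ → ℝ} {C N W : ℝ}

lemma setIntegral_norm (hm : m.Admissible) (h : m.RegSol T M (𝔼(m) yT) (𝔼(m) g₀) y g f r) {Λ : ℝ}
    (hE : ∀ t ∈ Icc 0 T, m.scl T f t ≤ Λ) {t : ℝ} (ht : t ∈ Icc 0 T) {φ : ℝ → ℝ → ℝ}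
    (hφ : BddCont (univ ×ˢ 𝕁(m)) fun x => φ x.1 x.2) :
    ∫ x in 𝔹(m,Λ), φ x.1 x.2 * (m.normG T g f r).val t x.1 x.2
      = ∫ x in 𝔹(m), φ (m.scl T f t * x.1) x.2 * g.val t x.1 x.2 := by
  obtain ⟨M', -, hG⟩ := h.exists_norm_regular hm
  obtain ⟨e, he, hEe⟩ := h.scl_pos hm
  have hEp := he.trans_le (hEe t ht)
  have hA := hm.A_pos
  have h1 : m.scl T f t * (3 * m.A) ≤ 3 * m.A * Λ := by
    rw [mul_comm]; exact mul_le_mul_of_nonneg_left (hE t ht) (by linarith)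
  rw [setIntegral_box_mono (F := fun a z => φ a z * (m.normG T g f r).val t a z) h1 fun a z hz ha => by
      have : 2 * m.A ≤ |a / m.scl T f t| := by
        rw [abs_div, abs_of_pos hEp, le_div_iff₀ hEp]; nlinarith
      simp only [Model.normG, StripPath.scale]
      rw [h.g_supp t ht _ z hz this, mul_zero, mul_zero],
    setIntegral_box_scale hEp (by linarith) (F := fun a z => φ a z * (m.normG T g f r).val t a z)
      (hφ.mul (hG.bdd_val ht)), ← integral_const_mul]
  refine setIntegral_congr_fun measurableSet_box fun x hx => ?_
  simp only [Model.normG, StripPath.scale]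
  rw [mul_div_cancel_left₀ _ hEp.ne']
  field_simp

lemma normSol (hm : m.Admissible) (hk : m.CoeffRegular C)
    (hd : m.RegData N W yT g₀) (h : m.RegSol T M (𝔼(m) yT) (𝔼(m) g₀) y g f r) {Λ : ℝ}
    (hΛ : 1 ≤ Λ) (hf : ∀ t ∈ Icc 0 T, f t ∈ Icc Λ⁻¹ Λ ∧ m.scl T f t ∈ Icc Λ⁻¹ Λ) :
    ∃ M', m.NormSol N W Λ yT g₀ T M' (m.normY T y f r) (m.normG T g f r) f := by
  obtain ⟨M', hY, hG⟩ := h.exists_norm_regular hm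
  have hΛp : 0 < Λ := by linarith
  have hΛi : 0 < Λ⁻¹ := by positivity
  have hfp : ∀ t ∈ Icc 0 T, 0 < f t := fun t ht => hΛi.trans_le (hf t ht).1.1
  have hEp : ∀ t ∈ Icc 0 T, 0 < m.scl T f t := fun t ht => hΛi.trans_le (hf t ht).2.1
  have hEu : ∀ t ∈ Icc 0 T, m.scl T f t ≤ Λ := fun t ht => (hf t ht).2.2
  have hA := hm.A_pos
  have hI {t} (h : t ∈ Ioo 0 T) := Ioo_subset_Icc_self h
  have hvb := h.v_bounds hm hk hd
  have hqm : ∀ t ∈ Icc 0 T, ∀ a, ∀ z ∈ 𝕁(m),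
      Λ⁻¹ * W ≤ f t * ((m.normY T y f r).val t a z + m.wInf) ∧
      f t * ((m.normY T y f r).val t a z + m.wInf) ≤ Λ * (N + m.wInf) := fun t ht a z hz =>
    ⟨mul_le_mul (hf t ht).1.1 (hvb t ht a z hz).1 hd.W_pos.le (hfp t ht).le,
      mul_le_mul (hf t ht).1.2 (hvb t ht a z hz).2 (hd.W_pos.le.trans (hvb t ht a z hz).1) hΛp.le⟩
  have hq0 : 0 < Λ⁻¹ * W := mul_pos hΛi hd.W_pos
  have bH : ∀ {φ : ℝ → ℝ}, ContinuousOn φ (Ioi 0) → ∃ L, 0 ≤ L ∧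
      (∀ t ∈ Icc 0 T, ∀ a, ∀ z ∈ 𝕁(m),
        |φ (f t * ((m.normY T y f r).val t a z + m.wInf))| ≤ L) ∧
      ∀ t ∈ Icc 0 T, BddCont (univ ×ˢ 𝕁(m))
        fun x => φ (f t * ((m.normY T y f r).val t x.1 x.2 + m.wInf)) := by
    intro φ hφ
    obtain ⟨L, hL, hb⟩ := exists_bound_comp hφ hq0 (Λ * (N + m.wInf))
    refine ⟨L, hL, fun t ht a z hz => hb _ (hqm t ht a z hz).1 (hqm t ht a z hz).2, fun t ht => ⟨?_, L,
      fun x hx => hb _ (hqm t ht _ _ hx.2).1 (hqm t ht _ _ hx.2).2⟩⟩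
    exact hφ.comp (continuousOn_const.mul ((hY.cont_slice ht).add continuousOn_const))
      fun x hx => hq0.trans_le (hqm t ht _ _ hx.2).1
  obtain ⟨L0, hL0, h0b, h0c⟩ := bH hm.utility.continuousOn_Hp
  obtain ⟨L1, hL1, h1b, h1c⟩ := bH hm.utility.continuousOn_Hpp
  have bz := m.bddCont_z
  have hEabs : ∀ t ∈ Icc 0 T, |m.scl T f t| ≤ Λ := fun t ht => by
    rw [abs_of_pos (hEp t ht)]; exact hEu t ht
  have hfabs : ∀ t ∈ Icc 0 T, |f t| ≤ Λ := fun t ht => by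
    rw [abs_of_pos (hfp t ht)]; exact (hf t ht).1.2
  exact ⟨M',
  { T_pos := h.T_pos
    Y_reg := hY
    G_reg := hG
    Y_supp := fun t ht a z hz ha => (h.normY_supp hm hEu ht hz ha).1
    Y_da_usc := fun t₀ ht₀ c hc ε hε => by
      have hfE : ContinuousOn (fun t => (f t)⁻¹ / m.scl T f t) (Icc 0 T) :=
        (h.f_cont.inv₀ fun t ht => (hfp t ht).ne').div h.scl_cont fun t ht => (hEp t ht).ne'
      have p0 := hfp t₀ ht₀
      have p1 := hEp t₀ ht₀
      obtain ⟨ε', hε'⟩ : ∃ ε', ε' = ε * (f t₀ * m.scl T f t₀) / 2 := ⟨_, rfl⟩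
      have hε'0 : 0 < ε' := by rw [hε']; positivity
      have hlim := ((hfE t₀ ht₀).mul_const (c * (f t₀ * m.scl T f t₀) + ε'))
      have hval : (f t₀)⁻¹ / m.scl T f t₀ * (c * (f t₀ * m.scl T f t₀) + ε') < c + ε := by
        rw [hε']; field_simp; linarith
      filter_upwards [hlim.eventually (Iio_mem_nhds hval), h.y_da_cont t₀ ht₀ ε' hε'0,
        self_mem_nhdsWithin] with t h1 h2 ht a z hz
      simp only [Model.normY, StripPath.scale]
      have p2 : 0 < (f t)⁻¹ / m.scl T f t := div_pos (inv_pos.2 (hfp t ht)) (hEp t ht)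
      rw [abs_mul, abs_of_pos p2]
      refine le_trans (mul_le_mul_of_nonneg_left ?_ p2.le) (le_of_lt h1)
      have e1 := h2 (a / m.scl T f t) z hz
      have e2 := hc (m.scl T f t₀ * (a / m.scl T f t)) z hz
      simp only [Model.normY, StripPath.scale] at e2
      rw [mul_div_cancel_left₀ _ p1.ne', abs_mul, abs_of_pos (div_pos (inv_pos.2 p0) p1)] at e2
      have e3 : |y.da t₀ (a / m.scl T f t) z| ≤ c * (f t₀ * m.scl T f t₀) := by
        have : (f t₀)⁻¹ / m.scl T f t₀ * |y.da t₀ (a / m.scl T f t) z| * (f t₀ * m.scl T f t₀)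
          = |y.da t₀ (a / m.scl T f t) z| := by field_simp
        rw [← this]
        exact mul_le_mul_of_nonneg_right e2 (by positivity)
      rw [abs_le] at e1 e3 ⊢
      constructor <;> linarith [e1.1, e1.2, e3.1, e3.2]
    f_mem := fun t ht => (hf t ht).1
    scl_mem := fun t ht => (hf t ht).2
    f_T := h.f_T
    le_v := fun t ht a z hz => (hvb t ht a z hz).1
    v_le := fun t ht a z hz => (hvb t ht a z hz).2
    Y_eq := fun t ht a z hz => h.normY_eq hm ht a hz
    G_forward :=
    { R_nonneg := by positivity
      supp := fun t ht a z hz ha => (h.normY_supp hm hEu ht hz ha).2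
      has_ba := fun t ht a z hz =>
        (((hm.utility.hasDerivAt_Hp (hq0.trans_le (hqm t (hI ht) a z hz).1)).comp a
          (((hY.has_da t (hI ht) a z hz).add_const m.wInf).const_mul (f t))).const_add z).const_mul
            (m.scl T f t)
      cont_b := fun t ht => continuousOn_const.mul (continuousOn_snd.add (h0c t (hI ht)).1)
      cont_ba := fun t ht => continuousOn_const.mul ((h1c t (hI ht)).1.mul
        (continuousOn_const.mul (hY.cont_da_slice (hI ht))))
      bdd_b := fun t ht R' => ((((BddCont.const (m.scl T f t)).mul (bz.add (h0c t (hI ht))))).mono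
        box_subset_strip).2
      bdd_ba := ⟨Λ * (L1 * (Λ * M')), fun t ht a z hz => abs_mul_le (hEabs t (hI ht)) (abs_mul_le
        (h1b t (hI ht) a z hz) (abs_mul_le (hfabs t (hI ht)) (hY.bound_da t (hI ht) a z hz)))⟩
      eq := fun t ht a z hz => h.normG_eq hm ht a hz }
    G_nonneg := fun t ht a z hz => by
      simp only [Model.normG, StripPath.scale]
      exact mul_nonneg (inv_nonneg.2 (hEp t ht).le) (h.g_nonneg hm hk hd.g₀_nonneg t ht _ z hz)
    mass := fun t ht => by
      have := h.setIntegral_norm hm hEu ht (φ := fun _ _ => 1) (BddCont.const 1)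
      simp only [one_mul] at this
      rw [this, h.mass hm hk t ht, hd.g₀_mass]
    cons := fun t ht => by
      have key : ∀ s ∈ Icc 0 T, ∫ x in 𝔹(m,Λ),
          (x.2 + Hp m.u (f s * ((m.normY T y f r).val s x.1 x.2 + m.wInf)))
            * (m.normG T g f r).val s x.1 x.2
          = ∫ x in 𝔹(m),
            (x.2 + Hp m.u (y.val s x.1 x.2 + f s * m.wInf)) * g.val s x.1 x.2 := by
        intro s hs
        rw [h.setIntegral_norm hm hEu hs (φ := fun a z =>
          z + Hp m.u (f s * ((m.normY T y f r).val s a z + m.wInf))) (bz.add (h0c s hs))]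
        refine setIntegral_congr_fun measurableSet_box fun x hx => ?_
        have e := h.normY_q hm hs (m.scl T f s * x.1) x.2
        rw [mul_div_cancel_left₀ _ (hEp s hs).ne'] at e
        simp only [e]
      rw [key t ht, key T h.T_mem, h.conservation hm hk hd.g₀_nonneg hd.g₀_mass ht]
    Y_T := fun a z hz => h.normY_T a hz
    G_0 := fun a z hz => by
      simp only [Model.normG, StripPath.scale]
      rw [h.g_0 _ z hz] }⟩

end Model.RegSol

end

section

variable {zl zr T M : ℝ}

/-! ### Integration by parts against a Lipschitz function -/

lemma abs_integral_mul_deriv_le {R ℓ γ : ℝ} (hR : 0 ≤ R) {ψ Γ Γa : ℝ → ℝ}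
    (hψ : ∀ a b, |ψ a - ψ b| ≤ ℓ * |a - b|) (hΓ : ∀ a, HasDerivAt Γ (Γa a) a) (hc : Continuous Γa)
    (hγ : ∀ a, |Γ a| ≤ γ) (hl : Γ (-R) = 0) (hr : Γ R = 0) :
    |∫ a in (-R)..R, ψ a * Γa a| ≤ ℓ * γ * (2 * R) := by
  have hℓ : 0 ≤ ℓ := by simpa using (abs_nonneg _).trans (hψ 1 0)
  have hL : LipschitzWith (Real.toNNReal ℓ) ψ := LipschitzWith.of_dist_le_mul fun a b => by
    rw [Real.dist_eq, Real.dist_eq, Real.coe_toNNReal _ hℓ]; exact hψ a b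
  have hΓc : ContDiff ℝ 1 Γ := by
    rw [contDiff_one_iff_deriv]
    refine ⟨fun a => (hΓ a).differentiableAt, ?_⟩
    rwa [show deriv Γ = Γa from funext fun a => (hΓ a).deriv]
  have h1 := (hL.lipschitzOnWith (s := uIcc (-R) R)).absolutelyContinuousOnInterval
  have h2 : AbsolutelyContinuousOnInterval Γ (-R) R := by
    obtain ⟨K, hK⟩ := isCompact_Icc.exists_bound_of_continuousOn (hc.continuousOn (s := Icc (-R) R))
    have : LipschitzOnWith (Real.toNNReal K) Γ (uIcc (-R) R) := by
      rw [uIcc_of_le (by linarith)]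
      refine (convex_Icc _ _).lipschitzOnWith_of_nnnorm_hasDerivWithin_le (f' := Γa)
        (fun a _ => (hΓ a).hasDerivWithinAt) fun a ha => ?_
      rw [← NNReal.coe_le_coe, coe_nnnorm]
      exact (hK a ha).trans (Real.le_coe_toNNReal K)
    exact this.absolutelyContinuousOnInterval
  have h3 := h1.integral_mul_deriv_eq_deriv_mul h2
  rw [hl, hr, show deriv Γ = Γa from funext fun a => (hΓ a).deriv] at h3
  rw [h3, mul_zero, mul_zero, sub_zero, zero_sub, abs_neg]
  have h4 := intervalIntegral.norm_integral_le_of_norm_le_const (a := -R) (b := R) (C := ℓ * γ)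
    (f := fun a => deriv ψ a * Γ a) fun a _ => by
      rw [Real.norm_eq_abs]
      refine abs_mul_le ?_ (hγ a)
      have := norm_deriv_le_of_lipschitz hL (x₀ := a)
      rwa [Real.coe_toNNReal _ hℓ] at this
  rw [show R - -R = 2 * R by ring, abs_of_nonneg (by linarith : (0:ℝ) ≤ 2 * R)] at h4
  exact h4

lemma abs_setIntegral_box_mul_deriv_le {R ℓ γ : ℝ} (hR : 0 ≤ R) (hz : zl ≤ zr)
    {ψ Γ Γa : ℝ → ℝ → ℝ} (hψ : ∀ a b, ∀ z ∈ Ioo zl zr, |ψ a z - ψ b z| ≤ ℓ * |a - b|)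
    (hψc : BddCont (univ ×ˢ Ioo zl zr) fun x => ψ x.1 x.2)
    (hΓ : ∀ a, ∀ z ∈ Ioo zl zr, HasDerivAt (fun a => Γ a z) (Γa a z) a)
    (hc : BddCont (univ ×ˢ Ioo zl zr) fun x => Γa x.1 x.2)
    (hγ : ∀ a, ∀ z ∈ Ioo zl zr, |Γ a z| ≤ γ) (hl : ∀ z ∈ Ioo zl zr, Γ (-R) z = 0)
    (hr : ∀ z ∈ Ioo zl zr, Γ R z = 0) :
    |∫ x in box R zl zr, ψ x.1 x.2 * Γa x.1 x.2| ≤ ℓ * γ * (2 * R * (zr - zl)) := by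
  have hint := ((hψc.mul hc).mono (box_subset_strip (R := R))).integrableOn
  rw [IntegrableOn, volume_restrict_box] at hint
  rw [volume_restrict_box, integral_prod_symm _ hint]
  have := norm_setIntegral_le_of_norm_le_const (μ := volume) (s := Ioo zl zr)
    (f := fun z => ∫ a in Ioo (-R) R, ψ a z * Γa a z) (C := ℓ * γ * (2 * R)) (by simp) fun z hz => by
      rw [← integral_Ioc_eq_integral_Ioo, ← intervalIntegral.integral_of_le (by linarith)]
      exact abs_integral_mul_deriv_le hR (hψ · · z hz) (hΓ · z hz) (continuous_line hc.1 hz)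
        (hγ · z hz) (hl z hz) (hr z hz)
  rw [Real.volume_real_Ioo_of_le hz, Real.norm_eq_abs] at this
  exact this.trans (le_of_eq (by ring))

/-! ### Functions which are bounded and Lipschitz in the wealth variable -/

/-- `ψ` is bounded by `K` and `K`-Lipschitz in the first variable. -/
def LipBdd (zl zr K : ℝ) (ψ : ℝ → ℝ → ℝ) : Prop :=
  0 ≤ K ∧ ∀ a, ∀ z ∈ Ioo zl zr, |ψ a z| ≤ K ∧ ∀ b, |ψ a z - ψ b z| ≤ K * |a - b|

namespace LipBdd

variable {K K' : ℝ} {ψ φ : ℝ → ℝ → ℝ}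

lemma add (h : LipBdd zl zr K ψ) (h' : LipBdd zl zr K' φ) :
    LipBdd zl zr (K + K') fun a z => ψ a z + φ a z := by
  refine ⟨add_nonneg h.1 h'.1, fun a z hz => ⟨(abs_add_le _ _).trans
    (add_le_add (h.2 a z hz).1 (h'.2 a z hz).1), fun b => ?_⟩⟩
  have e1 := (h.2 a z hz).2 b
  have e2 := (h'.2 a z hz).2 b
  rw [show ψ a z + φ a z - (ψ b z + φ b z) = (ψ a z - ψ b z) + (φ a z - φ b z) by ring]
  linarith [abs_add_le (ψ a z - ψ b z) (φ a z - φ b z)]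

lemma mul (h : LipBdd zl zr K ψ) (h' : LipBdd zl zr K' φ) :
    LipBdd zl zr (2 * (K * K')) fun a z => ψ a z * φ a z := by
  have hKK : 0 ≤ K * K' := mul_nonneg h.1 h'.1
  refine ⟨by linarith, fun a z hz => ⟨(abs_mul_le (h.2 a z hz).1 (h'.2 a z hz).1).trans (by linarith),
    fun b => ?_⟩⟩
  have e1 := abs_mul_le ((h.2 a z hz).2 b) (h'.2 a z hz).1
  have e2 := abs_mul_le (h.2 b z hz).1 ((h'.2 a z hz).2 b)
  rw [show ψ a z * φ a z - ψ b z * φ b z = (ψ a z - ψ b z) * φ a z + ψ b z * (φ a z - φ b z) by ring]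
  refine (abs_add_le _ _).trans ((add_le_add e1 e2).trans (le_of_eq (by ring)))

lemma of_snd {c : ℝ → ℝ} (hK : 0 ≤ K) (hc : ∀ z ∈ Ioo zl zr, |c z| ≤ K) : LipBdd zl zr K fun _ z => c z :=
  ⟨hK, fun a z hz => ⟨hc z hz, fun b => by simpa using mul_nonneg hK (abs_nonneg _)⟩⟩

lemma of_bounds (hK : 0 ≤ K) (hb : ∀ a, ∀ z ∈ Ioo zl zr, |ψ a z| ≤ K)
    (hl : ∀ a b, ∀ z ∈ Ioo zl zr, |ψ a z - ψ b z| ≤ K * |a - b|) : LipBdd zl zr K ψ :=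
  ⟨hK, fun a z hz => ⟨hb a z hz, fun b => hl a b z hz⟩⟩

lemma of_hasDerivAt {ψa : ℝ → ℝ → ℝ} (hK : 0 ≤ K) (hb : ∀ a, ∀ z ∈ Ioo zl zr, |ψ a z| ≤ K)
    (hd : ∀ a, ∀ z ∈ Ioo zl zr, HasDerivAt (fun a => ψ a z) (ψa a z) a)
    (hb' : ∀ a, ∀ z ∈ Ioo zl zr, |ψa a z| ≤ K) : LipBdd zl zr K ψ :=
  of_bounds hK hb fun a b z hz => abs_sub_le_of_hasDerivAt (hd · z hz) (hb' · z hz) a b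

lemma comp {L δ B : ℝ} {F : ℝ → ℝ} (hL : 0 ≤ L) (h : LipBdd zl zr K ψ)
    (hm : ∀ a, ∀ z ∈ Ioo zl zr, ψ a z ∈ Icc δ B) (hb : ∀ p ∈ Icc δ B, |F p| ≤ L)
    (hl : ∀ p ∈ Icc δ B, ∀ q ∈ Icc δ B, |F p - F q| ≤ L * |p - q|) :
    LipBdd zl zr (L * (K + 1)) fun a z => F (ψ a z) := by
  have hK := h.1
  have hLK : 0 ≤ L * K := mul_nonneg hL hK
  refine ⟨by nlinarith, fun a z hz => ⟨(hb _ (hm a z hz)).trans (by linarith), fun b => ?_⟩⟩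
  refine (hl _ (hm a z hz) _ (hm b z hz)).trans ?_
  have := mul_le_mul_of_nonneg_left ((h.2 a z hz).2 b) hL
  nlinarith [mul_nonneg hL (abs_nonneg (a - b))]

end LipBdd

/-! ### Bounds for the Hamiltonian -/

lemma exists_lipschitz_comp {φ : ℝ → ℝ} (hφ : ContDiffOn ℝ ∞ φ (Ioi 0)) {δ : ℝ} (hδ : 0 < δ) (B : ℝ) :
    ∃ L, 0 ≤ L ∧ (∀ p ∈ Icc δ B, |φ p| ≤ L) ∧ ∀ p ∈ Icc δ B, ∀ q ∈ Icc δ B, |φ p - φ q| ≤ L * |p - q| := by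
  obtain ⟨L0, h0, hL0⟩ := exists_bound_comp hφ.continuousOn hδ B
  have hφ' := ((contDiffOn_infty_iff_deriv_of_isOpen isOpen_Ioi).1 hφ).2
  obtain ⟨L1, h1, hL1⟩ := exists_bound_comp hφ'.continuousOn hδ B
  refine ⟨L0 + L1, by linarith, fun p hp => (hL0 p hp.1 hp.2).trans (by linarith), fun p hp q hq => ?_⟩
  have := (convex_Icc δ B).norm_image_sub_le_of_norm_hasDerivWithin_le (f := φ) (f' := deriv φ) (C := L1)
    (fun x hx => (((hφ.contDiffAt (Ioi_mem_nhds (hδ.trans_le hx.1))).differentiableAt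
      (by simp)).hasDerivAt).hasDerivWithinAt) (fun x hx => hL1 x hx.1 hx.2) hq hp
  rw [Real.norm_eq_abs, Real.norm_eq_abs] at this
  exact this.trans (by nlinarith [abs_nonneg (p - q)])

/-- Bounds for the derivatives of the Hamiltonian on `[δ, B]`. -/
structure UtilBounds (u : ℝ → ℝ) (δ B L : ℝ) : Prop where
  L_nonneg : 0 ≤ L
  b0 : ∀ p ∈ Icc δ B, |Hp u p| ≤ L
  b1 : ∀ p ∈ Icc δ B, |Hpp u p| ≤ L
  b2 : ∀ p ∈ Icc δ B, |deriv (Hpp u) p| ≤ L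
  l0 : ∀ p ∈ Icc δ B, ∀ q ∈ Icc δ B, |Hp u p - Hp u q| ≤ L * |p - q|
  l1 : ∀ p ∈ Icc δ B, ∀ q ∈ Icc δ B, |Hpp u p - Hpp u q| ≤ L * |p - q|
  l2 : ∀ p ∈ Icc δ B, ∀ q ∈ Icc δ B, |deriv (Hpp u) p - deriv (Hpp u) q| ≤ L * |p - q|
  low : ∀ p ∈ Icc δ B, ∀ q ∈ Icc δ B, p ≤ q → q - p ≤ L * (Hp u q - Hp u p)

/-- The bounds on the range of `f (y + w_∞)` for normalized solutions. -/
abbrev Model.UBounds (m : Model) (N W Λ L : ℝ) : Prop := UtilBounds m.u (Λ⁻¹ * W) (Λ * (N + m.wInf)) L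

lemma IsUtility.exists_utilBounds {u : ℝ → ℝ} (hu : IsUtility u) {δ : ℝ} (hδ : 0 < δ) (B : ℝ) :
    ∃ L, UtilBounds u δ B L := by
  have h2 := ((contDiffOn_infty_iff_deriv_of_isOpen isOpen_Ioi).1 hu.contDiffOn_Hpp).2
  obtain ⟨L0, n0, b0, l0⟩ := exists_lipschitz_comp hu.Hp_props.1 hδ B
  obtain ⟨L1, n1, b1, l1⟩ := exists_lipschitz_comp hu.contDiffOn_Hpp hδ B
  obtain ⟨L2, n2, b2, l2⟩ := exists_lipschitz_comp h2 hδ B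
  obtain ⟨κ, hκ, hκb⟩ := exists_pos_lower hu.continuousOn_Hpp hu.Hp_props.2 hδ B
  have n3 : 0 ≤ κ⁻¹ := by positivity
  refine ⟨L0 + L1 + L2 + κ⁻¹, by linarith, fun p hp => (b0 p hp).trans (by linarith),
    fun p hp => (b1 p hp).trans (by linarith), fun p hp => (b2 p hp).trans (by linarith),
    fun p hp q hq => (l0 p hp q hq).trans ?_, fun p hp q hq => (l1 p hp q hq).trans ?_,
    fun p hp q hq => (l2 p hp q hq).trans ?_, fun p hp q hq hpq => ?_⟩
  iterate 3
    refine mul_le_mul_of_nonneg_right (by linarith) (abs_nonneg _)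
  have hd : ∀ x ∈ Icc δ B, HasDerivAt (Hp u) (Hpp u x) x := fun x hx => hu.hasDerivAt_Hp (hδ.trans_le hx.1)
  have h4 := (convex_Icc δ B).mul_sub_le_image_sub_of_le_deriv (f := Hp u) (C := κ)
    (fun x hx => (hd x hx).continuousAt.continuousWithinAt)
    (fun x hx => (hd x (interior_subset hx)).differentiableAt.differentiableWithinAt)
    (fun x hx => by
      rw [(hd x (interior_subset hx)).deriv]
      exact hκb x (interior_subset hx).1 (interior_subset hx).2) p hp q hq hpq
  have h5 : 0 ≤ Hp u q - Hp u p := le_trans (mul_nonneg hκ.le (by linarith)) h4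
  have h6 : q - p ≤ κ⁻¹ * (Hp u q - Hp u p) := by
    rw [inv_mul_eq_div, le_div_iff₀ hκ]; linarith
  nlinarith

/-- A function of one variable, applied to a path plus a constant. -/
def StripPath.comp (φ : ℝ → ℝ) (p : StripPath) (w : ℝ) : StripPath where
  val t a z := φ (p.val t a z + w)
  da t a z := deriv φ (p.val t a z + w) * p.da t a z
  dz t a z := deriv φ (p.val t a z + w) * p.dz t a z
  dzz t a z := deriv (deriv φ) (p.val t a z + w) * p.dz t a z * p.dz t a z
    + deriv φ (p.val t a z + w) * p.dzz t a z
  dt t a z := deriv φ (p.val t a z + w) * p.dt t a z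

lemma StripPath.Regular.comp {p : StripPath} (hp : p.Regular zl zr T M) {φ : ℝ → ℝ}
    (hφ : ContDiffOn ℝ ∞ φ (Ioi 0)) {w δ B L : ℝ} (hδ : 0 < δ) (hL : 0 ≤ L) (hM : 0 ≤ M)
    (hm : ∀ t ∈ Icc 0 T, ∀ a, ∀ z ∈ Ioo zl zr, p.val t a z + w ∈ Icc δ B)
    (h0 : ∀ x ∈ Icc δ B, |φ x| ≤ L) (h1 : ∀ x ∈ Icc δ B, |deriv φ x| ≤ L)
    (h2 : ∀ x ∈ Icc δ B, |deriv (deriv φ) x| ≤ L) : (p.comp φ w).Regular zl zr T (L * (1 + M + M * M)) := by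
  have hφ1 := ((contDiffOn_infty_iff_deriv_of_isOpen isOpen_Ioi).1 hφ).2
  have hφ2 := ((contDiffOn_infty_iff_deriv_of_isOpen isOpen_Ioi).1 hφ1).2
  have hI {t} (h : t ∈ Ioo 0 T) := Ioo_subset_Icc_self h
  have d0 : ∀ x, 0 < x → HasDerivAt φ (deriv φ x) x := fun x hx =>
    ((hφ.contDiffAt (Ioi_mem_nhds hx)).differentiableAt (by simp)).hasDerivAt
  have d1 : ∀ x, 0 < x → HasDerivAt (deriv φ) (deriv (deriv φ) x) x := fun x hx =>
    ((hφ1.contDiffAt (Ioi_mem_nhds hx)).differentiableAt (by simp)).hasDerivAt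
  have pos : ∀ t ∈ Icc 0 T, ∀ a, ∀ z ∈ Ioo zl zr, 0 < p.val t a z + w := fun t ht a z hz =>
    hδ.trans_le (hm t ht a z hz).1
  have cs : ∀ {χ : ℝ → ℝ}, ContDiffOn ℝ ∞ χ (Ioi 0) → ∀ t ∈ Icc 0 T,
      ContinuousOn (fun x : ℝ² => χ (p.val t x.1 x.2 + w)) (univ ×ˢ Ioo zl zr) := fun hχ t ht =>
    hχ.continuousOn.comp ((hp.cont_slice ht).add continuousOn_const) fun x hx => pos t ht _ _ hx.2
  have cf : ∀ {χ : ℝ → ℝ}, ContDiffOn ℝ ∞ χ (Ioi 0) →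
      ContinuousOn (fun x : ℝ × ℝ × ℝ => χ (p.val x.1 x.2.1 x.2.2 + w)) (Icc 0 T ×ˢ univ ×ˢ Ioo zl zr) :=
    fun hχ => hχ.continuousOn.comp (hp.cont.add continuousOn_const) fun x hx => pos _ hx.1 _ _ hx.2.2
  have n1 : 0 ≤ L * M := mul_nonneg hL hM
  have n2 : 0 ≤ L * (M * M) := by positivity
  have e : L * (1 + M + M * M) = L + L * M + L * (M * M) := by ring
  exact
  { cont := cf hφ
    cont_da := (cf hφ1).mul hp.cont_da
    cont_dz := fun t ht => (cs hφ1 t ht).mul (hp.cont_dz t ht)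
    cont_dzz := fun t ht => (((cs hφ2 t ht).mul (hp.cont_dz t ht)).mul (hp.cont_dz t ht)).add
      ((cs hφ1 t ht).mul (hp.cont_dzz t ht))
    cont_dt := fun t ht => (cs hφ1 t (hI ht)).mul (hp.cont_dt t ht)
    has_da := fun t ht a z hz => (d0 _ (pos t ht a z hz)).comp a ((hp.has_da t ht a z hz).add_const w)
    has_dz := fun t ht a z hz => HasDerivAt.comp (h₂ := φ) (h := fun z => p.val t a z + w) z
      (d0 _ (pos t ht a z hz)) ((hp.has_dz t ht a z hz).add_const w)
    has_dzz := fun t ht a z hz => (HasDerivAt.comp (h₂ := deriv φ) (h := fun z => p.val t a z + w) z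
      (d1 _ (pos t ht a z hz)) ((hp.has_dz t ht a z hz).add_const w)).fun_mul (hp.has_dzz t ht a z hz)
    has_dt := fun t ht a z hz => HasDerivAt.comp (h₂ := φ) (h := fun t => p.val t a z + w) t
      (d0 _ (pos t (hI ht) a z hz)) ((hp.has_dt t ht a z hz).add_const w)
    bound := fun t ht a z hz => (h0 _ (hm t ht a z hz)).trans (by linarith)
    bound_da := fun t ht a z hz => (abs_mul_le (h1 _ (hm t ht a z hz)) (hp.bound_da t ht a z hz)).trans
      (by linarith)
    bound_dz := fun t ht a z hz => (abs_mul_le (h1 _ (hm t ht a z hz)) (hp.bound_dz t ht a z hz)).trans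
      (by linarith)
    bound_dzz := fun t ht a z hz => (abs_add_le _ _).trans ((add_le_add
      (abs_mul_le (abs_mul_le (h2 _ (hm t ht a z hz)) (hp.bound_dz t ht a z hz)) (hp.bound_dz t ht a z hz))
      (abs_mul_le (h1 _ (hm t ht a z hz)) (hp.bound_dzz t ht a z hz))).trans (by linarith))
    bound_dt := fun t ht a z hz => (abs_mul_le (h1 _ (hm t (hI ht) a z hz)) (hp.bound_dt t ht a z hz)).trans
      (by linarith) }

end

section

variable {T M : ℝ}

/-- A Lipschitz bound in the wealth variable for the backward equation. -/
lemma StripPath.Regular.da_le_of_backward {zl zr : ℝ} {p : StripPath}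
    (hp : p.Regular zl zr T M) {A m : ℝ → ℝ} {C : ℝ} (hC : 0 ≤ C) (hA : Degenerate zl zr C A m)
    {b s : ℝ → ℝ → ℝ → ℝ} {R N β K ς t₀ : ℝ} (ht₀ : 0 ≤ t₀) (hR : 0 ≤ R) (hN : 0 ≤ N) (hβ : 0 ≤ β)
    (hK : 0 ≤ K) (hς : 0 ≤ ς) (hsupp : ∀ t ∈ Icc 0 T, ∀ a, ∀ z ∈ Ioo zl zr, R ≤ |a| → p.val t a z = 0)
    (heq : ∀ t ∈ Ioo t₀ T, ∀ a, ∀ z ∈ Ioo zl zr,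
      p.dt t a z + A z * p.dzz t a z + m z * p.dz t a z + b t a z * p.da t a z = s t a z)
    (hb : ∀ t ∈ Ioo t₀ T, ∀ a a', ∀ z ∈ Ioo zl zr, |b t a z - b t a' z| ≤ β * |a - a'|)
    (hs : ∀ t ∈ Ioo t₀ T, ∀ a a', ∀ z ∈ Ioo zl zr, |s t a z - s t a' z| ≤ ς * |a - a'|)
    (hda : ∀ t ∈ Icc t₀ T, ∀ a, ∀ z ∈ Ioo zl zr, |p.da t a z| ≤ K)
    (hT : ∀ a a', ∀ z ∈ Ioo zl zr, |p.val T a z - p.val T a' z| ≤ N * |a - a'|) :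
    ∀ t ∈ Icc t₀ T, ∀ a, ∀ z ∈ Ioo zl zr, |p.da t a z| ≤ N + (β * K + ς) * (T - t) := by
  have hI : ∀ {t}, t ∈ Icc t₀ T → t ∈ Icc 0 T := fun h => ⟨ht₀.trans h.1, h.2⟩
  have hβK : 0 ≤ β * K + ς := by positivity
  have key : ∀ h, ∀ t ∈ Icc t₀ T, ∀ a, ∀ z ∈ Ioo zl zr,
      p.val t (a + h) z - p.val t a z ≤ (N + (β * K + ς) * (T - t)) * |h| := by
    intro h t ht a z hz
    have hh := abs_nonneg h
    have := ((hp.shift h).comb hp 1 (-1)).le_of_backward hC hA (b := fun t a z => b t (a + h) z)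
      (R := R + |h|) (K := N * |h|) (S := (β * K + ς) * |h|) (c := 0) ht₀ (by positivity)
      (by positivity) le_rfl
      (fun t ht a z hz => exists_clamp (F := fun a => ((p.shift h).comb 1 p (-1)).val t a z) (by positivity)
        (fun a ha => by
          have e1 : R ≤ |a + h| := by
            have := abs_sub_abs_le_abs_sub a (-h)
            rw [abs_neg, sub_neg_eq_add] at this
            linarith
          simp [StripPath.comb, StripPath.shift, hsupp t (hI ht) _ z hz e1,
            hsupp t (hI ht) a z hz (by linarith)]) a)
      (fun a z hz => by
        have := (le_abs_self _).trans (hT (a + h) a z hz)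
        rw [add_sub_cancel_left] at this
        simp only [StripPath.comb, StripPath.shift]
        linarith)
      (fun t ht a z hz _ => by
        have e1 := heq t ht (a + h) z hz
        have e2 := heq t ht a z hz
        have e3 := hs t ht (a + h) a z hz
        have e4 := abs_mul_le (hb t ht (a + h) a z hz) (hda t (Ioo_subset_Icc_self ht) a z hz)
        rw [add_sub_cancel_left, abs_le] at e3 e4
        simp only [StripPath.comb, StripPath.shift]
        linarith [e3.1, e4.2]) t ht a z hz
    simp only [StripPath.comb, StripPath.shift, zero_mul, Real.exp_zero, mul_one] at this
    linarith
  intro t ht a z hz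
  have h0 : 0 ≤ N + (β * K + ς) * (T - t) :=
    add_nonneg hN (mul_nonneg hβK (by linarith [ht.2]))
  refine (hp.has_da t (hI ht) a z hz).le_of_lip' h0 (Eventually.of_forall fun x => ?_)
  have e1 := key (x - a) t ht a z hz
  have e2 := key (a - x) t ht x z hz
  rw [add_sub_cancel] at e1 e2
  rw [abs_sub_comm] at e2
  rw [Real.norm_eq_abs, Real.norm_eq_abs, abs_le]
  constructor <;> linarith

/-- The test function `z + H_p(y_T + w_∞)`. -/
def Model.test (m : Model) (yT : ℝ² → ℝ) : StripPath :=
  (affine 0 1).comb 1 ((𝕊(m) yT).comp (Hp m.u) m.wInf) 1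

lemma Model.test_val (m : Model) (yT : ℝ² → ℝ) (t a z : ℝ) :
    (m.test yT).val t a z = z + Hp m.u (𝔼(m) yT a z + m.wInf) := by
  simp [Model.test, StripPath.comb, StripPath.comp, affine, static, pathOf]

lemma Model.test_dt (m : Model) (yT : ℝ² → ℝ) (t a z : ℝ) : (m.test yT).dt t a z = 0 := by
  simp [Model.test, StripPath.comb, StripPath.comp, affine, static, pathOf]

/-- The bounds on normalized solutions on short time intervals. -/
structure Model.Apriori (m : Model) (K : ℝ) (yT : ℝ² → ℝ) (T : ℝ) (Y G : StripPath) (f : ℝ → ℝ) :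
    Prop where
  da_le : ∀ t ∈ Icc 0 T, ∀ a, ∀ z ∈ 𝕁(m), |Y.da t a z| ≤ K
  G_le : ∀ t ∈ Icc 0 T, ∀ a, ∀ z ∈ 𝕁(m), |G.val t a z| ≤ K
  sub_le : ∀ t ∈ Icc 0 T, ∀ a, ∀ z ∈ 𝕁(m), |Y.val t a z - 𝔼(m) yT a z| ≤ K * T
  da_sub_le : ∀ t ∈ Icc 0 T, ∀ a, ∀ z ∈ 𝕁(m),
    |Y.da t a z - (𝕊(m) yT).da t a z| ≤ K * T
  f_sub_le : ∀ t ∈ Icc 0 T, |f t - 1| ≤ K * T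

lemma mul_mem_scaled {Λ W V c v : ℝ} (hΛ : 1 ≤ Λ) (hW : 0 < W) (hc : c ∈ Icc Λ⁻¹ Λ) (hv : v ∈ Icc W V) :
    c * v ∈ Icc (Λ⁻¹ * W) (Λ * V) := by
  have hi : 0 < Λ⁻¹ := by positivity
  exact ⟨mul_le_mul hc.1 hv.1 hW.le (hi.le.trans hc.1),
    mul_le_mul hc.2 hv.2 (hW.le.trans hv.1) (by linarith)⟩

lemma one_mem_scale {Λ : ℝ} (hΛ : 1 ≤ Λ) : (1 : ℝ) ∈ Icc Λ⁻¹ Λ := ⟨inv_le_one_of_one_le₀ hΛ, hΛ⟩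

namespace Model.RegData

variable {m : Model} {yT g₀ : ℝ² → ℝ} {N W Λ L : ℝ}

lemma vT_mem (hd : m.RegData N W yT g₀) (a : ℝ) {z : ℝ} (hz : z ∈ 𝕁(m)) :
    𝔼(m) yT a z + m.wInf ∈ Icc W (N + m.wInf) :=
  ⟨hd.le_v a z hz, by
    have := (le_abs_self _).trans ((hd.yT_reg 0).bound 0 ⟨le_rfl, le_rfl⟩ a z hz)
    change 𝔼(m) yT a z ≤ N at this
    linarith⟩

lemma vT_mem_scaled (hd : m.RegData N W yT g₀) (hΛ : 1 ≤ Λ) (a : ℝ) {z : ℝ} (hz : z ∈ 𝕁(m)) :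
    𝔼(m) yT a z + m.wInf ∈ Icc (Λ⁻¹ * W) (Λ * (N + m.wInf)) := by
  simpa using mul_mem_scaled hΛ hd.W_pos (one_mem_scale hΛ) (hd.vT_mem a hz)

lemma exists_test_regular (hm : m.Admissible) (hd : m.RegData N W yT g₀) (hΛ : 1 ≤ Λ)
    (hU : m.UBounds N W Λ L) : ∃ Q, 0 ≤ Q ∧ (∀ T, (m.test yT).Regular m.zMin m.zMax T Q) ∧
      ∀ t, LipBdd m.zMin m.zMax Q ((m.test yT).val t) ∧ LipBdd m.zMin m.zMax Q ((m.test yT).da t) ∧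
        LipBdd m.zMin m.zMax Q ((m.test yT).dz t) ∧ LipBdd m.zMin m.zMax Q ((m.test yT).dzz t) := by
  have hδ : 0 < Λ⁻¹ * W := mul_pos (by positivity) hd.W_pos
  have hN := hd.N_pos
  have hL := hU.L_nonneg
  have r1 : ∀ T, (m.test yT).Regular m.zMin m.zMax T _ := fun T =>
    (affine_regular 0 1).comb ((hd.yT_reg T).comp hm.utility.Hp_props.1 hδ hL hN.le
      (fun t _ a z hz => hd.vT_mem_scaled hΛ a hz) hU.b0 hU.b1 hU.b2) 1 1
  have hyr := fun t : ℝ => hd.yT_reg |t|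
  have htm : ∀ t : ℝ, |t| ∈ Icc 0 |t| := fun t => ⟨abs_nonneg t, le_rfl⟩
  have l0 : ∀ t, LipBdd m.zMin m.zMax N ((𝕊(m) yT).val t) := fun t =>
    .of_hasDerivAt hN.le ((hyr t).bound |t| (htm t)) ((hyr t).has_da |t| (htm t)) ((hyr t).bound_da |t| (htm t))
  have la : ∀ t, LipBdd m.zMin m.zMax N ((𝕊(m) yT).da t) := fun t =>
    .of_bounds hN.le ((hyr t).bound_da |t| (htm t)) fun a b z hz => (hd.yT_lip t a b z hz).1
  have lz : ∀ t, LipBdd m.zMin m.zMax N ((𝕊(m) yT).dz t) := fun t =>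
    .of_bounds hN.le ((hyr t).bound_dz |t| (htm t)) fun a b z hz => (hd.yT_lip t a b z hz).2.1
  have lzz : ∀ t, LipBdd m.zMin m.zMax N ((𝕊(m) yT).dzz t) := fun t =>
    .of_bounds hN.le ((hyr t).bound_dzz |t| (htm t)) fun a b z hz => (hd.yT_lip t a b z hz).2.2
  have lv : ∀ t, LipBdd m.zMin m.zMax (N + |m.wInf|) fun a z => (𝕊(m) yT).val t a z + m.wInf :=
    fun t => (l0 t).add (.of_snd (c := fun _ => m.wInf) (abs_nonneg _) fun _ _ => le_rfl)
  have hvm : ∀ t a, ∀ z ∈ 𝕁(m), (𝕊(m) yT).val t a z + m.wInf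
      ∈ Icc (Λ⁻¹ * W) (Λ * (N + m.wInf)) := fun t a z hz => hd.vT_mem_scaled hΛ a hz
  have c0 := fun t => (lv t).comp hL (hvm t) hU.b0 hU.l0
  have c1 := fun t => (lv t).comp hL (hvm t) hU.b1 hU.l1
  have c2 := fun t => (lv t).comp hL (hvm t) hU.b2 hU.l2
  obtain ⟨Zb, hZb⟩ : ∃ Zb, Zb = 𝕫(m) := ⟨_, rfl⟩
  have hZb0 : 0 ≤ Zb := by rw [hZb]; exact (abs_nonneg _).trans (le_max_left _ _)
  have hz : LipBdd m.zMin m.zMax Zb fun _ z => z := .of_snd hZb0 fun z hz => by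
    rw [hZb]; exact abs_le_max_abs_abs hz.1.le hz.2.le
  have one : LipBdd m.zMin m.zMax 1 fun _ _ => (1 : ℝ) :=
    .of_snd (c := fun _ => 1) zero_le_one fun _ _ => by simp
  have f0 := fun t => hz.add (c0 t)
  have fa := fun t => (c1 t).mul (la t)
  have fz := fun t => one.add ((c1 t).mul (lz t))
  have fzz := fun t => (((c2 t).mul (lz t)).mul (lz t)).add ((c1 t).mul (lzz t))
  have mono : ∀ {K K' : ℝ} {ψ φ : ℝ → ℝ → ℝ}, LipBdd m.zMin m.zMax K ψ → K ≤ K' →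
      (∀ a z, φ a z = ψ a z) → LipBdd m.zMin m.zMax K' φ := fun {K K' ψ φ} h hKK e => by
    obtain rfl : φ = ψ := funext fun a => funext fun z => e a z
    exact ⟨h.1.trans hKK, fun a z hz => ⟨(h.2 a z hz).1.trans hKK, fun b => ((h.2 a z hz).2 b).trans
      (mul_le_mul_of_nonneg_right hKK (abs_nonneg _))⟩⟩
  obtain ⟨Q0, hQ0, r⟩ : ∃ Q0, 0 ≤ Q0 ∧ ∀ T, (m.test yT).Regular m.zMin m.zMax T Q0 := by
    refine ⟨_, ?_, r1⟩
    positivity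
  have n0 := (f0 0).1
  have n1 := (fa 0).1
  have n2 := (fz 0).1
  have n3 := (fzz 0).1
  refine ⟨Q0 + (_ + (_ + (_ + _))), add_nonneg hQ0 (add_nonneg n0 (add_nonneg n1 (add_nonneg n2 n3))),
    fun T => ?_, fun t => ⟨mono (f0 t) ?_ ?_, mono (fa t) ?_ ?_, mono (fz t) ?_ ?_, mono (fzz t) ?_ ?_⟩⟩
  · exact (r T).mono (le_add_of_nonneg_right (add_nonneg n0 (add_nonneg n1 (add_nonneg n2 n3))))
  · linarith
  · intro a z; simp [Model.test, StripPath.comb, StripPath.comp, affine]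
  · linarith
  · intro a z; simp [Model.test, StripPath.comb, StripPath.comp, affine, Hpp]
  · linarith
  · intro a z; simp [Model.test, StripPath.comb, StripPath.comp, affine, Hpp]
  · linarith
  · intro a z; simp [Model.test, StripPath.comb, StripPath.comp, affine, Hpp]

end Model.RegData

namespace Model.NormSol

variable {m : Model} {yT g₀ : ℝ² → ℝ} {Y G : StripPath} {f : ℝ → ℝ} {C N W Λ L : ℝ}

lemma zero_mem (h : m.NormSol N W Λ yT g₀ T M Y G f) : (0 : ℝ) ∈ Icc 0 T := ⟨le_rfl, h.T_pos.le⟩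

lemma T_mem (h : m.NormSol N W Λ yT g₀ T M Y G f) : T ∈ Icc 0 T := ⟨h.T_pos.le, le_rfl⟩

lemma v_mem (h : m.NormSol N W Λ yT g₀ T M Y G f) {t : ℝ} (ht : t ∈ Icc 0 T) (a : ℝ) {z : ℝ}
    (hz : z ∈ 𝕁(m)) : Y.val t a z + m.wInf ∈ Icc W (N + m.wInf) :=
  ⟨h.le_v t ht a z hz, h.v_le t ht a z hz⟩

lemma q_mem (h : m.NormSol N W Λ yT g₀ T M Y G f) (hΛ : 1 ≤ Λ) (hW : 0 < W) {t : ℝ} (ht : t ∈ Icc 0 T)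
    (a : ℝ) {z : ℝ} (hz : z ∈ 𝕁(m)) : f t * (Y.val t a z + m.wInf) ∈ Icc (Λ⁻¹ * W) (Λ * (N + m.wInf)) :=
  mul_mem_scaled hΛ hW (h.f_mem t ht) (h.v_mem ht a hz)

lemma abs_f_le (h : m.NormSol N W Λ yT g₀ T M Y G f) (hΛ : 1 ≤ Λ) {t : ℝ} (ht : t ∈ Icc 0 T) : |f t| ≤ Λ := by
  have : 0 < Λ⁻¹ := by positivity
  rw [abs_of_pos (this.trans_le (h.f_mem t ht).1)]; exact (h.f_mem t ht).2

lemma abs_scl_le (h : m.NormSol N W Λ yT g₀ T M Y G f) (hΛ : 1 ≤ Λ) {t : ℝ} (ht : t ∈ Icc 0 T) :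
    |m.scl T f t| ≤ Λ := by
  have : 0 < Λ⁻¹ := by positivity
  rw [abs_of_pos (this.trans_le (h.scl_mem t ht).1)]; exact (h.scl_mem t ht).2

lemma abs_drift_le (h : m.NormSol N W Λ yT g₀ T M Y G f) (hΛ : 1 ≤ Λ) (hW : 0 < W)
    (hU : m.UBounds N W Λ L) {t : ℝ} (ht : t ∈ Icc 0 T) (a : ℝ) {z : ℝ}
    (hz : z ∈ 𝕁(m)) : |m.ndrift T Y f t a z| ≤ Λ * (𝕫(m) + L) :=
  abs_mul_le (h.abs_scl_le hΛ ht) ((abs_add_le _ _).trans (add_le_add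
    (abs_le_max_abs_abs hz.1.le hz.2.le) (hU.b0 _ (h.q_mem hΛ hW ht a hz))))

lemma drift_lip (h : m.NormSol N W Λ yT g₀ T M Y G f) (hΛ : 1 ≤ Λ) (hW : 0 < W)
    (hU : m.UBounds N W Λ L) {t K : ℝ} (ht : t ∈ Icc 0 T)
    (hK : ∀ a, ∀ z ∈ 𝕁(m), |Y.da t a z| ≤ K) (a b : ℝ) {z : ℝ} (hz : z ∈ 𝕁(m)) :
    |m.ndrift T Y f t a z - m.ndrift T Y f t b z| ≤ Λ * (L * (Λ * K)) * |a - b| := by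
  have e1 := hU.l0 _ (h.q_mem hΛ hW ht a hz) _ (h.q_mem hΛ hW ht b hz)
  have e2 := abs_sub_le_of_hasDerivAt (fun a => h.Y_reg.has_da t ht a z hz) (fun a => hK a z hz) a b
  have e3 : |f t * (Y.val t a z + m.wInf) - f t * (Y.val t b z + m.wInf)| ≤ Λ * (K * |a - b|) := by
    rw [← mul_sub, add_sub_add_right_eq_sub]
    exact abs_mul_le (h.abs_f_le hΛ ht) e2
  have e4 := abs_mul_le (h.abs_scl_le hΛ ht) (e1.trans (mul_le_mul_of_nonneg_left e3 hU.L_nonneg))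
  rw [Model.ndrift, Model.ndrift, ← mul_sub, add_sub_add_left_eq_sub]
  exact e4.trans (le_of_eq (by ring))

lemma da_T (h : m.NormSol N W Λ yT g₀ T M Y G f) (a : ℝ) {z : ℝ} (hz : z ∈ 𝕁(m))
    (hd : m.RegData N W yT g₀) : Y.da T a z = (𝕊(m) yT).da T a z := by
  have h1 := h.Y_reg.has_da T h.T_mem a z hz
  have h2 := (hd.yT_reg T).has_da T h.T_mem a z hz
  rw [show (fun a => Y.val T a z) = fun a => (𝕊(m) yT).val T a z from
    funext fun a => h.Y_T a z hz] at h1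
  exact h1.unique h2

lemma val_T_lip (h : m.NormSol N W Λ yT g₀ T M Y G f) (hd : m.RegData N W yT g₀) (a b : ℝ) {z : ℝ}
    (hz : z ∈ 𝕁(m)) : |Y.val T a z - Y.val T b z| ≤ N * |a - b| := by
  rw [h.Y_T a z hz, h.Y_T b z hz]
  exact abs_sub_le_of_hasDerivAt (fun a => (hd.yT_reg T).has_da T h.T_mem a z hz)
    (fun a => (hd.yT_reg T).bound_da T h.T_mem a z hz) a b

/-- A uniform bound for `∂_α Y` on short time intervals. -/
lemma da_le (hm : m.Admissible) (hk : m.CoeffRegular C) (hd : m.RegData N W yT g₀)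
    (hΛ : 1 ≤ Λ) (hU : m.UBounds N W Λ L) (h : m.NormSol N W Λ yT g₀ T M Y G f)
    (hT : Λ * (L * (Λ * (N + 2))) * (N + 2) * T ≤ 1) :
    ∀ t ∈ Icc 0 T, ∀ a, ∀ z ∈ 𝕁(m), |Y.da t a z| ≤ N + 1 := by
  have hN := hd.N_pos
  have hL := hU.L_nonneg
  have hA := hm.A_pos
  have hΛ0 : 0 < Λ := by linarith
  obtain ⟨s, hs⟩ : ∃ s : Set ℝ, s = {τ | ∀ σ ∈ Icc (0 : ℝ) 1, ∀ a, ∀ z ∈ 𝕁(m),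
    |Y.da (T - σ * τ) a z| ≤ N + 1} := ⟨_, rfl⟩
  have hmem : ∀ σ ∈ Icc (0 : ℝ) 1, ∀ τ ∈ Icc 0 T, T - σ * τ ∈ Icc 0 T := fun σ hσ τ hτ =>
    ⟨by nlinarith [hσ.1, hσ.2, hτ.1, hτ.2], by nlinarith [hσ.1, hτ.1]⟩
  have hclosed : IsClosed (s ∩ Icc 0 T) := by
    have e : s ∩ Icc 0 T = Icc 0 T ∩ ⋂ σ ∈ Icc (0 : ℝ) 1, ⋂ a : ℝ, ⋂ z ∈ 𝕁(m),
        Icc 0 T ∩ (fun τ => |Y.da (T - σ * τ) a z|) ⁻¹' Iic (N + 1) := by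
      ext τ
      simp only [hs, mem_inter_iff, mem_ofPred_eq, mem_iInter, mem_preimage, mem_Iic]
      exact ⟨fun H => ⟨H.2, fun σ hσ a z hz => ⟨H.2, H.1 σ hσ a z hz⟩⟩,
        fun H => ⟨fun σ hσ a z hz => (H.2 σ hσ a z hz).2, H.1⟩⟩
    rw [e]
    refine isClosed_Icc.inter (isClosed_biInter fun σ hσ => isClosed_iInter fun a =>
      isClosed_biInter fun z hz => ContinuousOn.preimage_isClosed_of_isClosed ?_ isClosed_Icc isClosed_Iic)
    exact (h.Y_reg.cont_da.comp (f := fun τ : ℝ => ((T - σ * τ, a, z) : ℝ × ℝ × ℝ)) (by fun_prop)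
      fun τ hτ => ⟨hmem σ hσ τ hτ, mem_univ _, hz⟩).abs
  have main : Icc 0 T ⊆ s := by
    refine hclosed.Icc_subset_of_forall_exists_gt ?_ ?_
    · rw [hs]
      intro σ hσ a z hz
      rw [mul_zero, sub_zero, h.da_T a hz hd]
      exact ((hd.yT_reg T).bound_da T h.T_mem a z hz).trans (by linarith)
    · rintro x ⟨hxs, hx⟩ y (hy : x < y)
      rw [hs] at hxs
      have hx' : x ∈ Icc 0 T := ⟨hx.1, hx.2.le⟩
      have hx1 : ∀ t ∈ Icc (T - x) T, ∀ a, ∀ z ∈ 𝕁(m), |Y.da t a z| ≤ N + 1 := by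
        intro t ht a z hz
        rcases hx.1.eq_or_lt with h0 | h0
        · have := hxs 0 ⟨le_rfl, zero_le_one⟩ a z hz
          rw [zero_mul, sub_zero] at this
          rwa [show t = T by linarith [ht.1, ht.2]]
        · have := hxs ((T - t) / x) ⟨div_nonneg (by linarith [ht.2]) h0.le,
            (div_le_one h0).2 (by linarith [ht.1])⟩ a z hz
          rwa [div_mul_cancel₀ _ h0.ne', sub_sub_cancel] at this
      have hev := h.Y_da_usc (T - x) ⟨by linarith [hx.2], by linarith [hx.1]⟩ (N + 1)
        (hx1 (T - x) ⟨le_rfl, by linarith [hx.1]⟩) 1 one_pos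
      obtain ⟨η, hη, hball⟩ := Metric.eventually_nhds_iff.1 (eventually_nhdsWithin_iff.1 hev)
      obtain ⟨τ, hτ⟩ : ∃ τ, τ = min (min (x + η / 2) y) T := ⟨_, rfl⟩
      have hτ1 : τ ≤ x + η / 2 := by rw [hτ]; exact (min_le_left _ _).trans (min_le_left _ _)
      have hτ2 : τ ≤ y := by rw [hτ]; exact (min_le_left _ _).trans (min_le_right _ _)
      have hτ3 : τ ≤ T := by rw [hτ]; exact min_le_right _ _
      have hτ4 : x < τ := by rw [hτ]; exact lt_min (lt_min (by linarith) hy) hx.2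
      have hb2 : ∀ t ∈ Icc (T - τ) T, ∀ a, ∀ z ∈ 𝕁(m), |Y.da t a z| ≤ N + 2 := by
        intro t ht a z hz
        rcases le_total (T - x) t with h1 | h1
        · exact (hx1 t ⟨h1, ht.2⟩ a z hz).trans (by linarith)
        · refine (hball (y := t) ?_ ⟨by linarith [ht.1], ht.2⟩ a z hz).trans (by linarith)
          rw [Real.dist_eq, abs_of_nonpos (by linarith)]
          linarith [ht.1]
      refine ⟨τ, ?_, hτ4, hτ2⟩
      rw [hs]
      have hI : ∀ {t}, t ∈ Ioo (T - τ) T → t ∈ Icc 0 T := fun ht => ⟨by linarith [ht.1], ht.2.le⟩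
      have key := h.Y_reg.da_le_of_backward hk.C_nonneg hk.degenerate (b := m.ndrift T Y f)
        (s := fun _ _ _ => 0) (R := 3 * m.A * Λ) (N := N) (β := Λ * (L * (Λ * (N + 2)))) (K := N + 2)
        (ς := 0) (t₀ := T - τ) (by linarith) (by positivity) hN.le (by positivity) (by positivity) le_rfl
        h.Y_supp (fun t ht a z hz => by
          rw [h.Y_eq t ⟨by linarith [ht.1], ht.2⟩ a z hz]; ring)
        (fun t ht a a' z hz => h.drift_lip hΛ hd.W_pos hU (hI ht)
          (fun a z hz => hb2 t (Ioo_subset_Icc_self ht) a z hz) a a' hz)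
        (fun t ht a a' z hz => by simp) hb2 (fun a a' z hz => h.val_T_lip hd a a' hz)
      intro σ hσ a z hz
      have hτ0 : 0 ≤ τ := by linarith [hx.1]
      refine (key (T - σ * τ) ⟨by nlinarith [hσ.2], by nlinarith [hσ.1]⟩ a z hz).trans ?_
      have e1 : σ * τ ≤ T := by nlinarith [hσ.2]
      have e2 : 0 ≤ Λ * (L * (Λ * (N + 2))) * (N + 2) := by positivity
      have := mul_le_mul_of_nonneg_left e1 e2
      rw [sub_sub_cancel, add_zero]
      linarith
  intro t ht a z hz
  have := main (show T - t ∈ Icc 0 T from ⟨by linarith [ht.2], by linarith [ht.1]⟩)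
  rw [hs] at this
  have := this 1 ⟨zero_le_one, le_rfl⟩ a z hz
  rwa [one_mul, sub_sub_cancel] at this

end Model.NormSol

end

section

variable {T M : ℝ}

namespace Model.NormSol

variable {m : Model} {yT g₀ : ℝ² → ℝ} {Y G : StripPath} {f : ℝ → ℝ} {C N W Λ L : ℝ}

lemma le_integral (h : m.NormSol N W Λ yT g₀ T M Y G f) {t : ℝ} (ht : t ∈ Icc 0 T) {c : ℝ}
    {φ : ℝ → ℝ → ℝ} (hφ : BddCont (univ ×ˢ 𝕁(m)) fun x => φ x.1 x.2) (hc : ∀ a, ∀ z ∈ 𝕁(m), c ≤ φ a z) :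
    c ≤ ∫ x in 𝔹(m,Λ), φ x.1 x.2 * G.val t x.1 x.2 := by
  have hg := h.G_reg.bdd_val ht
  have e : c = ∫ x in 𝔹(m,Λ), c * G.val t x.1 x.2 := by
    rw [integral_const_mul, h.mass t ht, mul_one]
  rw [e]
  exact setIntegral_mono_on ((hg.mono box_subset_strip).integrableOn.const_mul _)
    ((hφ.mul hg).mono box_subset_strip).integrableOn measurableSet_box
    fun x hx => mul_le_mul_of_nonneg_right (hc _ _ hx.2) (h.G_nonneg t ht _ _ hx.2)

lemma integral_terminal (h : m.NormSol N W Λ yT g₀ T M Y G f) :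
    ∫ x in 𝔹(m,Λ), (x.2 + Hp m.u (f T * (Y.val T x.1 x.2 + m.wInf))) * G.val T x.1 x.2
      = ∫ x in 𝔹(m,Λ), (m.test yT).val T x.1 x.2 * G.val T x.1 x.2 :=
  setIntegral_congr_fun measurableSet_box fun x hx => by
    simp only [Model.test_val]
    rw [h.f_T, one_mul, h.Y_T _ _ hx.2]

lemma bddCont_Hp (hm : m.Admissible) (h : m.NormSol N W Λ yT g₀ T M Y G f) (hΛ : 1 ≤ Λ) (hW : 0 < W)
    (hU : m.UBounds N W Λ L) {t : ℝ} (ht : t ∈ Icc 0 T) :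
    BddCont (univ ×ˢ 𝕁(m)) fun x => Hp m.u (f t * (Y.val t x.1 x.2 + m.wInf)) := by
  refine ⟨hm.utility.continuousOn_Hp.comp (continuousOn_const.mul
    ((h.Y_reg.cont_slice ht).add continuousOn_const)) fun x hx => ?_, L,
    fun x hx => hU.b0 _ (h.q_mem hΛ hW ht _ hx.2)⟩
  exact lt_of_lt_of_le (mul_pos (by positivity) hW) (h.q_mem hΛ hW ht _ hx.2).1

/-- The marginal of consumption determines the scale. -/
lemma scale_sub_le (h : m.NormSol N W Λ yT g₀ T M Y G f) (hΛ : 1 ≤ Λ) (hW : 0 < W)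
    (hU : m.UBounds N W Λ L) {t : ℝ} (ht : t ∈ Icc 0 T) {c₁ c₂ e : ℝ}
    (hc₁ : c₁ ∈ Icc Λ⁻¹ Λ) (hc₂ : c₂ ∈ Icc Λ⁻¹ Λ) {v ψ : ℝ → ℝ → ℝ}
    (hv : ∀ a, ∀ z ∈ 𝕁(m), v a z ∈ Icc W (N + m.wInf)) (hψ : BddCont (univ ×ˢ 𝕁(m)) fun x => ψ x.1 x.2)
    (hψe : ∀ a, ∀ z ∈ 𝕁(m), |ψ a z - (Hp m.u (c₁ * v a z) - Hp m.u (c₂ * v a z))| ≤ e) : |c₁ - c₂| * W ≤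
      L * (|∫ x in 𝔹(m,Λ), ψ x.1 x.2 * G.val t x.1 x.2| + e) := by
  have hL := hU.L_nonneg
  have key : ∀ ε : ℝ, |ε| = 1 → 0 ≤ ε * (c₁ - c₂) → |c₁ - c₂| * W ≤
      L * (|∫ x in 𝔹(m,Λ), ψ x.1 x.2 * G.val t x.1 x.2| + e) := by
    intro ε hε hs
    have hε1 : ε = 1 ∨ ε = -1 := (abs_eq zero_le_one).1 hε
    have e0 : |c₁ - c₂| = ε * (c₁ - c₂) := by rw [← abs_of_nonneg hs, abs_mul, hε, one_mul]
    have := h.le_integral ht (c := ε * (c₁ - c₂) * W - L * e) (φ := fun a z => L * ε * ψ a z)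
      ((BddCont.const (L * ε)).mul hψ) fun a z hz => by
        have m1 := mul_mem_scaled hΛ hW hc₁ (hv a z hz)
        have m2 := mul_mem_scaled hΛ hW hc₂ (hv a z hz)
        have hw := hv a z hz
        have b := abs_le.1 (hψe a z hz)
        rcases hε1 with rfl | rfl
        · rw [one_mul] at hs
          have := hU.low _ m2 _ m1 (mul_le_mul_of_nonneg_right (by linarith) (hW.le.trans hw.1))
          have b2 := mul_le_mul_of_nonneg_left b.1 hL
          nlinarith [mul_le_mul_of_nonneg_left hw.1 hs]
        · have := hU.low _ m1 _ m2 (mul_le_mul_of_nonneg_right (by linarith) (hW.le.trans hw.1))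
          have b2 := mul_le_mul_of_nonneg_left b.2 hL
          nlinarith [mul_le_mul_of_nonneg_left hw.1 hs]
    have e1 : ∫ x in 𝔹(m,Λ), L * ε * ψ x.1 x.2 * G.val t x.1 x.2
        = L * (ε * ∫ x in 𝔹(m,Λ), ψ x.1 x.2 * G.val t x.1 x.2) := by
      rw [← integral_const_mul, ← integral_const_mul]
      exact setIntegral_congr_fun measurableSet_box fun x _ => by ring
    rw [e1] at this
    have e2 : ε * (∫ x in 𝔹(m,Λ), ψ x.1 x.2 * G.val t x.1 x.2)
        ≤ |∫ x in 𝔹(m,Λ), ψ x.1 x.2 * G.val t x.1 x.2| := by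
      refine (le_abs_self _).trans ?_
      rw [abs_mul, hε, one_mul]
    rw [e0]
    nlinarith [mul_le_mul_of_nonneg_left e2 hL]
  rcases le_total c₂ c₁ with hc | hc
  · exact key 1 abs_one (by linarith)
  · exact key (-1) (by simp) (by linarith)

lemma test_sub_le (hm : m.Admissible) (hk : m.CoeffRegular C) (hΛ : 1 ≤ Λ) (hW : 0 < W)
    (hU : m.UBounds N W Λ L) (h : m.NormSol N W Λ yT g₀ T M Y G f)
    {q : StripPath} {Q γ : ℝ} (hq : q.Regular m.zMin m.zMax T Q) (hq0 : ∀ t a z, q.dt t a z = 0)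
    (hγ : ∀ t ∈ Icc 0 T, ∀ a, ∀ z ∈ 𝕁(m), |G.val t a z| ≤ γ) {t s : ℝ} (ht : t ∈ Icc 0 T) (hs : s ∈ Icc 0 T) :
    |(∫ x in 𝔹(m,Λ), q.val t x.1 x.2 * G.val t x.1 x.2) - ∫ x in 𝔹(m,Λ), q.val s x.1 x.2 * G.val s x.1 x.2|
    ≤ γ * (C * Q + C * Q + Λ * (𝕫(m) + L) * Q) * (2 * (3 * m.A * Λ) * (m.zMax - m.zMin)) * |t - s| := by
  have hA := hm.A_pos
  have hI {t} (h : t ∈ Ioo 0 T) := Ioo_subset_Icc_self h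
  refine abs_sub_le_of_deriv_le (StripPath.Forward.continuousOn_integral h.G_reg hq _)
    (fun t ht => h.G_forward.hasDerivAt_integral hk h.G_reg hq ht) (fun t ht => ?_) ht hs
  refine abs_setIntegral_box_le (by positivity) hm.zMin_lt_zMax.le fun x hx => ?_
  rw [hq0, zero_add]
  refine abs_mul_le (hγ t (hI ht) _ _ hx.2) ((abs_add_le _ _).trans (add_le_add ((abs_add_le _ _).trans
    (add_le_add (abs_mul_le (hk.D_bdd _ hx.2) (hq.bound_dzz t (hI ht) _ _ hx.2))
      (abs_mul_le (hk.μ_bdd _ hx.2) (hq.bound_dz t (hI ht) _ _ hx.2))))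
    (abs_mul_le (h.abs_drift_le hΛ hW hU (hI ht) _ hx.2) (hq.bound_da t (hI ht) _ _ hx.2))))

/-- Away from the support of the density of wealth, `y_T` vanishes too. -/
lemma ext_eq_zero (hm : m.Admissible) (hd : m.RegData N W yT g₀) (hΛ : 1 ≤ Λ) {a z : ℝ}
    (hz : z ∈ 𝕁(m)) (ha : 3 * m.A * Λ ≤ |a|) : 𝔼(m) yT a z = 0 :=
  hd.yT_supp a z hz (by nlinarith [hm.A_pos])

lemma sub_le (hm : m.Admissible) (hk : m.CoeffRegular C) (hd : m.RegData N W yT g₀)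
    (hΛ : 1 ≤ Λ) (hU : m.UBounds N W Λ L)
    (h : m.NormSol N W Λ yT g₀ T M Y G f) {t : ℝ} (ht : t ∈ Icc 0 T) (a : ℝ) {z : ℝ}
    (hz : z ∈ 𝕁(m)) : |Y.val t a z - 𝔼(m) yT a z| ≤ (C * N + C * N + Λ * (𝕫(m) + L) * N) * T := by
  have hA := hm.A_pos
  have hC := hk.C_nonneg
  have hN := hd.N_pos
  have hL := hU.L_nonneg
  have hI {t} (h : t ∈ Ioo 0 T) := Ioo_subset_Icc_self h
  have hm0 := m.zBound_nonneg
  have hyr := hd.yT_reg T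
  obtain ⟨S, hS⟩ : ∃ S, S = C * N + C * N + Λ * (𝕫(m) + L) * N := ⟨_, rfl⟩
  have hS0 : 0 ≤ S := by rw [hS]; positivity
  have key : ∀ ε : ℝ, |ε| = 1 → ε * (Y.val t a z - 𝔼(m) yT a z) ≤ S * (T - t) := by
    intro ε hε
    have := (h.Y_reg.comb hyr ε (-ε)).le_of_backward hC hk.degenerate (b := m.ndrift T Y f)
      (R := 3 * m.A * Λ) (K := 0) (S := S) (c := 0) le_rfl le_rfl hS0 le_rfl
      (fun t ht a z hz => exists_clamp (F := fun a => (Y.comb ε (𝕊(m) yT) (-ε)).val t a z)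
        (by positivity) (fun a ha => by
          have e1 : (𝕊(m) yT).val t a z = 0 := ext_eq_zero hm hd hΛ hz ha
          simp [StripPath.comb, h.Y_supp t ht a z hz ha, e1]) a)
      (fun a z hz => by
        have e1 : (𝕊(m) yT).val T a z = Y.val T a z := (h.Y_T a z hz).symm
        simp [StripPath.comb, e1])
      (fun t ht a z hz _ => by
        have e1 : |ε * (m.coeff.D z * (𝕊(m) yT).dzz t a z
            + m.coeff.μ z * (𝕊(m) yT).dz t a z
            + m.ndrift T Y f t a z * (𝕊(m) yT).da t a z)| ≤ S := by
          rw [abs_mul, hε, one_mul, hS]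
          exact (abs_add_le _ _).trans (add_le_add ((abs_add_le _ _).trans (add_le_add
            (abs_mul_le (hk.D_bdd z hz) (hyr.bound_dzz t (hI ht) a z hz))
            (abs_mul_le (hk.μ_bdd z hz) (hyr.bound_dz t (hI ht) a z hz))))
            (abs_mul_le (h.abs_drift_le hΛ hd.W_pos hU (hI ht) a hz) (hyr.bound_da t (hI ht) a z hz)))
        have e2 : (𝕊(m) yT).dt t a z = 0 := rfl
        simp only [StripPath.comb]
        rw [h.Y_eq t ht a z hz, e2]
        linarith [(abs_le.1 e1).2]) t ht a z hz
    simp only [StripPath.comb, zero_mul, Real.exp_zero, mul_one, zero_add] at this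
    change ε * Y.val t a z + -ε * 𝔼(m) yT a z ≤ S * (T - t) at this
    linarith
  have h1 := key 1 abs_one
  have h2 := key (-1) (by simp)
  have h3 : S * (T - t) ≤ S * T := mul_le_mul_of_nonneg_left (by linarith [ht.1]) hS0
  rw [← hS, abs_le]
  constructor <;> linarith

lemma da_sub_le (hm : m.Admissible) (hk : m.CoeffRegular C) (hd : m.RegData N W yT g₀)
    (hΛ : 1 ≤ Λ) (hU : m.UBounds N W Λ L) (h : m.NormSol N W Λ yT g₀ T M Y G f) {K : ℝ} (hK : 0 ≤ K)
    (hda : ∀ t ∈ Icc 0 T, ∀ a, ∀ z ∈ 𝕁(m), |Y.da t a z| ≤ K) {t : ℝ} (ht : t ∈ Icc 0 T)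
    (a : ℝ) {z : ℝ} (hz : z ∈ 𝕁(m)) : |Y.da t a z - (𝕊(m) yT).da t a z|
      ≤ (Λ * (L * (Λ * K)) * (K + N) + (C * N + C * N
        + (Λ * (L * (Λ * K)) * N + Λ * (𝕫(m) + L) * N))) * T := by
  have hA := hm.A_pos
  have hC := hk.C_nonneg
  have hN := hd.N_pos
  have hL := hU.L_nonneg
  have hI {t} (h : t ∈ Ioo 0 T) := Ioo_subset_Icc_self h
  have hm0 := m.zBound_nonneg
  have hyr := hd.yT_reg T
  obtain ⟨β, hβ⟩ : ∃ β, β = Λ * (L * (Λ * K)) := ⟨_, rfl⟩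
  obtain ⟨B, hB⟩ : ∃ B, B = Λ * (𝕫(m) + L) := ⟨_, rfl⟩
  have hβ0 : 0 ≤ β := by rw [hβ]; positivity
  have hB0 : 0 ≤ B := by rw [hB]; positivity
  rw [← hβ, ← hB]
  have := (h.Y_reg.comb hyr 1 (-1)).da_le_of_backward hC hk.degenerate (b := m.ndrift T Y f)
    (s := fun t a z => -(m.coeff.D z * (𝕊(m) yT).dzz t a z
            + m.coeff.μ z * (𝕊(m) yT).dz t a z
            + m.ndrift T Y f t a z * (𝕊(m) yT).da t a z))
    (R := 3 * m.A * Λ) (N := 0) (β := β) (K := K + N) (ς := C * N + C * N + (β * N + B * N)) le_rfl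
    (by positivity) le_rfl hβ0 (by positivity) (by positivity)
    (fun t ht a z hz ha => by
      have e1 : (𝕊(m) yT).val t a z = 0 := ext_eq_zero hm hd hΛ hz ha
      simp [StripPath.comb, h.Y_supp t ht a z hz ha, e1])
    (fun t ht a z hz => by
      have e2 : (𝕊(m) yT).dt t a z = 0 := rfl
      simp only [StripPath.comb]
      rw [h.Y_eq t ht a z hz, e2]; ring)
    (fun t ht a a' z hz => by
      rw [hβ]; exact h.drift_lip hΛ hd.W_pos hU (hI ht) (hda t (hI ht)) a a' hz)
    (fun t ht a a' z hz => by
      obtain ⟨l1, l2, l3⟩ := hd.yT_lip t a a' z hz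
      have e1 := abs_mul_le (hk.D_bdd z hz) l3
      have e2 := abs_mul_le (hk.μ_bdd z hz) l2
      have e3 := abs_mul_le (h.abs_drift_le hΛ hd.W_pos hU (hI ht) a hz) l1
      have e4 := abs_mul_le (h.drift_lip hΛ hd.W_pos hU (hI ht) (hda t (hI ht)) a a' hz)
        (hyr.bound_da t (hI ht) a' z hz)
      rw [← hB] at e3
      rw [← hβ] at e4
      rw [abs_le] at e1 e2 e3 e4 ⊢
      constructor <;> linarith [e1.1, e1.2, e2.1, e2.2, e3.1, e3.2, e4.1, e4.2])
    (fun t ht a z hz => by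
      have := abs_comb_le (c := 1) (d := -1) (hda t ht a z hz) (hyr.bound_da t ht a z hz)
      simpa [StripPath.comb] using this)
    (fun a a' z hz => by
      have e1 : ∀ a, (𝕊(m) yT).val T a z = Y.val T a z := fun a => (h.Y_T a z hz).symm
      simp [StripPath.comb, e1]) t ht a z hz
  simp only [StripPath.comb, zero_add] at this
  have h0 : 0 ≤ β * (K + N) + (C * N + C * N + (β * N + B * N)) := by positivity
  have h3 := mul_le_mul_of_nonneg_left (show T - t ≤ T by linarith [ht.1]) h0
  rw [show Y.da t a z - (𝕊(m) yT).da t a z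
    = 1 * Y.da t a z + -1 * (𝕊(m) yT).da t a z by ring]
  exact this.trans h3

lemma G_le (hk : m.CoeffRegular C) (hd : m.RegData N W yT g₀) (hΛ : 1 ≤ Λ) (hU : m.UBounds N W Λ L)
    (h : m.NormSol N W Λ yT g₀ T M Y G f) {K : ℝ} (hK : 0 ≤ K) (hT : T ≤ 1)
    (hda : ∀ t ∈ Icc 0 T, ∀ a, ∀ z ∈ 𝕁(m), |Y.da t a z| ≤ K) {t : ℝ} (ht : t ∈ Icc 0 T)
    (a : ℝ) {z : ℝ} (hz : z ∈ 𝕁(m)) : |G.val t a z| ≤ Λ * N * Real.exp (2 * C + Λ * (L * (Λ * K))) := by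
  have hN := hd.N_pos
  have hL := hU.L_nonneg
  have hC := hk.C_nonneg
  have hI {t} (h : t ∈ Ioo 0 T) := Ioo_subset_Icc_self h
  have hΛi : 0 < Λ⁻¹ := by positivity
  have hβ : 0 ≤ Λ * (L * (Λ * K)) := by positivity
  have key := h.G_forward.le_exp hk h.G_reg (K := Λ * (L * (Λ * K))) (N := Λ * N) (by positivity)
    (fun t ht a z hz => abs_mul_le (h.abs_scl_le hΛ (hI ht)) (abs_mul_le
      (hU.b1 _ (h.q_mem hΛ hd.W_pos (hI ht) a hz)) (abs_mul_le (h.abs_f_le hΛ (hI ht)) (hda t (hI ht) a z hz))))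
    hβ (fun a z hz => by
      have s1 := h.scl_mem 0 h.zero_mem
      have e1 : |(m.scl T f 0)⁻¹| ≤ Λ := by
        rw [abs_inv, abs_of_pos (hΛi.trans_le s1.1)]
        exact inv_le_of_inv_le₀ (by linarith) s1.1
      rw [h.G_0 a z hz]
      exact (le_abs_self _).trans (abs_mul_le e1 ((hd.g₀_reg T).bound 0 h.zero_mem _ z hz))) t ht a z hz
  rw [abs_of_nonneg (h.G_nonneg t ht a z hz)]
  refine key.trans (mul_le_mul_of_nonneg_left (Real.exp_le_exp.2 ?_) (by positivity))
  nlinarith [ht.1, ht.2]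

lemma f_sub_le (hm : m.Admissible) (hk : m.CoeffRegular C) (hd : m.RegData N W yT g₀)
    (hΛ : 1 ≤ Λ) (hU : m.UBounds N W Λ L)
    (h : m.NormSol N W Λ yT g₀ T M Y G f) {Q γ S : ℝ} (hQ : (m.test yT).Regular m.zMin m.zMax T Q)
    (hQ0 : 0 ≤ Q) (hγ0 : 0 ≤ γ) (hγ : ∀ t ∈ Icc 0 T, ∀ a, ∀ z ∈ 𝕁(m), |G.val t a z| ≤ γ)
    (hS : ∀ t ∈ Icc 0 T, ∀ a, ∀ z ∈ 𝕁(m), |Y.val t a z - 𝔼(m) yT a z| ≤ S * T) {t : ℝ} (ht : t ∈ Icc 0 T) :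
    |f t - 1| ≤ L * (γ * (C * Q + C * Q + Λ * (𝕫(m) + L) * Q)
      * (2 * (3 * m.A * Λ) * (m.zMax - m.zMin)) + L * (Λ * S)) / W * T := by
  have hC := hk.C_nonneg
  have hL := hU.L_nonneg
  have hA := hm.A_pos
  have hz0 := hm.zMin_lt_zMax
  have hm0 := m.zBound_nonneg
  have hI {t} (h : t ∈ Ioo 0 T) := Ioo_subset_Icc_self h
  obtain ⟨P, hP⟩ : ∃ P, P = γ * (C * Q + C * Q + Λ * (𝕫(m) + L) * Q)
      * (2 * (3 * m.A * Λ) * (m.zMax - m.zMin)) := ⟨_, rfl⟩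
  have hP0 : 0 ≤ P := by
    have : 0 ≤ m.zMax - m.zMin := by linarith
    rw [hP]; positivity
  have h1 := h.test_sub_le hm hk hΛ hd.W_pos hU hQ (m.test_dt yT) hγ ht h.T_mem
  rw [← hP] at h1 ⊢
  have h2 := h.cons t ht
  rw [h.integral_terminal] at h2
  have bg := h.G_reg.bdd_val ht
  have bz := m.bddCont_z
  have bH := h.bddCont_Hp hm hΛ hd.W_pos hU ht
  have bq := hQ.bdd_val ht
  have bψ : BddCont (univ ×ˢ 𝕁(m)) fun x =>
      x.2 + Hp m.u (f t * (Y.val t x.1 x.2 + m.wInf)) - (m.test yT).val t x.1 x.2 := (bz.add bH).sub bq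
  have e2 : ∫ x in 𝔹(m,Λ),
      (x.2 + Hp m.u (f t * (Y.val t x.1 x.2 + m.wInf)) - (m.test yT).val t x.1 x.2) * G.val t x.1 x.2
      = (∫ x in 𝔹(m,Λ), (m.test yT).val T x.1 x.2 * G.val T x.1 x.2)
        - ∫ x in 𝔹(m,Λ), (m.test yT).val t x.1 x.2 * G.val t x.1 x.2 := by
    simp only [sub_mul]
    rw [← h2]
    exact integral_sub (((bz.add bH).mul bg).mono box_subset_strip).integrableOn
      ((bq.mul bg).mono box_subset_strip).integrableOn
  have h3 := h.scale_sub_le hΛ hd.W_pos hU ht (c₁ := f t) (c₂ := 1) (e := L * (Λ * (S * T)))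
    (h.f_mem t ht) (one_mem_scale hΛ) (v := fun a z => 𝔼(m) yT a z + m.wInf)
    (ψ := fun a z => z + Hp m.u (f t * (Y.val t a z + m.wInf)) - (m.test yT).val t a z)
    (fun a z hz => hd.vT_mem a hz) bψ fun a z hz => by
      have l := hU.l0 _ (h.q_mem hΛ hd.W_pos ht a hz) _
        (mul_mem_scaled hΛ hd.W_pos (h.f_mem t ht) (hd.vT_mem a hz))
      have l2 := abs_mul_le (h.abs_f_le hΛ ht) (hS t ht a z hz)
      rw [← mul_sub, add_sub_add_right_eq_sub] at l
      rw [Model.test_val, one_mul]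
      refine le_trans (le_of_eq ?_) (l.trans (mul_le_mul_of_nonneg_left l2 hL))
      congr 1; ring
  rw [e2] at h3
  rw [abs_sub_comm] at h1
  have h4 : P * |t - T| ≤ P * T := mul_le_mul_of_nonneg_left
    (by rw [abs_of_nonpos (by linarith [ht.2])]; linarith [ht.1]) hP0
  have h5 := mul_le_mul_of_nonneg_left (add_le_add_left (h1.trans h4) (L * (Λ * (S * T)))) hL
  rw [div_mul_eq_mul_div, le_div_iff₀ hd.W_pos]
  linarith

end Model.NormSol

/-- Bounds on normalized solutions which depend only on the data. -/
lemma Model.RegData.exists_apriori {m : Model} {yT g₀ : ℝ² → ℝ} {C N W Λ L : ℝ} (hm : m.Admissible)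
    (hk : m.CoeffRegular C) (hd : m.RegData N W yT g₀) (hΛ : 1 ≤ Λ) (hU : m.UBounds N W Λ L) :
    ∃ K, 0 ≤ K ∧ ∃ τ > 0, τ ≤ 1 ∧ ∀ T < τ, ∀ M Y G f, m.NormSol N W Λ yT g₀ T M Y G f →
      m.Apriori K yT T Y G f := by
  have hN := hd.N_pos
  have hL := hU.L_nonneg
  have hC := hk.C_nonneg
  have hW := hd.W_pos
  have hA := hm.A_pos
  have hz0 : 0 < m.zMax - m.zMin := by linarith [hm.zMin_lt_zMax]
  have hm0 := m.zBound_nonneg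
  obtain ⟨Q, hQ0, hQ, -⟩ := hd.exists_test_regular hm hΛ hU
  obtain ⟨c, hc⟩ : ∃ c, c = Λ * (L * (Λ * (N + 2))) * (N + 2) := ⟨_, rfl⟩
  have hc0 : 0 ≤ c := by rw [hc]; positivity
  obtain ⟨K₁, hK₁⟩ : ∃ K₁, K₁ = Λ * N * Real.exp (2 * C + Λ * (L * (Λ * (N + 1)))) := ⟨_, rfl⟩
  have n1 : 0 ≤ K₁ := by rw [hK₁]; positivity
  obtain ⟨K₂, hK₂⟩ : ∃ K₂, K₂ = C * N + C * N + Λ * (𝕫(m) + L) * N := ⟨_, rfl⟩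
  have n2 : 0 ≤ K₂ := by rw [hK₂]; positivity
  obtain ⟨K₃, hK₃⟩ : ∃ K₃, K₃ = Λ * (L * (Λ * (N + 1))) * ((N + 1) + N) + (C * N + C * N
        + (Λ * (L * (Λ * (N + 1))) * N + Λ * (𝕫(m) + L) * N)) := ⟨_, rfl⟩
  have n3 : 0 ≤ K₃ := by rw [hK₃]; positivity
  obtain ⟨K₄, hK₄⟩ : ∃ K₄, K₄ = L * (K₁ * (C * Q + C * Q + Λ * (𝕫(m) + L) * Q)
      * (2 * (3 * m.A * Λ) * (m.zMax - m.zMin)) + L * (Λ * K₂)) / W := ⟨_, rfl⟩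
  have n4 : 0 ≤ K₄ := by rw [hK₄]; positivity
  refine ⟨(N + 1) + K₁ + K₂ + K₃ + K₄, by positivity, min 1 (1 / (c + 1)), by positivity, min_le_left _ _,
    fun T hT M Y G f h => ?_⟩
  have hT0 := h.T_pos
  have hT1 : T ≤ 1 := hT.le.trans (min_le_left _ _)
  have hcT : c * T ≤ 1 := by
    have : T ≤ 1 / (c + 1) := hT.le.trans (min_le_right _ _)
    rw [le_div_iff₀ (by linarith)] at this
    nlinarith
  rw [hc] at hcT
  have d1 := h.da_le hm hk hd hΛ hU hcT
  have d2 : ∀ t ∈ Icc 0 T, ∀ a, ∀ z ∈ 𝕁(m), |G.val t a z| ≤ K₁ := fun t ht a z hz => by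
    rw [hK₁]; exact h.G_le hk hd hΛ hU (by positivity) hT1 d1 ht a hz
  have d3 : ∀ t ∈ Icc 0 T, ∀ a, ∀ z ∈ 𝕁(m), |Y.val t a z - 𝔼(m) yT a z| ≤ K₂ * T :=
    fun t ht a z hz => by
      rw [hK₂]; exact h.sub_le hm hk hd hΛ hU ht a hz
  exact
  { da_le := fun t ht a z hz => (d1 t ht a z hz).trans (by linarith)
    G_le := fun t ht a z hz => (d2 t ht a z hz).trans (by linarith)
    sub_le := fun t ht a z hz => (d3 t ht a z hz).trans
      (mul_le_mul_of_nonneg_right (by linarith) hT0.le)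
    da_sub_le := fun t ht a z hz => by
      have := h.da_sub_le hm hk hd hΛ hU (by positivity) d1 ht a hz
      rw [← hK₃] at this
      exact this.trans (mul_le_mul_of_nonneg_right (by linarith) hT0.le)
    f_sub_le := fun t ht => by
      have := h.f_sub_le hm hk hd hΛ hU (hQ T) hQ0 n1 d2 d3 ht
      rw [← hK₄] at this
      exact this.trans (mul_le_mul_of_nonneg_right (by linarith) hT0.le) }

end

section

variable {T M : ℝ}

/-! ### The forward equation for the primitive -/

lemma StripPath.Forward.prim_eq {zl zr R : ℝ} {p : StripPath} {k : CoeffData}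
    {b ba : ℝ → ℝ → ℝ → ℝ} (h : p.Forward k b ba zl zr T R) (hp : p.Regular zl zr T M) {t : ℝ}
    (ht : t ∈ Ioo 0 T) (a : ℝ) {z : ℝ} (hz : z ∈ Ioo zl zr) :
    (p.prim R).dt t a z = k.fwd z ((p.prim R).val t a z) ((p.prim R).dz t a z) ((p.prim R).dzz t a z)
      - b t a z * p.val t a z := by
  have htI := Ioo_subset_Icc_self ht
  have c0 := (continuous_line (hp.cont_slice htI) hz).intervalIntegrable (μ := volume) (-R) a
  have c1 := (continuous_line (hp.cont_dz t htI) hz).intervalIntegrable (μ := volume) (-R) a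
  have c2 := (continuous_line (hp.cont_dzz t htI) hz).intervalIntegrable (μ := volume) (-R) a
  have cb := continuous_line (h.cont_b t ht) hz
  have cba := continuous_line (h.cont_ba t ht) hz
  have cp := continuous_line (hp.cont_slice htI) hz
  have cpa := continuous_line (hp.cont_da_slice htI) hz
  have c3 : IntervalIntegrable (fun s => ba t s z * p.val t s z + b t s z * p.da t s z) volume (-R) a :=
    ((cba.mul cp).add (cb.mul cpa)).intervalIntegrable _ _
  have e : ∫ s in (-R)..a, (ba t s z * p.val t s z + b t s z * p.da t s z) = b t a z * p.val t a z := by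
    rw [intervalIntegral.integral_eq_sub_of_hasDerivAt (f := fun s => b t s z * p.val t s z)
      (fun s _ => (h.has_ba t ht s z hz).fun_mul (hp.has_da t htI s z hz)) c3,
      h.supp t htI (-R) z hz (by rw [abs_neg]; exact le_abs_self R), mul_zero, sub_zero]
  simp only [StripPath.prim, CoeffData.fwd]
  rw [← e, ← intervalIntegral.integral_const_mul, ← intervalIntegral.integral_const_mul,
    ← intervalIntegral.integral_const_mul, ← intervalIntegral.integral_add (c2.const_mul _) (c1.const_mul _),
    ← intervalIntegral.integral_add ((c2.const_mul _).add (c1.const_mul _)) (c0.const_mul _),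
    ← intervalIntegral.integral_sub (((c2.const_mul _).add (c1.const_mul _)).add (c0.const_mul _)) c3]
  refine intervalIntegral.integral_congr fun s _ => ?_
  simp only [h.eq t ht s z hz, CoeffData.fwd]

lemma StripPath.Forward.prim_clamp {zl zr R : ℝ} {p : StripPath} {k : CoeffData}
    {b ba : ℝ → ℝ → ℝ → ℝ} (h : p.Forward k b ba zl zr T R) (hp : p.Regular zl zr T M) {t : ℝ}
    (ht : t ∈ Icc 0 T) (a : ℝ) {z : ℝ} (hz : z ∈ Ioo zl zr) :
    (p.prim R).val t (max (-R) (min R a)) z = (p.prim R).val t a z := by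
  have hR := h.R_nonneg
  have hs := fun a => h.supp t ht a z hz
  simp only [StripPath.prim]
  rcases le_total R a with h1 | h1
  · rw [min_eq_left h1, max_eq_right (by linarith),
      primitive_eq_right hR (continuous_line (hp.cont_slice ht) hz) hs h1]
  · rw [min_eq_right h1]
    rcases le_total (-R) a with h2 | h2
    · rw [max_eq_right h2]
    · rw [max_eq_left h2, primitive_eq_zero hR hs h2, intervalIntegral.integral_same]

lemma clamp_mem {R : ℝ} (hR : 0 ≤ R) (a : ℝ) : max (-R) (min R a) ∈ Icc (-R) R :=
  ⟨le_max_left _ _, max_le (by linarith) (min_le_left _ _)⟩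

/-! ### The difference of two solutions -/

/-- The solutions differ by at most `δ`. -/
def Model.Close (m : Model) (T δ : ℝ) (Y₁ Y₂ : StripPath) (f₁ f₂ : ℝ → ℝ) : Prop :=
  ∀ t ∈ Icc 0 T, |f₁ t - f₂ t| ≤ δ ∧ ∀ a, ∀ z ∈ 𝕁(m), |Y₁.val t a z - Y₂.val t a z| ≤ δ

lemma Model.Close.symm {m : Model} {δ : ℝ} {Y₁ Y₂ : StripPath} {f₁ f₂ : ℝ → ℝ}
    (h : m.Close T δ Y₁ Y₂ f₁ f₂) : m.Close T δ Y₂ Y₁ f₂ f₁ := fun t ht =>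
  ⟨by rw [abs_sub_comm]; exact (h t ht).1, fun a z hz => by rw [abs_sub_comm]; exact (h t ht).2 a z hz⟩

namespace Model.NormSol

variable {m : Model} {yT g₀ : ℝ² → ℝ} {Y₁ G₁ Y₂ G₂ : StripPath} {f₁ f₂ : ℝ → ℝ}
  {C N W Λ L M₁ M₂ δ K : ℝ}

lemma scl_sub_le (hT : T ≤ 1) {t : ℝ} (ht : t ∈ Icc 0 T) (hδ : |f₁ t - f₂ t| ≤ δ) :
    |m.scl T f₁ t - m.scl T f₂ t| ≤ Real.exp |m.ρ| * δ := by
  have e : m.scl T f₁ t - m.scl T f₂ t = Real.exp (m.ρ * (T - t)) * (f₁ t - f₂ t) := by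
    simp only [Model.scl]; ring
  rw [e]
  refine abs_mul_le ?_ hδ
  rw [abs_of_pos (Real.exp_pos _)]
  refine Real.exp_le_exp.2 ((le_abs_self _).trans ?_)
  have := abs_mul_le (le_refl |m.ρ|) (show |T - t| ≤ 1 by
      rw [abs_of_nonneg (by linarith [ht.2])]; linarith [ht.1])
  linarith

lemma q_sub_le (hΛ : 1 ≤ Λ) (hW : 0 < W) (h₁ : m.NormSol N W Λ yT g₀ T M₁ Y₁ G₁ f₁)
    (h₂ : m.NormSol N W Λ yT g₀ T M₂ Y₂ G₂ f₂) (hc : m.Close T δ Y₁ Y₂ f₁ f₂) {t : ℝ} (ht : t ∈ Icc 0 T)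
    (a : ℝ) {z : ℝ} (hz : z ∈ 𝕁(m)) :
    |f₁ t * (Y₁.val t a z + m.wInf) - f₂ t * (Y₂.val t a z + m.wInf)| ≤ Λ * δ + δ * (N + m.wInf) := by
  have hv := h₂.v_mem ht a hz
  have e : f₁ t * (Y₁.val t a z + m.wInf) - f₂ t * (Y₂.val t a z + m.wInf)
      = f₁ t * (Y₁.val t a z - Y₂.val t a z) + (f₁ t - f₂ t) * (Y₂.val t a z + m.wInf) := by ring
  rw [e]
  exact (abs_add_le _ _).trans (add_le_add (abs_mul_le (h₁.abs_f_le hΛ ht) ((hc t ht).2 a z hz))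
    (abs_mul_le (hc t ht).1 (by rw [abs_of_nonneg (hW.le.trans hv.1)]; exact hv.2)))

/-- The constant in the bound for the difference of the drifts. -/
def driftConst (m : Model) (N Λ L : ℝ) : ℝ :=
  Real.exp |m.ρ| * (𝕫(m) + L) + Λ * (L * (Λ + (N + m.wInf)))

lemma drift_sub_le (hΛ : 1 ≤ Λ) (hW : 0 < W) (hU : m.UBounds N W Λ L)
    (h₁ : m.NormSol N W Λ yT g₀ T M₁ Y₁ G₁ f₁) (h₂ : m.NormSol N W Λ yT g₀ T M₂ Y₂ G₂ f₂) (hT : T ≤ 1)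
    (hc : m.Close T δ Y₁ Y₂ f₁ f₂) {t : ℝ} (ht : t ∈ Icc 0 T) (a : ℝ) {z : ℝ} (hz : z ∈ 𝕁(m)) :
    |m.ndrift T Y₁ f₁ t a z - m.ndrift T Y₂ f₂ t a z| ≤ driftConst m N Λ L * δ := by
  have e : m.ndrift T Y₁ f₁ t a z - m.ndrift T Y₂ f₂ t a z
      = (m.scl T f₁ t - m.scl T f₂ t) * (z + Hp m.u (f₁ t * (Y₁.val t a z + m.wInf)))
        + m.scl T f₂ t * (Hp m.u (f₁ t * (Y₁.val t a z + m.wInf))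
          - Hp m.u (f₂ t * (Y₂.val t a z + m.wInf))) := by
    simp only [Model.ndrift]; ring
  have e1 := abs_mul_le (scl_sub_le hT ht (hc t ht).1 (m := m)) ((abs_add_le z
    (Hp m.u (f₁ t * (Y₁.val t a z + m.wInf)))).trans (add_le_add (abs_le_max_abs_abs hz.1.le hz.2.le)
      (hU.b0 _ (h₁.q_mem hΛ hW ht a hz))))
  have e2 := abs_mul_le (h₂.abs_scl_le hΛ ht) ((hU.l0 _ (h₁.q_mem hΛ hW ht a hz) _
    (h₂.q_mem hΛ hW ht a hz)).trans (mul_le_mul_of_nonneg_left (h₁.q_sub_le hΛ hW h₂ hc ht a hz) hU.L_nonneg))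
  rw [e, driftConst]
  exact (abs_add_le _ _).trans ((add_le_add e1 e2).trans (le_of_eq (by ring)))

lemma driftConst_nonneg (hm : m.Admissible) (hΛ : 1 ≤ Λ) (hN : 0 < N) (hL : 0 ≤ L) :
    0 ≤ driftConst m N Λ L := by
  have hm0 := m.zBound_nonneg
  have := hm.wInf_pos
  rw [driftConst]; positivity

/-- Two solutions which satisfy the a priori bounds and differ by at most `δ`. -/
structure ClosePair (m : Model) (yT g₀ : ℝ² → ℝ) (C N W Λ L K δ T M₁ M₂ : ℝ) (Y₁ G₁ : StripPath)
    (f₁ : ℝ → ℝ) (Y₂ G₂ : StripPath) (f₂ : ℝ → ℝ) : Prop where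
  adm : m.Admissible
  coeff : m.CoeffRegular C
  data : m.RegData N W yT g₀
  one_le : 1 ≤ Λ
  util : m.UBounds N W Λ L
  sol₁ : m.NormSol N W Λ yT g₀ T M₁ Y₁ G₁ f₁
  sol₂ : m.NormSol N W Λ yT g₀ T M₂ Y₂ G₂ f₂
  T_le : T ≤ 1
  K_nonneg : 0 ≤ K
  apriori₁ : m.Apriori K yT T Y₁ G₁ f₁
  apriori₂ : m.Apriori K yT T Y₂ G₂ f₂
  δ_nonneg : 0 ≤ δ
  close : m.Close T δ Y₁ Y₂ f₁ f₂

lemma ClosePair.symm (P : ClosePair m yT g₀ C N W Λ L K δ T M₁ M₂ Y₁ G₁ f₁ Y₂ G₂ f₂) :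
    ClosePair m yT g₀ C N W Λ L K δ T M₂ M₁ Y₂ G₂ f₂ Y₁ G₁ f₁ :=
  ⟨P.1, P.2, P.3, P.4, P.5, P.7, P.6, P.8, P.9, P.11, P.10, P.12, P.13.symm⟩

lemma ClosePair.val_sub_le_aux (P : ClosePair m yT g₀ C N W Λ L K δ T M₁ M₂ Y₁ G₁ f₁ Y₂ G₂ f₂)
    {t : ℝ} (ht : t ∈ Icc 0 T) (a : ℝ) {z : ℝ} (hz : z ∈ 𝕁(m)) :
    Y₁.val t a z - Y₂.val t a z ≤ driftConst m N Λ L * δ * K * T := by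
  obtain ⟨hm, hk, hd, hΛ, hU, h₁, h₂, hT, hK, ha₁, ha₂, hδ, hc⟩ := id P
  have hN := hd.N_pos
  have hW := hd.W_pos
  have hI {t} (h : t ∈ Ioo 0 T) := Ioo_subset_Icc_self h
  have hA := hm.A_pos
  have hS : 0 ≤ driftConst m N Λ L * δ * K :=
    mul_nonneg (mul_nonneg (driftConst_nonneg hm hΛ hN hU.L_nonneg) hδ) hK
  have key := (h₁.Y_reg.comb h₂.Y_reg 1 (-1)).le_of_backward hk.C_nonneg hk.degenerate
    (b := m.ndrift T Y₁ f₁) (R := 3 * m.A * Λ) (K := 0) (S := driftConst m N Λ L * δ * K) (c := 0)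
    le_rfl le_rfl hS le_rfl
    (fun t ht a z hz => exists_clamp (F := fun a => (Y₁.comb 1 Y₂ (-1)).val t a z) (by positivity)
      (fun a ha => by simp [StripPath.comb, h₁.Y_supp t ht a z hz ha, h₂.Y_supp t ht a z hz ha]) a)
    (fun a z hz => by simp [StripPath.comb, h₁.Y_T a z hz, h₂.Y_T a z hz])
    (fun t ht a z hz _ => by
      have e := abs_mul_le (h₁.drift_sub_le hΛ hW hU h₂ hT hc (hI ht) a hz) (ha₂.da_le t (hI ht) a z hz)
      simp only [StripPath.comb]
      rw [h₁.Y_eq t ht a z hz, h₂.Y_eq t ht a z hz]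
      linarith [(abs_le.1 e).2]) t ht a z hz
  simp only [StripPath.comb, zero_mul, Real.exp_zero, mul_one, zero_add] at key
  have := mul_le_mul_of_nonneg_left (show T - t ≤ T by linarith [ht.1]) hS
  linarith

lemma ClosePair.val_sub_le (P : ClosePair m yT g₀ C N W Λ L K δ T M₁ M₂ Y₁ G₁ f₁ Y₂ G₂ f₂)
    {t : ℝ} (ht : t ∈ Icc 0 T) (a : ℝ) {z : ℝ} (hz : z ∈ 𝕁(m)) :
    |Y₁.val t a z - Y₂.val t a z| ≤ driftConst m N Λ L * δ * K * T :=
  abs_sub_le_iff.2 ⟨P.val_sub_le_aux ht a hz, P.symm.val_sub_le_aux ht a hz⟩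

/-! ### The primitives of the densities -/

lemma prim_regular (h₁ : m.NormSol N W Λ yT g₀ T M₁ Y₁ G₁ f₁) :
    ∃ M', (G₁.prim (3 * m.A * Λ)).Regular m.zMin m.zMax T M' := by
  exact ⟨_, (h₁.G_reg.mono (le_abs_self _)).prim h₁.G_forward.R_nonneg h₁.G_forward.supp (abs_nonneg _)⟩

lemma prim_zero_eq (hm : m.Admissible) (hΛ : 1 ≤ Λ)
    (h₁ : m.NormSol N W Λ yT g₀ T M₁ Y₁ G₁ f₁) {z : ℝ} (hz : z ∈ 𝕁(m)) :
    (G₁.prim (3 * m.A * Λ)).val 0 (3 * m.A * Λ) z = ∫ a, 𝔼(m) g₀ a z := by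
  have hA := hm.A_pos
  have hR := h₁.G_forward.R_nonneg
  have hE : 0 < m.scl T f₁ 0 := lt_of_lt_of_le (by positivity) (h₁.scl_mem 0 h₁.zero_mem).1
  have hsupp : Function.support (fun a => G₁.val 0 a z) ⊆ Ioc (-(3 * m.A * Λ)) (3 * m.A * Λ) := fun a ha => by
    by_contra hcon
    refine ha (h₁.G_forward.supp 0 h₁.zero_mem a z hz (not_lt.1 fun hlt => hcon ?_))
    exact ⟨(abs_lt.1 hlt).1, (abs_lt.1 hlt).2.le⟩
  simp only [StripPath.prim]
  rw [intervalIntegral.integral_eq_integral_of_support_subset hsupp,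
    show (fun a => G₁.val 0 a z) = fun a => (m.scl T f₁ 0)⁻¹ * 𝔼(m) g₀ (a / m.scl T f₁ 0) z from
      funext fun a => h₁.G_0 a z hz, integral_const_mul,
    Measure.integral_comp_div (fun a => 𝔼(m) g₀ a z), abs_of_pos hE, smul_eq_mul,
    inv_mul_cancel_left₀ hE.ne']

lemma prim_right_le (hm : m.Admissible) (hk : m.CoeffRegular C)
    (hΛ : 1 ≤ Λ) (h₁ : m.NormSol N W Λ yT g₀ T M₁ Y₁ G₁ f₁)
    (h₂ : m.NormSol N W Λ yT g₀ T M₂ Y₂ G₂ f₂) {t : ℝ} (ht : t ∈ Icc 0 T) {z : ℝ} (hz : z ∈ 𝕁(m)) :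
    (G₁.prim (3 * m.A * Λ)).val t (3 * m.A * Λ) z ≤ (G₂.prim (3 * m.A * Λ)).val t (3 * m.A * Λ) z := by
  have hI {t} (h : t ∈ Ioo 0 T) := Ioo_subset_Icc_self h
  have hC := hk.C_nonneg
  have hR := h₁.G_forward.R_nonneg
  obtain ⟨M₁', r₁⟩ := h₁.prim_regular
  obtain ⟨M₂', r₂⟩ := h₂.prim_regular
  have key := ((r₁.comb r₂ 1 (-1)).at (3 * m.A * Λ)).le_of_forward (mul_nonneg (by norm_num) hC)
    hk.degenerate_fwd (b := fun _ _ _ => 0) (R := 3 * m.A * Λ) (K := 0) (S := 0) (c := 2 * C) le_rfl le_rfl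
    (by positivity) (fun t ht a z hz => ⟨0, ⟨by linarith, hR⟩, le_rfl⟩)
    (fun a z hz => by
      simp only [StripPath.at, StripPath.comb]
      rw [h₁.prim_zero_eq hm hΛ hz, h₂.prim_zero_eq hm hΛ hz]; simp)
    (fun t ht a z hz hv => by
      simp only [StripPath.at, StripPath.comb] at hv ⊢
      rw [h₁.G_forward.prim_eq h₁.G_reg ht _ hz, h₂.G_forward.prim_eq h₂.G_reg ht _ hz,
        h₁.G_forward.supp t (hI ht) _ z hz (le_abs_self _), h₂.G_forward.supp t (hI ht) _ z hz (le_abs_self _)]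
      simp only [CoeffData.fwd]
      have e1 := (abs_le.1 (hk.D2_bdd z hz))
      have e2 := (abs_le.1 (hk.μ1_bdd z hz))
      nlinarith [mul_le_mul_of_nonneg_right
        (show m.coeff.D2 z - m.coeff.μ1 z ≤ 2 * C by linarith [e1.2, e2.1]) hv.le]) t ht 0 z hz
  simp only [StripPath.at, StripPath.comb, zero_mul, add_zero] at key
  linarith

lemma prim_right_eq (hm : m.Admissible) (hk : m.CoeffRegular C)
    (hΛ : 1 ≤ Λ) (h₁ : m.NormSol N W Λ yT g₀ T M₁ Y₁ G₁ f₁)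
    (h₂ : m.NormSol N W Λ yT g₀ T M₂ Y₂ G₂ f₂) {t : ℝ} (ht : t ∈ Icc 0 T) {z : ℝ} (hz : z ∈ 𝕁(m)) :
    (G₁.prim (3 * m.A * Λ)).val t (3 * m.A * Λ) z = (G₂.prim (3 * m.A * Λ)).val t (3 * m.A * Λ) z :=
  le_antisymm (h₁.prim_right_le hm hk hΛ h₂ ht hz) (h₂.prim_right_le hm hk hΛ h₁ ht hz)

lemma initial_sub_le (hd : m.RegData N W yT g₀) (hΛ : 1 ≤ Λ)
    (h₁ : m.NormSol N W Λ yT g₀ T M₁ Y₁ G₁ f₁) (h₂ : m.NormSol N W Λ yT g₀ T M₂ Y₂ G₂ f₂) (hT : T ≤ 1)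
    (hc : m.Close T δ Y₁ Y₂ f₁ f₂) {a z : ℝ} (ha : |a| ≤ 3 * m.A * Λ) (hz : z ∈ 𝕁(m)) :
    |G₁.val 0 a z - G₂.val 0 a z| ≤ Λ * Λ * (Real.exp |m.ρ| * δ) * (N + Λ * (N * (3 * m.A * Λ))) := by
  have hΛi : 0 < Λ⁻¹ := by positivity
  have hN := hd.N_pos
  have p₁ := hΛi.trans_le (h₁.scl_mem 0 h₁.zero_mem).1
  have p₂ := hΛi.trans_le (h₂.scl_mem 0 h₂.zero_mem).1
  have i₁ : |(m.scl T f₁ 0)⁻¹| ≤ Λ := by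
    rw [abs_inv, abs_of_pos p₁]; exact inv_le_of_inv_le₀ (by linarith) (h₁.scl_mem 0 h₁.zero_mem).1
  have i₂ : |(m.scl T f₂ 0)⁻¹| ≤ Λ := by
    rw [abs_inv, abs_of_pos p₂]; exact inv_le_of_inv_le₀ (by linarith) (h₂.scl_mem 0 h₂.zero_mem).1
  have hinv : |(m.scl T f₁ 0)⁻¹ - (m.scl T f₂ 0)⁻¹| ≤ Λ * Λ * (Real.exp |m.ρ| * δ) := by
    have e : (m.scl T f₁ 0)⁻¹ - (m.scl T f₂ 0)⁻¹
        = (m.scl T f₁ 0)⁻¹ * (m.scl T f₂ 0)⁻¹ * (m.scl T f₂ 0 - m.scl T f₁ 0) := by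
      field_simp
    rw [e]
    exact abs_mul_le (abs_mul_le i₁ i₂) (scl_sub_le hT h₁.zero_mem (hc.symm 0 h₁.zero_mem).1)
  have l := abs_sub_le_of_hasDerivAt (fun a => (hd.g₀_reg T).has_da 0 h₁.zero_mem a z hz)
    (fun a => (hd.g₀_reg T).bound_da 0 h₁.zero_mem a z hz) (a / m.scl T f₁ 0) (a / m.scl T f₂ 0)
  change |𝔼(m) g₀ (a / m.scl T f₁ 0) z - 𝔼(m) g₀ (a / m.scl T f₂ 0) z| ≤ _ at l
  rw [div_eq_mul_inv, div_eq_mul_inv, ← mul_sub] at l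
  have l2 := l.trans (mul_le_mul_of_nonneg_left (abs_mul_le ha hinv) hN.le)
  have b := (hd.g₀_reg T).bound 0 h₁.zero_mem (a * (m.scl T f₁ 0)⁻¹) z hz
  rw [h₁.G_0 a z hz, h₂.G_0 a z hz, div_eq_mul_inv, div_eq_mul_inv]
  have e : (m.scl T f₁ 0)⁻¹ * 𝔼(m) g₀ (a * (m.scl T f₁ 0)⁻¹) z
      - (m.scl T f₂ 0)⁻¹ * 𝔼(m) g₀ (a * (m.scl T f₂ 0)⁻¹) z
      = ((m.scl T f₁ 0)⁻¹ - (m.scl T f₂ 0)⁻¹) * 𝔼(m) g₀ (a * (m.scl T f₁ 0)⁻¹) z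
        + (m.scl T f₂ 0)⁻¹ * (𝔼(m) g₀ (a * (m.scl T f₁ 0)⁻¹) z
          - 𝔼(m) g₀ (a * (m.scl T f₂ 0)⁻¹) z) := by ring
  rw [e]
  exact (abs_add_le _ _).trans ((add_le_add (abs_mul_le hinv b) (abs_mul_le i₂ l2)).trans
    (le_of_eq (by ring)))

/-- The constant in the bound for the difference of the primitives. -/
def primConst (m : Model) (C N Λ L K : ℝ) : ℝ :=
  (Λ * Λ * Real.exp |m.ρ| * (N + Λ * (N * (3 * m.A * Λ))) * (2 * (3 * m.A * Λ))
    + driftConst m N Λ L * K) * Real.exp (2 * C)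

lemma primConst_nonneg (hm : m.Admissible) (hΛ : 1 ≤ Λ) (hN : 0 < N) (hL : 0 ≤ L) (hK : 0 ≤ K) :
    0 ≤ primConst m C N Λ L K := by
  have h1 := driftConst_nonneg hm hΛ hN hL
  have h2 := hm.A_pos
  rw [primConst]; positivity

lemma ClosePair.prim_sub_le_aux (P : ClosePair m yT g₀ C N W Λ L K δ T M₁ M₂ Y₁ G₁ f₁ Y₂ G₂ f₂)
    {t : ℝ} (ht : t ∈ Icc 0 T) (a : ℝ) {z : ℝ} (hz : z ∈ 𝕁(m)) :
    (G₁.prim (3 * m.A * Λ)).val t a z - (G₂.prim (3 * m.A * Λ)).val t a z ≤ primConst m C N Λ L K * δ := by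
  obtain ⟨hm, hk, hd, hΛ, hU, h₁, h₂, hT, hK, ha₁, ha₂, hδ, hc⟩ := id P
  have hI {t} (h : t ∈ Ioo 0 T) := Ioo_subset_Icc_self h
  have hC := hk.C_nonneg
  have hN := hd.N_pos
  have hA := hm.A_pos
  have hR := h₁.G_forward.R_nonneg
  have hdc := driftConst_nonneg hm hΛ hN hU.L_nonneg
  obtain ⟨M₁', r₁⟩ := h₁.prim_regular
  obtain ⟨M₂', r₂⟩ := h₂.prim_regular
  obtain ⟨K₀, hK₀⟩ : ∃ K₀, K₀ = Λ * Λ * (Real.exp |m.ρ| * δ) * (N + Λ * (N * (3 * m.A * Λ))) := ⟨_, rfl⟩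
  have n0 : 0 ≤ K₀ := by rw [hK₀]; positivity
  have n1 : 0 ≤ K₀ * (2 * (3 * m.A * Λ)) := by positivity
  have n2 : 0 ≤ driftConst m N Λ L * δ * K := by positivity
  have key := (r₁.comb r₂ 1 (-1)).le_of_forward (mul_nonneg (by norm_num) hC)
    hk.degenerate_fwd (b := fun t a z => -m.ndrift T Y₁ f₁ t a z) (R := 3 * m.A * Λ)
    (K := K₀ * (2 * (3 * m.A * Λ))) (S := driftConst m N Λ L * δ * K) (c := 2 * C) n1 n2
    (by positivity)
    (fun t ht a z hz => ⟨_, clamp_mem hR a, by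
      simp only [StripPath.comb]
      rw [h₁.G_forward.prim_clamp h₁.G_reg ht a hz, h₂.G_forward.prim_clamp h₂.G_reg ht a hz]⟩)
    (fun a z hz => by
      simp only [StripPath.comb]
      rw [← h₁.G_forward.prim_clamp h₁.G_reg h₁.zero_mem a hz,
        ← h₂.G_forward.prim_clamp h₂.G_reg h₁.zero_mem a hz]
      obtain ⟨b, hb⟩ : ∃ b, b = max (-(3 * m.A * Λ)) (min (3 * m.A * Λ) a) := ⟨_, rfl⟩
      have hbm : b ∈ Icc (-(3 * m.A * Λ)) (3 * m.A * Λ) := by rw [hb]; exact clamp_mem hR a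
      rw [← hb]
      have c1 := (continuous_line (h₁.G_reg.cont_slice h₁.zero_mem) hz).intervalIntegrable
        (μ := volume) (-(3 * m.A * Λ)) b
      have c2 := (continuous_line (h₂.G_reg.cont_slice h₁.zero_mem) hz).intervalIntegrable
        (μ := volume) (-(3 * m.A * Λ)) b
      have e1 : 1 * (G₁.prim (3 * m.A * Λ)).val 0 b z + -1 * (G₂.prim (3 * m.A * Λ)).val 0 b z
          = ∫ s in (-(3 * m.A * Λ))..b, (G₁.val 0 s z - G₂.val 0 s z) := by
        rw [intervalIntegral.integral_sub c1 c2]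
        simp only [StripPath.prim]; ring
      rw [e1]
      refine (le_abs_self _).trans ((intervalIntegral.norm_integral_le_of_norm_le_const (C := K₀)
        (f := fun s => G₁.val 0 s z - G₂.val 0 s z) fun s hs => ?_).trans
        (mul_le_mul_of_nonneg_left ?_ n0))
      · rw [uIoc_of_le hbm.1] at hs
        rw [hK₀]
        exact h₁.initial_sub_le hd hΛ h₂ hT hc (abs_le.2 ⟨hs.1.le, hs.2.trans hbm.2⟩) hz
      · rw [abs_of_nonneg (by linarith [hbm.1])]
        linarith [hbm.2])
    (fun t ht a z hz hv => by
      have e := abs_mul_le (h₁.drift_sub_le hΛ hd.W_pos hU h₂ hT hc (hI ht) a hz)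
        (ha₂.G_le t (hI ht) a z hz)
      simp only [StripPath.comb] at hv ⊢
      rw [h₁.G_forward.prim_eq h₁.G_reg ht _ hz, h₂.G_forward.prim_eq h₂.G_reg ht _ hz]
      have da₁ : (G₁.prim (3 * m.A * Λ)).da t a z = G₁.val t a z := rfl
      have da₂ : (G₂.prim (3 * m.A * Λ)).da t a z = G₂.val t a z := rfl
      rw [da₁, da₂]
      simp only [CoeffData.fwd]
      have e1 := (abs_le.1 (hk.D2_bdd z hz))
      have e2 := (abs_le.1 (hk.μ1_bdd z hz))
      have e3 := mul_le_mul_of_nonneg_right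
        (show m.coeff.D2 z - m.coeff.μ1 z ≤ 2 * C by linarith [e1.2, e2.1]) hv.le
      linarith [(abs_le.1 e).1]) t ht a z hz
  simp only [StripPath.comb] at key
  have h3 : (K₀ * (2 * (3 * m.A * Λ)) + driftConst m N Λ L * δ * K * t) * Real.exp (2 * C * t)
      ≤ (K₀ * (2 * (3 * m.A * Λ)) + driftConst m N Λ L * δ * K) * Real.exp (2 * C) := by
    have ht1 : t ≤ 1 := ht.2.trans hT
    refine mul_le_mul ?_ (Real.exp_le_exp.2 (by nlinarith)) (Real.exp_pos _).le (by positivity)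
    nlinarith
  have h4 : primConst m C N Λ L K * δ
      = (K₀ * (2 * (3 * m.A * Λ)) + driftConst m N Λ L * δ * K) * Real.exp (2 * C) := by
    rw [hK₀, primConst]; ring
  rw [h4]
  linarith

lemma ClosePair.prim_sub_le (P : ClosePair m yT g₀ C N W Λ L K δ T M₁ M₂ Y₁ G₁ f₁ Y₂ G₂ f₂)
    {t : ℝ} (ht : t ∈ Icc 0 T) (a : ℝ) {z : ℝ} (hz : z ∈ 𝕁(m)) :
    |(G₁.prim (3 * m.A * Λ)).val t a z - (G₂.prim (3 * m.A * Λ)).val t a z| ≤ primConst m C N Λ L K * δ :=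
  abs_sub_le_iff.2 ⟨P.prim_sub_le_aux ht a hz, P.symm.prim_sub_le_aux ht a hz⟩

/-- The difference of the densities in a negative norm. -/
lemma ClosePair.abs_integral_mul_sub_le (P : ClosePair m yT g₀ C N W Λ L K δ T M₁ M₂ Y₁ G₁ f₁ Y₂ G₂ f₂)
    {t : ℝ} (ht : t ∈ Icc 0 T) {ψ : ℝ → ℝ → ℝ} {ℓ : ℝ} (hψ : ∀ a b, ∀ z ∈ 𝕁(m), |ψ a z - ψ b z| ≤ ℓ * |a - b|)
    (hψc : BddCont (univ ×ˢ 𝕁(m)) fun x => ψ x.1 x.2) :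
    |∫ x in 𝔹(m,Λ), ψ x.1 x.2 * (G₁.val t x.1 x.2 - G₂.val t x.1 x.2)|
      ≤ ℓ * (primConst m C N Λ L K * δ) * (2 * (3 * m.A * Λ) * (m.zMax - m.zMin)) := by
  obtain ⟨hm, hk, hd, hΛ, hU, h₁, h₂, hT, hK, ha₁, ha₂, hδ, hc⟩ := id P
  obtain ⟨M₁', r₁⟩ := h₁.prim_regular
  obtain ⟨M₂', r₂⟩ := h₂.prim_regular
  refine abs_setIntegral_box_mul_deriv_le (ψ := ψ)
    (Γ := fun a z => (G₁.prim (3 * m.A * Λ)).val t a z - (G₂.prim (3 * m.A * Λ)).val t a z)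
    (Γa := fun a z => G₁.val t a z - G₂.val t a z) h₁.G_forward.R_nonneg hm.zMin_lt_zMax.le hψ hψc
    (fun a z hz => (r₁.has_da t ht a z hz).fun_sub (r₂.has_da t ht a z hz))
    ((h₁.G_reg.bdd_val ht).sub (h₂.G_reg.bdd_val ht))
    (fun a z hz => P.prim_sub_le ht a hz)
    (fun z hz => by simp [StripPath.prim])
    fun z hz => sub_eq_zero.2 (h₁.prim_right_eq hm hk hΛ h₂ ht hz)

end Model.NormSol

end

section

variable {T M : ℝ}

namespace Model.NormSol

variable {m : Model} {yT g₀ : ℝ² → ℝ} {Y₁ G₁ Y₂ G₂ : StripPath} {f₁ f₂ : ℝ → ℝ}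
  {C N W Λ L M₁ M₂ δ K Q : ℝ}

/-- The constant in the bound for the Lipschitz constant of the consumption, compared with the terminal time. -/
def consumptionConst (m : Model) (N Λ L K : ℝ) : ℝ :=
  L * (K * (N + m.wInf) + K) * (Λ * K) + L * (K * K + K)

lemma consumption_lip (hm : m.Admissible) (hd : m.RegData N W yT g₀) (hΛ : 1 ≤ Λ)
    (hU : m.UBounds N W Λ L) (h₁ : m.NormSol N W Λ yT g₀ T M₁ Y₁ G₁ f₁)
    (ha₁ : m.Apriori K yT T Y₁ G₁ f₁) {t : ℝ} (ht : t ∈ Icc 0 T) (a b : ℝ) {z : ℝ} (hz : z ∈ 𝕁(m)) :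
    |Hp m.u (f₁ t * (Y₁.val t a z + m.wInf)) - Hp m.u (𝔼(m) yT a z + m.wInf)
      - (Hp m.u (f₁ t * (Y₁.val t b z + m.wInf)) - Hp m.u (𝔼(m) yT b z + m.wInf))|
      ≤ consumptionConst m N Λ L K * T * |a - b| := by
  have hδ : 0 < Λ⁻¹ * W := mul_pos (by positivity) hd.W_pos
  refine abs_sub_le_of_hasDerivAt
    (F := fun a => Hp m.u (f₁ t * (Y₁.val t a z + m.wInf)) - Hp m.u (𝔼(m) yT a z + m.wInf))
    (F' := fun a => Hpp m.u (f₁ t * (Y₁.val t a z + m.wInf)) * (f₁ t * Y₁.da t a z)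
      - Hpp m.u (𝔼(m) yT a z + m.wInf) * (𝕊(m) yT).da t a z)
    (fun a => ?_) (fun a => ?_) a b
  · have d1 := (hm.utility.hasDerivAt_Hp (hδ.trans_le (h₁.q_mem hΛ hd.W_pos ht a hz).1)).comp a
      (((h₁.Y_reg.has_da t ht a z hz).add_const m.wInf).const_mul (f₁ t))
    have d2 := (hm.utility.hasDerivAt_Hp (hδ.trans_le (hd.vT_mem_scaled hΛ a hz).1)).comp a
      (((hd.yT_reg T).has_da t ht a z hz).add_const m.wInf)
    exact d1.sub d2
  · have hv := h₁.v_mem ht a hz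
    have e1 : |f₁ t * (Y₁.val t a z + m.wInf) - (𝔼(m) yT a z + m.wInf)|
        ≤ K * T * (N + m.wInf) + K * T := by
      have e : f₁ t * (Y₁.val t a z + m.wInf) - (𝔼(m) yT a z + m.wInf)
        = (f₁ t - 1) * (Y₁.val t a z + m.wInf) + (Y₁.val t a z - 𝔼(m) yT a z) := by ring
      rw [e]
      exact (abs_add_le _ _).trans (add_le_add (abs_mul_le (ha₁.f_sub_le t ht)
        (by rw [abs_of_nonneg (hd.W_pos.le.trans hv.1)]; exact hv.2)) (ha₁.sub_le t ht a z hz))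
    have e2 : |f₁ t * Y₁.da t a z - (𝕊(m) yT).da t a z| ≤ K * T * K + K * T := by
      have e : f₁ t * Y₁.da t a z - (𝕊(m) yT).da t a z
        = (f₁ t - 1) * Y₁.da t a z + (Y₁.da t a z - (𝕊(m) yT).da t a z) := by ring
      rw [e]
      exact (abs_add_le _ _).trans (add_le_add (abs_mul_le (ha₁.f_sub_le t ht) (ha₁.da_le t ht a z hz))
        (ha₁.da_sub_le t ht a z hz))
    have e3 := (hU.l1 _ (h₁.q_mem hΛ hd.W_pos ht a hz) _ (hd.vT_mem_scaled hΛ a hz)).trans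
      (mul_le_mul_of_nonneg_left e1 hU.L_nonneg)
    have e4 := abs_mul_le e3 (abs_mul_le (h₁.abs_f_le hΛ ht) (ha₁.da_le t ht a z hz))
    have e5 := abs_mul_le (hU.b1 _ (hd.vT_mem_scaled hΛ a hz)) e2
    have e : Hpp m.u (f₁ t * (Y₁.val t a z + m.wInf)) * (f₁ t * Y₁.da t a z)
        - Hpp m.u (𝔼(m) yT a z + m.wInf) * (𝕊(m) yT).da t a z
        = (Hpp m.u (f₁ t * (Y₁.val t a z + m.wInf)) - Hpp m.u (𝔼(m) yT a z + m.wInf))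
            * (f₁ t * Y₁.da t a z)
          + Hpp m.u (𝔼(m) yT a z + m.wInf)
            * (f₁ t * Y₁.da t a z - (𝕊(m) yT).da t a z) := by ring
    rw [e, consumptionConst]
    exact (abs_add_le _ _).trans ((add_le_add e4 e5).trans (le_of_eq (by ring)))

lemma drift_lipBdd (hΛ : 1 ≤ Λ) (hW : 0 < W)
    (hU : m.UBounds N W Λ L) (h₁ : m.NormSol N W Λ yT g₀ T M₁ Y₁ G₁ f₁)
    (hK : 0 ≤ K) (ha₁ : m.Apriori K yT T Y₁ G₁ f₁) {t : ℝ} (ht : t ∈ Icc 0 T) :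
    LipBdd m.zMin m.zMax (Λ * (𝕫(m) + L) + Λ * (L * (Λ * K))) (m.ndrift T Y₁ f₁ t) := by
  have hL := hU.L_nonneg
  have hm0 := m.zBound_nonneg
  have n1 : 0 ≤ Λ * (𝕫(m) + L) := by positivity
  have n2 : 0 ≤ Λ * (L * (Λ * K)) := by positivity
  exact .of_bounds (by positivity) (fun a z hz => (h₁.abs_drift_le hΛ hW hU ht a hz).trans (by linarith))
    fun a b z hz => (h₁.drift_lip hΛ hW hU ht (ha₁.da_le t ht) a b hz).trans
      (mul_le_mul_of_nonneg_right (by linarith) (abs_nonneg _))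

/-- The constant in the bound for the moments of the difference of the densities. -/
def momentConst (m : Model) (C N Λ L K Q : ℝ) : ℝ :=
  (2 * (C * Q) + 2 * (C * Q)
    + 2 * ((Λ * (𝕫(m) + L) + Λ * (L * (Λ * K))) * Q)) * primConst m C N Λ L K
      * (2 * (3 * m.A * Λ) * (m.zMax - m.zMin))
    + K * (driftConst m N Λ L * Q) * (2 * (3 * m.A * Λ) * (m.zMax - m.zMin))

lemma ClosePair.moment_sub_le (P : ClosePair m yT g₀ C N W Λ L K δ T M₁ M₂ Y₁ G₁ f₁ Y₂ G₂ f₂)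
    {q : StripPath} (hq : q.Regular m.zMin m.zMax T Q) (hq0 : ∀ t a z, q.dt t a z = 0)
    (hl : ∀ t, LipBdd m.zMin m.zMax Q (q.da t) ∧ LipBdd m.zMin m.zMax Q (q.dz t) ∧
      LipBdd m.zMin m.zMax Q (q.dzz t)) {t s : ℝ} (ht : t ∈ Icc 0 T) (hs : s ∈ Icc 0 T) :
    |(∫ x in 𝔹(m,Λ), q.val t x.1 x.2 * G₁.val t x.1 x.2) - (∫ x in 𝔹(m,Λ), q.val t x.1 x.2 * G₂.val t x.1 x.2)
      - ((∫ x in 𝔹(m,Λ), q.val s x.1 x.2 * G₁.val s x.1 x.2)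
      - ∫ x in 𝔹(m,Λ), q.val s x.1 x.2 * G₂.val s x.1 x.2)| ≤ momentConst m C N Λ L K Q * δ * |t - s| := by
  obtain ⟨hm, hk, hd, hΛ, hU, h₁, h₂, hT, hK, ha₁, ha₂, hδ, hc⟩ := id P
  have hA := hm.A_pos
  have hI {t} (h : t ∈ Ioo 0 T) := Ioo_subset_Icc_self h
  refine abs_sub_le_of_deriv_le (T := T)
    (F := fun t => (∫ x in 𝔹(m,Λ), q.val t x.1 x.2 * G₁.val t x.1 x.2)
      - ∫ x in 𝔹(m,Λ), q.val t x.1 x.2 * G₂.val t x.1 x.2)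
    ((StripPath.Forward.continuousOn_integral h₁.G_reg hq _).sub
      (StripPath.Forward.continuousOn_integral h₂.G_reg hq _))
    (fun t ht => (h₁.G_forward.hasDerivAt_integral hk h₁.G_reg hq ht).sub
      (h₂.G_forward.hasDerivAt_integral hk h₂.G_reg hq ht)) (fun t ht => ?_) ht hs
  have htI := hI ht
  obtain ⟨la, lz, lzz⟩ := hl t
  have lψ := (((LipBdd.of_snd hk.C_nonneg hk.D_bdd).mul lzz).add
    ((LipBdd.of_snd hk.C_nonneg hk.μ_bdd).mul lz)).add
      ((h₁.drift_lipBdd hΛ hd.W_pos hU hK ha₁ htI).mul la)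
  have bb₁ : BddCont (univ ×ˢ 𝕁(m)) fun x => m.ndrift T Y₁ f₁ t x.1 x.2 :=
    ⟨h₁.G_forward.cont_b t ht, _, fun x hx => h₁.abs_drift_le hΛ hd.W_pos hU htI _ hx.2⟩
  have bb₂ : BddCont (univ ×ˢ 𝕁(m)) fun x => m.ndrift T Y₂ f₂ t x.1 x.2 :=
    ⟨h₂.G_forward.cont_b t ht, _, fun x hx => h₂.abs_drift_le hΛ hd.W_pos hU htI _ hx.2⟩
  have bL := (hk.bdd_D.mul (hq.bdd_dzz htI)).add (hk.bdd_μ.mul (hq.bdd_dz htI))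
  have b₁ := bL.add (bb₁.mul (hq.bdd_da htI))
  have b₂ := bL.add (bb₂.mul (hq.bdd_da htI))
  have g₁ := h₁.G_reg.bdd_val htI
  have g₂ := h₂.G_reg.bdd_val htI
  have i₁ := ((g₁.mul b₁).mono (box_subset_strip (R := 3 * m.A * Λ))).integrableOn
  have i₂ := ((g₂.mul b₂).mono (box_subset_strip (R := 3 * m.A * Λ))).integrableOn
  have i₃ := ((b₁.mul (g₁.sub g₂)).mono (box_subset_strip (R := 3 * m.A * Λ))).integrableOn
  have i₄ := ((g₂.mul ((bb₁.sub bb₂).mul (hq.bdd_da htI))).mono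
    (box_subset_strip (R := 3 * m.A * Λ))).integrableOn
  simp only [hq0, zero_add]
  rw [← integral_sub i₁ i₂, setIntegral_congr_fun (g := fun x : ℝ² =>
      (m.coeff.D x.2 * q.dzz t x.1 x.2 + m.coeff.μ x.2 * q.dz t x.1 x.2
        + m.ndrift T Y₁ f₁ t x.1 x.2 * q.da t x.1 x.2) * (G₁.val t x.1 x.2 - G₂.val t x.1 x.2)
      + G₂.val t x.1 x.2 * ((m.ndrift T Y₁ f₁ t x.1 x.2 - m.ndrift T Y₂ f₂ t x.1 x.2)
        * q.da t x.1 x.2)) measurableSet_box fun x _ => by ring, integral_add i₃ i₄]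
  have e1 := P.abs_integral_mul_sub_le htI
    (fun a b z hz => (lψ.2 a z hz).2 b) b₁
  have e2 := abs_setIntegral_box_le (zl := m.zMin) (zr := m.zMax) h₁.G_forward.R_nonneg
    hm.zMin_lt_zMax.le (f := fun x : ℝ² => G₂.val t x.1 x.2 *
      ((m.ndrift T Y₁ f₁ t x.1 x.2 - m.ndrift T Y₂ f₂ t x.1 x.2) * q.da t x.1 x.2))
    fun x hx => abs_mul_le (ha₂.G_le t htI _ _ hx.2) (abs_mul_le
      (h₁.drift_sub_le hΛ hd.W_pos hU h₂ hT hc htI _ hx.2) (hq.bound_da t htI _ _ hx.2))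
  exact (abs_add_le _ _).trans ((add_le_add e1 e2).trans (le_of_eq (by rw [momentConst]; ring)))

lemma ClosePair.scale_close (P : ClosePair m yT g₀ C N W Λ L K δ T M₁ M₂ Y₁ G₁ f₁ Y₂ G₂ f₂)
    (hQ0 : 0 ≤ Q) (hq : (m.test yT).Regular m.zMin m.zMax T Q)
    (hl : ∀ t, LipBdd m.zMin m.zMax Q ((m.test yT).da t) ∧ LipBdd m.zMin m.zMax Q ((m.test yT).dz t) ∧
      LipBdd m.zMin m.zMax Q ((m.test yT).dzz t)) {t : ℝ} (ht : t ∈ Icc 0 T) :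
    |f₁ t - f₂ t| * W ≤ L * (momentConst m C N Λ L K Q + consumptionConst m N Λ L K
      * primConst m C N Λ L K * (2 * (3 * m.A * Λ) * (m.zMax - m.zMin))
      + L * (Λ * (driftConst m N Λ L * K))) * T * δ := by
  obtain ⟨hm, hk, hd, hΛ, hU, h₁, h₂, hT, hK, ha₁, ha₂, hδ, hc⟩ := id P
  have hW := hd.W_pos
  have hN := hd.N_pos
  have hL := hU.L_nonneg
  have hC := hk.C_nonneg
  have hA := hm.A_pos
  have hz0 : 0 < m.zMax - m.zMin := by linarith [hm.zMin_lt_zMax]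
  have hm0 := m.zBound_nonneg
  have bz := m.bddCont_z
  have bH₁ := h₁.bddCont_Hp hm hΛ hW hU ht
  have bH₂ := h₂.bddCont_Hp hm hΛ hW hU ht
  have g₁ := h₁.G_reg.bdd_val ht
  have g₂ := h₂.G_reg.bdd_val ht
  have bq := hq.bdd_val ht
  have bT : BddCont (univ ×ˢ 𝕁(m)) fun x => Hp m.u (𝔼(m) yT x.1 x.2 + m.wInf) :=
    (bq.sub bz).congr fun x _ => by rw [Model.test_val]; ring
  have c₁ := h₁.cons t ht
  have c₂ := h₂.cons t ht
  rw [h₁.integral_terminal] at c₁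
  rw [h₂.integral_terminal] at c₂
  have mom := P.moment_sub_le hq (m.test_dt yT) hl ht h₁.T_mem
  have bψ := bH₂.sub bT
  have con := P.abs_integral_mul_sub_le ht
    (ψ := fun a z => Hp m.u (f₂ t * (Y₂.val t a z + m.wInf)) - Hp m.u (𝔼(m) yT a z + m.wInf))
    (fun a b z hz => h₂.consumption_lip hm hd hΛ hU ha₂ ht a b hz) bψ
  have vs := fun a z hz => P.val_sub_le ht a (z := z) hz
  have key := h₁.scale_sub_le hΛ hW hU ht (h₁.f_mem t ht) (h₂.f_mem t ht)
    (e := L * (Λ * (driftConst m N Λ L * δ * K * T)))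
    (v := fun a z => Y₁.val t a z + m.wInf)
    (ψ := fun a z => Hp m.u (f₁ t * (Y₁.val t a z + m.wInf)) - Hp m.u (f₂ t * (Y₂.val t a z + m.wInf)))
    (fun a z hz => h₁.v_mem ht a hz) (bH₁.sub bH₂) fun a z hz => by
      have l := hU.l0 _ (mul_mem_scaled hΛ hW (h₂.f_mem t ht) (h₁.v_mem ht a hz)) _
        (h₂.q_mem hΛ hW ht a hz)
      rw [← mul_sub, add_sub_add_right_eq_sub] at l
      rw [sub_sub_sub_cancel_left]
      exact l.trans (mul_le_mul_of_nonneg_left (abs_mul_le (h₂.abs_f_le hΛ ht) (vs a z hz)) hL)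
  have i : ∀ {F : ℝ² → ℝ}, BddCont (univ ×ˢ 𝕁(m)) F →
      IntegrableOn F (𝔹(m,Λ)) := fun h => (h.mono box_subset_strip).integrableOn
  have j₁ := ((bz.add bH₁).mul g₁).sub ((bz.add bH₂).mul g₂)
  have j₂ := (bq.mul g₁).sub (bq.mul g₂)
  have e : ∫ x in 𝔹(m,Λ), (Hp m.u (f₁ t * (Y₁.val t x.1 x.2 + m.wInf))
      - Hp m.u (f₂ t * (Y₂.val t x.1 x.2 + m.wInf))) * G₁.val t x.1 x.2
      = (∫ x in 𝔹(m,Λ), (m.test yT).val T x.1 x.2 * G₁.val T x.1 x.2)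
      - (∫ x in 𝔹(m,Λ), (m.test yT).val T x.1 x.2 * G₂.val T x.1 x.2)
      - ((∫ x in 𝔹(m,Λ), (m.test yT).val t x.1 x.2 * G₁.val t x.1 x.2)
      - ∫ x in 𝔹(m,Λ), (m.test yT).val t x.1 x.2 * G₂.val t x.1 x.2)
      - ∫ x in 𝔹(m,Λ), (Hp m.u (f₂ t * (Y₂.val t x.1 x.2 + m.wInf))
        - Hp m.u (𝔼(m) yT x.1 x.2 + m.wInf)) * (G₁.val t x.1 x.2 - G₂.val t x.1 x.2) := by
    rw [← c₁, ← c₂, ← integral_sub (i ((bz.add bH₁).mul g₁)) (i ((bz.add bH₂).mul g₂)),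
      ← integral_sub (i (bq.mul g₁)) (i (bq.mul g₂)),
      ← integral_sub (i j₁) (i j₂), ← integral_sub (i (j₁.sub j₂)) (i (bψ.mul (g₁.sub g₂)))]
    refine setIntegral_congr_fun measurableSet_box fun x _ => ?_
    simp only [Model.test_val]; ring
  rw [e] at key
  obtain ⟨B, hB⟩ : ∃ B, B = momentConst m C N Λ L K Q := ⟨_, rfl⟩
  have hprim := primConst_nonneg (C := C) hm hΛ hN hL hK
  have hdrift := driftConst_nonneg hm hΛ hN hL
  have hB0 : 0 ≤ B := by rw [hB, momentConst]; positivity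
  rw [← hB] at mom ⊢
  have hT' : B * δ * |t - T| ≤ B * δ * T := mul_le_mul_of_nonneg_left
    (by rw [abs_of_nonpos (by linarith [ht.2])]; linarith [ht.1]) (by positivity)
  rw [abs_sub_comm] at mom
  refine key.trans ((mul_le_mul_of_nonneg_left (add_le_add_left ((abs_sub _ _).trans
    (add_le_add (mom.trans hT') con)) _) hL).trans (le_of_eq (by ring)))

lemma ClosePair.val_eq_of_close_zero (P : ClosePair m yT g₀ C N W Λ L K 0 T M₁ M₂ Y₁ G₁ f₁ Y₂ G₂ f₂)
    {t : ℝ} (ht : t ∈ Icc 0 T) (a : ℝ) {z : ℝ} (hz : z ∈ 𝕁(m)) : G₁.val t a z = G₂.val t a z := by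
  obtain ⟨hm, hk, hd, hΛ, hU, h₁, h₂, hT, hK, ha₁, ha₂, hδ, hc⟩ := id P
  obtain ⟨M₁', r₁⟩ := h₁.prim_regular
  obtain ⟨M₂', r₂⟩ := h₂.prim_regular
  have e : ∀ a, (G₁.prim (3 * m.A * Λ)).val t a z = (G₂.prim (3 * m.A * Λ)).val t a z := fun a => by
    have := P.prim_sub_le ht a hz
    rw [mul_zero] at this
    exact sub_eq_zero.1 (abs_nonpos_iff.1 this)
  have d₁ := r₁.has_da t ht a z hz
  rw [show (fun a => (G₁.prim (3 * m.A * Λ)).val t a z) = fun a => (G₂.prim (3 * m.A * Λ)).val t a z from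
    funext e] at d₁
  exact d₁.unique (r₂.has_da t ht a z hz)

end Model.NormSol

/-- On short time intervals the normalized solution is unique. -/
lemma Model.RegData.normSol_unique {m : Model} {yT g₀ : ℝ² → ℝ} {C N W Λ : ℝ} (hm : m.Admissible)
    (hk : m.CoeffRegular C) (hd : m.RegData N W yT g₀) (hΛ : 1 ≤ Λ) :
    ∃ τ > 0, ∀ T < τ, ∀ M₁ M₂ Y₁ G₁ f₁ Y₂ G₂ f₂, m.NormSol N W Λ yT g₀ T M₁ Y₁ G₁ f₁ →
      m.NormSol N W Λ yT g₀ T M₂ Y₂ G₂ f₂ → ∀ t ∈ Icc 0 T, f₁ t = f₂ t ∧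
        ∀ a, ∀ z ∈ 𝕁(m), Y₁.val t a z = Y₂.val t a z ∧ G₁.val t a z = G₂.val t a z := by
  have hW := hd.W_pos
  have hN := hd.N_pos
  obtain ⟨L, hU⟩ := hm.utility.exists_utilBounds (show 0 < Λ⁻¹ * W by positivity) (Λ * (N + m.wInf))
  obtain ⟨K, hK, τ, hτ, hτ1, hap⟩ := hd.exists_apriori hm hk hΛ hU
  obtain ⟨Q, hQ0, hQ, hl⟩ := hd.exists_test_regular hm hΛ hU
  obtain ⟨c₁, hc₁⟩ : ∃ c₁, c₁ = NormSol.driftConst m N Λ L * K := ⟨_, rfl⟩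
  obtain ⟨c₂, hc₂⟩ : ∃ c₂, c₂ = L * (NormSol.momentConst m C N Λ L K Q + NormSol.consumptionConst m N Λ L K
      * NormSol.primConst m C N Λ L K * (2 * (3 * m.A * Λ) * (m.zMax - m.zMin))
      + L * (Λ * (NormSol.driftConst m N Λ L * K))) := ⟨_, rfl⟩
  refine ⟨min τ (min (1 / (2 * (|c₁| + 1))) (W / (2 * (|c₂| + 1)))), by positivity,
    fun T hT M₁ M₂ Y₁ G₁ f₁ Y₂ G₂ f₂ h₁ h₂ => ?_⟩
  have hT0 := h₁.T_pos
  have hTτ : T < τ := hT.trans_le (min_le_left _ _)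
  have hT1 : T ≤ 1 := hTτ.le.trans hτ1
  have hTc₁ : c₁ * T ≤ 1 / 2 := by
    have : T ≤ 1 / (2 * (|c₁| + 1)) := hT.le.trans ((min_le_right _ _).trans (min_le_left _ _))
    rw [le_div_iff₀ (by positivity)] at this
    nlinarith [le_abs_self c₁]
  have hTc₂ : c₂ * T ≤ W / 2 := by
    have : T ≤ W / (2 * (|c₂| + 1)) := hT.le.trans ((min_le_right _ _).trans (min_le_right _ _))
    rw [le_div_iff₀ (by positivity)] at this
    nlinarith [le_abs_self c₂]
  have a₁ := hap T hTτ M₁ Y₁ G₁ f₁ h₁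
  have a₂ := hap T hTτ M₂ Y₂ G₂ f₂ h₂
  have pair {δ} (hδ : 0 ≤ δ) (hc : m.Close T δ Y₁ Y₂ f₁ f₂) :=
    NormSol.ClosePair.mk hm hk hd hΛ hU h₁ h₂ hT1 hK a₁ a₂ hδ hc
  have step : ∀ δ, 0 ≤ δ → m.Close T δ Y₁ Y₂ f₁ f₂ → m.Close T (δ / 2) Y₁ Y₂ f₁ f₂ := by
    intro δ hδ hc t ht
    refine ⟨?_, fun a z hz => ?_⟩
    · have := (pair hδ hc).scale_close hQ0 (hQ T) (fun t => (hl t).2) ht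
      rw [← hc₂] at this
      have e := mul_le_mul_of_nonneg_right hTc₂ hδ
      have : |f₁ t - f₂ t| * W ≤ δ / 2 * W := by linarith
      exact le_of_mul_le_mul_right this hW
    · have := (pair hδ hc).val_sub_le ht a hz
      have e := mul_le_mul_of_nonneg_right hTc₁ hδ
      rw [hc₁] at e
      linarith
  obtain ⟨δ₀, hδ₀, hc₀⟩ : ∃ δ₀, 0 ≤ δ₀ ∧ m.Close T δ₀ Y₁ Y₂ f₁ f₂ := by
    have hΛ0 : 0 ≤ Λ := by linarith
    refine ⟨2 * Λ + (|M₁| + |M₂|), by positivity, fun t ht => ⟨?_, fun a z hz => ?_⟩⟩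
    · have e1 := h₁.abs_f_le hΛ ht
      have e2 := h₂.abs_f_le hΛ ht
      have := abs_sub (f₁ t) (f₂ t)
      linarith [abs_nonneg M₁, abs_nonneg M₂]
    · have e1 := (h₁.Y_reg.bound t ht a z hz).trans (le_abs_self _)
      have e2 := (h₂.Y_reg.bound t ht a z hz).trans (le_abs_self _)
      have := abs_sub (Y₁.val t a z) (Y₂.val t a z)
      linarith
  have hn : ∀ n : ℕ, m.Close T (δ₀ * (1 / 2) ^ n) Y₁ Y₂ f₁ f₂ := by
    intro n
    induction n with
    | zero => simpa using hc₀
    | succ n ih =>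
      have := step _ (by positivity) ih
      rwa [show δ₀ * (1 / 2) ^ n / 2 = δ₀ * (1 / 2) ^ (n + 1) by ring] at this
  have hlim : Tendsto (fun n : ℕ => δ₀ * (1 / 2 : ℝ) ^ n) atTop (𝓝 0) := by
    simpa using (tendsto_pow_atTop_nhds_zero_of_lt_one (r := (1 / 2 : ℝ)) (by norm_num)
      (by norm_num)).const_mul δ₀
  have hc : m.Close T 0 Y₁ Y₂ f₁ f₂ := fun t ht =>
    ⟨ge_of_tendsto' hlim fun n => (hn n t ht).1, fun a z hz =>
      ge_of_tendsto' hlim fun n => (hn n t ht).2 a z hz⟩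
  exact fun t ht => ⟨sub_eq_zero.1 (abs_nonpos_iff.1 (hc t ht).1), fun a z hz =>
    ⟨sub_eq_zero.1 (abs_nonpos_iff.1 ((hc t ht).2 a z hz)),
      (pair le_rfl hc).val_eq_of_close_zero ht a hz⟩⟩

lemma Model.D_subset_closure {m : Model} (hm : m.Admissible) : m.D ⊆ closure m.Ω := by
  have hA := hm.A_pos
  rw [Model.D, Model.Ω, closure_prod_eq, closure_Ioo (by linarith), closure_Ioo hm.zMin_lt_zMax.ne]

end

end WealthMFG

end

theorem theorem7p1 (m : WealthMFG.Model) (hm : m.Admissible) (s : ℕ) (hs : 4 ≤ s)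
    (yT g₀ : ℝ × ℝ → ℝ) (hdata : m.IsData s yT g₀) :
    ∃ Tstar : ℝ, 0 < Tstar ∧ ∀ T : ℝ, 0 < T → T < Tstar →
      ∀ (y₁ g₁ y₂ g₂ : ℝ → ℝ × ℝ → ℝ) (f₁ f₂ : ℝ → ℝ),
        m.IsSolution s yT g₀ T y₁ g₁ f₁ → m.IsSolution s yT g₀ T y₂ g₂ f₂ →
        ∀ t ∈ Set.Icc 0 T, f₁ t = f₂ t ∧
          ∀ x ∈ m.D, y₁ t x = y₂ t x ∧ g₁ t x = g₂ t x := by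
  obtain ⟨C, hk⟩ := hm.exists_coeff_regular
  obtain ⟨N, W, hd⟩ := hdata.exists_regData hm hs
  obtain ⟨Λ, hΛ, τ₁, hτ₁, -, hscale⟩ := hd.exists_scale_bounds hm hk
  obtain ⟨τ₂, hτ₂, huniq⟩ := hd.normSol_unique hm hk hΛ
  refine ⟨min τ₁ τ₂, lt_min hτ₁ hτ₂, fun T hT0 hT y₁ g₁ y₂ g₂ f₁ f₂ s₁ s₂ => ?_⟩
  obtain ⟨M₁, r₁, y₁', g₁', R₁, e₁⟩ := s₁.exists_regSol hm hs hT0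
  obtain ⟨M₂, r₂, y₂', g₂', R₂, e₂⟩ := s₂.exists_regSol hm hs hT0
  have b₁ := hscale T (hT.trans_le (min_le_left _ _)) M₁ y₁' g₁' f₁ r₁ R₁
  have b₂ := hscale T (hT.trans_le (min_le_left _ _)) M₂ y₂' g₂' f₂ r₂ R₂
  obtain ⟨M₁', n₁⟩ := R₁.normSol hm hk hd hΛ b₁
  obtain ⟨M₂', n₂⟩ := R₂.normSol hm hk hd hΛ b₂
  have U := huniq T (hT.trans_le (min_le_right _ _)) M₁' M₂' _ _ f₁ _ _ f₂ n₁ n₂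
  intro t ht
  obtain ⟨hf, hYG⟩ := U t ht
  have hΛi : 0 < Λ⁻¹ := by positivity
  have hfp : f₂ t ≠ 0 := (hΛi.trans_le (b₂ t ht).1.1).ne'
  have hEp : m.scl T f₂ t ≠ 0 := (hΛi.trans_le (b₂ t ht).2.1).ne'
  have hE : m.scl T f₁ t = m.scl T f₂ t := by simp only [WealthMFG.Model.scl, hf]
  have hΩ : ∀ x ∈ m.Ω, y₁ t x = y₂ t x ∧ g₁ t x = g₂ t x := fun x hx => by
    obtain ⟨hY, hG⟩ := hYG (m.scl T f₂ t * x.1) x.2 hx.2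
    simp only [WealthMFG.Model.normY, WealthMFG.Model.normG, WealthMFG.StripPath.scale, hE, hf,
      mul_div_cancel_left₀ _ hEp] at hY hG
    rw [← (e₁ t ht x hx).1, ← (e₂ t ht x hx).1, ← (e₁ t ht x hx).2, ← (e₂ t ht x hx).2]
    exact ⟨mul_left_cancel₀ (inv_ne_zero hfp) hY, mul_left_cancel₀ (inv_ne_zero hEp) hG⟩
  have hy : Set.EqOn (y₁ t) (y₂ t) m.D := Set.EqOn.of_subset_closure (fun x hx => (hΩ x hx).1)
    (s₁.y_cont t ht) (s₂.y_cont t ht) m.Ω_subset_D (WealthMFG.Model.D_subset_closure hm)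
  have hg : Set.EqOn (g₁ t) (g₂ t) m.D := Set.EqOn.of_subset_closure (fun x hx => (hΩ x hx).2)
    (s₁.g_cont t ht) (s₂.g_cont t ht) m.Ω_subset_D (WealthMFG.Model.D_subset_closure hm)
  exact ⟨hf, fun x hx => ⟨hy hx, hg hx⟩⟩
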